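/- **Setting.** A simplex-wise zigzag filtration $\mathcal F:\emptyset=K_0\leftrightarrow K_1\leftrightarrow\cdots\leftrightarrow K_m$ is a sequence of finite simplicial complexes in which each $K_{i+1}$ arises from $K_i$ by inserting or by deleting one simplex $\sigma_i$; the vertices are natural numbers. Let $n$ be the maximum number of simplices of a $K_i$. With $\mathbb Z_2$ coefficients and over all degrees, let $\mathsf Z(K_i)$, $\mathsf B(K_i)$ and $\mathsf H(K_i)=\mathsf Z(K_i)/\mathsf B(K_i)$ be the cycle, boundary and homology groups. The inclusions induce zigzag modules $\mathsf H(\mathcal F)$ and $\mathsf B(\mathcal F)$ with arrows $\psi^*_j$ between $\mathsf H(K_j)$ and $\mathsf H(K_{j+1})$ and $\psi^\#_j$ between $\mathsf B(K_j)$ and $\mathsf B(K_{j+1})$. The barcodes $\mathsf{Pers}^H(\mathcal F)$ and $\mathsf{Pers}^B(\mathcal F)$ are the multisets of intervals $[b,d]\subseteq\{0,\dots,m\}$ for which $\mathsf H(\mathcal F)$ and $\mathsf B(\mathcal F)$, respectively, are isomorphic to the direct sum of the interval modules on these $[b,d]$. *Birth and death indices.* For homology, $j+1$ is a birth index if $\psi^*_j$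 is forward and injective or backward and surjective, and otherwise $j$ is a death index ($0\le j<m$); $m$ is also a death index if $\mathsf H(K_m)\ne0$. For boundaries, $j+1$ is a birth index if $\psi^\#_j$ is forward and not surjective, and $j$ is a death index if $\psi^\#_j$ is backward and not surjective; $m$ is also a death index if $\mathsf B(K_m)\neq 0$. *Representatives.* A homology representative for $[b,d]$, with $b$ a homology birth index and $d\geq b$ a homology death index, is a sequence of cycles $z_\alpha\in\mathsf Z(K_\alpha)$, $b\le\alpha\le d$, all of the same degree $p$, such that for $b\le\alpha<d$ the map $\psi^*_\alpha$ sends $[z_\alpha]$ to $[z_{\alpha+1}]$ if it is forward and $[z_{\alpha+1}]$ to $[z_\alpha]$ if it is backward; $z_b\notin\mathsf Z(K_{b-1})$ if $\psi^*_{b-1}$ is forward, while $0\ne[z_b]\in\ker\psi^*_{b-1}$ if it is backward; and, if $d<m$, $z_d\notin\mathsf Z(K_{d+1})$ if $\psi^*_d$ is backward, while $0\neq[z_d]\in\ker\psi^*_d$ if it is forward. A boundary representative for $[b,d]$, with $b$ a boundary birth index and $d\ge b$ a boundary death index, is a sequence $z_\alpha\in\mathsf B(K_\alpha)$, $b\le\alpha\le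 d$, of chains of one degree that are all equal as chains, with $z_b\notin\mathsf B(K_{b-1})$ and, if $d<m$, $z_d\notin\mathsf B(K_{d+1})$. **Theorem.** The barcodes $\mathsf{Pers}^H(\mathcal F)$ and $\mathsf{Pers}^B(\mathcal F)$, along with representatives for all their intervals, can be computed in $O(m^2n)$ time and $O(mn)$ space. Precisely: there are a single program for a word RAM and a constant $C$ such that for every simplex-wise zigzag filtration $\mathcal F$, given as the list of its $m$ insertions and deletions with each simplex written as its list of vertices, the program halts after at most $C(m^2n+1)$ steps, addresses only the first $C(mn+1)$ words of each of its finitely many arrays of working memory (the input included, the write-only output stream not included), handles only numbers smaller than $(m+v+2)^C$, where $v$ is the largest vertex (that is, words of $O(\log(m+v+2))$ bits), and outputs a list of bars such that * the bars marked as homology bars form $\mathsf{Pers}^H(\mathcal F)$ and the bars marked as boundary bars form $\mathsf{Pers}^B(\mathcal F)$; * each homology (boundary) bar $[b,d]$ comes with a homology (boundary) representative for $[b,d]$, written out as the list of the cycles $z_b,z_{b+1},\dots,z_d$, where a cycle is the list of its simplices and a simplex is named by an index $j$ with $\sigma_j$ equal to it. -/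

import Mathlib

namespace ZigzagRep

/-! ## Subquotients -/

section Subquotient

variable {M : Type} [AddCommGroup M] [Module (ZMod 2) M]

/-- The quotient `Z / B` of two subspaces `B ≤ Z` of a vector space. -/
def Subquotient (Z B : Submodule (ZMod 2) M) : Type := Z ⧸ B.submoduleOf Z

namespace Subquotient

instance (Z B : Submodule (ZMod 2) M) : AddCommGroup (Subquotient Z B) :=
  inferInstanceAs (AddCommGroup (Z ⧸ B.submoduleOf Z))

instance (Z B : Submodule (ZMod 2) M) : Module (ZMod 2) (Subquotient Z B) :=
  inferInstanceAs (Module (ZMod 2) (Z ⧸ B.submoduleOf Z))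

/-- The quotient map `Z → Z / B`. -/
def mk (Z B : Submodule (ZMod 2) M) : Z →ₗ[ZMod 2] Subquotient Z B :=
  (B.submoduleOf Z).mkQ

/-- The map `Z / B → Z' / B'` induced by inclusions `Z ≤ Z'` and `B ≤ B'`. -/
def map {Z B Z' B' : Submodule (ZMod 2) M} (hZ : Z ≤ Z') (hB : B ≤ B') :
    Subquotient Z B →ₗ[ZMod 2] Subquotient Z' B' :=
  Submodule.mapQ _ _ (Submodule.inclusion hZ) (fun _ hx => hB hx)

end Subquotient

end Subquotient

/-! ## Simplicial chains modulo two -/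

/-- Chains with coefficients in `ZMod 2`, over all degrees; the simplices are finite sets of natural
numbers.  The chains of all complexes live in this one space, so that a chain of one complex is a
chain of another one as soon as all its simplices belong to it. -/
abbrev Chain : Type := Finset ℕ →₀ ZMod 2

/-- The sum of the facets of a simplex.  The empty set is not a simplex: the boundary of a vertex
is zero. -/
noncomputable def facetSum (s : Finset ℕ) : Chain :=
  ∑ v ∈ s, if (s.erase v).Nonempty then Finsupp.single (s.erase v) 1 else 0

/-- The boundary operator. -/
noncomputable def boundary : Chain →ₗ[ZMod 2] Chain :=
  Finsupp.linearCombination (ZMod 2) facetSum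

/-- The chain group `C(K)` over all degrees. -/
noncomputable def chains (K : PreAbstractSimplicialComplex ℕ) : Submodule (ZMod 2) Chain :=
  Finsupp.supported (ZMod 2) (ZMod 2) K.faces

/-- The cycle group `Z(K)` over all degrees. -/
noncomputable def cycles (K : PreAbstractSimplicialComplex ℕ) : Submodule (ZMod 2) Chain :=
  chains K ⊓ LinearMap.ker boundary

/-- The boundary group `B(K)` over all degrees. -/
noncomputable def boundaries (K : PreAbstractSimplicialComplex ℕ) : Submodule (ZMod 2) Chain :=
  (chains K).map boundary

/-- The homology group `H(K) = Z(K) / B(K)` over all degrees. -/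
abbrev Homology (K : PreAbstractSimplicialComplex ℕ) : Type :=
  Subquotient (cycles K) (boundaries K)

/-- The homology class of a cycle. -/
noncomputable def homologyClass (K : PreAbstractSimplicialComplex ℕ) (z : cycles K) : Homology K :=
  Subquotient.mk (cycles K) (boundaries K) z

theorem chains_mono {K L : PreAbstractSimplicialComplex ℕ} (h : K.faces ⊆ L.faces) :
    chains K ≤ chains L :=
  Finsupp.supported_mono h

theorem cycles_mono {K L : PreAbstractSimplicialComplex ℕ} (h : K.faces ⊆ L.faces) :
    cycles K ≤ cycles L :=
  inf_le_inf_right _ (chains_mono h)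

theorem boundaries_mono {K L : PreAbstractSimplicialComplex ℕ} (h : K.faces ⊆ L.faces) :
    boundaries K ≤ boundaries L :=
  Submodule.map_mono (chains_mono h)

/-- The map on homology induced by an inclusion of complexes. -/
noncomputable def homologyMap {K L : PreAbstractSimplicialComplex ℕ} (h : K.faces ⊆ L.faces) :
    Homology K →ₗ[ZMod 2] Homology L :=
  Subquotient.map (cycles_mono h) (boundaries_mono h)

/-- The map on boundary groups induced by an inclusion of complexes: itself an inclusion. -/
noncomputable def boundariesMap {K L : PreAbstractSimplicialComplex ℕ} (h : K.faces ⊆ L.faces) :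
    boundaries K →ₗ[ZMod 2] boundaries L :=
  Submodule.inclusion (boundaries_mono h)

/-! ## Zigzag modules and their barcodes -/

/-- A zigzag module over `ZMod 2` on the indices `0, …, m`.  The arrow between `i` and `i + 1` points
forward if `dir i = true` and backward if `dir i = false`.  Spaces at indices beyond `m` are
irrelevant. -/
structure ZigzagModule (m : ℕ) (dir : ℕ → Bool) where
  V : ℕ → Type
  [addCommGroup : ∀ i, AddCommGroup (V i)]
  [module : ∀ i, Module (ZMod 2) (V i)]
  fwd : ∀ i, i < m → dir i = true → (V i →ₗ[ZMod 2] V (i + 1))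
  bwd : ∀ i, i < m → dir i = false → (V (i + 1) →ₗ[ZMod 2] V i)

attribute [instance] ZigzagModule.addCommGroup ZigzagModule.module

namespace ZigzagModule

variable {m : ℕ} {dir : ℕ → Bool}

/-- Isomorphism of zigzag modules. -/
structure Iso (M N : ZigzagModule m dir) where
  equiv : ∀ i, i ≤ m → (M.V i ≃ₗ[ZMod 2] N.V i)
  comm_fwd : ∀ (i : ℕ) (hi : i < m) (h : dir i = true) (x : M.V i),
    equiv (i + 1) hi (M.fwd i hi h x) = N.fwd i hi h (equiv i hi.le x)
  comm_bwd : ∀ (i : ℕ) (hi : i < m) (h : dir i = false) (x : M.V (i + 1)),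
    equiv i hi.le (M.bwd i hi h x) = N.bwd i hi h (equiv (i + 1) hi x)

/-- The interval module on `[b, d]`: it is `ZMod 2` at the indices in `[b, d]` and zero at the other
ones. -/
abbrev IntervalSpace (b d i : ℕ) : Type := PLift (b ≤ i ∧ i ≤ d) → ZMod 2

open Classical in
/-- The map of an interval module between the indices `i` and `j`: the identity of `ZMod 2` if both
lie in `[b, d]`, and zero otherwise. -/
noncomputable def intervalMap (b d i j : ℕ) :
    IntervalSpace b d i →ₗ[ZMod 2] IntervalSpace b d j where
  toFun f := fun _ => if h : b ≤ i ∧ i ≤ d then f ⟨h⟩ else 0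
  map_add' f g := by
    funext _
    by_cases h : b ≤ i ∧ i ≤ d <;> simp [h]
  map_smul' c f := by
    funext _
    by_cases h : b ≤ i ∧ i ≤ d <;> simp [h]

/-- The interval module on `[b, d]`. -/
noncomputable def interval (m : ℕ) (dir : ℕ → Bool) (b d : ℕ) : ZigzagModule m dir where
  V i := IntervalSpace b d i
  fwd i _ _ := intervalMap b d i (i + 1)
  bwd i _ _ := intervalMap b d (i + 1) i

/-- The direct sum of a finite family of zigzag modules. -/
noncomputable def directSum {k : ℕ} (M : Fin k → ZigzagModule m dir) : ZigzagModule m dir where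
  V i := ∀ j, (M j).V i
  fwd i hi h := LinearMap.pi fun j => ((M j).fwd i hi h).comp (LinearMap.proj j)
  bwd i hi h := LinearMap.pi fun j => ((M j).bwd i hi h).comp (LinearMap.proj j)

/-- The list `l` of pairs `(b, d)`, regarded as a multiset of intervals `[b, d]`, is the barcode of
`M`: all of them are nonempty intervals in `{0, …, m}`, and `M` is isomorphic to the direct sum of
the corresponding interval modules. -/
def IsBarcode (M : ZigzagModule m dir) (l : List (ℕ × ℕ)) : Prop :=
  (∀ I ∈ l, I.1 ≤ I.2 ∧ I.2 ≤ m) ∧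
    Nonempty (Iso M (directSum fun k : Fin l.length => interval m dir (l.get k).1 (l.get k).2))

end ZigzagModule

/-! ## Zigzag filtrations -/

/-- A simplex-wise zigzag filtration `∅ = K 0 ↔ K 1 ↔ ⋯ ↔ K m`.  For `i < m`, the simplex `σ i` is
inserted when going from `K i` to `K (i + 1)` if `dir i = true`, and it is deleted if
`dir i = false`.  Values at later indices are irrelevant. -/
structure Filtration where
  m : ℕ
  K : ℕ → PreAbstractSimplicialComplex ℕ
  dir : ℕ → Bool
  σ : ℕ → Finset ℕ
  K_zero : (K 0).faces = ∅
  insertion : ∀ i < m, dir i = true →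
    σ i ∉ (K i).faces ∧ (K (i + 1)).faces = insert (σ i) (K i).faces
  deletion : ∀ i < m, dir i = false →
    σ i ∈ (K i).faces ∧ (K (i + 1)).faces = (K i).faces \ {σ i}

namespace Filtration

/-- The maximum number of simplices of a complex in the filtration. -/
noncomputable def n (F : Filtration) : ℕ :=
  (Finset.range (F.m + 1)).sup fun i => (F.K i).faces.ncard

/-- The largest vertex in the filtration (zero if there is none). -/
def maxVertex (F : Filtration) : ℕ :=
  (Finset.range F.m).sup fun i => (F.σ i).sup id

theorem subset_of_fwd (F : Filtration) (i : ℕ) (hi : i < F.m) (h : F.dir i = true) :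
    (F.K i).faces ⊆ (F.K (i + 1)).faces := by
  rw [(F.insertion i hi h).2]
  exact Set.subset_insert _ _

theorem subset_of_bwd (F : Filtration) (i : ℕ) (hi : i < F.m) (h : F.dir i = false) :
    (F.K (i + 1)).faces ⊆ (F.K i).faces := by
  rw [(F.deletion i hi h).2]
  exact Set.sdiff_subset

/-- The homology zigzag module `H(F)`. -/
noncomputable def homologyModule (F : Filtration) : ZigzagModule F.m F.dir where
  V i := Homology (F.K i)
  fwd i hi h := homologyMap (F.subset_of_fwd i hi h)
  bwd i hi h := homologyMap (F.subset_of_bwd i hi h)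

/-- The boundary zigzag module `B(F)`. -/
noncomputable def boundaryModule (F : Filtration) : ZigzagModule F.m F.dir where
  V i := boundaries (F.K i)
  fwd i hi h := boundariesMap (F.subset_of_fwd i hi h)
  bwd i hi h := boundariesMap (F.subset_of_bwd i hi h)

/-! ### Birth and death indices -/

/-- `j + 1` is a homology birth index if the map between `j` and `j + 1` is forward and injective,
or backward and surjective. -/
def IsHomologyBirth (F : Filtration) (b : ℕ) : Prop :=
  ∃ (j : ℕ) (hj : j < F.m), b = j + 1 ∧
    ((∃ h : F.dir j = true, Function.Injective (F.homologyModule.fwd j hj h)) ∨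
      (∃ h : F.dir j = false, Function.Surjective (F.homologyModule.bwd j hj h)))

/-- `j < m` is a homology death index if the map between `j` and `j + 1` is forward and not
injective, or backward and not surjective; `m` is one (with multiplicity the dimension of `H(K m)`)
if `H(K m)` is not zero. -/
def IsHomologyDeath (F : Filtration) (d : ℕ) : Prop :=
  (∃ hd : d < F.m,
    (∃ h : F.dir d = true, ¬ Function.Injective (F.homologyModule.fwd d hd h)) ∨
      (∃ h : F.dir d = false, ¬ Function.Surjective (F.homologyModule.bwd d hd h))) ∨
  (d = F.m ∧ Nontrivial (Homology (F.K F.m)))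

/-- `j + 1` is a boundary birth index if the map between `j` and `j + 1` is forward and not
surjective. -/
def IsBoundaryBirth (F : Filtration) (b : ℕ) : Prop :=
  ∃ (j : ℕ) (hj : j < F.m), b = j + 1 ∧
    ∃ h : F.dir j = true, ¬ Function.Surjective (F.boundaryModule.fwd j hj h)

/-- `j < m` is a boundary death index if the map between `j` and `j + 1` is backward and not
surjective; `m` is one (with multiplicity the dimension of `B(K m)`) if `B(K m)` is not zero. -/
def IsBoundaryDeath (F : Filtration) (d : ℕ) : Prop :=
  (∃ hd : d < F.m, ∃ h : F.dir d = false,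
    ¬ Function.Surjective (F.boundaryModule.bwd d hd h)) ∨
  (d = F.m ∧ Nontrivial (boundaries (F.K F.m)))

/-! ### Representatives -/

/-- All simplices of the chain `c` have dimension `p`. -/
def IsHomogeneous (p : ℕ) (c : Chain) : Prop :=
  ∀ s ∈ c.support, s.card = p + 1

/-- The cycles `z α` for `α ∈ [b, d]` form a homology representative for the interval `[b, d]`.
The values of `z` outside `[b, d]` are irrelevant. -/
structure IsHomologyRep (F : Filtration) (b d : ℕ) (z : ∀ α, cycles (F.K α)) : Prop where
  le : b ≤ d
  birth : F.IsHomologyBirth b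
  death : F.IsHomologyDeath d
  homogeneous : ∃ p, ∀ α, b ≤ α → α ≤ d → IsHomogeneous p (z α : Chain)
  link_fwd : ∀ (α : ℕ) (hα : α < F.m) (h : F.dir α = true), b ≤ α → α < d →
    F.homologyModule.fwd α hα h (homologyClass (F.K α) (z α)) =
      homologyClass (F.K (α + 1)) (z (α + 1))
  link_bwd : ∀ (α : ℕ) (hα : α < F.m) (h : F.dir α = false), b ≤ α → α < d →
    F.homologyModule.bwd α hα h (homologyClass (F.K (α + 1)) (z (α + 1))) =
      homologyClass (F.K α) (z α)
  birth_fwd : ∀ j < F.m, F.dir j = true → b = j + 1 → (z (j + 1) : Chain) ∉ cycles (F.K j)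
  birth_bwd : ∀ (j : ℕ) (hj : j < F.m) (h : F.dir j = false), b = j + 1 →
    homologyClass (F.K (j + 1)) (z (j + 1)) ≠ 0 ∧
      F.homologyModule.bwd j hj h (homologyClass (F.K (j + 1)) (z (j + 1))) = 0
  death_bwd : d < F.m → F.dir d = false → (z d : Chain) ∉ cycles (F.K (d + 1))
  death_fwd : ∀ (hd : d < F.m) (h : F.dir d = true),
    homologyClass (F.K d) (z d) ≠ 0 ∧
      F.homologyModule.fwd d hd h (homologyClass (F.K d) (z d)) = 0

/-- The boundaries `z α` for `α ∈ [b, d]` form a boundary representative for the interval `[b, d]`.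
The values of `z` outside `[b, d]` are irrelevant. -/
structure IsBoundaryRep (F : Filtration) (b d : ℕ) (z : ∀ α, boundaries (F.K α)) : Prop where
  le : b ≤ d
  birth : F.IsBoundaryBirth b
  death : F.IsBoundaryDeath d
  homogeneous : ∃ p, ∀ α, b ≤ α → α ≤ d → IsHomogeneous p (z α : Chain)
  link_fwd : ∀ (α : ℕ) (hα : α < F.m) (h : F.dir α = true), b ≤ α → α < d →
    F.boundaryModule.fwd α hα h (z α) = z (α + 1)
  link_bwd : ∀ (α : ℕ) (hα : α < F.m) (h : F.dir α = false), b ≤ α → α < d →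
    F.boundaryModule.bwd α hα h (z (α + 1)) = z α
  birth_cond : ∀ j < F.m, b = j + 1 → (z (j + 1) : Chain) ∉ boundaries (F.K j)
  death_cond : d < F.m → (z d : Chain) ∉ boundaries (F.K (d + 1))

/-! ### Input encoding -/

/-- The input word list of a filtration: the number `m` followed, for each `i < m`, by `1` for an
insertion or `0` for a deletion, the number of vertices of `σ i`, and these vertices in increasing
order. -/
def encode (F : Filtration) : List ℕ :=
  F.m :: (List.range F.m).flatMap fun i =>
    (if F.dir i then 1 else 0) :: (F.σ i).card :: (F.σ i).sort (· ≤ ·)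

/-- The list `js` of indices denotes the chain `c`: the simplices `σ j` with `j` in `js` are pairwise
different, and `c` is their sum. -/
def Denotes (F : Filtration) (js : List ℕ) (c : Chain) : Prop :=
  (∀ j ∈ js, j < F.m) ∧ (js.map F.σ).Nodup ∧
    c = (js.map fun j => Finsupp.single (F.σ j) (1 : ZMod 2)).sum

end Filtration

/-! ## Output -/

/-- A bar of the output: an interval `[birth, death]` of the homology barcode
(`isBoundary = false`) or of the boundary barcode (`isBoundary = true`), with the list of the cycles
at the indices `birth, birth + 1, …, death`, each of them a list of simplices that are referred to by
indices in the filtration. -/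
structure Bar where
  isBoundary : Bool
  birth : ℕ
  death : ℕ
  cycleList : List (List ℕ)

namespace Bar

/-- The output word list of a bar: the kind of the bar, its two end points, and each of the cycles
preceded by its length. -/
def encode (B : Bar) : List ℕ :=
  (if B.isBoundary then 1 else 0) :: B.birth :: B.death ::
    B.cycleList.flatMap fun js => js.length :: js

/-- The cycles listed for the bar are a representative for its interval: a homology representative
or a boundary representative, according to the kind of the bar. -/
def HasRep (F : Filtration) (B : Bar) : Prop :=
  B.cycleList.length = B.death - B.birth + 1 ∧
  (B.isBoundary = false → ∃ z : ∀ α, cycles (F.K α), F.IsHomologyRep B.birth B.death z ∧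
    ∀ α, B.birth ≤ α → α ≤ B.death →
      F.Denotes (B.cycleList.getD (α - B.birth) []) (z α : Chain)) ∧
  (B.isBoundary = true → ∃ z : ∀ α, boundaries (F.K α), F.IsBoundaryRep B.birth B.death z ∧
    ∀ α, B.birth ≤ α → α ≤ B.death →
      F.Denotes (B.cycleList.getD (α - B.birth) []) (z α : Chain))

end Bar

/-- The intervals of the bars of one kind, with multiplicity. -/
def intervalsOf (isBoundary : Bool) (bars : List Bar) : List (ℕ × ℕ) :=
  (bars.filter fun B => B.isBoundary == isBoundary).map fun B => (B.birth, B.death)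

/-- The list of bars is a correct answer for `F`: its bars of the two kinds form the homology and the
boundary barcode of `F`, and each of its bars comes with a representative. -/
def IsSolution (F : Filtration) (bars : List Bar) : Prop :=
  F.homologyModule.IsBarcode (intervalsOf false bars) ∧
  F.boundaryModule.IsBarcode (intervalsOf true bars) ∧
  ∀ B ∈ bars, B.HasRep F

/-! ## The machine model

A word RAM with structured control flow.  A program uses a fixed finite number of registers and
a fixed finite number of arrays of words.  Each elementary instruction and each test costs one unit of
time.  There is a write-only output stream. -/

/-- A state of the machine: the registers, the arrays (`mem A i` is the word with address `i` in
array `A`), and the words written to the output so far. -/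
structure State where
  reg : ℕ → ℕ
  mem : ℕ → ℕ → ℕ
  out : List ℕ

/-- The elementary instructions; `r`, `a`, `b` are numbers of registers and `A` is the number of an
array. -/
inductive Instr where
  | const (r c : ℕ)
  | move (r a : ℕ)
  | add (r a b : ℕ)
  | sub (r a b : ℕ)
  | mul (r a b : ℕ)
  | load (r A a : ℕ)
  | store (A a r : ℕ)
  | emit (a : ℕ)

/-- Write the value `v` to the register `r`; this fails unless `v < W`. -/
def State.setReg (W : ℕ) (s : State) (r v : ℕ) : Option State :=
  if v < W then some { s with reg := Function.update s.reg r v } else none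

/-- The effect of an elementary instruction.  It fails if it addresses a memory word beyond the
first `S` words of an array, or if it produces a value that is not smaller than `W`. -/
def Instr.exec (S W : ℕ) (s : State) : Instr → Option State
  | .const r c => s.setReg W r c
  | .move r a => s.setReg W r (s.reg a)
  | .add r a b => s.setReg W r (s.reg a + s.reg b)
  | .sub r a b => s.setReg W r (s.reg a - s.reg b)
  | .mul r a b => s.setReg W r (s.reg a * s.reg b)
  | .load r A a => if s.reg a < S then s.setReg W r (s.mem A (s.reg a)) else none
  | .store A a r =>
      if s.reg a < S then
        some { s with
          mem := Function.update s.mem A (Function.update (s.mem A) (s.reg a) (s.reg r)) }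
      else none
  | .emit a => some { s with out := s.out ++ [s.reg a] }

/-- Programs.  The tests compare the contents of the registers `a` and `b`. -/
inductive Prog where
  | skip
  | instr (i : Instr)
  | seq (P Q : Prog)
  | ifLt (a b : ℕ) (P Q : Prog)
  | whileLt (a b : ℕ) (P : Prog)

/-- `Exec S W P s t s'`: the program `P`, started in the state `s`, halts after exactly `t` steps in
the state `s'`, it never addresses a memory word beyond the first `S` words of an array, and all
values that it computes are smaller than `W`. -/
inductive Exec (S W : ℕ) : Prog → State → ℕ → State → Prop
  | skip (s : State) : Exec S W .skip s 1 s
  | instr {i : Instr} {s s' : State} (h : i.exec S W s = some s') : Exec S W (.instr i) s 1 s'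
  | seq {P Q : Prog} {s s' s'' : State} {t t' : ℕ} (h : Exec S W P s t s')
      (h' : Exec S W Q s' t' s'') : Exec S W (.seq P Q) s (t + t') s''
  | ifTrue {a b : ℕ} {P Q : Prog} {s s' : State} {t : ℕ} (hab : s.reg a < s.reg b)
      (h : Exec S W P s t s') : Exec S W (.ifLt a b P Q) s (t + 1) s'
  | ifFalse {a b : ℕ} {P Q : Prog} {s s' : State} {t : ℕ} (hab : ¬ s.reg a < s.reg b)
      (h : Exec S W Q s t s') : Exec S W (.ifLt a b P Q) s (t + 1) s'
  | whileTrue {a b : ℕ} {P : Prog} {s s' s'' : State} {t t' : ℕ} (hab : s.reg a < s.reg b)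
      (h : Exec S W P s t s') (h' : Exec S W (.whileLt a b P) s' t' s'') :
      Exec S W (.whileLt a b P) s (t + t' + 1) s''
  | whileFalse {a b : ℕ} {P : Prog} {s : State} (hab : ¬ s.reg a < s.reg b) :
      Exec S W (.whileLt a b P) s 1 s

/-- The initial state: the input is in array `0`, all other words are zero and the output is
empty. -/
def initState (input : List ℕ) : State where
  reg := fun _ => 0
  mem := fun A i => if A = 0 then input.getD i 0 else 0
  out := []

end ZigzagRep

/-! The mathematical core is a basis of the chain group of `K_i` that is carried along the
filtration. It consists of cycles `x_r`, which either represent a basis of homology (rows in `HR`)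
or form a basis of the boundaries (rows in `BR`), and of chains `y_r` with `∂ y_r = x_r` for the
rows in `BR`. Functionals `φ_r` dual to the `x_r` and zero on the `y_r` give the coordinates of a
cycle without solving a linear system. Each step changes this basis by a few row operations
(`Decomp`, `Decomp.Valid`).

The type of a step depends on one question: does the boundary of `σ_i` bound in the smaller of the
two complexes (`Bounds`)? When `σ_i` is inserted, the coordinates of `∂σ_i` are computed, and its
part in `BR` is cancelled by adding the corresponding `y_r` to `σ_i`. If nothing remains, a new
cycle is born. Otherwise the remaining sum of homology cycles becomes a boundary: one homology bar
dies and a boundary bar starts. When `σ_i` is deleted and some homology cycle contains it, one such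
cycle is added to all other basis chains containing `σ_i` and is dropped. If no cycle contains
`σ_i`, some `y_r` does: the bar of the boundary `x_r` ends and `x_r` becomes a nontrivial cycle.

Correctness of the barcodes needs no uniqueness argument. Once births and deaths are paired so that
each pair has a representative, the classes of the living representatives form a basis at every
index (`homology_isBarcode`, `boundary_isBarcode`, by `isBarcode_of_basis`). The point is therefore
to choose the dying bar such that its sum, or the sums of the survivors, are still representatives.
A sequence may be added to another one if its birth comes earlier in the order given by `key`:
births at deletions precede births at insertions, the former ordered backward and the latter forward
(`PartialRep.add`). The largest key is chosen at an insertion and the smallest one at a deletion;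
for boundary bars the earliest birth is chosen.

A representative has up to `m + 1` terms with up to `n` simplices each, and storing all of them
would exceed the space bound. Each one is instead a set of wires: the wire `w` is the chain that was
newborn at `w`, and it contributes to all terms from `w` on. A set of wires is a bit row of length
`m + 1`, so adding two representatives costs `O(m)` and writing one costs `O(mn)`. The simplices of
the current complex occupy `n` slots; a chain is a bit row over the slots, which stays valid as long
as the chain avoids the simplex being changed (`SlotStep.bitAt_eq`).

A step then costs `O(n ^ 2 + mn)` apart from the search for the facets of `σ_i`, and writing all
bars costs `O(m ^ 2 n)`. The search compares vertex lists, and it is cheap because a simplex with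
`k` vertices has `2 ^ k - 1` nonempty faces in its complex, whence `k ^ 2 ≤ 2 n`. With `n ≤ m` the
total is `O(m ^ 2 n)`.

The program is written in a small structured language with a weakest-precondition calculus, and one
theorem (`Cmd.sound`) transfers termination, time, memory and word size to the RAM. The predicate
`Stores` ties the arrays to the decomposition, `Account` collects the bars written so far, and
`Fits` counts loop iterations. -/

namespace ZigzagRep

/-! ## A structured language compiled to the word RAM -/

/-- Expressions over an environment and the memory. -/
inductive Ex where
  | var (i : ℕ)
  | lit (c : ℕ)
  | add (a b : Ex)
  | sub (a b : Ex)
  | mul (a b : Ex)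
  | load (A : ℕ) (a : Ex)

namespace Ex

/-- The value of an expression. -/
def eval (ρ : List ℕ) (μ : ℕ → ℕ → ℕ) : Ex → ℕ
  | var i => ρ.getD i 0
  | lit c => c
  | add a b => a.eval ρ μ + b.eval ρ μ
  | sub a b => a.eval ρ μ - b.eval ρ μ
  | mul a b => a.eval ρ μ * b.eval ρ μ
  | load A a => μ A (a.eval ρ μ)

/-- The variables are in scope and the loads are within the first `S` words. -/
def Ok (S : ℕ) (ρ : List ℕ) (μ : ℕ → ℕ → ℕ) : Ex → Prop
  | var i => i < ρ.length
  | lit _ => True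
  | add a b => a.Ok S ρ μ ∧ b.Ok S ρ μ
  | sub a b => a.Ok S ρ μ ∧ b.Ok S ρ μ
  | mul a b => a.Ok S ρ μ ∧ b.Ok S ρ μ
  | load _ a => a.Ok S ρ μ ∧ a.eval ρ μ < S

/-- The size of an expression bounds both its evaluation time and the growth of its value. -/
def size : Ex → ℕ
  | var _ => 1
  | lit c => c + 1
  | add a b => a.size + b.size + 1
  | sub a b => a.size + b.size + 1
  | mul a b => a.size + b.size + 1
  | load _ a => a.size + 1

/-- Code that evaluates an expression into the register `tgt`; the environment starts at the
register `base`, and the registers above `tgt` are used as scratch space. -/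
def comp (base : ℕ) : ℕ → Ex → Prog
  | tgt, var i => .instr (.move tgt (base + i))
  | tgt, lit c => .instr (.const tgt c)
  | tgt, add a b => .seq (a.comp base tgt) (.seq (b.comp base (tgt + 1))
      (.instr (.add tgt tgt (tgt + 1))))
  | tgt, sub a b => .seq (a.comp base tgt) (.seq (b.comp base (tgt + 1))
      (.instr (.sub tgt tgt (tgt + 1))))
  | tgt, mul a b => .seq (a.comp base tgt) (.seq (b.comp base (tgt + 1))
      (.instr (.mul tgt tgt (tgt + 1))))
  | tgt, load A a => .seq (a.comp base tgt) (.instr (.load tgt A tgt))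

/-- Since `B + 2 ≥ 2`, a sum of two powers is at most the power whose exponent is the sum of the
exponents plus one, and a literal `c` is below `2 ^ (c + 1)`. A single exponent, fixed by the
program text, thus controls all intermediate words. -/
theorem eval_le {S B : ℕ} {ρ : List ℕ} {μ : ℕ → ℕ → ℕ} (hρ : ∀ v ∈ ρ, v ≤ B)
    (hμ : ∀ A a, μ A a ≤ B) (e : Ex) (h : e.Ok S ρ μ) : e.eval ρ μ ≤ (B + 2) ^ e.size := by
  have key : ∀ a b : ℕ, (B + 2) ^ a + (B + 2) ^ b ≤ (B + 2) ^ (a + b + 1) := by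
    intro a b
    have h1 : (B + 2) ^ a ≤ (B + 2) ^ (a + b) := Nat.pow_le_pow_right (by omega) (by omega)
    have h2 : (B + 2) ^ b ≤ (B + 2) ^ (a + b) := Nat.pow_le_pow_right (by omega) (by omega)
    have h3 : (B + 2) ^ (a + b) * 2 ≤ (B + 2) ^ (a + b) * (B + 2) := Nat.mul_le_mul_left _ (by omega)
    rw [pow_succ]
    omega
  induction e with
  | var i =>
    simp only [Ok] at h
    simp only [eval, size, pow_one, List.getD_eq_getElem _ _ h]
    have := hρ _ (List.getElem_mem h)
    omega
  | lit c =>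
    simp only [eval, size]
    calc c ≤ 2 ^ (c + 1) := by
            have := @Nat.lt_two_pow_self (c + 1)
            omega
      _ ≤ _ := Nat.pow_le_pow_left (by omega) _
  | add a b iha ihb =>
    exact (Nat.add_le_add (iha h.1) (ihb h.2)).trans (key _ _)
  | sub a b iha ihb =>
    refine (Nat.sub_le _ _).trans ((iha h.1).trans ?_)
    exact Nat.pow_le_pow_right (by omega) (by simp only [size]; omega)
  | mul a b iha ihb =>
    refine (Nat.mul_le_mul (iha h.1) (ihb h.2)).trans ?_
    rw [← pow_add]
    exact Nat.pow_le_pow_right (by omega) (by simp only [size]; omega)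
  | load A a _ =>
    refine (hμ _ _).trans ?_
    calc B ≤ (B + 2) ^ 1 := by rw [pow_one]; omega
      _ ≤ _ := Nat.pow_le_pow_right (by omega) (by simp only [size]; omega)

/-- The code writes only to registers from `tgt` on. The second operand is evaluated with target
`tgt + 1` and therefore disturbs neither the first operand nor the environment. -/
theorem comp_sound {S B W : ℕ} {ρ : List ℕ} {base : ℕ} (hρ : ∀ v ∈ ρ, v ≤ B) (e : Ex) :
    ∀ (u : State) (tgt : ℕ), e.Ok S ρ u.mem → (B + 2) ^ e.size < W → (∀ A a, u.mem A a ≤ B) →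
      (∀ i < ρ.length, u.reg (base + i) = ρ.getD i 0) → base + ρ.length ≤ tgt →
      ∃ (t : ℕ) (u' : State), Exec S W (e.comp base tgt) u t u' ∧ t ≤ e.size ∧
        u'.reg tgt = e.eval ρ u.mem ∧ (∀ r < tgt, u'.reg r = u.reg r) ∧ u'.mem = u.mem ∧
        u'.out = u.out := by
  have single : ∀ (u : State) (tgt : ℕ) (i : Instr) (v : ℕ),
      i.exec S W u = u.setReg W tgt v → v < W →
      ∃ u', Exec S W (.instr i) u 1 u' ∧ u'.reg tgt = v ∧ (∀ r < tgt, u'.reg r = u.reg r) ∧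
        u'.mem = u.mem ∧ u'.out = u.out := by
    intro u tgt i v hi hv
    refine ⟨{ u with reg := Function.update u.reg tgt v }, .instr ?_, ?_, ?_, rfl, rfl⟩
    · rw [hi, State.setReg, if_pos hv]
    · simp
    · intro r hr
      simp [Function.update_of_ne (Nat.ne_of_lt hr)]
  -- The three binary operations differ only in the final instruction `I` and its meaning `f`.
  have binary : ∀ (a b : Ex) (f : ℕ → ℕ → ℕ) (I : ℕ → Instr),
      (∀ tgt (u : State), (I tgt).exec S W u =
        u.setReg W tgt (f (u.reg tgt) (u.reg (tgt + 1)))) →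
      (∀ (u : State) (tgt : ℕ), a.Ok S ρ u.mem → (B + 2) ^ a.size < W → (∀ A a, u.mem A a ≤ B) →
        (∀ i < ρ.length, u.reg (base + i) = ρ.getD i 0) → base + ρ.length ≤ tgt →
        ∃ (t : ℕ) (u' : State), Exec S W (a.comp base tgt) u t u' ∧ t ≤ a.size ∧
          u'.reg tgt = a.eval ρ u.mem ∧ (∀ r < tgt, u'.reg r = u.reg r) ∧ u'.mem = u.mem ∧
          u'.out = u.out) →
      (∀ (u : State) (tgt : ℕ), b.Ok S ρ u.mem → (B + 2) ^ b.size < W → (∀ A a, u.mem A a ≤ B) →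
        (∀ i < ρ.length, u.reg (base + i) = ρ.getD i 0) → base + ρ.length ≤ tgt →
        ∃ (t : ℕ) (u' : State), Exec S W (b.comp base tgt) u t u' ∧ t ≤ b.size ∧
          u'.reg tgt = b.eval ρ u.mem ∧ (∀ r < tgt, u'.reg r = u.reg r) ∧ u'.mem = u.mem ∧
          u'.out = u.out) →
      ∀ (u : State) (tgt : ℕ), a.Ok S ρ u.mem → b.Ok S ρ u.mem →
        (B + 2) ^ (a.size + b.size + 1) < W → f (a.eval ρ u.mem) (b.eval ρ u.mem) < W →
        (∀ A a, u.mem A a ≤ B) →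
        (∀ i < ρ.length, u.reg (base + i) = ρ.getD i 0) → base + ρ.length ≤ tgt →
        ∃ (t : ℕ) (u' : State), Exec S W (.seq (a.comp base tgt) (.seq (b.comp base (tgt + 1))
            (.instr (I tgt)))) u t u' ∧ t ≤ a.size + b.size + 1 ∧
          u'.reg tgt = f (a.eval ρ u.mem) (b.eval ρ u.mem) ∧ (∀ r < tgt, u'.reg r = u.reg r) ∧
          u'.mem = u.mem ∧ u'.out = u.out := by
    intro a b f I hI ha hb u tgt oka okb hW hf hμ hreg htgt
    obtain ⟨t1, u1, e1, ht1, r1, f1, m1, o1⟩ := ha u tgt oka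
      ((Nat.pow_le_pow_right (by omega) (by omega)).trans_lt hW) hμ hreg htgt
    obtain ⟨t2, u2, e2, ht2, r2, f2, m2, o2⟩ := hb u1 (tgt + 1) (m1 ▸ okb)
      ((Nat.pow_le_pow_right (by omega) (by omega)).trans_lt hW) (m1 ▸ hμ)
      (fun i hi => by rw [f1 (base + i) (by omega), hreg i hi]) (by omega)
    have r1' : u2.reg tgt = a.eval ρ u.mem := by rw [f2 _ (by omega), r1]
    rw [m1] at r2
    obtain ⟨u3, e3, r3, f3, m3, o3⟩ := single u2 tgt (I tgt) _ (hI tgt u2)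
      (by rw [r1', r2]; exact hf)
    refine ⟨_, u3, .seq e1 (.seq e2 e3), by omega, by rw [r3, r1', r2], ?_, ?_, ?_⟩
    · intro r hr
      rw [f3 r hr, f2 r (by omega), f1 r hr]
    · rw [m3, m2, m1]
    · rw [o3, o2, o1]
  induction e with
  | var i =>
    intro u tgt ok hW hμ hreg htgt
    have hb := eval_le hρ hμ _ ok
    obtain ⟨u', h1, h2, h3, h4, h5⟩ := single u tgt (.move tgt (base + i)) (ρ.getD i 0)
      (by rw [← hreg i ok]; rfl) (hb.trans_lt hW)
    exact ⟨1, u', h1, le_rfl, h2, h3, h4, h5⟩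
  | lit c =>
    intro u tgt ok hW hμ hreg htgt
    have hb := eval_le hρ hμ _ ok
    obtain ⟨u', h1, h2, h3, h4, h5⟩ := single u tgt (.const tgt c) c rfl (hb.trans_lt hW)
    exact ⟨1, u', h1, by simp [size], h2, h3, h4, h5⟩
  | add a b iha ihb =>
    intro u tgt ok hW hμ hreg htgt
    exact binary a b (· + ·) (fun t => .add t t (t + 1)) (fun _ _ => rfl) iha ihb u tgt ok.1 ok.2 hW
      ((eval_le hρ hμ _ ok).trans_lt hW) hμ hreg htgt
  | sub a b iha ihb =>
    intro u tgt ok hW hμ hreg htgt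
    exact binary a b (· - ·) (fun t => .sub t t (t + 1)) (fun _ _ => rfl) iha ihb u tgt ok.1 ok.2 hW
      ((eval_le hρ hμ _ ok).trans_lt hW) hμ hreg htgt
  | mul a b iha ihb =>
    intro u tgt ok hW hμ hreg htgt
    exact binary a b (· * ·) (fun t => .mul t t (t + 1)) (fun _ _ => rfl) iha ihb u tgt ok.1 ok.2 hW
      ((eval_le hρ hμ _ ok).trans_lt hW) hμ hreg htgt
  | load A a iha =>
    intro u tgt ok hW hμ hreg htgt
    obtain ⟨t1, u1, e1, ht1, r1, f1, m1, o1⟩ := iha u tgt ok.1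
      ((Nat.pow_le_pow_right (by omega) (by simp only [size]; omega)).trans_lt hW) hμ hreg htgt
    obtain ⟨u2, e2, r2, f2, m2, o2⟩ := single u1 tgt (.load tgt A tgt) (u.mem A (a.eval ρ u.mem))
      (by
        have := ok.2
        simp only [Instr.exec, r1, m1, if_pos this])
      ((eval_le hρ hμ _ ok).trans_lt hW)
    refine ⟨_, u2, .seq e1 e2, by simp only [size]; omega, r2, ?_, ?_, ?_⟩
    · intro r hr
      rw [f2 r hr, f1 r hr]
    · rw [m2, m1]
    · rw [o2, o1]

end Ex

/-- Commands.  Loops, local definitions and calls extend the environment for their bodies; a loop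
pushes its bound and its counter.  The tag of a loop names an a priori bound for the number of its
iterations. -/
inductive Cmd where
  | skip
  | store (A : ℕ) (a v : Ex)
  | emit (e : Ex)
  | seq (c d : Cmd)
  | ite (a b : Ex) (c d : Cmd)
  | letv (e : Ex) (c : Cmd)
  | loop (tag : ℕ) (e : Ex) (c : Cmd)
  | call (args : List Ex) (c : Cmd)

/-- The parameters that bound a run: the memory size, the largest stored value, and the bounds for
the loops. -/
structure Limits where
  S : ℕ
  B : ℕ
  β : ℕ → ℕ

/-- The memory after a store. -/
def upd (μ : ℕ → ℕ → ℕ) (A : ℕ) (g : ℕ → ℕ) : ℕ → ℕ → ℕ := Function.update μ A g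

namespace Cmd

/-- Weakest precondition. -/
def wp (X : Limits) : Cmd → List ℕ → (ℕ → ℕ → ℕ) → List ℕ → ((ℕ → ℕ → ℕ) → List ℕ → Prop) → Prop
  | skip, _, μ, o, Q => Q μ o
  | store A a v, ρ, μ, o, Q => a.Ok X.S ρ μ ∧ v.Ok X.S ρ μ ∧ a.eval ρ μ < X.S ∧ v.eval ρ μ ≤ X.B ∧
      Q (upd μ A (Function.update (μ A) (a.eval ρ μ) (v.eval ρ μ))) o
  | emit e, ρ, μ, o, Q => e.Ok X.S ρ μ ∧ Q μ (o ++ [e.eval ρ μ])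
  | seq c d, ρ, μ, o, Q => c.wp X ρ μ o fun μ' o' => d.wp X ρ μ' o' Q
  | ite a b c d, ρ, μ, o, Q => a.Ok X.S ρ μ ∧ b.Ok X.S ρ μ ∧
      (a.eval ρ μ < b.eval ρ μ → c.wp X ρ μ o Q) ∧ (¬ a.eval ρ μ < b.eval ρ μ → d.wp X ρ μ o Q)
  | letv e c, ρ, μ, o, Q => e.Ok X.S ρ μ ∧ e.eval ρ μ ≤ X.B ∧ c.wp X (ρ ++ [e.eval ρ μ]) μ o Q
  | loop tag e c, ρ, μ, o, Q => e.Ok X.S ρ μ ∧ e.eval ρ μ ≤ X.β tag ∧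
      ∃ I : ℕ → (ℕ → ℕ → ℕ) → List ℕ → Prop, I 0 μ o ∧
        (∀ k < e.eval ρ μ, ∀ μ' o', I k μ' o' →
          c.wp X (ρ ++ [e.eval ρ μ, k]) μ' o' (I (k + 1))) ∧
        ∀ μ' o', I (e.eval ρ μ) μ' o' → Q μ' o'
  | call args c, ρ, μ, o, Q => (∀ e ∈ args, e.Ok X.S ρ μ ∧ e.eval ρ μ ≤ X.B) ∧
      c.wp X (args.map (Ex.eval ρ μ)) μ o Q

/-- The size of a command bounds the sizes of its expressions. -/
def size : Cmd → ℕ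
  | skip => 1
  | store _ a v => a.size + v.size
  | emit e => e.size
  | seq c d => c.size + d.size
  | ite a b c d => a.size + b.size + c.size + d.size
  | letv e c => e.size + c.size
  | loop _ e c => e.size + c.size
  | call args c => (args.map Ex.size).sum + c.size

/-- A bound for the number of steps. -/
def cost (β : ℕ → ℕ) : Cmd → ℕ
  | skip => 1
  | store _ a v => v.size + a.size + 1
  | emit e => e.size + 1
  | seq c d => c.cost β + d.cost β
  | ite a b c d => a.size + b.size + 1 + (c.cost β + d.cost β)
  | letv e c => e.size + c.cost β
  | loop tag e c => e.size + 2 + β tag * (c.cost β + 3)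
  | call args c => (args.map Ex.size).sum + 1 + c.cost β

/-- Code that evaluates a list of arguments. -/
def compArgs (base : ℕ) : ℕ → List Ex → Prog
  | _, [] => .skip
  | tgt, e :: l => .seq (e.comp base tgt) (compArgs base (tgt + 1) l)

/-- Compilation; the environment of length `len` starts at the register `base`. -/
def comp : ℕ → ℕ → Cmd → Prog
  | _, _, skip => .skip
  | base, len, store A a v => .seq (v.comp base (base + len)) (.seq (a.comp base (base + len + 1))
      (.instr (.store A (base + len + 1) (base + len))))
  | base, len, emit e => .seq (e.comp base (base + len)) (.instr (.emit (base + len)))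
  | base, len, seq c d => .seq (c.comp base len) (d.comp base len)
  | base, len, ite a b c d => .seq (a.comp base (base + len)) (.seq (b.comp base (base + len + 1))
      (.ifLt (base + len) (base + len + 1) (c.comp base len) (d.comp base len)))
  | base, len, letv e c => .seq (e.comp base (base + len)) (c.comp base (len + 1))
  | base, len, loop _ e c => .seq (e.comp base (base + len)) (.seq (.instr (.const (base + len + 1) 0))
      (.whileLt (base + len + 1) (base + len) (.seq (c.comp base (len + 2))
        (.seq (.instr (.const (base + len + 2) 1))
          (.instr (.add (base + len + 1) (base + len + 1) (base + len + 2)))))))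
  | base, len, call args c => .seq (compArgs base (base + len) args) (c.comp (base + len) args.length)

theorem wp_mono {X : Limits} (c : Cmd) : ∀ {ρ : List ℕ} {μ : ℕ → ℕ → ℕ} {o : List ℕ}
    {Q R : (ℕ → ℕ → ℕ) → List ℕ → Prop}, c.wp X ρ μ o Q → (∀ μ' o', Q μ' o' → R μ' o') →
    c.wp X ρ μ o R := by
  induction c with
  | skip => exact fun h hQ => hQ _ _ h
  | store A a v => exact fun h hQ => ⟨h.1, h.2.1, h.2.2.1, h.2.2.2.1, hQ _ _ h.2.2.2.2⟩
  | emit e => exact fun h hQ => ⟨h.1, hQ _ _ h.2⟩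
  | seq c d ihc ihd => exact fun h hQ => ihc h fun _ _ h' => ihd h' hQ
  | ite a b c d ihc ihd =>
    exact fun h hQ => ⟨h.1, h.2.1, fun hl => ihc (h.2.2.1 hl) hQ, fun hl => ihd (h.2.2.2 hl) hQ⟩
  | letv e c ih => exact fun h hQ => ⟨h.1, h.2.1, ih h.2.2 hQ⟩
  | loop tag e c _ =>
    rintro ρ μ o Q R ⟨h1, h2, I, h3, h4, h5⟩ hQ
    exact ⟨h1, h2, I, h3, h4, fun _ _ h => hQ _ _ (h5 _ _ h)⟩
  | call args c ih => exact fun h hQ => ⟨h.1, ih h.2 hQ⟩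

/-- The arguments are stacked above the old environment, so each of them is evaluated in the
caller's environment; the block that they form is the environment of the called command. -/
theorem compArgs_sound {S B W : ℕ} {ρ : List ℕ} {base : ℕ} (hρ : ∀ v ∈ ρ, v ≤ B) (args : List Ex) :
    ∀ (u : State) (tgt : ℕ), (∀ e ∈ args, e.Ok S ρ u.mem) →
      (B + 2) ^ (args.map Ex.size).sum < W → (∀ A a, u.mem A a ≤ B) →
      (∀ i < ρ.length, u.reg (base + i) = ρ.getD i 0) → base + ρ.length ≤ tgt →
      ∃ (t : ℕ) (u' : State), Exec S W (compArgs base tgt args) u t u' ∧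
        t ≤ (args.map Ex.size).sum + 1 ∧
        (∀ i < args.length, u'.reg (tgt + i) = (args.map (Ex.eval ρ u.mem)).getD i 0) ∧
        (∀ r < tgt, u'.reg r = u.reg r) ∧ u'.mem = u.mem ∧ u'.out = u.out := by
  induction args with
  | nil =>
    intro u tgt _ _ _ _ _
    exact ⟨1, u, .skip u, by simp, by simp, fun _ _ => rfl, rfl, rfl⟩
  | cons e l ih =>
    intro u tgt ok hW hμ hreg htgt
    simp only [List.map_cons, List.sum_cons] at hW
    obtain ⟨t1, u1, e1, ht1, r1, f1, m1, o1⟩ := e.comp_sound hρ u tgt (ok e (by simp))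
      ((Nat.pow_le_pow_right (by omega) (by omega)).trans_lt hW) hμ hreg htgt
    obtain ⟨t2, u2, e2, ht2, r2, f2, m2, o2⟩ := ih u1 (tgt + 1)
      (fun e he => m1 ▸ ok e (by simp [he]))
      ((Nat.pow_le_pow_right (by omega) (by omega)).trans_lt hW) (m1 ▸ hμ)
      (fun i hi => by rw [f1 (base + i) (by omega), hreg i hi]) (by omega)
    refine ⟨_, u2, .seq e1 e2, ?_, ?_, ?_, ?_, ?_⟩
    · simp only [List.map_cons, List.sum_cons]
      omega
    · intro i hi
      cases i with
      | zero => simp [f2 tgt (by omega), r1]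
      | succ i =>
        have := r2 i (by simpa using hi)
        rw [show tgt + (i + 1) = tgt + 1 + i by omega, this, m1]
        simp
    · intro r hr
      rw [f2 r (by omega), f1 r hr]
    · rw [m2, m1]
    · rw [o2, o1]

/-- The invariant of the induction: the environment occupies the registers from `base` on, all
memory words are at most `B`, and the registers below the end of the environment are unchanged
afterwards. The last clause is what lets local variables and loop counters live just above the
environment. -/
theorem sound {X : Limits} {W : ℕ} (hβ : ∀ t, X.β t ≤ X.B) (c : Cmd) :
    ∀ (ρ : List ℕ) (base : ℕ) (u : State) (Q : (ℕ → ℕ → ℕ) → List ℕ → Prop),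
      c.wp X ρ u.mem u.out Q → (X.B + 2) ^ (c.size + 1) < W → (∀ v ∈ ρ, v ≤ X.B) →
      (∀ A a, u.mem A a ≤ X.B) → (∀ i < ρ.length, u.reg (base + i) = ρ.getD i 0) →
      ∃ (t : ℕ) (u' : State), Exec X.S W (c.comp base ρ.length) u t u' ∧ t ≤ c.cost X.β ∧
        Q u'.mem u'.out ∧ (∀ A a, u'.mem A a ≤ X.B) ∧
        ∀ r < base + ρ.length, u'.reg r = u.reg r := by
  have sm : ∀ {a b : ℕ}, a ≤ b → (X.B + 2) ^ b < W → (X.B + 2) ^ a < W :=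
    fun hab h => (Nat.pow_le_pow_right (by omega) hab).trans_lt h
  induction c with
  | skip =>
    intro ρ base u Q h _ _ hμ _
    exact ⟨1, u, .skip u, le_rfl, h, hμ, fun _ _ => rfl⟩
  | store A a v =>
    rintro ρ base u Q ⟨oka, okv, ha, hv, hQ⟩ hW hρ hμ hreg
    simp only [size] at hW
    obtain ⟨t1, u1, e1, ht1, r1, f1, m1, o1⟩ := v.comp_sound hρ u (base + ρ.length) okv
      (sm (by omega) hW) hμ hreg le_rfl
    obtain ⟨t2, u2, e2, ht2, r2, f2, m2, o2⟩ := a.comp_sound hρ u1 (base + ρ.length + 1) (m1 ▸ oka)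
      (sm (by omega) hW) (m1 ▸ hμ) (fun i hi => by rw [f1 (base + i) (by omega), hreg i hi]) (by omega)
    have r1' : u2.reg (base + ρ.length) = v.eval ρ u.mem := by rw [f2 _ (by omega), r1]
    rw [m1] at r2 m2
    let u3 : State := ⟨u2.reg, upd u.mem A
      (Function.update (u.mem A) (a.eval ρ u.mem) (v.eval ρ u.mem)), u2.out⟩
    refine ⟨_, u3, .seq e1 (.seq e2 (.instr ?_)), ?_, ?_, ?_, ?_⟩
    · simp only [Instr.exec, r2, r1', if_pos ha, m2, u3, upd]
    · simp only [cost]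
      omega
    · rw [← o1, ← o2] at hQ
      exact hQ
    · intro A' a'
      simp only [u3, upd]
      rcases eq_or_ne A' A with rfl | h
      · rw [Function.update_self, Function.update_apply]
        split_ifs
        · exact hv
        · exact hμ _ _
      · rw [Function.update_of_ne h]
        exact hμ _ _
    · intro r hr
      rw [f2 r (by omega), f1 r hr]
  | emit e =>
    rintro ρ base u Q ⟨ok, hQ⟩ hW hρ hμ hreg
    simp only [size] at hW
    obtain ⟨t1, u1, e1, ht1, r1, f1, m1, o1⟩ := e.comp_sound hρ u (base + ρ.length) ok
      (sm (by omega) hW) hμ hreg le_rfl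
    refine ⟨_, { u1 with out := u1.out ++ [e.eval ρ u.mem] }, .seq e1 (.instr ?_), ?_, ?_, ?_, f1⟩
    · simp only [Instr.exec, r1]
    · simp only [cost]
      omega
    · simpa [m1, o1] using hQ
    · simpa [m1] using hμ
  | seq c d ihc ihd =>
    intro ρ base u Q h hW hρ hμ hreg
    simp only [size] at hW
    obtain ⟨t1, u1, e1, ht1, q1, b1, f1⟩ := ihc ρ base u _ h (sm (by omega) hW) hρ hμ hreg
    obtain ⟨t2, u2, e2, ht2, q2, b2, f2⟩ := ihd ρ base u1 _ q1 (sm (by omega) hW) hρ b1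
      (fun i hi => by rw [f1 (base + i) (by omega), hreg i hi])
    exact ⟨_, u2, .seq e1 e2, by simp only [cost]; omega, q2, b2,
      fun r hr => by rw [f2 r hr, f1 r hr]⟩
  | ite a b c d ihc ihd =>
    rintro ρ base u Q ⟨oka, okb, hc, hd⟩ hW hρ hμ hreg
    simp only [size] at hW
    obtain ⟨t1, u1, e1, ht1, r1, f1, m1, o1⟩ := a.comp_sound hρ u (base + ρ.length) oka
      (sm (by omega) hW) hμ hreg le_rfl
    obtain ⟨t2, u2, e2, ht2, r2, f2, m2, o2⟩ := b.comp_sound hρ u1 (base + ρ.length + 1) (m1 ▸ okb)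
      (sm (by omega) hW) (m1 ▸ hμ) (fun i hi => by rw [f1 (base + i) (by omega), hreg i hi]) (by omega)
    have r1' : u2.reg (base + ρ.length) = a.eval ρ u.mem := by rw [f2 _ (by omega), r1]
    rw [m1] at r2 m2
    rw [o1] at o2
    have hreg2 : ∀ i < ρ.length, u2.reg (base + i) = ρ.getD i 0 := fun i hi => by
      rw [f2 (base + i) (by omega), f1 (base + i) (by omega), hreg i hi]
    by_cases hl : a.eval ρ u.mem < b.eval ρ u.mem
    · obtain ⟨t3, u3, e3, ht3, q3, b3, f3⟩ := ihc ρ base u2 Q (m2 ▸ o2 ▸ hc hl)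
        (sm (by omega) hW) hρ (m2 ▸ hμ) hreg2
      refine ⟨_, u3, .seq e1 (.seq e2 (.ifTrue (by rw [r1', r2]; exact hl) e3)), ?_, q3, b3, ?_⟩
      · simp only [cost]
        omega
      · intro r hr
        rw [f3 r hr, f2 r (by omega), f1 r hr]
    · obtain ⟨t3, u3, e3, ht3, q3, b3, f3⟩ := ihd ρ base u2 Q (m2 ▸ o2 ▸ hd hl)
        (sm (by omega) hW) hρ (m2 ▸ hμ) hreg2
      refine ⟨_, u3, .seq e1 (.seq e2 (.ifFalse (by rw [r1', r2]; exact hl) e3)), ?_, q3, b3, ?_⟩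
      · simp only [cost]
        omega
      · intro r hr
        rw [f3 r hr, f2 r (by omega), f1 r hr]
  | letv e c ih =>
    rintro ρ base u Q ⟨ok, hB, hc⟩ hW hρ hμ hreg
    simp only [size] at hW
    obtain ⟨t1, u1, e1, ht1, r1, f1, m1, o1⟩ := e.comp_sound hρ u (base + ρ.length) ok
      (sm (by omega) hW) hμ hreg le_rfl
    obtain ⟨t2, u2, e2, ht2, q2, b2, f2⟩ := ih (ρ ++ [e.eval ρ u.mem]) base u1 Q
      (by rw [m1, o1]; exact hc) (sm (by omega) hW)
      (fun v hv => by
        rcases List.mem_append.1 hv with hv | hv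
        · exact hρ v hv
        · rw [List.mem_singleton.1 hv]; exact hB) (m1 ▸ hμ)
      (fun i hi => by
        rw [List.length_append, List.length_singleton] at hi
        rcases Nat.lt_succ_iff_lt_or_eq.1 hi with h | rfl
        · rw [f1 _ (by omega), hreg i h, List.getD_append _ _ _ _ h]
        · rw [r1, List.getD_append_right _ _ _ _ le_rfl]
          simp)
    rw [List.length_append, List.length_singleton] at e2 f2
    exact ⟨_, u2, .seq e1 e2, by simp only [cost]; omega, q2, b2,
      fun r hr => by rw [f2 r (by omega), f1 r hr]⟩
  | loop tag e c ih =>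
    rintro ρ base u Q ⟨ok, hN, I, hI0, hIs, hIQ⟩ hW hρ hμ hreg
    simp only [size] at hW
    set N := e.eval ρ u.mem with hNdef
    obtain ⟨t1, u1, e1, ht1, r1, f1, m1, o1⟩ := e.comp_sound hρ u (base + ρ.length) ok
      (sm (by omega) hW) hμ hreg le_rfl
    have hBW : X.B + 2 < W := by simpa using sm (a := 1) (by omega) hW
    have hNB : N ≤ X.B := hN.trans (hβ tag)
    -- Induction on the number `j` of iterations still to be made; `k` is the current value of the
    -- counter.
    have loop : ∀ (j k : ℕ) (v : State), j + k = N → I k v.mem v.out → (∀ A a, v.mem A a ≤ X.B) →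
        v.reg (base + ρ.length + 1) = k → (∀ r < base + ρ.length + 1, v.reg r = u1.reg r) →
        ∃ (t : ℕ) (v' : State), Exec X.S W
          (.whileLt (base + ρ.length + 1) (base + ρ.length) (.seq (c.comp base (ρ.length + 2))
            (.seq (.instr (.const (base + ρ.length + 2) 1)) (.instr
              (.add (base + ρ.length + 1) (base + ρ.length + 1) (base + ρ.length + 2)))))) v t v' ∧
          t ≤ j * (c.cost X.β + 3) + 1 ∧ I N v'.mem v'.out ∧ (∀ A a, v'.mem A a ≤ X.B) ∧
          ∀ r < base + ρ.length + 1, v'.reg r = u1.reg r := by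
      intro j
      induction j with
      | zero =>
        intro k v hk hI hb hc hf
        refine ⟨1, v, .whileFalse ?_, by omega, ?_, hb, hf⟩
        · rw [hc, hf _ (by omega), r1]
          omega
        · rw [← hk, Nat.zero_add]
          exact hI
      | succ j ihj =>
        intro k v hk hI hb hc hf
        obtain ⟨t2, v2, e2, ht2, q2, b2, f2⟩ := ih (ρ ++ [N, k]) base v (I (k + 1))
          (hIs k (by omega) _ _ hI) (sm (by omega) hW)
          (fun w hw => by
            rcases List.mem_append.1 hw with hw | hw
            · exact hρ w hw
            · simp only [List.mem_cons, List.not_mem_nil, or_false] at hw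
              omega) hb
          (fun i hi => by
            simp only [List.length_append, List.length_cons, List.length_nil] at hi
            by_cases h : i < ρ.length
            · rw [hf _ (by omega), f1 _ (by omega), hreg i h, List.getD_append _ _ _ _ h]
            · rw [List.getD_append_right _ _ _ _ (by omega)]
              obtain rfl | rfl : i = ρ.length ∨ i = ρ.length + 1 := by omega
              · rw [hf _ (by omega), r1]
                simp [hNdef]
              · rw [← Nat.add_assoc, hc]
                simp)
        simp only [List.length_append, List.length_cons, List.length_nil] at e2 f2
        let v3 : State := { v2 with reg := Function.update v2.reg (base + ρ.length + 2) 1 }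
        let v4 : State := { v3 with reg := Function.update v3.reg (base + ρ.length + 1) (k + 1) }
        have e3 : Exec X.S W (.instr (.const (base + ρ.length + 2) 1)) v2 1 v3 := .instr (by
          simp only [Instr.exec, State.setReg, if_pos (show 1 < W by omega), v3])
        have e4 : Exec X.S W (.instr
            (.add (base + ρ.length + 1) (base + ρ.length + 1) (base + ρ.length + 2))) v3 1 v4 :=
          .instr (by
            have h1 : v3.reg (base + ρ.length + 1) = k := by
              simp [v3, f2 (base + ρ.length + 1) (by omega), hc]
            have h2 : v3.reg (base + ρ.length + 2) = 1 := by simp [v3]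
            simp only [Instr.exec, State.setReg, h1, h2, if_pos (show k + 1 < W by omega), v4])
        obtain ⟨t5, v5, e5, ht5, q5, b5, f5⟩ := ihj (k + 1) v4 (by omega) q2 b2 (by simp [v4])
          (fun r hr => by
            rw [← hf r hr, ← f2 r (by omega)]
            simp [v4, v3, Function.update_of_ne (show r ≠ base + ρ.length + 1 by omega),
              Function.update_of_ne (show r ≠ base + ρ.length + 2 by omega)])
        refine ⟨_, v5, .whileTrue ?_ (.seq e2 (.seq e3 e4)) e5, ?_, q5, b5, f5⟩
        · rw [hc, hf _ (by omega), r1]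
          omega
        · rw [Nat.succ_mul]
          omega
    let u2 : State := { u1 with reg := Function.update u1.reg (base + ρ.length + 1) 0 }
    have e2 : Exec X.S W (.instr (.const (base + ρ.length + 1) 0)) u1 1 u2 := .instr (by
      simp only [Instr.exec, State.setReg, if_pos (show 0 < W by omega), u2])
    obtain ⟨t3, u3, e3, ht3, q3, b3, f3⟩ := loop N 0 u2 (by omega)
      (by simpa [u2, m1, o1] using hI0) (by simpa [u2, m1] using hμ) (by simp [u2])
      (fun r hr => by simp [u2, Function.update_of_ne (Nat.ne_of_lt hr)])
    refine ⟨_, u3, .seq e1 (.seq e2 e3), ?_, hIQ _ _ q3, b3, ?_⟩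
    · simp only [cost]
      have := Nat.mul_le_mul_right (c.cost X.β + 3) hN
      omega
    · intro r hr
      rw [f3 r (by omega), f1 r hr]
  | call args c ih =>
    rintro ρ base u Q ⟨hargs, hc⟩ hW hρ hμ hreg
    simp only [size] at hW
    obtain ⟨t1, u1, e1, ht1, r1, f1, m1, o1⟩ := compArgs_sound hρ args u (base + ρ.length)
      (fun e he => (hargs e he).1) (sm (by omega) hW) hμ hreg le_rfl
    obtain ⟨t2, u2, e2, ht2, q2, b2, f2⟩ := ih (args.map (Ex.eval ρ u.mem)) (base + ρ.length) u1 Q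
      (by rw [m1, o1]; exact hc) (sm (by omega) hW)
      (fun v hv => by
        obtain ⟨e, he, rfl⟩ := List.mem_map.1 hv
        exact (hargs e he).2) (m1 ▸ hμ)
      (fun i hi => r1 i (by simpa using hi))
    rw [List.length_map] at e2 f2
    exact ⟨_, u2, .seq e1 e2, by simp only [cost]; omega, q2, b2,
      fun r hr => by rw [f2 r (by omega), f1 r hr]⟩

end Cmd

/-! ## Bases of vector spaces over the field with two elements -/

/-- Every vector is the sum of the `v k`, `k ∈ S`, for a unique subset `S` of `s`. -/
def IsBasisOn {ι V : Type} [AddCommGroup V] (v : ι → V) (s : Finset ι) : Prop :=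
  (∀ S ⊆ s, ∑ k ∈ S, v k = 0 → S = ∅) ∧ ∀ x, ∃ S ⊆ s, ∑ k ∈ S, v k = x

theorem add_self_eq_zero_of_module {V : Type} [AddCommGroup V] [Module (ZMod 2) V] (x : V) :
    x + x = 0 := by
  have : ((1 : ZMod 2) + 1) • x = 0 := by
    rw [show (1 : ZMod 2) + 1 = 0 by decide, zero_smul]
  simpa [add_smul] using this

theorem eq_of_add_eq_zero {V : Type} [AddCommGroup V] [Module (ZMod 2) V] {x y : V}
    (h : x + y = 0) : x = y := by
  have := add_self_eq_zero_of_module y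
  exact add_right_cancel (h.trans this.symm)

theorem zmod_two_cases (a : ZMod 2) : a = 0 ∨ a = 1 := by
  revert a
  decide

namespace IsBasisOn

variable {ι V V' : Type} [AddCommGroup V] [Module (ZMod 2) V] [AddCommGroup V']
  [Module (ZMod 2) V'] {v : ι → V} {v' : ι → V'} {s : Finset ι}

theorem of_bijective (h : IsBasisOn v s) {f : V →ₗ[ZMod 2] V'} (hf : Function.Bijective f)
    (hv : ∀ k ∈ s, f (v k) = v' k) : IsBasisOn v' s := by
  have hs : ∀ S ⊆ s, f (∑ k ∈ S, v k) = ∑ k ∈ S, v' k := fun S hS => by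
    rw [map_sum]
    exact Finset.sum_congr rfl fun k hk => hv k (hS hk)
  refine ⟨fun S hS h0 => h.1 S hS (hf.1 (by rw [hs S hS, h0, map_zero])), fun x => ?_⟩
  obtain ⟨y, rfl⟩ := hf.2 x
  obtain ⟨S, hS, rfl⟩ := h.2 y
  exact ⟨S, hS, (hs S hS).symm⟩

theorem of_bijective_symm (h : IsBasisOn v s) {f : V' →ₗ[ZMod 2] V} (hf : Function.Bijective f)
    (hv : ∀ k ∈ s, f (v' k) = v k) : IsBasisOn v' s := by
  refine h.of_bijective (f := ((LinearEquiv.ofBijective f hf).symm : V →ₗ[ZMod 2] V'))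
    (LinearEquiv.bijective _) fun k hk => ?_
  rw [← hv k hk]
  exact (LinearEquiv.ofBijective f hf).symm_apply_apply _

variable [DecidableEq ι]

/-- The image of `f` is a hyperplane that misses `v' k₀`. Over the field with two elements it has
just two cosets, and `hc` says that every vector lies in one of them. This and the next three lemmas
are the ways in which a basis can change along one arrow of a zigzag module. -/
theorem insert_of_injective (h : IsBasisOn v s) {f : V →ₗ[ZMod 2] V'} (hf : Function.Injective f)
    (hv : ∀ k ∈ s, f (v k) = v' k) {k₀ : ι} (hk₀ : k₀ ∉ s) (hr : ∀ x, f x ≠ v' k₀)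
    (hc : ∀ x, (∃ y, f y = x) ∨ ∃ y, f y = x + v' k₀) : IsBasisOn v' (insert k₀ s) := by
  have hs : ∀ S ⊆ s, f (∑ k ∈ S, v k) = ∑ k ∈ S, v' k := fun S hS => by
    rw [map_sum]
    exact Finset.sum_congr rfl fun k hk => hv k (hS hk)
  refine ⟨fun S hS h0 => ?_, fun x => ?_⟩
  · by_cases hk : k₀ ∈ S
    · exfalso
      rw [← Finset.add_sum_erase _ _ hk] at h0
      refine hr (∑ k ∈ S.erase k₀, v k) ?_
      rw [hs _ (fun k hk' => Finset.mem_of_mem_insert_of_ne (hS (Finset.mem_of_mem_erase hk'))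
        (Finset.ne_of_mem_erase hk'))]
      exact (eq_of_add_eq_zero h0).symm
    · have hS' : S ⊆ s := (Finset.subset_insert_iff_of_notMem hk).1 hS
      exact h.1 S hS' (hf (by rw [hs S hS', h0, map_zero]))
  · rcases hc x with ⟨y, hy⟩ | ⟨y, hy⟩
    · obtain ⟨S, hS, rfl⟩ := h.2 y
      exact ⟨S, hS.trans (Finset.subset_insert _ _), by rw [← hs S hS, hy]⟩
    · obtain ⟨S, hS, rfl⟩ := h.2 y
      refine ⟨insert k₀ S, Finset.insert_subset_insert _ hS, ?_⟩
      rw [Finset.sum_insert (fun hk => hk₀ (hS hk)), ← hs S hS, hy, add_comm, add_assoc,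
        add_self_eq_zero_of_module, add_zero]

/-- The kernel has the two elements `0` and `v k₀`. A relation among the images lifts to a sum lying
in the kernel, and it is ruled out by the independence of the old basis with or without `v k₀`. -/
theorem erase_of_surjective (h : IsBasisOn v s) {f : V →ₗ[ZMod 2] V'} (hf : Function.Surjective f)
    {k₀ : ι} (hk₀ : k₀ ∈ s) (hv : ∀ k ∈ s.erase k₀, f (v k) = v' k) (hz : f (v k₀) = 0)
    (hker : ∀ x, f x = 0 → x = 0 ∨ x = v k₀) : IsBasisOn v' (s.erase k₀) := by
  have hs : ∀ S ⊆ s.erase k₀, f (∑ k ∈ S, v k) = ∑ k ∈ S, v' k := fun S hS => by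
    rw [map_sum]
    exact Finset.sum_congr rfl fun k hk => hv k (hS hk)
  refine ⟨fun S hS h0 => ?_, fun x => ?_⟩
  · have hkS : k₀ ∉ S := fun hk => (Finset.ne_of_mem_erase (hS hk)) rfl
    rw [← hs S hS] at h0
    rcases hker _ h0 with h1 | h1
    · exact h.1 S (hS.trans (Finset.erase_subset _ _)) h1
    · have := h.1 (insert k₀ S) (Finset.insert_subset hk₀ (hS.trans (Finset.erase_subset _ _)))
        (by rw [Finset.sum_insert hkS, h1, add_self_eq_zero_of_module])
      exact absurd this (Finset.insert_ne_empty _ _)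
  · obtain ⟨y, rfl⟩ := hf x
    obtain ⟨S, hS, rfl⟩ := h.2 y
    refine ⟨S.erase k₀, Finset.erase_subset_erase _ hS, ?_⟩
    rw [← hs _ (Finset.erase_subset_erase _ hS)]
    by_cases hk : k₀ ∈ S
    · rw [← Finset.add_sum_erase _ _ hk, map_add, hz, zero_add]
    · rw [Finset.erase_eq_of_notMem hk]

/-- The arrow points from the new space into the old one. If `v k₀` occurred in the expansion of a
vector in the image, then `v k₀` itself would be in the image, because the other basis vectors are.
-/
theorem erase_of_injective (h : IsBasisOn v s) {f : V' →ₗ[ZMod 2] V} (hf : Function.Injective f)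
    {k₀ : ι} (hv : ∀ k ∈ s.erase k₀, f (v' k) = v k) (hr : ∀ x, f x ≠ v k₀) :
    IsBasisOn v' (s.erase k₀) := by
  have hs : ∀ S ⊆ s.erase k₀, f (∑ k ∈ S, v' k) = ∑ k ∈ S, v k := fun S hS => by
    rw [map_sum]
    exact Finset.sum_congr rfl fun k hk => hv k (hS hk)
  refine ⟨fun S hS h0 => h.1 S (hS.trans (Finset.erase_subset _ _))
    (by rw [← hs S hS, h0, map_zero]), fun x => ?_⟩
  obtain ⟨S, hS, hx⟩ := h.2 (f x)
  have hk : k₀ ∉ S := fun hk => by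
    rw [← Finset.add_sum_erase _ _ hk, ← hs _ (Finset.erase_subset_erase _ hS)] at hx
    refine hr (x + ∑ k ∈ S.erase k₀, v' k) ?_
    rw [map_add, ← hx, add_assoc, add_self_eq_zero_of_module, add_zero]
  have hS' : S ⊆ s.erase k₀ := fun k hk' =>
    Finset.mem_erase.2 ⟨fun e => hk (e ▸ hk'), hS hk'⟩
  exact ⟨S, hS', hf (by rw [hs S hS', hx])⟩

/-- The arrow points back to the old space and its kernel is generated by the new vector: a vector
minus a lift of its image lies in `{0, v' k₀}`. -/
theorem insert_of_kernel (h : IsBasisOn v s) {f : V' →ₗ[ZMod 2] V} {k₀ : ι} (hk₀ : k₀ ∉ s) (hv : ∀ k ∈ s, f (v' k) = v k)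
    (hz : f (v' k₀) = 0) (hne : v' k₀ ≠ 0) (hker : ∀ x, f x = 0 → x = 0 ∨ x = v' k₀) :
    IsBasisOn v' (insert k₀ s) := by
  have hs : ∀ S ⊆ s, f (∑ k ∈ S, v' k) = ∑ k ∈ S, v k := fun S hS => by
    rw [map_sum]
    exact Finset.sum_congr rfl fun k hk => hv k (hS hk)
  refine ⟨fun S hS h0 => ?_, fun x => ?_⟩
  · by_cases hk : k₀ ∈ S
    · exfalso
      have hS' : S.erase k₀ ⊆ s := fun k hk' =>
        Finset.mem_of_mem_insert_of_ne (hS (Finset.mem_of_mem_erase hk'))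
          (Finset.ne_of_mem_erase hk')
      rw [← Finset.add_sum_erase _ _ hk] at h0
      have h1 := congrArg f h0
      rw [map_add, hz, zero_add, hs _ hS', map_zero] at h1
      rw [h.1 _ hS' h1, Finset.sum_empty, add_zero] at h0
      exact hne h0
    · have hS' : S ⊆ s := (Finset.subset_insert_iff_of_notMem hk).1 hS
      exact h.1 S hS' (by rw [← hs S hS', h0, map_zero])
  · obtain ⟨S, hS, hx⟩ := h.2 (f x)
    have h1 : f (x + ∑ k ∈ S, v' k) = 0 := by
      rw [map_add, hs S hS, hx, add_self_eq_zero_of_module]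
    rcases hker _ h1 with h2 | h2
    · exact ⟨S, hS.trans (Finset.subset_insert _ _), (eq_of_add_eq_zero h2).symm⟩
    · refine ⟨insert k₀ S, Finset.insert_subset_insert _ hS, ?_⟩
      rw [Finset.sum_insert (fun hk => hk₀ (hS hk)), ← h2, add_assoc, add_self_eq_zero_of_module,
        add_zero]

end IsBasisOn

/-! ## A criterion for barcodes -/

namespace ZigzagModule

variable {m : ℕ} {dir : ℕ → Bool}

/-- The bars of `l` that are alive at the index `i`. -/
def alive (l : List (ℕ × ℕ)) (i : ℕ) : Finset (Fin l.length) :=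
  Finset.univ.filter fun k => (l.get k).1 ≤ i ∧ i ≤ (l.get k).2

open Classical in
/-- The coordinate of an element of an interval space, extended by zero. -/
noncomputable def coord (b d i : ℕ) : IntervalSpace b d i →ₗ[ZMod 2] ZMod 2 :=
  if h : b ≤ i ∧ i ≤ d then LinearMap.proj ⟨h⟩ else 0

theorem coord_of_alive {b d i : ℕ} (h : b ≤ i ∧ i ≤ d) (f : IntervalSpace b d i) :
    coord b d i f = f ⟨h⟩ := by
  simp [coord, h]

theorem coord_of_not_alive {b d i : ℕ} (h : ¬ (b ≤ i ∧ i ≤ d)) (f : IntervalSpace b d i) :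
    coord b d i f = 0 := by
  simp [coord, h]

theorem coord_intervalMap (b d i j : ℕ) (f : IntervalSpace b d i) :
    coord b d j (intervalMap b d i j f) = if b ≤ j ∧ j ≤ d then coord b d i f else 0 := by
  by_cases hj : b ≤ j ∧ j ≤ d
  · rw [if_pos hj, coord_of_alive hj]
    by_cases hi : b ≤ i ∧ i ≤ d
    · rw [coord_of_alive hi]
      simp [intervalMap, hi]
    · rw [coord_of_not_alive hi]
      simp [intervalMap, hi]
  · rw [if_neg hj, coord_of_not_alive hj]

/-- Vectors that form a basis at every index and that are compatible with the arrows exhibit a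
barcode. -/
theorem isBarcode_of_basis (M : ZigzagModule m dir) (l : List (ℕ × ℕ))
    (v : Fin l.length → ∀ i, M.V i) (hl : ∀ I ∈ l, I.1 ≤ I.2 ∧ I.2 ≤ m)
    (hbas : ∀ i ≤ m, IsBasisOn (fun k => v k i) (alive l i))
    (hfwd : ∀ i hi h, ∀ k ∈ alive l i,
      M.fwd i hi h (v k i) = if k ∈ alive l (i + 1) then v k (i + 1) else 0)
    (hbwd : ∀ i hi h, ∀ k ∈ alive l (i + 1),
      M.bwd i hi h (v k (i + 1)) = if k ∈ alive l i then v k i else 0) : M.IsBarcode l := by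
  classical
  refine ⟨hl, ?_⟩
  let N := directSum fun k : Fin l.length => interval m dir (l.get k).1 (l.get k).2
  let co : ∀ i, N.V i → Fin l.length → ZMod 2 := fun i f k => coord (l.get k).1 (l.get k).2 i (f k)
  let Φ : ∀ i, N.V i →ₗ[ZMod 2] M.V i := fun i =>
    ∑ k, ((coord (l.get k).1 (l.get k).2 i).comp (LinearMap.proj k)).smulRight (v k i)
  have hΦ : ∀ i f, Φ i f = ∑ k, co i f k • v k i := fun i f => by
    simp only [Φ, co, LinearMap.sum_apply, LinearMap.smulRight_apply]
    rfl
  have hco : ∀ i f k, k ∉ alive l i → co i f k = 0 := fun i f k hk =>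
    coord_of_not_alive (by simpa [alive] using hk) _
  have hbij : ∀ i ≤ m, Function.Bijective (Φ i) := by
    intro i hi
    -- With two scalars a coefficient vector is the indicator of a subset, so `Φ` takes subset sums
    -- and the two halves of `IsBasisOn` are injectivity and surjectivity.
    have hsum : ∀ f, Φ i f = ∑ k ∈ (alive l i).filter (fun k => co i f k = 1), v k i := fun f => by
      rw [hΦ, Finset.sum_filter, ← Finset.sum_subset (Finset.subset_univ (alive l i))
        (fun k _ hk => by rw [hco i f k hk, zero_smul])]
      refine Finset.sum_congr rfl fun k _ => ?_
      rcases zmod_two_cases (co i f k) with h | h <;> simp [h]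
    constructor
    · rw [injective_iff_map_eq_zero]
      intro f hf
      rw [hsum] at hf
      have h0 := (hbas i hi).1 _ (Finset.filter_subset _ _) hf
      funext k ⟨h⟩
      have hk : k ∈ alive l i := by simpa [alive] using h
      rcases zmod_two_cases (co i f k) with h1 | h1
      · have : co i f k = f k ⟨h⟩ := coord_of_alive h _
        rw [← this, h1]
        rfl
      · have : k ∈ (alive l i).filter (fun k => co i f k = 1) := Finset.mem_filter.2 ⟨hk, h1⟩
        rw [h0] at this
        exact absurd this (Finset.notMem_empty _)
    · intro x
      obtain ⟨S, hS, rfl⟩ := (hbas i hi).2 x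
      let f : N.V i := fun k _ => if k ∈ S then 1 else 0
      refine ⟨f, ?_⟩
      rw [hsum]
      refine Finset.sum_congr ?_ fun _ _ => rfl
      ext k
      rw [Finset.mem_filter]
      constructor
      · rintro ⟨hk, h1⟩
        have h : (l.get k).1 ≤ i ∧ i ≤ (l.get k).2 := by simpa [alive] using hk
        have : co i f k = f k ⟨h⟩ := coord_of_alive h _
        rw [this] at h1
        by_contra hkS
        simp [f, hkS] at h1
      · intro hk
        have h : (l.get k).1 ≤ i ∧ i ≤ (l.get k).2 := by simpa [alive] using hS hk
        have : co i f k = f k ⟨h⟩ := coord_of_alive h _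
        exact ⟨hS hk, by rw [this]; simp [f, hk]⟩
  -- Stated for arbitrary `i` and `j`, so that it serves forward and backward arrows alike.
  have key : ∀ (i j : ℕ) (g : M.V i →ₗ[ZMod 2] M.V j) (h : N.V i →ₗ[ZMod 2] N.V j)
      (_ : ∀ f k, h f k = intervalMap (l.get k).1 (l.get k).2 i j (f k))
      (_ : ∀ k ∈ alive l i, g (v k i) = if k ∈ alive l j then v k j else 0) (f : N.V i),
      g (Φ i f) = Φ j (h f) := by
    intro i j g h hh hg f
    rw [hΦ, hΦ, map_sum]
    refine Finset.sum_congr rfl fun k _ => ?_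
    have e : co j (h f) k = if k ∈ alive l j then co i f k else 0 := by
      simp only [co, hh]
      refine (coord_intervalMap _ _ _ _ _).trans ?_
      simp only [alive, Finset.mem_filter, Finset.mem_univ, true_and]
    rw [map_smul, e]
    by_cases hk : k ∈ alive l i
    · rw [hg k hk]
      split_ifs <;> simp
    · rw [hco i f k hk]
      simp
  let E : ∀ i, i ≤ m → (N.V i ≃ₗ[ZMod 2] M.V i) := fun i hi =>
    LinearEquiv.ofBijective (Φ i) (hbij i hi)
  have hE : ∀ i hi f, E i hi f = Φ i f := fun _ _ _ => rfl
  refine ⟨⟨fun i hi => (E i hi).symm, fun i hi h x => ?_, fun i hi h x => ?_⟩⟩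
  · rw [LinearEquiv.symm_apply_eq, hE _ hi]
    obtain ⟨f, rfl⟩ := (E i hi.le).surjective x
    rw [LinearEquiv.symm_apply_apply]
    exact key i (i + 1) (M.fwd i hi h) (N.fwd i hi h) (fun _ _ => rfl) (hfwd i hi h) f
  · rw [LinearEquiv.symm_apply_eq, hE _ hi.le]
    obtain ⟨f, rfl⟩ := (E (i + 1) hi).surjective x
    rw [LinearEquiv.symm_apply_apply]
    exact key (i + 1) i (M.bwd i hi h) (N.bwd i hi h) (fun _ _ => rfl) (hbwd i hi h) f

end ZigzagModule

/-! ## Adding one simplex to a complex -/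

/-- The chain of a simplex. -/
noncomputable abbrev simplexChain (s : Finset ℕ) : Chain := Finsupp.single s 1

theorem mem_chains {K : PreAbstractSimplicialComplex ℕ} {c : Chain} :
    c ∈ chains K ↔ ∀ s, c s ≠ 0 → s ∈ K.faces := by
  rw [chains, Finsupp.mem_supported]
  simp [Set.subset_def]

theorem mem_cycles {K : PreAbstractSimplicialComplex ℕ} {c : Chain} :
    c ∈ cycles K ↔ c ∈ chains K ∧ boundary c = 0 := by
  rw [cycles, Submodule.mem_inf, LinearMap.mem_ker]

theorem mem_boundaries {K : PreAbstractSimplicialComplex ℕ} {c : Chain} :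
    c ∈ boundaries K ↔ ∃ y ∈ chains K, boundary y = c :=
  Submodule.mem_map

theorem boundary_simplexChain (s : Finset ℕ) : boundary (simplexChain s) = facetSum s := by
  simp [boundary, simplexChain]

theorem facetSum_apply_ne_zero {s t : Finset ℕ} (h : facetSum s t ≠ 0) :
    t.Nonempty ∧ ∃ v ∈ s, t = s.erase v := by
  rw [facetSum, Finsupp.finsetSum_apply] at h
  obtain ⟨v, hv, hne⟩ := Finset.exists_ne_zero_of_sum_ne_zero h
  split_ifs at hne with h1
  · rw [Finsupp.single_apply] at hne
    split_ifs at hne with h2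
    · exact ⟨h2 ▸ h1, v, hv, h2.symm⟩
    · exact absurd rfl hne
  · exact absurd rfl hne

/-- The coefficient depends only on an inclusion and on cardinalities, which is what the program can
test from the size of an intersection. -/
theorem facetSum_apply {s t : Finset ℕ} :
    facetSum s t = if t.Nonempty ∧ t ⊆ s ∧ t.card + 1 = s.card then 1 else 0 := by
  split_ifs with h
  · obtain ⟨h1, h2, h3⟩ := h
    obtain ⟨v, hv⟩ : ∃ v, s \ t = {v} := by
      rw [← Finset.card_eq_one, Finset.card_sdiff_of_subset h2]
      omega
    have hvs : v ∈ s := (Finset.mem_sdiff.1 (hv ▸ Finset.mem_singleton_self v)).1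
    have hvt : v ∉ t := (Finset.mem_sdiff.1 (hv ▸ Finset.mem_singleton_self v)).2
    have ht : s.erase v = t := by
      rw [Finset.erase_eq, ← hv, Finset.sdiff_sdiff_eq_self h2]
    rw [facetSum, Finsupp.finsetSum_apply, Finset.sum_eq_single v]
    · rw [ht, if_pos h1, Finsupp.single_eq_same]
    · intro w hw hwv
      split_ifs
      · rw [Finsupp.single_apply, if_neg]
        intro e
        have : w ∈ s.erase v := Finset.mem_erase.2 ⟨hwv, hw⟩
        rw [ht, ← e] at this
        exact Finset.notMem_erase _ _ this
      · rfl
    · exact fun hn => absurd hvs hn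
  · by_contra hne
    obtain ⟨h1, v, hv, rfl⟩ := facetSum_apply_ne_zero hne
    exact h ⟨h1, Finset.erase_subset _ _, Finset.card_erase_add_one hv⟩

/-- Each face of codimension two arises from two ordered pairs of removed vertices, and the two
terms cancel modulo two. -/
theorem boundary_boundary (c : Chain) : boundary (boundary c) = 0 := by
  have key : ∀ s : Finset ℕ, boundary (facetSum s) = 0 := by
    intro s
    let G : ℕ → ℕ → Chain := fun v w =>
      if ((s.erase v).erase w).Nonempty then simplexChain ((s.erase v).erase w) else 0
    have h1 : boundary (facetSum s) = ∑ v ∈ s, ∑ w ∈ s.erase v, G v w := by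
      rw [facetSum, map_sum]
      refine Finset.sum_congr rfl fun v _ => ?_
      split_ifs with h
      · rw [boundary_simplexChain]
        rfl
      -- If removing `v` leaves nothing, the inner sum is empty as well, so a vertex needs no
      -- separate treatment.
      · rw [Finset.not_nonempty_iff_eq_empty.1 h, map_zero, Finset.sum_empty]
    rw [h1, Finset.sum_sigma']
    -- The involution exchanges the two removed vertices; it has no fixed point because they differ.
    refine Finset.sum_involution (fun p _ => ⟨p.2, p.1⟩) ?_ ?_ ?_ ?_
    · rintro ⟨v, w⟩ _
      simp only [G, Finset.erase_right_comm (a := w)]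
      exact add_self_eq_zero_of_module _
    · rintro ⟨v, w⟩ hp _ e
      simp only [Finset.mem_sigma, Finset.mem_erase] at hp
      simp only [Sigma.mk.injEq, heq_eq_eq] at e
      exact hp.2.1 e.1
    · rintro ⟨v, w⟩ hp
      simp only [Finset.mem_sigma, Finset.mem_erase] at hp ⊢
      exact ⟨hp.2.2, hp.2.1.symm, hp.1⟩
    · rintro ⟨v, w⟩ _
      rfl
  have : boundary.comp boundary = 0 := by
    refine Finsupp.lhom_ext' fun s => LinearMap.ext_ring ?_
    simp only [LinearMap.comp_apply, Finsupp.lsingle_apply, LinearMap.zero_apply]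
    rw [boundary_simplexChain, key]
  exact LinearMap.congr_fun this c

theorem boundaries_le_cycles (K : PreAbstractSimplicialComplex ℕ) : boundaries K ≤ cycles K := by
  intro c hc
  obtain ⟨y, hy, rfl⟩ := mem_boundaries.1 hc
  refine mem_cycles.2 ⟨mem_chains.2 fun t ht => ?_, boundary_boundary y⟩
  rw [boundary, Finsupp.linearCombination_apply, Finsupp.sum, Finsupp.finsetSum_apply] at ht
  obtain ⟨s, hs, hne⟩ := Finset.exists_ne_zero_of_sum_ne_zero ht
  have h1 : facetSum s t ≠ 0 := fun h0 => hne (by simp [h0])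
  obtain ⟨h2, v, _, rfl⟩ := facetSum_apply_ne_zero h1
  exact (K.isRelLowerSet_faces (mem_chains.1 hy s (Finsupp.mem_support_iff.1 hs))).2
    (Finset.erase_subset _ _) h2

theorem homologyClass_eq_zero {K : PreAbstractSimplicialComplex ℕ} {z : cycles K} :
    homologyClass K z = 0 ↔ (z : Chain) ∈ boundaries K := by
  rw [homologyClass, Subquotient.mk]
  exact (Submodule.Quotient.mk_eq_zero _).trans Iff.rfl

theorem homologyClass_surjective (K : PreAbstractSimplicialComplex ℕ) :
    Function.Surjective (homologyClass K) :=
  Submodule.mkQ_surjective _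

theorem homologyClass_add (K : PreAbstractSimplicialComplex ℕ) (y z : cycles K) :
    homologyClass K (y + z) = homologyClass K y + homologyClass K z :=
  map_add (Subquotient.mk _ _) y z

theorem homologyMap_homologyClass {K L : PreAbstractSimplicialComplex ℕ} (h : K.faces ⊆ L.faces)
    (z : cycles K) :
    homologyMap h (homologyClass K z) = homologyClass L ⟨z, cycles_mono h z.2⟩ :=
  rfl

theorem homologyClass_eq_iff {K : PreAbstractSimplicialComplex ℕ} {y z : cycles K} :
    homologyClass K y = homologyClass K z ↔ (y : Chain) + z ∈ boundaries K := by
  have h : homologyClass K (y + z) = 0 ↔ (y : Chain) + z ∈ boundaries K := homologyClass_eq_zero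
  rw [← h, homologyClass_add]
  constructor
  · intro e
    rw [e]
    exact add_self_eq_zero_of_module _
  · exact eq_of_add_eq_zero

/-- The complex `L` is obtained from `K` by inserting the simplex `s`. -/
structure Adds (K L : PreAbstractSimplicialComplex ℕ) (s : Finset ℕ) : Prop where
  notMem : s ∉ K.faces
  faces : L.faces = insert s K.faces

namespace Adds

variable {K L : PreAbstractSimplicialComplex ℕ} {s : Finset ℕ}

theorem subset (h : Adds K L s) : K.faces ⊆ L.faces := by
  rw [h.faces]
  exact Set.subset_insert _ _

theorem mem (h : Adds K L s) : s ∈ L.faces := by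
  rw [h.faces]
  exact Set.mem_insert _ _

theorem simplexChain_mem (h : Adds K L s) : simplexChain s ∈ chains L :=
  mem_chains.2 fun t ht => by
    rw [Finsupp.single_apply] at ht
    split_ifs at ht with e
    · exact e ▸ h.mem
    · exact absurd rfl ht

theorem apply_eq_zero (h : Adds K L s) {c : Chain} (hc : c ∈ chains K) : c s = 0 := by
  by_contra hne
  exact h.notMem (mem_chains.1 hc s hne)

theorem mem_chains_of_apply (h : Adds K L s) {c : Chain} (hc : c ∈ chains L) (h0 : c s = 0) :
    c ∈ chains K :=
  mem_chains.2 fun t ht => by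
    have := mem_chains.1 hc t ht
    rw [h.faces] at this
    rcases this with rfl | this
    · exact absurd h0 ht
    · exact this

theorem mem_or_add_mem (h : Adds K L s) {c : Chain} (hc : c ∈ chains L) :
    c ∈ chains K ∨ c + simplexChain s ∈ chains K := by
  rcases zmod_two_cases (c s) with h0 | h1
  · exact .inl (h.mem_chains_of_apply hc h0)
  · refine .inr (h.mem_chains_of_apply (add_mem hc h.simplexChain_mem) ?_)
    rw [Finsupp.add_apply, h1, Finsupp.single_eq_same]
    rfl

/-- The new simplex is a facet of no simplex. -/
theorem boundary_apply (h : Adds K L s) {c : Chain} (hc : c ∈ boundaries L) : c s = 0 := by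
  obtain ⟨y, hy, rfl⟩ := mem_boundaries.1 hc
  by_contra hne
  rw [boundary, Finsupp.linearCombination_apply, Finsupp.sum, Finsupp.finsetSum_apply] at hne
  obtain ⟨t, ht, hne⟩ := Finset.exists_ne_zero_of_sum_ne_zero hne
  have h1 : facetSum t s ≠ 0 := fun h0 => hne (by simp [h0])
  obtain ⟨h2, v, hv, e⟩ := facetSum_apply_ne_zero h1
  have htL := mem_chains.1 hy t (Finsupp.mem_support_iff.1 ht)
  rw [h.faces] at htL
  rcases htL with rfl | htK
  · rw [e] at hv
    exact Finset.notMem_erase _ _ hv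
  · exact h.notMem ((K.isRelLowerSet_faces htK).2 (e ▸ Finset.erase_subset _ _) h2)

theorem boundary_mem (h : Adds K L s) : boundary (simplexChain s) ∈ cycles K := by
  have h1 : boundary (simplexChain s) ∈ boundaries L :=
    mem_boundaries.2 ⟨_, h.simplexChain_mem, rfl⟩
  have h2 := mem_cycles.1 (boundaries_le_cycles L h1)
  exact mem_cycles.2 ⟨h.mem_chains_of_apply h2.1 (h.boundary_apply h1), h2.2⟩

theorem mem_boundaries_or (h : Adds K L s) {c : Chain} (hc : c ∈ boundaries L) :
    c ∈ boundaries K ∨ c + boundary (simplexChain s) ∈ boundaries K := by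
  obtain ⟨y, hy, rfl⟩ := mem_boundaries.1 hc
  rcases h.mem_or_add_mem hy with h1 | h1
  · exact .inl (mem_boundaries.2 ⟨y, h1, rfl⟩)
  · exact .inr (mem_boundaries.2 ⟨_, h1, map_add _ _ _⟩)

theorem mem_boundaries_of_chains (h : Adds K L s) {c : Chain} (hc : c ∈ boundaries L) :
    c ∈ cycles K :=
  mem_cycles.2 ⟨h.mem_chains_of_apply (mem_cycles.1 (boundaries_le_cycles L hc)).1
    (h.boundary_apply hc), (mem_cycles.1 (boundaries_le_cycles L hc)).2⟩

/-- First half of the dichotomy: if `∂s` already bounds, the new generator of the boundary group is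
redundant, and only the cycle group grows. -/
theorem boundaries_eq (h : Adds K L s) (hs : boundary (simplexChain s) ∈ boundaries K) :
    boundaries L = boundaries K := by
  refine le_antisymm (fun c hc => ?_) (boundaries_mono h.subset)
  rcases h.mem_boundaries_or hc with h1 | h1
  · exact h1
  · exact (Submodule.add_mem_iff_left _ hs).1 h1

/-- Second half: a cycle using `s` would exhibit `∂s` as the boundary of its remaining part, so no
cycle uses `s`. -/
theorem cycles_eq (h : Adds K L s) (hs : boundary (simplexChain s) ∉ boundaries K) :
    cycles L = cycles K := by
  refine le_antisymm (fun c hc => ?_) (cycles_mono h.subset)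
  obtain ⟨h1, h2⟩ := mem_cycles.1 hc
  rcases h.mem_or_add_mem h1 with h3 | h3
  · exact mem_cycles.2 ⟨h3, h2⟩
  · refine absurd (mem_boundaries.2 ⟨_, h3, ?_⟩) hs
    rw [map_add, h2, zero_add]

/-- The simplex closed up by a chain that bounds `∂s` in the smaller complex. -/
theorem exists_cycle (h : Adds K L s) (hs : boundary (simplexChain s) ∈ boundaries K) :
    ∃ u ∈ cycles L, u ∉ cycles K := by
  obtain ⟨y, hy, e⟩ := mem_boundaries.1 hs
  refine ⟨y + simplexChain s, mem_cycles.2 ⟨add_mem (chains_mono h.subset hy) h.simplexChain_mem,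
    ?_⟩, fun hc => ?_⟩
  · rw [map_add, e]
    exact add_self_eq_zero_of_module _
  · have := h.apply_eq_zero (mem_cycles.1 hc).1
    rw [Finsupp.add_apply, h.apply_eq_zero hy, Finsupp.single_eq_same] at this
    exact absurd this (by decide)

theorem injective (h : Adds K L s) (hs : boundary (simplexChain s) ∈ boundaries K) :
    Function.Injective (homologyMap h.subset) := by
  rw [injective_iff_map_eq_zero]
  intro x hx
  obtain ⟨z, rfl⟩ := homologyClass_surjective K x
  rw [homologyMap_homologyClass, homologyClass_eq_zero, h.boundaries_eq hs] at hx
  exact homologyClass_eq_zero.2 hx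

/-- If a class of `K` became the class of `u`, then `u` would differ from a cycle of `K` by a
boundary of `L`. Such a boundary does not contain `s`, so `u` would be a cycle of `K`. -/
theorem notMem_range (h : Adds K L s) {u : cycles L} (hu : (u : Chain) ∉ cycles K)
    (x : Homology K) : homologyMap h.subset x ≠ homologyClass L u := by
  intro e
  obtain ⟨z, rfl⟩ := homologyClass_surjective K x
  rw [homologyMap_homologyClass, homologyClass_eq_iff] at e
  have := h.mem_boundaries_of_chains e
  exact hu ((Submodule.add_mem_iff_right _ z.2).1 this)

/-- Cycles of `L` outside `K` all have coefficient one at `s`; the sum of two of them falls back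
into `K`. -/
theorem range_or (h : Adds K L s) {u : cycles L} (hu : (u : Chain) ∉ cycles K)
    (x : Homology L) : (∃ y, homologyMap h.subset y = x) ∨
      ∃ y, homologyMap h.subset y = x + homologyClass L u := by
  obtain ⟨z, rfl⟩ := homologyClass_surjective L x
  have key : ∀ w : cycles L, (w : Chain) s = 0 → (w : Chain) ∈ cycles K := fun w hw =>
    mem_cycles.2 ⟨h.mem_chains_of_apply (mem_cycles.1 w.2).1 hw, (mem_cycles.1 w.2).2⟩
  have hu1 : (u : Chain) s = 1 := (zmod_two_cases _).resolve_left fun h0 => hu (key u h0)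
  rcases zmod_two_cases ((z : Chain) s) with h0 | h1
  · exact .inl ⟨homologyClass K ⟨z, key z h0⟩, homologyMap_homologyClass _ _⟩
  · refine .inr ⟨homologyClass K ⟨z + u, key (z + u) ?_⟩, ?_⟩
    · rw [Submodule.coe_add, Finsupp.add_apply, h1, hu1]
      rfl
    · rw [homologyMap_homologyClass, ← homologyClass_add]
      rfl

theorem not_surjective (h : Adds K L s) (hs : boundary (simplexChain s) ∈ boundaries K) :
    ¬ Function.Surjective (homologyMap h.subset) := by
  obtain ⟨u, hu, hu'⟩ := h.exists_cycle hs
  intro hsurj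
  obtain ⟨x, hx⟩ := hsurj (homologyClass L ⟨u, hu⟩)
  exact h.notMem_range (u := ⟨u, hu⟩) hu' x hx

theorem surjective (h : Adds K L s) (hs : boundary (simplexChain s) ∉ boundaries K) :
    Function.Surjective (homologyMap h.subset) := by
  intro x
  obtain ⟨z, rfl⟩ := homologyClass_surjective L x
  exact ⟨homologyClass K ⟨z, h.cycles_eq hs ▸ z.2⟩, homologyMap_homologyClass _ _⟩

/-- The kernel is generated by the class of `∂s`, so it has at most one nonzero element, and any
given nonzero element `u` of it is that one. -/
theorem ker_or (h : Adds K L s) {u : Homology K} (hu : u ≠ 0) (hu0 : homologyMap h.subset u = 0)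
    (x : Homology K) (hx : homologyMap h.subset x = 0) : x = 0 ∨ x = u := by
  have key : ∀ y : Homology K, homologyMap h.subset y = 0 →
      y = 0 ∨ y = homologyClass K ⟨_, h.boundary_mem⟩ := by
    intro y hy
    obtain ⟨z, rfl⟩ := homologyClass_surjective K y
    rw [homologyMap_homologyClass, homologyClass_eq_zero] at hy
    rcases h.mem_boundaries_or hy with h1 | h1
    · exact .inl (homologyClass_eq_zero.2 h1)
    · exact .inr (homologyClass_eq_iff.2 h1)
  rcases key x hx with h1 | h1
  · exact .inl h1
  · exact .inr (h1.trans ((key u hu0).resolve_left hu).symm)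

theorem not_injective (h : Adds K L s) (hs : boundary (simplexChain s) ∉ boundaries K) :
    ¬ Function.Injective (homologyMap h.subset) := by
  intro hi
  refine hs ((homologyClass_eq_zero (z := ⟨_, h.boundary_mem⟩)).1 (hi ?_))
  rw [homologyMap_homologyClass, map_zero, homologyClass_eq_zero]
  exact mem_boundaries.2 ⟨_, h.simplexChain_mem, rfl⟩

theorem boundariesMap_injective (h : Adds K L s) :
    Function.Injective (boundariesMap h.subset) :=
  Submodule.inclusion_injective _

theorem boundariesMap_bijective (h : Adds K L s)
    (hs : boundary (simplexChain s) ∈ boundaries K) :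
    Function.Bijective (boundariesMap h.subset) :=
  ⟨h.boundariesMap_injective, fun x => ⟨⟨x, h.boundaries_eq hs ▸ x.2⟩, rfl⟩⟩

theorem boundariesMap_not_surjective (h : Adds K L s)
    (hs : boundary (simplexChain s) ∉ boundaries K) :
    ¬ Function.Surjective (boundariesMap h.subset) := by
  intro hsurj
  obtain ⟨x, hx⟩ := hsurj ⟨_, mem_boundaries.2 ⟨_, h.simplexChain_mem, rfl⟩⟩
  have e : (x : Chain) = boundary (simplexChain s) := congrArg Subtype.val hx
  exact hs (e ▸ x.2)

theorem boundariesMap_ne (h : Adds K L s) {u : boundaries L} (hu : (u : Chain) ∉ boundaries K)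
    (x : boundaries K) : boundariesMap h.subset x ≠ u := fun e => hu (congrArg Subtype.val e ▸ x.2)

theorem boundariesMap_range_or (h : Adds K L s) {u : boundaries L}
    (hu : (u : Chain) ∉ boundaries K) (x : boundaries L) :
    (∃ y, boundariesMap h.subset y = x) ∨ ∃ y, boundariesMap h.subset y = x + u := by
  rcases h.mem_boundaries_or x.2 with h1 | h1
  · exact .inl ⟨⟨x, h1⟩, rfl⟩
  · refine .inr ⟨⟨x + u, ?_⟩, rfl⟩
    have h2 := add_mem h1 ((h.mem_boundaries_or u.2).resolve_left hu)
    rwa [add_add_add_comm, add_self_eq_zero_of_module, add_zero] at h2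

end Adds
namespace Filtration

variable (F : Filtration)

theorem adds_of_fwd {i : ℕ} (hi : i < F.m) (h : F.dir i = true) :
    Adds (F.K i) (F.K (i + 1)) (F.σ i) :=
  ⟨(F.insertion i hi h).1, (F.insertion i hi h).2⟩

theorem adds_of_bwd {i : ℕ} (hi : i < F.m) (h : F.dir i = false) :
    Adds (F.K (i + 1)) (F.K i) (F.σ i) := by
  obtain ⟨h1, h2⟩ := F.deletion i hi h
  refine ⟨fun hn => ?_, ?_⟩
  · rw [h2] at hn
    exact hn.2 rfl
  · rw [h2, Set.insert_sdiff_singleton, Set.insert_eq_of_mem h1]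

/-- The boundary of the simplex `σ i` is a boundary of the smaller one of the complexes at `i` and
`i + 1`. -/
def Bounds (i : ℕ) : Prop :=
  boundary (simplexChain (F.σ i)) ∈ boundaries (if F.dir i then F.K i else F.K (i + 1))

variable {F} {i : ℕ}

theorem bounds_of_fwd (h : F.dir i = true) :
    F.Bounds i ↔ boundary (simplexChain (F.σ i)) ∈ boundaries (F.K i) := by
  rw [Bounds, if_pos h]

theorem bounds_of_bwd (h : F.dir i = false) :
    F.Bounds i ↔ boundary (simplexChain (F.σ i)) ∈ boundaries (F.K (i + 1)) := by
  rw [Bounds, if_neg (by simp [h])]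

/-- `Bounds` decides the type of every step. With the next three lemmas: each step gives either a
homology birth at `i + 1` or a homology death at `i`, and a boundary birth or death occurs exactly
when `∂σ_i` does not bound in the smaller complex. -/
theorem homologyBirth_iff (hi : i < F.m) :
    F.IsHomologyBirth (i + 1) ↔ (F.dir i = true ↔ F.Bounds i) := by
  cases h : F.dir i
  · have ha := F.adds_of_bwd hi h
    rw [bounds_of_bwd h]
    by_cases hb : boundary (simplexChain (F.σ i)) ∈ boundaries (F.K (i + 1))
    · simp only [hb, iff_true, Bool.false_eq_true, iff_false]
      rintro ⟨j, hj, e, hc⟩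
      obtain rfl : i = j := by omega
      rcases hc with ⟨h', _⟩ | ⟨_, hc⟩
      · simp [h] at h'
      · exact ha.not_surjective hb hc
    · simp only [hb, Bool.false_eq_true, iff_true]
      exact ⟨i, hi, rfl, .inr ⟨h, ha.surjective hb⟩⟩
  · have ha := F.adds_of_fwd hi h
    rw [bounds_of_fwd h]
    by_cases hb : boundary (simplexChain (F.σ i)) ∈ boundaries (F.K i)
    · simp only [hb, iff_true]
      exact ⟨i, hi, rfl, .inl ⟨h, ha.injective hb⟩⟩
    · simp only [hb, iff_false, not_true_eq_false]
      rintro ⟨j, hj, e, hc⟩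
      obtain rfl : i = j := by omega
      rcases hc with ⟨_, hc⟩ | ⟨h', _⟩
      · exact ha.not_injective hb hc
      · simp [h] at h'

theorem homologyDeath_iff (hi : i < F.m) :
    F.IsHomologyDeath i ↔ ¬ (F.dir i = true ↔ F.Bounds i) := by
  have hm : ¬ i = F.m := by omega
  simp only [IsHomologyDeath, hm, false_and, or_false, exists_prop_of_true hi]
  rcases Bool.eq_false_or_eq_true (F.dir i) with h | h
  · have ha := F.adds_of_fwd hi h
    have e : (F.dir i = true ↔ F.Bounds i) ↔ F.Bounds i := by simp [h]
    rw [e, bounds_of_fwd h]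
    constructor
    · rintro (⟨_, hc⟩ | ⟨h', _⟩) hb
      · exact hc (ha.injective hb)
      · simp [h] at h'
    · exact fun hb => .inl ⟨h, ha.not_injective hb⟩
  · have ha := F.adds_of_bwd hi h
    have e : (F.dir i = true ↔ F.Bounds i) ↔ ¬ F.Bounds i := by simp [h]
    rw [e, not_not, bounds_of_bwd h]
    constructor
    · rintro (⟨h', _⟩ | ⟨_, hc⟩)
      · simp [h] at h'
      · by_contra hb
        exact hc (ha.surjective hb)
    · exact fun hb => .inr ⟨h, ha.not_surjective hb⟩

theorem boundaryBirth_iff (hi : i < F.m) :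
    F.IsBoundaryBirth (i + 1) ↔ F.dir i = true ∧ ¬ F.Bounds i := by
  constructor
  · rintro ⟨j, hj, e, h, hc⟩
    obtain rfl : i = j := by omega
    refine ⟨h, fun hb => hc ?_⟩
    exact ((F.adds_of_fwd hi h).boundariesMap_bijective ((bounds_of_fwd h).1 hb)).2
  · rintro ⟨h, hb⟩
    rw [bounds_of_fwd h] at hb
    exact ⟨i, hi, rfl, h, (F.adds_of_fwd hi h).boundariesMap_not_surjective hb⟩

theorem boundaryDeath_iff (hi : i < F.m) :
    F.IsBoundaryDeath i ↔ F.dir i = false ∧ ¬ F.Bounds i := by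
  have hm : ¬ i = F.m := by omega
  simp only [IsBoundaryDeath, hm, false_and, or_false, exists_prop_of_true hi]
  constructor
  · rintro ⟨h, hc⟩
    refine ⟨h, fun hb => hc ?_⟩
    exact ((F.adds_of_bwd hi h).boundariesMap_bijective ((bounds_of_bwd h).1 hb)).2
  · rintro ⟨h, hb⟩
    rw [bounds_of_bwd h] at hb
    exact ⟨h, (F.adds_of_bwd hi h).boundariesMap_not_surjective hb⟩

/-! ## Bars with representatives form the barcode -/

/-- The births and deaths of the bars in `l` before the last index are exactly the ones in the sets
`Bi` and `De`, each once. -/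
structure Pairs (m : ℕ) (Bi De : ℕ → Prop) (l : List (ℕ × ℕ)) : Prop where
  le : ∀ I ∈ l, 1 ≤ I.1 ∧ I.1 ≤ I.2 ∧ I.2 ≤ m
  birth : ∀ i < m, Bi (i + 1) → ∃ k : Fin l.length, (l.get k).1 = i + 1 ∧
    ∀ k' : Fin l.length, (l.get k').1 = i + 1 → k' = k
  birth_not : ∀ i < m, ¬ Bi (i + 1) → ∀ k : Fin l.length, (l.get k).1 ≠ i + 1
  death : ∀ i < m, De i → ∃ k : Fin l.length, (l.get k).2 = i ∧
    ∀ k' : Fin l.length, (l.get k').2 = i → k' = k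
  death_not : ∀ i < m, ¬ De i → ∀ k : Fin l.length, (l.get k).2 ≠ i

open ZigzagModule

theorem mem_alive {l : List (ℕ × ℕ)} {i : ℕ} {k : Fin l.length} :
    k ∈ alive l i ↔ (l.get k).1 ≤ i ∧ i ≤ (l.get k).2 := by
  simp [alive]

namespace Pairs

variable {m : ℕ} {Bi De : ℕ → Prop} {l : List (ℕ × ℕ)}

theorem get_le (h : Pairs m Bi De l) (k : Fin l.length) :
    1 ≤ (l.get k).1 ∧ (l.get k).1 ≤ (l.get k).2 ∧ (l.get k).2 ≤ m :=
  h.le _ (l.get_mem k)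

theorem alive_zero (h : Pairs m Bi De l) : alive l 0 = ∅ := by
  ext k
  have := h.get_le k
  simp only [mem_alive, Finset.notMem_empty, iff_false]
  omega

/-- The sets of bars alive at neighbouring indices differ at most by the unique bar that starts or
ends between them. Together with the next two lemmas this provides the change of index set for the
induction on bases. -/
theorem alive_birth (h : Pairs m Bi De l) {i : ℕ} (hi : i < m) (hb : Bi (i + 1)) (hd : ¬ De i) :
    ∃ k, (l.get k).1 = i + 1 ∧ k ∉ alive l i ∧ alive l (i + 1) = insert k (alive l i) := by
  obtain ⟨k, hk, hu⟩ := h.birth i hi hb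
  refine ⟨k, hk, fun hn => ?_, ?_⟩
  · rw [mem_alive] at hn
    omega
  · ext k'
    rw [Finset.mem_insert, mem_alive, mem_alive]
    have h1 := h.get_le k'
    have h2 := h.death_not i hi hd k'
    by_cases hkk : k' = k
    · subst hkk
      simp only [true_or, iff_true]
      omega
    · have h3 : (l.get k').1 ≠ i + 1 := fun e => hkk (hu k' e)
      simp only [hkk, false_or]
      omega

theorem alive_death (h : Pairs m Bi De l) {i : ℕ} (hi : i < m) (hb : ¬ Bi (i + 1)) (hd : De i) :
    ∃ k, (l.get k).2 = i ∧ k ∈ alive l i ∧ alive l (i + 1) = (alive l i).erase k := by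
  obtain ⟨k, hk, hu⟩ := h.death i hi hd
  have h0 := h.get_le k
  refine ⟨k, hk, mem_alive.2 (by omega), ?_⟩
  ext k'
  rw [Finset.mem_erase, mem_alive, mem_alive]
  have h1 := h.get_le k'
  have h2 := h.birth_not i hi hb k'
  by_cases hkk : k' = k
  · subst hkk
    simp only [ne_eq, not_true_eq_false, false_and, iff_false]
    omega
  · have h3 : (l.get k').2 ≠ i := fun e => hkk (hu k' e)
    simp only [ne_eq, hkk, not_false_eq_true, true_and]
    omega

theorem alive_succ (h : Pairs m Bi De l) {i : ℕ} (hi : i < m) (hb : ¬ Bi (i + 1)) (hd : ¬ De i) :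
    alive l (i + 1) = alive l i := by
  ext k'
  rw [mem_alive, mem_alive]
  have h1 := h.get_le k'
  have h2 := h.birth_not i hi hb k'
  have h3 := h.death_not i hi hd k'
  omega

end Pairs

theorem subsingleton_chains_zero (F : Filtration) : chains (F.K 0) = ⊥ := by
  rw [chains, F.K_zero, Finsupp.supported_empty]

/-- By induction on the index, the classes of the living representatives form a basis of homology.
The four types of steps correspond to the four lemmas on bases, and their hypotheses are the end
conditions of a representative: the class that appears lies outside the image or spans the kernel,
and so does the class that disappears. -/
theorem homology_isBarcode {l : List (ℕ × ℕ)}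
    (hp : Pairs F.m F.IsHomologyBirth F.IsHomologyDeath l)
    (z : Fin l.length → ∀ α, cycles (F.K α))
    (hz : ∀ k, F.IsHomologyRep (l.get k).1 (l.get k).2 (z k)) : F.homologyModule.IsBarcode l := by
  let v : Fin l.length → ∀ i, F.homologyModule.V i := fun k i => homologyClass (F.K i) (z k i)
  have hfwd : ∀ i hi h, ∀ k ∈ alive l i, F.homologyModule.fwd i hi h (v k i) =
      if k ∈ alive l (i + 1) then v k (i + 1) else 0 := by
    intro i hi h k hk
    have := hp.get_le k
    rw [mem_alive] at hk
    split_ifs with h1 <;> rw [mem_alive] at h1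
    · exact (hz k).link_fwd i hi h hk.1 (by omega)
    · obtain rfl : i = (l.get k).2 := by omega
      exact ((hz k).death_fwd hi h).2
  have hbwd : ∀ i hi h, ∀ k ∈ alive l (i + 1), F.homologyModule.bwd i hi h (v k (i + 1)) =
      if k ∈ alive l i then v k i else 0 := by
    intro i hi h k hk
    have := hp.get_le k
    rw [mem_alive] at hk
    split_ifs with h1 <;> rw [mem_alive] at h1
    · exact (hz k).link_bwd i hi h h1.1 (by omega)
    · exact ((hz k).birth_bwd i hi h (by omega)).2
  refine isBarcode_of_basis _ l v (fun I hI => (hp.le I hI).2) (fun i hi => ?_) hfwd hbwd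
  induction i with
  | zero =>
    rw [hp.alive_zero]
    refine ⟨fun S hS _ => Finset.subset_empty.1 hS, fun x => ⟨∅, le_rfl, ?_⟩⟩
    obtain ⟨c, rfl⟩ := homologyClass_surjective (F.K 0) x
    have hc : (c : Chain) = 0 := by
      have := (mem_cycles.1 c.2).1
      rwa [subsingleton_chains_zero, Submodule.mem_bot] at this
    rw [Finset.sum_empty]
    exact (homologyClass_eq_zero.2 (hc ▸ zero_mem _)).symm
  | succ i ih =>
    have hi' : i < F.m := hi
    have ih := ih hi'.le
    have hbi := homologyBirth_iff hi'
    have hde := homologyDeath_iff hi'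
    cases h : F.dir i
    · have ha := F.adds_of_bwd hi' h
      by_cases hb : F.Bounds i
      · obtain ⟨k, hk, hka, he⟩ := hp.alive_death hi' (by simp [hbi, h, hb]) (by simp [hde, h, hb])
        rw [he]
        refine ih.erase_of_injective (f := homologyMap ha.subset)
          (ha.injective ((bounds_of_bwd h).1 hb)) (fun k' hk' => ?_) ?_
        · rw [← he] at hk'
          have hk2 := hbwd i hi' h k' hk'
          rw [he] at hk'
          rw [if_pos (Finset.mem_of_mem_erase hk')] at hk2
          exact hk2
        · subst hk
          exact ha.notMem_range ((hz k).death_bwd hi' h)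
      · obtain ⟨k, hk, hka, he⟩ := hp.alive_birth hi' (by simp [hbi, h, hb]) (by simp [hde, h, hb])
        rw [he]
        have hr := (hz k).birth_bwd i hi' h hk
        refine ih.insert_of_kernel (f := homologyMap ha.subset) hka (fun k' hk' => ?_) hr.2 hr.1
          (ha.ker_or hr.1 hr.2)
        have hk2 := hbwd i hi' h k' (by rw [he]; exact Finset.mem_insert_of_mem hk')
        rw [if_pos hk'] at hk2
        exact hk2
    · have ha := F.adds_of_fwd hi' h
      by_cases hb : F.Bounds i
      · obtain ⟨k, hk, hka, he⟩ := hp.alive_birth hi' (by simp [hbi, h, hb]) (by simp [hde, h, hb])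
        rw [he]
        have hr := (hz k).birth_fwd i hi' h hk
        refine ih.insert_of_injective (f := homologyMap ha.subset)
          (ha.injective ((bounds_of_fwd h).1 hb)) (fun k' hk' => ?_) hka (ha.notMem_range hr)
          (ha.range_or hr)
        have hk2 := hfwd i hi' h k' hk'
        rw [if_pos (by rw [he]; exact Finset.mem_insert_of_mem hk')] at hk2
        exact hk2
      · obtain ⟨k, hk, hka, he⟩ := hp.alive_death hi' (by simp [hbi, h, hb]) (by simp [hde, h, hb])
        rw [he]
        subst hk
        have hr := (hz k).death_fwd hi' h
        refine ih.erase_of_surjective (f := homologyMap ha.subset)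
          (ha.surjective (fun hn => hb ((bounds_of_fwd h).2 hn))) hka (fun k' hk' => ?_) hr.2
          (ha.ker_or hr.1 hr.2)
        have hk2 := hfwd _ hi' h k' (Finset.mem_of_mem_erase hk')
        rw [if_pos (by rw [he]; exact hk')] at hk2
        exact hk2

/-- The same induction for boundary groups, where all arrows are inclusions. Births happen only at
insertions and deaths only at deletions, so an arrow never has to send a living vector to zero; a
step with `Bounds` is an isomorphism. -/
theorem boundary_isBarcode {l : List (ℕ × ℕ)}
    (hp : Pairs F.m F.IsBoundaryBirth F.IsBoundaryDeath l)
    (z : Fin l.length → ∀ α, boundaries (F.K α))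
    (hz : ∀ k, F.IsBoundaryRep (l.get k).1 (l.get k).2 (z k)) : F.boundaryModule.IsBarcode l := by
  let v : Fin l.length → ∀ i, F.boundaryModule.V i := fun k i => z k i
  have hfwd : ∀ i hi h, ∀ k ∈ alive l i, F.boundaryModule.fwd i hi h (v k i) =
      if k ∈ alive l (i + 1) then v k (i + 1) else 0 := by
    intro i hi h k hk
    have := hp.get_le k
    rw [mem_alive] at hk
    split_ifs with h1 <;> rw [mem_alive] at h1
    · exact (hz k).link_fwd i hi h hk.1 (by omega)
    · have hdea := (hz k).death
      rw [show (l.get k).2 = i by omega, boundaryDeath_iff hi] at hdea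
      exact absurd hdea.1 (by simp [h])
  have hbwd : ∀ i hi h, ∀ k ∈ alive l (i + 1), F.boundaryModule.bwd i hi h (v k (i + 1)) =
      if k ∈ alive l i then v k i else 0 := by
    intro i hi h k hk
    have := hp.get_le k
    rw [mem_alive] at hk
    split_ifs with h1 <;> rw [mem_alive] at h1
    · exact (hz k).link_bwd i hi h h1.1 (by omega)
    · have hbir := (hz k).birth
      rw [show (l.get k).1 = i + 1 by omega, boundaryBirth_iff hi] at hbir
      exact absurd hbir.1 (by simp [h])
  refine isBarcode_of_basis _ l v (fun I hI => (hp.le I hI).2) (fun i hi => ?_) hfwd hbwd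
  induction i with
  | zero =>
    rw [hp.alive_zero]
    refine ⟨fun S hS _ => Finset.subset_empty.1 hS, fun x => ⟨∅, le_rfl, ?_⟩⟩
    have hx : ∀ y : boundaries (F.K 0), (0 : boundaries (F.K 0)) = y := fun y => by
      have := (mem_cycles.1 (boundaries_le_cycles _ y.2)).1
      rw [subsingleton_chains_zero, Submodule.mem_bot] at this
      exact (Subtype.ext this).symm
    rw [Finset.sum_empty]
    exact hx x
  | succ i ih =>
    have hi' : i < F.m := hi
    have ih := ih hi'.le
    have hbi := boundaryBirth_iff hi'
    have hde := boundaryDeath_iff hi'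
    cases h : F.dir i
    · have ha := F.adds_of_bwd hi' h
      by_cases hb : F.Bounds i
      · have he := hp.alive_succ hi' (by simp [hbi, hb]) (by simp [hde, hb])
        rw [he]
        refine ih.of_bijective_symm (f := boundariesMap ha.subset)
          (ha.boundariesMap_bijective ((bounds_of_bwd h).1 hb)) (fun k' hk' => ?_)
        have hk2 := hbwd i hi' h k' (by rwa [he])
        rw [if_pos hk'] at hk2
        exact hk2
      · obtain ⟨k, hk, hka, he⟩ := hp.alive_death hi' (by simp [hbi, h]) (by simp [hde, h, hb])
        rw [he]
        refine ih.erase_of_injective (f := boundariesMap ha.subset)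
          ha.boundariesMap_injective (fun k' hk' => ?_) ?_
        · rw [← he] at hk'
          have hk2 := hbwd i hi' h k' hk'
          rw [he] at hk'
          rw [if_pos (Finset.mem_of_mem_erase hk')] at hk2
          exact hk2
        · subst hk
          exact ha.boundariesMap_ne ((hz k).death_cond hi')
    · have ha := F.adds_of_fwd hi' h
      by_cases hb : F.Bounds i
      · have he := hp.alive_succ hi' (by simp [hbi, hb]) (by simp [hde, hb])
        rw [he]
        refine ih.of_bijective (f := boundariesMap ha.subset)
          (ha.boundariesMap_bijective ((bounds_of_fwd h).1 hb)) (fun k' hk' => ?_)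
        have hk2 := hfwd i hi' h k' hk'
        rw [if_pos (by rwa [he])] at hk2
        exact hk2
      · obtain ⟨k, hk, hka, he⟩ := hp.alive_birth hi' (by simp [hbi, h, hb]) (by simp [hde, h])
        rw [he]
        have hr := (hz k).birth_cond i hi' hk
        refine ih.insert_of_injective (f := boundariesMap ha.subset)
          ha.boundariesMap_injective (fun k' hk' => ?_) hka (ha.boundariesMap_ne hr)
          (ha.boundariesMap_range_or hr)
        have hk2 := hfwd i hi' h k' hk'
        rw [if_pos (by rw [he]; exact Finset.mem_insert_of_mem hk')] at hk2
        exact hk2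

end Filtration

/-! ## Functionals on chains -/

/-- The linear functional on chains with prescribed values on the simplices. -/
noncomputable def pair (φ : Finset ℕ → ZMod 2) : Chain →ₗ[ZMod 2] ZMod 2 :=
  Finsupp.linearCombination (ZMod 2) φ

theorem pair_apply (φ : Finset ℕ → ZMod 2) (c : Chain) : pair φ c = c.sum fun s a => a * φ s := by
  simp [pair, Finsupp.linearCombination_apply]

theorem pair_simplexChain (φ : Finset ℕ → ZMod 2) (s : Finset ℕ) : pair φ (simplexChain s) = φ s := by
  simp [pair]

theorem pair_congr {φ ψ : Finset ℕ → ZMod 2} {c : Chain} (h : ∀ s, c s ≠ 0 → φ s = ψ s) :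
    pair φ c = pair ψ c := by
  rw [pair_apply, pair_apply]
  exact Finsupp.sum_congr fun s hs => by rw [h s (Finsupp.mem_support_iff.1 hs)]

theorem pair_add (φ ψ : Finset ℕ → ZMod 2) (c : Chain) :
    pair (φ + ψ) c = pair φ c + pair ψ c := by
  simp only [pair_apply, Pi.add_apply, mul_add]
  exact Finsupp.sum_add

theorem pair_sum {ι : Type} (s : Finset ι) (φ : ι → Finset ℕ → ZMod 2) (c : Chain) :
    pair (∑ r ∈ s, φ r) c = ∑ r ∈ s, pair (φ r) c := by
  classical
  induction s using Finset.induction_on with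
  | empty => simp [pair_apply]
  | insert a s ha ih => rw [Finset.sum_insert ha, Finset.sum_insert ha, pair_add, ih]

theorem exists_of_pair_ne_zero {φ : Finset ℕ → ZMod 2} {c : Chain} (h : pair φ c ≠ 0) :
    ∃ s, c s ≠ 0 ∧ φ s ≠ 0 := by
  rw [pair_apply, Finsupp.sum] at h
  obtain ⟨s, hs, hne⟩ := Finset.exists_ne_zero_of_sum_ne_zero h
  exact ⟨s, Finsupp.mem_support_iff.1 hs, right_ne_zero_of_mul hne⟩

theorem pair_single {s : Finset ℕ} {c : Chain} : pair (Pi.single s 1) c = c s := by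
  rw [pair_apply, Finsupp.sum, Finset.sum_eq_single s]
  · simp
  · intro t _ hts
    simp [hts]
  · intro hs
    simp [Finsupp.notMem_support_iff.1 hs]

namespace Filtration

theorem IsHomogeneous_iff {p : ℕ} {c : Chain} :
    IsHomogeneous p c ↔ ∀ s, c s ≠ 0 → s.card = p + 1 := by
  simp [IsHomogeneous]

theorem IsHomogeneous.zero (p : ℕ) : IsHomogeneous p 0 := by
  simp [IsHomogeneous]

theorem IsHomogeneous.add {p : ℕ} {c d : Chain} (hc : IsHomogeneous p c) (hd : IsHomogeneous p d) :
    IsHomogeneous p (c + d) := by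
  rw [IsHomogeneous_iff] at *
  intro s hs
  by_contra hn
  have h1 : c s = 0 := by
    by_contra h
    exact hn (hc s h)
  have h2 : d s = 0 := by
    by_contra h
    exact hn (hd s h)
  exact hs (by rw [Finsupp.add_apply, h1, h2, add_zero])

theorem IsHomogeneous.sum {ι : Type} {p : ℕ} {s : Finset ι} {c : ι → Chain}
    (h : ∀ k ∈ s, IsHomogeneous p (c k)) : IsHomogeneous p (∑ k ∈ s, c k) := by
  classical
  induction s using Finset.induction_on with
  | empty => simpa using IsHomogeneous.zero p
  | insert a s ha ih =>
    rw [Finset.sum_insert ha]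
    exact (h a (by simp)).add (ih fun k hk => h k (by simp [hk]))

theorem isHomogeneous_simplexChain {s : Finset ℕ} {p : ℕ} (h : s.card = p + 1) :
    IsHomogeneous p (simplexChain s) := by
  rw [IsHomogeneous_iff]
  intro t ht
  rw [Finsupp.single_apply] at ht
  split_ifs at ht with e
  · rw [← e, h]
  · exact absurd rfl ht

variable (F : Filtration)

/-! ## Partial representatives -/

/-- The chains `z α` form a homology representative from the birth index `b` up to the index `i`.
Before `b` they are cycles of the complexes, and they vanish if the birth is at a deletion. -/
structure PartialRep (i b p : ℕ) (z : ℕ → Chain) : Prop where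
  birth : F.IsHomologyBirth b
  le : b ≤ i
  mem : ∀ α ≤ i, z α ∈ cycles (F.K α)
  homogeneous : ∀ α, IsHomogeneous p (z α)
  link : ∀ α, b ≤ α → α < i → z α + z (α + 1) ∈ boundaries (F.K α) ⊔ boundaries (F.K (α + 1))
  birth_fwd : ∀ j, b = j + 1 → F.dir j = true → z b (F.σ j) = 1
  birth_bwd : ∀ j, b = j + 1 → F.dir j = false →
    z b ∉ boundaries (F.K b) ∧ z b ∈ boundaries (F.K j) ∧ ∀ α < b, z α = 0

/-- A representative of the bar with birth index `b` may be added to one of the bar with birth index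
`b'` if the key of `b` is the smaller one. -/
def key (b : ℕ) : ℕ :=
  if F.dir (b - 1) then F.m + 1 + b else F.m + 1 - b

variable {F} {i b p : ℕ} {z : ℕ → Chain}

theorem boundaries_sup_of_fwd (hi : i < F.m) (h : F.dir i = true) :
    boundaries (F.K i) ⊔ boundaries (F.K (i + 1)) = boundaries (F.K (i + 1)) :=
  sup_eq_right.2 (boundaries_mono (F.subset_of_fwd i hi h))

theorem boundaries_sup_of_bwd (hi : i < F.m) (h : F.dir i = false) :
    boundaries (F.K i) ⊔ boundaries (F.K (i + 1)) = boundaries (F.K i) :=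
  sup_eq_left.2 (boundaries_mono (F.subset_of_bwd i hi h))

namespace PartialRep

theorem extend (h : F.PartialRep i b p z) (hz : z (i + 1) = z i)
    (hm : z i ∈ cycles (F.K (i + 1))) : F.PartialRep (i + 1) b p z where
  birth := h.birth
  le := h.le.trans (Nat.le_succ i)
  mem α hα := by
    rcases Nat.le_succ_iff.1 hα with h1 | rfl
    · exact h.mem α h1
    · rw [hz]
      exact hm
  homogeneous := h.homogeneous
  link α h1 h2 := by
    rcases Nat.lt_succ_iff_lt_or_eq.1 h2 with h3 | rfl
    · exact h.link α h1 h3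
    · rw [hz, add_self_eq_zero_of_module]
      exact zero_mem _
  birth_fwd := h.birth_fwd
  birth_bwd := h.birth_bwd

/-- This justifies the order by `key`. There are two harmless situations. If the added bar is born
earlier and `b` is a birth at an insertion, then the added sequence already runs at `b` and has
coefficient zero at the new simplex, so the birth condition survives. If the added bar is born later
and at a deletion, then it is zero before its birth and enters through a chain that bounds in the
previous complex, so the homology classes still match. -/
theorem add {b' : ℕ} {z' : ℕ → Chain} (h : F.PartialRep i b p z)
    (h' : F.PartialRep i b' p z') (hk : F.key b' < F.key b) :
    F.PartialRep i b p (fun α => z α + z' α) := by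
  obtain ⟨j, hj, hbj, -⟩ := h.birth
  obtain ⟨j', hj', hbj', -⟩ := h'.birth
  have hle := h.le
  have hle' := h'.le
  -- Keys at insertions exceed `m + 1` and increase with the index, while those at deletions are
  -- below it and decrease. A smaller key therefore means one of these two situations.
  have hcase : (b' < b ∧ F.dir j = true) ∨ (b < b' ∧ F.dir j' = false) := by
    subst hbj hbj'
    simp only [key, Nat.add_sub_cancel] at hk
    rcases Nat.lt_trichotomy j j' with h1 | rfl | h1
    · right
      refine ⟨by omega, ?_⟩
      by_contra hd
      rw [Bool.not_eq_false] at hd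
      rw [if_pos hd] at hk
      split_ifs at hk <;> omega
    · omega
    · left
      refine ⟨by omega, ?_⟩
      by_contra hd
      rw [if_neg hd] at hk
      split_ifs at hk <;> omega
  refine ⟨h.birth, h.le, fun α hα => add_mem (h.mem α hα) (h'.mem α hα),
    fun α => (h.homogeneous α).add (h'.homogeneous α), fun α h1 h2 => ?_, fun k hk hd => ?_,
    fun k hk hd => ?_⟩
  · rw [add_add_add_comm]
    refine add_mem (h.link α h1 h2) ?_
    by_cases h3 : b' ≤ α
    · exact h'.link α h3 h2
    · rcases hcase with ⟨h4, _⟩ | ⟨h4, hd⟩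
      · omega
      · obtain ⟨_, h5, h6⟩ := h'.birth_bwd j' hbj' hd
        -- Before its birth the added sequence is zero; only at the link that enters the birth index
        -- does its first term remain, and this term bounds in the larger complex.
        rw [h6 α (by omega), zero_add]
        by_cases h7 : α + 1 < b'
        · rw [h6 _ h7]
          exact zero_mem _
        · obtain rfl : α = j' := by omega
          rw [← hbj']
          exact Submodule.mem_sup_left h5
  · obtain rfl : j = k := by omega
    rw [Finsupp.add_apply, h.birth_fwd j hk hd]
    rcases hcase with ⟨h4, _⟩ | ⟨h4, hd'⟩
    · have hl := h'.link j (by omega) (by omega)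
      have ha := F.adds_of_fwd hj hd
      rw [boundaries_sup_of_fwd hj hd] at hl
      have h5 := ha.boundary_apply hl
      rw [Finsupp.add_apply, ha.apply_eq_zero (mem_cycles.1 (h'.mem j (by omega))).1, zero_add] at h5
      rw [hbj, h5, add_zero]
    · rw [(h'.birth_bwd j' hbj' hd').2.2 b h4]
      simp
  · obtain rfl : j = k := by omega
    rcases hcase with ⟨_, h4⟩ | ⟨h4, hd'⟩
    · simp [h4] at hd
    · have h5 := (h'.birth_bwd j' hbj' hd').2.2
      obtain ⟨h6, h7, h8⟩ := h.birth_bwd j hk hd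
      refine ⟨?_, ?_, fun α hα => ?_⟩
      · rwa [h5 b h4, add_zero]
      · rwa [h5 b h4, add_zero]
      · rw [h8 α hα, h5 α (by omega), add_zero]

theorem add_sum {ι : Type} (h : F.PartialRep i b p z) (s : Finset ι) (b' : ι → ℕ)
    (z' : ι → ℕ → Chain) (h' : ∀ k ∈ s, F.PartialRep i (b' k) p (z' k))
    (hk : ∀ k ∈ s, F.key (b' k) < F.key b) :
    F.PartialRep i b p (fun α => z α + ∑ k ∈ s, z' k α) := by
  classical
  induction s using Finset.induction_on with
  | empty => simpa using h
  | insert a s ha ih =>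
    have h1 := (ih (fun k hk' => h' k (by simp [hk'])) fun k hk' => hk k (by simp [hk'])).add
      (h' a (by simp)) (hk a (by simp))
    convert h1 using 2 with α
    rw [Finset.sum_insert ha, add_assoc, add_comm (z' a α)]

/-- The partial representative that is constant from its birth on. -/
theorem of_birth {c : Chain} (hb : F.IsHomologyBirth (i + 1))
    (hc : c ∈ cycles (F.K (i + 1))) (hp : IsHomogeneous p c)
    (hf : F.dir i = true → c (F.σ i) = 1)
    (hd : F.dir i = false → c ∉ boundaries (F.K (i + 1)) ∧ c ∈ boundaries (F.K i)) :
    F.PartialRep (i + 1) (i + 1) p (fun α => if i + 1 ≤ α then c else 0) where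
  birth := hb
  le := le_rfl
  mem α hα := by
    split_ifs with h
    · obtain rfl : α = i + 1 := by omega
      exact hc
    · exact zero_mem _
  homogeneous α := by
    split_ifs
    · exact hp
    · exact IsHomogeneous.zero p
  link α h1 h2 := by omega
  birth_fwd j hj h := by
    obtain rfl : i = j := by omega
    rw [if_pos le_rfl]
    exact hf h
  birth_bwd j hj h := by
    obtain rfl : i = j := by omega
    refine ⟨?_, ?_, fun α hα => if_neg (by omega)⟩
    · rw [if_pos le_rfl]
      exact (hd h).1
    · rw [if_pos le_rfl]
      exact (hd h).2

open Classical in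
/-- A chain as a cycle of a complex, if it is one. -/
noncomputable def toCycle (K : PreAbstractSimplicialComplex ℕ) (c : Chain) : cycles K :=
  if h : c ∈ cycles K then ⟨c, h⟩ else 0

theorem coe_toCycle {K : PreAbstractSimplicialComplex ℕ} {c : Chain} (h : c ∈ cycles K) :
    (toCycle K c : Chain) = c := by
  rw [toCycle, dif_pos h]

/-- At a death index only the condition at the right end remains to be supplied. `toCycle` merely
turns the chains into a function on all indices; outside the interval its values do not matter. -/
theorem isHomologyRep (h : F.PartialRep i b p z) (hd : F.IsHomologyDeath i)
    (hb : i < F.m → F.dir i = false → z i ∉ cycles (F.K (i + 1)))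
    (hf : i < F.m → F.dir i = true → z i ∉ boundaries (F.K i) ∧ z i ∈ boundaries (F.K (i + 1))) :
    F.IsHomologyRep b i (fun α => toCycle (F.K α) (z α)) where
  le := h.le
  birth := h.birth
  death := hd
  homogeneous := ⟨p, fun α _ h2 => by
    rw [coe_toCycle (h.mem α h2)]
    exact h.homogeneous α⟩
  link_fwd α hα hdir h1 h2 := by
    change homologyMap (F.subset_of_fwd α hα hdir) (homologyClass _ _) = _
    rw [homologyMap_homologyClass, homologyClass_eq_iff]
    have h3 := h.link α h1 h2
    rw [boundaries_sup_of_fwd hα hdir] at h3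
    rw [coe_toCycle (h.mem _ h2)]
    change (toCycle (F.K α) (z α) : Chain) + _ ∈ _
    rwa [coe_toCycle (h.mem _ h2.le)]
  link_bwd α hα hdir h1 h2 := by
    change homologyMap (F.subset_of_bwd α hα hdir) (homologyClass _ _) = _
    rw [homologyMap_homologyClass, homologyClass_eq_iff]
    have h3 := h.link α h1 h2
    rw [boundaries_sup_of_bwd hα hdir, add_comm] at h3
    rw [coe_toCycle (h.mem _ h2.le)]
    change (toCycle (F.K (α + 1)) (z (α + 1)) : Chain) + _ ∈ _
    rwa [coe_toCycle (h.mem _ h2)]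
  birth_fwd j hj hdir hbj := by
    subst hbj
    rw [coe_toCycle (h.mem _ h.le)]
    intro hc
    have := (F.adds_of_fwd hj hdir).apply_eq_zero (mem_cycles.1 hc).1
    rw [h.birth_fwd j rfl hdir] at this
    exact absurd this (by decide)
  birth_bwd j hj hdir hbj := by
    subst hbj
    obtain ⟨h1, h2, _⟩ := h.birth_bwd j rfl hdir
    constructor
    · rw [Ne, homologyClass_eq_zero, coe_toCycle (h.mem _ h.le)]
      exact h1
    · change homologyMap (F.subset_of_bwd j hj hdir) (homologyClass _ _) = 0
      rw [homologyMap_homologyClass, homologyClass_eq_zero]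
      change (toCycle (F.K (j + 1)) (z (j + 1)) : Chain) ∈ _
      rwa [coe_toCycle (h.mem _ h.le)]
  death_bwd h1 h2 := by
    rw [coe_toCycle (h.mem _ le_rfl)]
    exact hb h1 h2
  death_fwd h1 h2 := by
    obtain ⟨h3, h4⟩ := hf h1 h2
    constructor
    · rw [Ne, homologyClass_eq_zero, coe_toCycle (h.mem _ le_rfl)]
      exact h3
    · change homologyMap (F.subset_of_fwd i h1 h2) (homologyClass _ _) = 0
      rw [homologyMap_homologyClass, homologyClass_eq_zero]
      change (toCycle (F.K i) (z i) : Chain) ∈ _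
      rwa [coe_toCycle (h.mem _ le_rfl)]

end PartialRep

variable (F)

/-- The chain `x` is a boundary representative from the birth index `b` up to the index `i`. -/
structure PartialBoundaryRep (i b p : ℕ) (x : Chain) : Prop where
  birth : F.IsBoundaryBirth b
  le : b ≤ i
  homogeneous : IsHomogeneous p x
  mem : ∀ α, b ≤ α → α ≤ i → x ∈ boundaries (F.K α)
  notMem : ∀ j, b = j + 1 → x ∉ boundaries (F.K j)

variable {F} {x : Chain}

namespace PartialBoundaryRep

theorem extend (h : F.PartialBoundaryRep i b p x) (hx : x ∈ boundaries (F.K (i + 1))) :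
    F.PartialBoundaryRep (i + 1) b p x where
  birth := h.birth
  le := h.le.trans (Nat.le_succ i)
  homogeneous := h.homogeneous
  mem α h1 h2 := by
    rcases Nat.le_succ_iff.1 h2 with h3 | rfl
    · exact h.mem α h1 h3
    · exact hx
  notMem := h.notMem

/-- Since `b' < b`, the chain `x'` is a boundary already at `b - 1`, so adding it does not affect
that `x` is none there. Boundary bars are thus ordered simply by birth. -/
theorem add {b' : ℕ} {x' : Chain} (h : F.PartialBoundaryRep i b p x)
    (h' : F.PartialBoundaryRep i b' p x') (hb : b' < b) :
    F.PartialBoundaryRep i b p (x + x') where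
  birth := h.birth
  le := h.le
  homogeneous := h.homogeneous.add h'.homogeneous
  mem α h1 h2 := add_mem (h.mem α h1 h2) (h'.mem α (hb.le.trans h1) h2)
  notMem j hj hx := by
    have hle := h.le
    exact h.notMem j hj ((Submodule.add_mem_iff_left _ (h'.mem j (by omega) (by omega))).1 hx)

open Classical in
/-- A chain as a boundary of a complex, if it is one. -/
noncomputable def toBoundary (K : PreAbstractSimplicialComplex ℕ) (c : Chain) : boundaries K :=
  if h : c ∈ boundaries K then ⟨c, h⟩ else 0

theorem coe_toBoundary {K : PreAbstractSimplicialComplex ℕ} {c : Chain} (h : c ∈ boundaries K) :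
    (toBoundary K c : Chain) = c := by
  rw [toBoundary, dif_pos h]

theorem isBoundaryRep (h : F.PartialBoundaryRep i b p x) (hd : F.IsBoundaryDeath i)
    (hb : i < F.m → x ∉ boundaries (F.K (i + 1))) :
    F.IsBoundaryRep b i (fun α => toBoundary (F.K α) x) where
  le := h.le
  birth := h.birth
  death := hd
  homogeneous := ⟨p, fun α h1 h2 => by
    rw [coe_toBoundary (h.mem α h1 h2)]
    exact h.homogeneous⟩
  link_fwd α hα hdir h1 h2 := by
    apply Subtype.ext
    rw [coe_toBoundary (h.mem _ (by omega) h2)]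
    exact coe_toBoundary (h.mem _ h1 h2.le)
  link_bwd α hα hdir h1 h2 := by
    apply Subtype.ext
    rw [coe_toBoundary (h.mem _ h1 h2.le)]
    exact coe_toBoundary (h.mem _ (by omega) h2)
  birth_cond j hj hbj := by
    subst hbj
    rw [coe_toBoundary (h.mem _ le_rfl h.le)]
    exact h.notMem j rfl
  death_cond h1 := by
    rw [coe_toBoundary (h.mem _ h.le le_rfl)]
    exact hb h1

end PartialBoundaryRep
end Filtration
open Filtration

/-! ## The decomposition of the chain group that the algorithm maintains -/

/-- A basis of a chain group: the cycles `x r` with `r ∈ HR` represent a basis of homology, the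
boundaries `x r` with `r ∈ BR` form a basis of the boundary group, and `y r` is a chain with boundary
`x r`.  The functionals `φ r` are the coordinates at the `x r`.  The cycle `x r` with `r ∈ HR` is the
last term of a representative, the sum of the wires `w` in the bundle `U r`; each wire contributes
from the index `w` on. -/
structure Decomp where
  HR : Finset ℕ
  BR : Finset ℕ
  x : ℕ → Chain
  y : ℕ → Chain
  φ : ℕ → Finset ℕ → ZMod 2
  birth : ℕ → ℕ
  deg : ℕ → ℕ
  U : ℕ → ℕ → ZMod 2
  wire : ℕ → Chain

/-- The term at the index `α` of the sequence with the bundle `u`. -/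
noncomputable def bundleChain (wire : ℕ → Chain) (u : ℕ → ZMod 2) (α : ℕ) : Chain :=
  ∑ w ∈ Finset.range (α + 1), u w • wire w

theorem bundleChain_add (wire : ℕ → Chain) (u v : ℕ → ZMod 2) (α : ℕ) :
    bundleChain wire (u + v) α = bundleChain wire u α + bundleChain wire v α := by
  simp [bundleChain, add_smul, Finset.sum_add_distrib]

theorem bundleChain_sum {ι : Type} (wire : ℕ → Chain) (s : Finset ι) (u : ι → ℕ → ZMod 2) (α : ℕ) :
    bundleChain wire (∑ k ∈ s, u k) α = ∑ k ∈ s, bundleChain wire (u k) α := by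
  simp only [bundleChain, Finset.sum_apply, Finset.sum_smul]
  exact Finset.sum_comm

theorem bundleChain_update {wire : ℕ → Chain} {u : ℕ → ZMod 2} {j : ℕ} (h : u j = 0) (c : Chain)
    (α : ℕ) : bundleChain (Function.update wire j c) u α = bundleChain wire u α := by
  refine Finset.sum_congr rfl fun w _ => ?_
  by_cases hw : w = j
  · rw [hw, h, zero_smul, zero_smul]
  · rw [Function.update_of_ne hw]

theorem bundleChain_single (wire : ℕ → Chain) (j : ℕ) (c : Chain) (α : ℕ) :
    bundleChain (Function.update wire j c) (Pi.single j 1) α = if j ≤ α then c else 0 := by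
  simp only [bundleChain, Pi.single_apply, ite_smul, one_smul, zero_smul, Finset.sum_ite_eq',
    Finset.mem_range, Function.update_self, Nat.lt_succ_iff]

theorem bundleChain_of_le {wire : ℕ → Chain} {u : ℕ → ZMod 2} {i α : ℕ}
    (h : ∀ w, u w ≠ 0 → w ≤ i) (hα : i ≤ α) : bundleChain wire u α = bundleChain wire u i := by
  refine (Finset.sum_subset (Finset.range_mono (by omega)) fun w _ hw => ?_).symm
  have : u w = 0 := by
    by_contra hne
    exact hw (Finset.mem_range.2 (Nat.lt_succ_iff.2 (h w hne)))
  rw [this, zero_smul]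

theorem chains_le_of_adds {K L : PreAbstractSimplicialComplex ℕ} {s : Finset ℕ} (h : Adds K L s)
    {P : Submodule (ZMod 2) Chain} (hK : chains K ≤ P) (hs : simplexChain s ∈ P) :
    chains L ≤ P := by
  intro c hc
  rcases h.mem_or_add_mem hc with h1 | h1
  · exact hK h1
  · exact (Submodule.add_mem_iff_left _ hs).1 (hK h1)

/-- Used at deletions to show that the reduced basis still spans. A chain of the smaller complex has
coefficient zero at `s`, as has everything in `P`, while `u` has coefficient one; hence `u` does not
occur in its expansion. -/
theorem chains_le_of_le_sup {K L : PreAbstractSimplicialComplex ℕ} {s : Finset ℕ} (h : Adds K L s)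
    {P : Submodule (ZMod 2) Chain} {u : Chain} (hL : chains L ≤ P ⊔ Submodule.span (ZMod 2) {u})
    (hP : P ≤ chains K) (hu : u s = 1) : chains K ≤ P := by
  intro c hc
  obtain ⟨p, hp, q, hq, rfl⟩ := Submodule.mem_sup.1 (hL (chains_mono h.subset hc))
  obtain ⟨a, rfl⟩ := Submodule.mem_span_singleton.1 hq
  have h1 := h.apply_eq_zero hc
  rw [Finsupp.add_apply, h.apply_eq_zero (hP hp), zero_add, Finsupp.smul_apply, hu, smul_eq_mul,
    mul_one] at h1
  rwa [h1, zero_smul, add_zero]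

namespace Filtration

variable (F : Filtration)

theorem finite_faces {i : ℕ} (hi : i ≤ F.m) : (F.K i).faces.Finite := by
  induction i with
  | zero => simp [F.K_zero]
  | succ i ih =>
    have ih := ih (Nat.le_of_succ_le hi)
    rcases Bool.eq_false_or_eq_true (F.dir i) with h | h
    · rw [(F.insertion i hi h).2]
      exact ih.insert _
    · rw [(F.deletion i hi h).2]
      exact ih.sdiff

theorem ncard_of_adds {K L : PreAbstractSimplicialComplex ℕ} {s : Finset ℕ} (h : Adds K L s)
    (hK : K.faces.Finite) : L.faces.ncard = K.faces.ncard + 1 := by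
  rw [h.faces, Set.ncard_insert_of_notMem h.notMem hK]

theorem ncard_le {i : ℕ} (hi : i ≤ F.m) : (F.K i).faces.ncard ≤ F.n :=
  Finset.le_sup (f := fun i => (F.K i).faces.ncard) (Finset.mem_range.2 (by omega))

/-- Keys at insertions are at least `m + 2`, keys at deletions at most `m`; the bound `b ≤ m` keeps
the truncated subtraction exact. -/
theorem key_inj {b b' : ℕ} (h1 : 1 ≤ b) (h2 : b ≤ F.m) (h1' : 1 ≤ b') (h2' : b' ≤ F.m)
    (h : F.key b = F.key b') : b = b' := by
  unfold key at h
  split_ifs at h <;> omega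

end Filtration

namespace Decomp

variable (A : Decomp)

/-- The rows in use. -/
def rows : Finset ℕ := A.HR ∪ A.BR

/-- The representative of the row `r`. -/
noncomputable def rep (r : ℕ) : ℕ → Chain := bundleChain A.wire (A.U r)

/-- The span of the basis. -/
noncomputable def spn : Submodule (ZMod 2) Chain :=
  Submodule.span (ZMod 2) (A.x '' A.rows) ⊔ Submodule.span (ZMod 2) (A.y '' A.BR)

variable {A}

theorem HR_subset {r : ℕ} (hr : r ∈ A.HR) : r ∈ A.rows := Finset.mem_union_left _ hr

theorem BR_subset {r : ℕ} (hr : r ∈ A.BR) : r ∈ A.rows := Finset.mem_union_right _ hr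

theorem x_mem_spn {r : ℕ} (hr : r ∈ A.rows) : A.x r ∈ A.spn :=
  Submodule.mem_sup_left (Submodule.subset_span ⟨r, hr, rfl⟩)

theorem y_mem_spn {r : ℕ} (hr : r ∈ A.BR) : A.y r ∈ A.spn :=
  Submodule.mem_sup_right (Submodule.subset_span ⟨r, hr, rfl⟩)

theorem spn_le {P : Submodule (ZMod 2) Chain} (hx : ∀ r ∈ A.rows, A.x r ∈ P)
    (hy : ∀ r ∈ A.BR, A.y r ∈ P) : A.spn ≤ P := by
  refine sup_le (Submodule.span_le.2 ?_) (Submodule.span_le.2 ?_)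
  · rintro _ ⟨r, hr, rfl⟩
    exact hx r hr
  · rintro _ ⟨r, hr, rfl⟩
    exact hy r hr

variable (F : Filtration) (i : ℕ) (A)

/-- The decomposition is one of the chain group of the complex at the index `i`. -/
structure Valid : Prop where
  disj : Disjoint A.HR A.BR
  -- The dimension of the chain group. It bounds the number of rows in use by the number of
  -- simplices, so that a free row below `n` exists at each insertion.
  card : A.HR.card + 2 * A.BR.card = (F.K i).faces.ncard
  lt_n : ∀ r ∈ A.rows, r < F.n
  y_mem : ∀ r ∈ A.BR, A.y r ∈ chains (F.K i)
  boundary_y : ∀ r ∈ A.BR, boundary (A.y r) = A.x r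
  pair_x : ∀ r ∈ A.rows, ∀ k ∈ A.rows, pair (A.φ r) (A.x k) = if r = k then 1 else 0
  pair_y : ∀ r ∈ A.rows, ∀ k ∈ A.BR, pair (A.φ r) (A.y k) = 0
  span : chains (F.K i) ≤ A.spn
  hom : ∀ r ∈ A.HR, F.PartialRep i (A.birth r) (A.deg r) (A.rep r)
  rep_self : ∀ r ∈ A.HR, A.rep r i = A.x r
  wire_mem : ∀ r ∈ A.HR, ∀ w, A.U r w ≠ 0 → w ≤ i ∧ A.wire w ∈ chains (F.K w)
  bd : ∀ r ∈ A.BR, F.PartialBoundaryRep i (A.birth r) (A.deg r) (A.x r)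
  deg_y : ∀ r ∈ A.BR, IsHomogeneous (A.deg r + 1) (A.y r)
  -- The functionals are homogeneous; consequently the rows hit by the boundary of one simplex all
  -- have the same degree, and their representatives may be added.
  deg_φ : ∀ r ∈ A.rows, ∀ s, A.φ r s ≠ 0 → s.card = A.deg r + 1
  inj_H : Set.InjOn A.birth A.HR
  inj_B : Set.InjOn A.birth A.BR

variable {F i A}

namespace Valid

theorem rep_eq (h : A.Valid F i) {r : ℕ} (hr : r ∈ A.HR) {α : ℕ} (hα : i ≤ α) :
    A.rep r α = A.x r := by
  rw [← h.rep_self r hr]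
  exact bundleChain_of_le (fun w hw => (h.wire_mem r hr w hw).1) hα

theorem x_mem (h : A.Valid F i) {r : ℕ} (hr : r ∈ A.rows) : A.x r ∈ cycles (F.K i) := by
  rcases Finset.mem_union.1 hr with hr | hr
  · rw [← h.rep_self r hr]
    exact (h.hom r hr).mem i le_rfl
  · exact boundaries_le_cycles _ ((h.bd r hr).mem i (h.bd r hr).le le_rfl)

theorem deg_x (h : A.Valid F i) {r : ℕ} (hr : r ∈ A.rows) : IsHomogeneous (A.deg r) (A.x r) := by
  rcases Finset.mem_union.1 hr with hr | hr
  · rw [← h.rep_self r hr]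
    exact (h.hom r hr).homogeneous i
  · exact (h.bd r hr).homogeneous

theorem notMem_BR (h : A.Valid F i) {r : ℕ} (hr : r ∈ A.HR) : r ∉ A.BR :=
  Finset.disjoint_left.1 h.disj hr

theorem notMem_HR (h : A.Valid F i) {r : ℕ} (hr : r ∈ A.BR) : r ∉ A.HR :=
  Finset.disjoint_right.1 h.disj hr

theorem pair_sum_x (h : A.Valid F i) {r : ℕ} (hr : r ∈ A.rows) (a : ℕ → ZMod 2) (s : Finset ℕ)
    (hs : s ⊆ A.rows) : pair (A.φ r) (∑ k ∈ s, a k • A.x k) = if r ∈ s then a r else 0 := by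
  rw [map_sum, ← Finset.sum_ite_eq s r]
  refine Finset.sum_congr rfl fun k hk => ?_
  rw [map_smul, h.pair_x r hr k (hs hk)]
  split_ifs with e
  · rw [smul_eq_mul, mul_one]
  · rw [smul_zero]

theorem exists_coeff (h : A.Valid F i) {c : Chain} (hc : c ∈ chains (F.K i)) :
    ∃ a b : ℕ → ZMod 2, c = ∑ r ∈ A.rows, a r • A.x r + ∑ r ∈ A.BR, b r • A.y r := by
  obtain ⟨p, hp, q, hq, rfl⟩ := Submodule.mem_sup.1 (h.span hc)
  obtain ⟨a, rfl⟩ := (Submodule.mem_span_image_finset_iff_exists_fun' (ZMod 2)).1 hp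
  obtain ⟨b, rfl⟩ := (Submodule.mem_span_image_finset_iff_exists_fun' (ZMod 2)).1 hq
  exact ⟨a, b, rfl⟩

/-- The boundary operator kills the `x_r` and maps the `y_r` to the `x_r` with `r ∈ BR`; coordinates
at rows in `HR` vanish on these. -/
theorem pair_boundary (h : A.Valid F i) {c : Chain} (hc : c ∈ boundaries (F.K i)) {r : ℕ}
    (hr : r ∈ A.HR) : pair (A.φ r) c = 0 := by
  obtain ⟨y, hy, rfl⟩ := mem_boundaries.1 hc
  obtain ⟨a, b, rfl⟩ := h.exists_coeff hy
  have h1 : boundary (∑ r ∈ A.rows, a r • A.x r + ∑ r ∈ A.BR, b r • A.y r) =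
      ∑ r ∈ A.BR, b r • A.x r := by
    rw [map_add, map_sum, map_sum, Finset.sum_eq_zero, zero_add]
    · exact Finset.sum_congr rfl fun k hk => by rw [map_smul, h.boundary_y k hk]
    · intro k hk
      rw [map_smul, (mem_cycles.1 (h.x_mem hk)).2, smul_zero]
  rw [h1, h.pair_sum_x (HR_subset hr) b A.BR (fun _ => BR_subset), if_neg (h.notMem_BR hr)]

/-- A cycle has no component along the `y_r`, because the boundary of this component is a
combination of the independent `x_r`, `r ∈ BR`. Its coordinates are then read off by the
functionals. -/
theorem cycle_eq (h : A.Valid F i) {c : Chain} (hc : c ∈ cycles (F.K i)) :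
    c = ∑ r ∈ A.rows, pair (A.φ r) c • A.x r := by
  obtain ⟨h1, h2⟩ := mem_cycles.1 hc
  obtain ⟨a, b, rfl⟩ := h.exists_coeff h1
  have h3 : ∑ r ∈ A.BR, b r • A.x r = 0 := by
    rw [map_add, map_sum, map_sum, Finset.sum_eq_zero, zero_add] at h2
    · rw [← h2]
      exact Finset.sum_congr rfl fun k hk => by rw [map_smul, h.boundary_y k hk]
    · intro k hk
      rw [map_smul, (mem_cycles.1 (h.x_mem hk)).2, smul_zero]
  have h4 : ∀ r ∈ A.BR, b r = 0 := fun r hr => by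
    have := h.pair_sum_x (BR_subset hr) b A.BR (fun _ => BR_subset)
    rw [if_pos hr, h3, map_zero] at this
    exact this.symm
  have h5 : ∑ r ∈ A.BR, b r • A.y r = 0 :=
    Finset.sum_eq_zero fun r hr => by rw [h4 r hr, zero_smul]
  rw [h5, add_zero]
  refine Finset.sum_congr rfl fun r hr => ?_
  rw [h.pair_sum_x hr a A.rows le_rfl, if_pos hr]

theorem cycle_eq_filter (h : A.Valid F i) {c : Chain} (hc : c ∈ cycles (F.K i)) :
    c = ∑ r ∈ A.HR.filter (fun r => pair (A.φ r) c = 1), A.x r +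
      ∑ r ∈ A.BR.filter (fun r => pair (A.φ r) c = 1), A.x r := by
  rw [Finset.sum_filter, Finset.sum_filter, ← Finset.sum_union h.disj]
  refine (h.cycle_eq hc).trans (Finset.sum_congr rfl fun r _ => ?_)
  rcases zmod_two_cases (pair (A.φ r) c) with h1 | h1 <;> simp [h1]

theorem x_notMem (h : A.Valid F i) {r : ℕ} (hr : r ∈ A.HR) : A.x r ∉ boundaries (F.K i) := by
  intro hx
  have := h.pair_boundary hx hr
  rw [h.pair_x r (HR_subset hr) r (HR_subset hr), if_pos rfl] at this
  exact absurd this (by decide)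

theorem birth_le (h : A.Valid F i) {r : ℕ} (hr : r ∈ A.rows) : A.birth r ≤ i := by
  rcases Finset.mem_union.1 hr with hr | hr
  · exact (h.hom r hr).le
  · exact (h.bd r hr).le

theorem one_le_birth (h : A.Valid F i) {r : ℕ} (hr : r ∈ A.rows) : 1 ≤ A.birth r := by
  rcases Finset.mem_union.1 hr with hr | hr
  · obtain ⟨j, _, e, _⟩ := (h.hom r hr).birth
    omega
  · obtain ⟨j, _, e, _⟩ := (h.bd r hr).birth
    omega

/-- Comparing keys only weakly suffices in the search for an extremal row: living homology rows have
different births, hence different keys. -/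
theorem key_lt (h : A.Valid F i) (hi : i ≤ F.m) {r k : ℕ} (hr : r ∈ A.HR) (hk : k ∈ A.HR)
    (hne : r ≠ k) (hle : F.key (A.birth r) ≤ F.key (A.birth k)) :
    F.key (A.birth r) < F.key (A.birth k) :=
  lt_of_le_of_ne hle fun e => hne (h.inj_H hr hk (F.key_inj (h.one_le_birth (HR_subset hr))
    ((h.birth_le (HR_subset hr)).trans hi) (h.one_le_birth (HR_subset hk))
    ((h.birth_le (HR_subset hk)).trans hi) e))

end Valid
end Decomp

/-! ### The four updates of the decomposition -/

namespace Decomp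

variable {F : Filtration} {i : ℕ} {A : Decomp}

/-- The rows of the first kind at which the coordinate of the boundary of `s` is one. -/
noncomputable def hitH (A : Decomp) (s : Finset ℕ) : Finset ℕ :=
  A.HR.filter fun r => pair (A.φ r) (boundary (simplexChain s)) = 1

/-- The rows of the second kind at which the coordinate of the boundary of `s` is one. -/
noncomputable def hitB (A : Decomp) (s : Finset ℕ) : Finset ℕ :=
  A.BR.filter fun r => pair (A.φ r) (boundary (simplexChain s)) = 1

/-- The simplex `s`, completed to a chain whose boundary is the sum of the `x r`, `r ∈ hitH s`. -/
noncomputable def cone (A : Decomp) (s : Finset ℕ) : Chain :=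
  simplexChain s + ∑ r ∈ A.hitB s, A.y r

/-- The decomposition after the insertion of `s` at `i` that gives birth to a cycle; it is stored in
the free row `r₀`. -/
noncomputable def insertBirth (A : Decomp) (i : ℕ) (s : Finset ℕ) (r₀ : ℕ) : Decomp where
  HR := insert r₀ A.HR
  BR := A.BR
  x := Function.update A.x r₀ (A.cone s)
  y := A.y
  φ r := if r = r₀ then Pi.single s 1 else Function.update (A.φ r) s 0
  birth := Function.update A.birth r₀ (i + 1)
  deg := Function.update A.deg r₀ (s.card - 1)
  U := Function.update A.U r₀ (Pi.single (i + 1) 1)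
  wire := Function.update A.wire (i + 1) (A.cone s)

/-- The decomposition after the insertion of `s` at `i` that makes the cycle of the row `M` a
boundary. -/
noncomputable def insertDeath (A : Decomp) (i : ℕ) (s : Finset ℕ) (M : ℕ) : Decomp where
  HR := A.HR.erase M
  BR := insert M A.BR
  x := Function.update A.x M (∑ r ∈ A.hitH s, A.x r)
  y := Function.update A.y M (A.cone s)
  φ r := if r ∈ (A.hitH s).erase M then Function.update (A.φ r) s 0 + Function.update (A.φ M) s 0
    else Function.update (A.φ r) s 0
  birth := Function.update A.birth M (i + 1)
  deg := A.deg
  U := A.U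
  wire := A.wire

/-- The decomposition after the deletion of `s`, which destroys the cycle of the row `M`. -/
noncomputable def deleteDeath (A : Decomp) (s : Finset ℕ) (M : ℕ) : Decomp where
  HR := A.HR.erase M
  BR := A.BR
  x r := if r ∈ A.HR ∧ A.x r s = 1 then A.x r + A.x M else A.x r
  y r := if A.y r s = 1 then A.y r + A.x M else A.y r
  φ := A.φ
  birth := A.birth
  deg := A.deg
  U r := if A.x r s = 1 then A.U r + A.U M else A.U r
  wire := A.wire

/-- The decomposition after the deletion of `s` at `i`, which makes the boundary of the row `M` a
nontrivial cycle. -/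
noncomputable def deleteBirth (A : Decomp) (i : ℕ) (s : Finset ℕ) (M : ℕ) : Decomp where
  HR := insert M A.HR
  BR := A.BR.erase M
  x r := if r ∈ A.BR.erase M ∧ A.y r s = 1 then A.x r + A.x M else A.x r
  y r := if A.y r s = 1 then A.y r + A.y M else A.y r
  φ := Function.update A.φ M (∑ r ∈ A.BR.filter (fun r => A.y r s = 1), A.φ r)
  birth := Function.update A.birth M (i + 1)
  deg := A.deg
  U := Function.update A.U M (Pi.single (i + 1) 1)
  wire := Function.update A.wire (i + 1) (A.x M)

theorem pair_update_zero {φ : Finset ℕ → ZMod 2} {s : Finset ℕ} {c : Chain} (h : c s = 0) :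
    pair (Function.update φ s 0) c = pair φ c :=
  pair_congr fun t ht => by
    rw [Function.update_of_ne]
    rintro rfl
    exact ht h

namespace Valid

/-! ### Insertions, and the birth of a cycle -/

section Insertion

variable {s : Finset ℕ}

theorem cycle_boundary (hs : Adds (F.K i) (F.K (i + 1)) s) :
    boundary (simplexChain s) ∈ cycles (F.K i) :=
  hs.boundary_mem

theorem boundary_simplex (h : A.Valid F i) (hs : Adds (F.K i) (F.K (i + 1)) s) :
    boundary (simplexChain s) = ∑ r ∈ A.hitH s, A.x r + ∑ r ∈ A.hitB s, A.x r :=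
  h.cycle_eq_filter hs.boundary_mem

/-- The added chains `y_r` cancel the part of `∂s` that is already a boundary; only the homology
part is left. -/
theorem boundary_cone (h : A.Valid F i) (hs : Adds (F.K i) (F.K (i + 1)) s) :
    boundary (A.cone s) = ∑ r ∈ A.hitH s, A.x r := by
  have h1 : ∑ r ∈ A.hitB s, boundary (A.y r) = ∑ r ∈ A.hitB s, A.x r :=
    Finset.sum_congr rfl fun r hr => h.boundary_y r (Finset.mem_filter.1 hr).1
  rw [cone, map_add, map_sum, h1, h.boundary_simplex hs, add_assoc, add_self_eq_zero_of_module,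
    add_zero]

theorem sum_y_mem (h : A.Valid F i) (s : Finset ℕ) :
    ∑ r ∈ A.hitB s, A.y r ∈ chains (F.K i) :=
  sum_mem fun r hr => h.y_mem r (Finset.mem_filter.1 hr).1

theorem cone_mem (h : A.Valid F i) (hs : Adds (F.K i) (F.K (i + 1)) s) :
    A.cone s ∈ chains (F.K (i + 1)) :=
  add_mem hs.simplexChain_mem (chains_mono hs.subset (h.sum_y_mem s))

theorem cone_apply (h : A.Valid F i) (hs : Adds (F.K i) (F.K (i + 1)) s) : A.cone s s = 1 := by
  rw [cone, Finsupp.add_apply, hs.apply_eq_zero (h.sum_y_mem s), Finsupp.single_eq_same, add_zero]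

theorem x_apply (h : A.Valid F i) (hs : Adds (F.K i) (F.K (i + 1)) s) {r : ℕ} (hr : r ∈ A.rows) :
    A.x r s = 0 :=
  hs.apply_eq_zero (mem_cycles.1 (h.x_mem hr)).1

theorem y_apply (h : A.Valid F i) (hs : Adds (F.K i) (F.K (i + 1)) s) {r : ℕ} (hr : r ∈ A.BR) :
    A.y r s = 0 :=
  hs.apply_eq_zero (h.y_mem r hr)

/-- Clearing a functional at `s` does not change it on old chains and removes the contribution of
`s`; on the `y_r` it vanishes anyway. This restores duality without any computation. -/
theorem pair_cone (h : A.Valid F i) (hs : Adds (F.K i) (F.K (i + 1)) s) {r : ℕ}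
    (hr : r ∈ A.rows) : pair (Function.update (A.φ r) s 0) (A.cone s) = 0 := by
  rw [cone, map_add, pair_simplexChain, Function.update_self, zero_add,
    pair_update_zero (hs.apply_eq_zero (h.sum_y_mem s)), map_sum]
  exact Finset.sum_eq_zero fun k hk => h.pair_y r hr k (Finset.mem_filter.1 hk).1

theorem card_of_hit (h : A.Valid F i) {r : ℕ} (hr : r ∈ A.rows)
    (h1 : pair (A.φ r) (boundary (simplexChain s)) = 1) : s.card = A.deg r + 2 := by
  obtain ⟨t, ht, hφ⟩ := exists_of_pair_ne_zero (φ := A.φ r) (c := boundary (simplexChain s))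
    (by rw [h1]; decide)
  rw [boundary_simplexChain] at ht
  obtain ⟨_, v, hv, rfl⟩ := facetSum_apply_ne_zero ht
  have := h.deg_φ r hr _ hφ
  rw [Finset.card_erase_of_mem hv] at this
  have : 0 < s.card := Finset.card_pos.2 ⟨v, hv⟩
  omega

theorem cone_homogeneous (h : A.Valid F i) {p : ℕ} (hp : s.card = p + 1) :
    IsHomogeneous p (A.cone s) := by
  refine (isHomogeneous_simplexChain hp).add (IsHomogeneous.sum fun r hr => ?_)
  obtain ⟨h1, h2⟩ := Finset.mem_filter.1 hr
  have h3 := h.card_of_hit (BR_subset h1) h2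
  have h4 := h.deg_y r h1
  rwa [show A.deg r + 1 = p by omega] at h4

/-- Boundaries have no coordinates at the rows in `HR`; conversely, without such coordinates `∂s` is
a sum of the `x_r` with `r ∈ BR`. -/
theorem bounds_iff_insert (h : A.Valid F i) (hi : i < F.m) (hd : F.dir i = true) :
    F.Bounds i ↔ A.hitH (F.σ i) = ∅ := by
  have hs := F.adds_of_fwd hi hd
  rw [bounds_of_fwd hd]
  constructor
  · intro hb
    ext r
    simp only [hitH, Finset.mem_filter, Finset.notMem_empty, iff_false, not_and]
    intro hr
    rw [h.pair_boundary hb hr]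
    decide
  · intro he
    rw [h.boundary_simplex hs, he, Finset.sum_empty, zero_add]
    refine sum_mem fun r hr => ?_
    have := h.bd r (Finset.mem_filter.1 hr).1
    exact this.mem i this.le le_rfl

/-- The cone is a cycle, and it is the only new basis vector. Its dual functional is the coefficient
at the new simplex, which is one on the cone and zero on every old chain. -/
theorem insertBirth (h : A.Valid F i) (hi : i < F.m) (hd : F.dir i = true)
    (hH : A.hitH (F.σ i) = ∅) {r₀ : ℕ} (h₀ : r₀ ∉ A.rows) (hn : r₀ < F.n) :
    (A.insertBirth i (F.σ i) r₀).Valid F (i + 1) := by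
  set s := F.σ i with hsdef
  have hs : Adds (F.K i) (F.K (i + 1)) s := F.adds_of_fwd hi hd
  have hb := (h.bounds_iff_insert hi hd).2 hH
  set A' := A.insertBirth i s r₀ with hA'
  have hne : ∀ r ∈ A.rows, r ≠ r₀ := fun r hr e => h₀ (e ▸ hr)
  have hrows : A'.rows = insert r₀ A.rows := Finset.insert_union _ _ _
  have hx0 : A'.x r₀ = A.cone s := Function.update_self _ _ _
  have hx : ∀ r ∈ A.rows, A'.x r = A.x r := fun r hr =>
    Function.update_of_ne (hne r hr) _ _
  have hφ0 : A'.φ r₀ = Pi.single s 1 := if_pos rfl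
  have hφ : ∀ r ∈ A.rows, A'.φ r = Function.update (A.φ r) s 0 := fun r hr =>
    if_neg (hne r hr)
  have hB0 : A'.birth r₀ = i + 1 := Function.update_self _ _ _
  have hB : ∀ r ∈ A.rows, A'.birth r = A.birth r := fun r hr =>
    Function.update_of_ne (hne r hr) _ _
  have hD0 : A'.deg r₀ = s.card - 1 := Function.update_self _ _ _
  have hD : ∀ r ∈ A.rows, A'.deg r = A.deg r := fun r hr =>
    Function.update_of_ne (hne r hr) _ _
  have hU0 : A'.U r₀ = Pi.single (i + 1) 1 := Function.update_self _ _ _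
  have hU : ∀ r ∈ A.rows, A'.U r = A.U r := fun r hr =>
    Function.update_of_ne (hne r hr) _ _
  have hcard : s.card = s.card - 1 + 1 := by
    have := Finset.card_pos.2 ((F.K (i + 1)).isRelLowerSet_faces hs.mem).1
    omega
  have hrep0 : ∀ α, A'.rep r₀ α = if i + 1 ≤ α then A.cone s else 0 := fun α => by
    rw [rep, hU0]
    exact bundleChain_single _ _ _ _
  have hrep : ∀ r ∈ A.HR, A'.rep r = A.rep r := fun r hr => by
    funext α
    rw [rep, hU r (HR_subset hr)]
    refine bundleChain_update ?_ _ _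
    by_contra hne
    have := (h.wire_mem r hr _ hne).1
    omega
  have hcyc : A.cone s ∈ cycles (F.K (i + 1)) := mem_cycles.2 ⟨h.cone_mem hs, by
    rw [h.boundary_cone hs, hH, Finset.sum_empty]⟩
  have hspn : A.spn ≤ A'.spn := spn_le
    (fun r hr => hx r hr ▸ x_mem_spn (by rw [hrows]; exact Finset.mem_insert_of_mem hr))
    (fun r hr => y_mem_spn (A := A') hr)
  refine ⟨?_, ?_, ?_, ?_, ?_, ?_, ?_, ?_, ?_, ?_, ?_, ?_, ?_, ?_, ?_, ?_⟩
  · exact Finset.disjoint_insert_left.2 ⟨fun hn => h₀ (BR_subset hn), h.disj⟩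
  · rw [ncard_of_adds hs (F.finite_faces hi.le), ← h.card]
    have : A'.HR.card = A.HR.card + 1 := Finset.card_insert_of_notMem fun hn => h₀ (HR_subset hn)
    rw [this]
    change _ + 2 * A.BR.card = _
    ring
  · intro r hr
    rw [hrows] at hr
    rcases Finset.mem_insert.1 hr with rfl | hr
    · exact hn
    · exact h.lt_n r hr
  · exact fun r hr => chains_mono hs.subset (h.y_mem r hr)
  · intro r hr
    rw [hx r (BR_subset hr)]
    exact h.boundary_y r hr
  · intro r hr k hk
    rw [hrows] at hr hk
    rcases Finset.mem_insert.1 hr with rfl | hr' <;> rcases Finset.mem_insert.1 hk with rfl | hk'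
    · rw [hφ0, hx0, pair_single, h.cone_apply hs, if_pos rfl]
    · rw [hφ0, hx k hk', pair_single, h.x_apply hs hk', if_neg (hne k hk').symm]
    · rw [hφ r hr', hx0, h.pair_cone hs hr', if_neg (hne r hr')]
    · rw [hφ r hr', hx k hk', pair_update_zero (h.x_apply hs hk'), h.pair_x r hr' k hk']
  · intro r hr k hk
    rw [hrows] at hr
    rcases Finset.mem_insert.1 hr with rfl | hr
    · rw [hφ0, pair_single]
      exact h.y_apply hs hk
    · rw [hφ r hr]
      exact (pair_update_zero (h.y_apply hs hk)).trans (h.pair_y r hr k hk)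
  -- The new simplex is the cone plus some of the `y_r`.
  · refine chains_le_of_adds hs (h.span.trans hspn) ?_
    have h1 : A.cone s ∈ A'.spn :=
      hx0 ▸ x_mem_spn (by rw [hrows]; exact Finset.mem_insert_self _ _)
    have h2 : ∑ r ∈ A.hitB s, A.y r ∈ A'.spn := sum_mem fun r hr =>
      y_mem_spn (A := A') (Finset.mem_filter.1 hr).1
    exact (Submodule.add_mem_iff_left _ h2).1 h1
  · intro r hr
    rcases Finset.mem_insert.1 hr with rfl | hr
    · rw [hB0, hD0, show A'.rep r = _ from funext hrep0]
      refine PartialRep.of_birth ((homologyBirth_iff hi).2 (by simp [hd, hb])) hcyc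
        (h.cone_homogeneous hcard) (fun _ => h.cone_apply hs) (fun h' => by simp [hd] at h')
    · rw [hB r (HR_subset hr), hD r (HR_subset hr), hrep r hr]
      refine (h.hom r hr).extend ?_ ?_
      · rw [h.rep_eq hr (Nat.le_succ i), h.rep_self r hr]
      · rw [h.rep_self r hr]
        exact cycles_mono hs.subset (h.x_mem (HR_subset hr))
  · intro r hr
    rcases Finset.mem_insert.1 hr with rfl | hr
    · rw [hrep0, if_pos le_rfl, hx0]
    · rw [hrep r hr, hx r (HR_subset hr)]
      exact h.rep_eq hr (Nat.le_succ i)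
  · intro r hr w hw
    rcases Finset.mem_insert.1 hr with rfl | hr
    · rw [hU0] at hw
      obtain rfl : w = i + 1 := by
        by_contra hne
        exact hw (by rw [Pi.single_apply, if_neg hne])
      refine ⟨le_rfl, ?_⟩
      rw [show A'.wire (i + 1) = A.cone s from Function.update_self _ _ _]
      exact h.cone_mem hs
    · rw [hU r (HR_subset hr)] at hw
      obtain ⟨h1, h2⟩ := h.wire_mem r hr w hw
      refine ⟨by omega, ?_⟩
      rw [show A'.wire w = A.wire w from Function.update_of_ne (by omega) _ _]
      exact h2
  · intro r hr
    rw [hB r (BR_subset hr), hD r (BR_subset hr), hx r (BR_subset hr)]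
    have := h.bd r hr
    exact this.extend (boundaries_mono hs.subset (this.mem i this.le le_rfl))
  · intro r hr
    rw [hD r (BR_subset hr)]
    exact h.deg_y r hr
  · intro r hr t ht
    rw [hrows] at hr
    rcases Finset.mem_insert.1 hr with rfl | hr
    · rw [hφ0] at ht
      obtain rfl : t = s := by
        by_contra hne
        exact ht (by rw [Pi.single_apply, if_neg hne])
      rw [hD0, ← hcard]
    · rw [hφ r hr, Function.update_apply] at ht
      rw [hD r hr]
      split_ifs at ht
      · exact absurd rfl ht
      · exact h.deg_φ r hr t ht
  · intro r hr k hk e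
    replace hr : r ∈ insert r₀ A.HR := hr
    replace hk : k ∈ insert r₀ A.HR := hk
    rcases Finset.mem_insert.1 hr with rfl | hr' <;> rcases Finset.mem_insert.1 hk with rfl | hk'
    · rfl
    · rw [hB0, hB k (HR_subset hk')] at e
      have := h.birth_le (HR_subset hk')
      omega
    · rw [hB0, hB r (HR_subset hr')] at e
      have := h.birth_le (HR_subset hr')
      omega
    · rw [hB r (HR_subset hr'), hB k (HR_subset hk')] at e
      exact h.inj_H hr' hk' e
  · intro r hr k hk e
    replace hr : r ∈ A.BR := hr
    replace hk : k ∈ A.BR := hk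
    rw [hB r (BR_subset hr), hB k (BR_subset hk)] at e
    exact h.inj_B hr hk e

end Insertion
end Valid
end Decomp

/-! ### Insertions that turn a cycle into a boundary -/

namespace Decomp

variable {F : Filtration} {i : ℕ} {A : Decomp}

namespace Valid

/-- Since `M` has the largest key among the rows hit, all other representatives may be added to its
own, and the sum has the birth of `M`. -/
theorem insertDeath_rep (h : A.Valid F i) (hi : i < F.m) {s : Finset ℕ} {M : ℕ}
    (hM : M ∈ A.hitH s)
    (hkey : ∀ r ∈ A.hitH s, F.key (A.birth r) ≤ F.key (A.birth M)) :
    F.PartialRep i (A.birth M) (A.deg M) (fun α => ∑ r ∈ A.hitH s, A.rep r α) := by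
  obtain ⟨hMH, hM1⟩ := Finset.mem_filter.1 hM
  have h1 := (h.hom M hMH).add_sum ((A.hitH s).erase M) A.birth A.rep
    (fun k hk => by
      obtain ⟨h2, h3⟩ := Finset.mem_filter.1 (Finset.mem_of_mem_erase hk)
      have h4 := h.card_of_hit (HR_subset h2) h3
      have h5 := h.card_of_hit (HR_subset hMH) hM1
      rw [show A.deg M = A.deg k by omega]
      exact h.hom k h2)
    (fun k hk => h.key_lt hi.le (Finset.mem_filter.1 (Finset.mem_of_mem_erase hk)).1 hMH
      (Finset.ne_of_mem_erase hk) (hkey k (Finset.mem_of_mem_erase hk)))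
  convert h1 using 2 with α
  exact (Finset.add_sum_erase _ _ hM).symm

theorem sum_hitH_rep (h : A.Valid F i) {s : Finset ℕ} :
    ∑ r ∈ A.hitH s, A.rep r i = ∑ r ∈ A.hitH s, A.x r :=
  Finset.sum_congr rfl fun r hr => h.rep_self r (Finset.mem_filter.1 hr).1

theorem pair_sum_hitH (h : A.Valid F i) {s : Finset ℕ} {r : ℕ} (hr : r ∈ A.rows) :
    pair (A.φ r) (∑ k ∈ A.hitH s, A.x k) = if r ∈ A.hitH s then 1 else 0 := by
  have := h.pair_sum_x hr (fun _ => 1) (A.hitH s)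
    (fun k hk => HR_subset (Finset.mem_filter.1 hk).1)
  simpa using this

/-- Its coordinate at the row `M` is one, which no boundary has. -/
theorem sum_hitH_notMem (h : A.Valid F i) {s : Finset ℕ} {M : ℕ} (hM : M ∈ A.hitH s) :
    ∑ k ∈ A.hitH s, A.x k ∉ boundaries (F.K i) := by
  have hMH := (Finset.mem_filter.1 hM).1
  intro hb
  have := h.pair_boundary hb hMH
  rw [h.pair_sum_hitH (HR_subset hMH), if_pos hM] at this
  exact absurd this (by decide)

/-- In the basis, `x_M` is replaced by the sum of the cycles hit, with the cone as its bounding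
chain. The dual base change adds `φ_M` to the functionals of the other rows that are hit. The number
of rows stays the same: `M` moves from `HR` to `BR`. -/
theorem insertDeath (h : A.Valid F i) (hi : i < F.m) (hd : F.dir i = true) {M : ℕ}
    (hM : M ∈ A.hitH (F.σ i)) : (A.insertDeath i (F.σ i) M).Valid F (i + 1) := by
  set s := F.σ i with hsdef
  have hs : Adds (F.K i) (F.K (i + 1)) s := F.adds_of_fwd hi hd
  have hnb : ¬ F.Bounds i := fun hb => by
    rw [h.bounds_iff_insert hi hd] at hb
    rw [hb] at hM
    exact Finset.notMem_empty _ hM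
  obtain ⟨hMH, hM1⟩ := Finset.mem_filter.1 hM
  have hMr := HR_subset hMH
  have hMB := h.notMem_BR hMH
  set A' := A.insertDeath i s M with hA'
  have hrows : A'.rows = A.rows := by
    ext r
    simp only [rows, A', Decomp.insertDeath, Finset.mem_union, Finset.mem_erase, Finset.mem_insert]
    by_cases hr : r = M
    · simp [hr, hMH]
    · simp [hr]
  have hx0 : A'.x M = ∑ r ∈ A.hitH s, A.x r := Function.update_self _ _ _
  have hx : ∀ r, r ≠ M → A'.x r = A.x r := fun r hr => Function.update_of_ne hr _ _
  have hy0 : A'.y M = A.cone s := Function.update_self _ _ _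
  have hy : ∀ r, r ≠ M → A'.y r = A.y r := fun r hr => Function.update_of_ne hr _ _
  have hB0 : A'.birth M = i + 1 := Function.update_self _ _ _
  have hB : ∀ r, r ≠ M → A'.birth r = A.birth r := fun r hr => Function.update_of_ne hr _ _
  have hBR : ∀ r ∈ A.BR, r ≠ M := fun r hr e => hMB (e ▸ hr)
  have hsum : ∑ r ∈ A.hitH s, A.x r ∈ cycles (F.K i) :=
    sum_mem fun r hr => h.x_mem (HR_subset (Finset.mem_filter.1 hr).1)
  have hpair : ∀ r c, pair (A'.φ r) c = pair (Function.update (A.φ r) s 0) c +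
      if r ∈ (A.hitH s).erase M then pair (Function.update (A.φ M) s 0) c else 0 := by
    intro r c
    simp only [A', Decomp.insertDeath]
    split_ifs
    · rw [pair_add]
    · rw [add_zero]
  have hbsum : ∑ r ∈ A.hitH s, A.x r ∈ boundaries (F.K (i + 1)) :=
    mem_boundaries.2 ⟨_, h.cone_mem hs, h.boundary_cone hs⟩
  have hdeg : ∀ r ∈ A.hitH s, A.deg r = A.deg M := fun r hr => by
    obtain ⟨h2, h3⟩ := Finset.mem_filter.1 hr
    have h4 := h.card_of_hit (HR_subset h2) h3
    have h5 := h.card_of_hit hMr hM1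
    omega
  -- The old `x_M` is recovered from the new one by subtracting the other summands, which are
  -- unchanged.
  have hxs : ∀ r ∈ A.rows, A.x r ∈ A'.spn := by
    have h1 : ∀ r ∈ A.rows, r ≠ M → A.x r ∈ A'.spn := fun r hr hrM =>
      hx r hrM ▸ x_mem_spn (by rwa [hrows])
    intro r hr
    by_cases hrM : r = M
    · subst hrM
      have h2 : ∑ r ∈ A.hitH s, A.x r ∈ A'.spn := hx0 ▸ x_mem_spn (by rwa [hrows])
      rw [← Finset.add_sum_erase _ _ hM] at h2
      refine (Submodule.add_mem_iff_left _ (sum_mem fun k hk => ?_)).1 h2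
      exact h1 k (HR_subset (Finset.mem_filter.1 (Finset.mem_of_mem_erase hk)).1)
        (Finset.ne_of_mem_erase hk)
    · exact h1 r hr hrM
  have hys : ∀ r ∈ A.BR, A.y r ∈ A'.spn := fun r hr =>
    hy r (hBR r hr) ▸ y_mem_spn (Finset.mem_insert_of_mem hr)
  refine ⟨?_, ?_, ?_, ?_, ?_, ?_, ?_, ?_, ?_, ?_, ?_, ?_, ?_, ?_, ?_, ?_⟩
  · refine Finset.disjoint_insert_right.2 ⟨Finset.notMem_erase _ _, ?_⟩
    exact h.disj.mono_left (Finset.erase_subset _ _)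
  · rw [ncard_of_adds hs (F.finite_faces hi.le), ← h.card]
    have h1 : A'.HR.card + 1 = A.HR.card := Finset.card_erase_add_one hMH
    have h2 : A'.BR.card = A.BR.card + 1 := Finset.card_insert_of_notMem hMB
    omega
  · rw [hrows]
    exact h.lt_n
  · intro r hr
    rcases Finset.mem_insert.1 hr with rfl | hr
    · rw [hy0]
      exact h.cone_mem hs
    · rw [hy r (hBR r hr)]
      exact chains_mono hs.subset (h.y_mem r hr)
  · intro r hr
    rcases Finset.mem_insert.1 hr with rfl | hr
    · rw [hy0, hx0, h.boundary_cone hs]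
    · rw [hy r (hBR r hr), hx r (hBR r hr)]
      exact h.boundary_y r hr
  · intro r hr k hk
    rw [hrows] at hr hk
    rw [hpair]
    by_cases hkM : k = M
    · subst hkM
      have h0 := hs.apply_eq_zero (mem_cycles.1 hsum).1
      rw [hx0, pair_update_zero h0, pair_update_zero h0, h.pair_sum_hitH hr, h.pair_sum_hitH hMr,
        if_pos hM]
      simp only [Finset.mem_erase]
      by_cases hrk : r = k
      · subst hrk
        simp [hM]
      · by_cases hrS : r ∈ A.hitH s
        -- Both `φ_r` and `φ_M` take the value one on the new `x_M`, and their sum vanishes there as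
        -- required.
        · simp only [hrS, hrk, ne_eq, not_false_eq_true, and_self, if_true, if_false]
          decide
        · simp [hrS, hrk]
    · rw [hx k hkM, pair_update_zero (h.x_apply hs hk), pair_update_zero (h.x_apply hs hk),
        h.pair_x r hr k hk, h.pair_x M hMr k hk, if_neg (Ne.symm hkM)]
      simp
  · intro r hr k hk
    rw [hrows] at hr
    rw [hpair]
    rcases Finset.mem_insert.1 hk with rfl | hk
    · rw [hy0, h.pair_cone hs hr, h.pair_cone hs hMr]
      simp
    · rw [hy k (hBR k hk), pair_update_zero (h.y_apply hs hk), pair_update_zero (h.y_apply hs hk),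
        h.pair_y r hr k hk, h.pair_y M hMr k hk]
      simp
  · refine chains_le_of_adds hs (h.span.trans (spn_le hxs hys)) ?_
    have h1 : A.cone s ∈ A'.spn := hy0 ▸ y_mem_spn (Finset.mem_insert_self _ _)
    have h2 : ∑ r ∈ A.hitB s, A.y r ∈ A'.spn := sum_mem fun r hr =>
      hys r (Finset.mem_filter.1 hr).1
    exact (Submodule.add_mem_iff_left _ h2).1 h1
  · intro r hr
    obtain ⟨hrM, hr⟩ := Finset.mem_erase.1 hr
    rw [hB r hrM]
    refine (h.hom r hr).extend ?_ ?_
    · rw [h.rep_eq hr (Nat.le_succ i), h.rep_self r hr]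
    · rw [h.rep_self r hr]
      exact cycles_mono hs.subset (h.x_mem (HR_subset hr))
  · intro r hr
    obtain ⟨hrM, hr⟩ := Finset.mem_erase.1 hr
    rw [hx r hrM]
    exact h.rep_eq hr (Nat.le_succ i)
  · intro r hr w hw
    obtain ⟨h1, h2⟩ := h.wire_mem r (Finset.mem_of_mem_erase hr) w hw
    exact ⟨by omega, h2⟩
  · intro r hr
    rcases Finset.mem_insert.1 hr with rfl | hr
    · rw [hB0, hx0]
      refine ⟨(boundaryBirth_iff hi).2 ⟨hd, hnb⟩, le_rfl, IsHomogeneous.sum fun k hk => ?_, ?_, ?_⟩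
      · have := h.deg_x (HR_subset (Finset.mem_filter.1 hk).1)
        rwa [hdeg k hk] at this
      · intro α h1 h2
        obtain rfl : α = i + 1 := by omega
        exact hbsum
      · intro j hj
        obtain rfl : i = j := by omega
        exact h.sum_hitH_notMem hM
    · rw [hB r (hBR r hr), hx r (hBR r hr)]
      have := h.bd r hr
      exact this.extend (boundaries_mono hs.subset (this.mem i this.le le_rfl))
  · intro r hr
    rcases Finset.mem_insert.1 hr with rfl | hr
    · rw [hy0]
      exact h.cone_homogeneous (h.card_of_hit hMr hM1)
    · rw [hy r (hBR r hr)]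
      exact h.deg_y r hr
  · intro r hr t ht
    rw [hrows] at hr
    have key : ∀ k ∈ A.rows, Function.update (A.φ k) s 0 t ≠ 0 → t.card = A.deg k + 1 := by
      intro k hk hkt
      rw [Function.update_apply] at hkt
      split_ifs at hkt
      · exact absurd rfl hkt
      · exact h.deg_φ k hk t hkt
    simp only [A', Decomp.insertDeath] at ht
    split_ifs at ht with hrS
    · by_cases h1 : Function.update (A.φ r) s 0 t = 0
      · rw [Pi.add_apply, h1, zero_add] at ht
        change t.card = A.deg r + 1
        rw [hdeg r (Finset.mem_of_mem_erase hrS)]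
        exact key M hMr ht
      · exact key r hr h1
    · exact key r hr ht
  · intro r hr k hk e
    obtain ⟨hrM, hr⟩ := Finset.mem_erase.1 hr
    obtain ⟨hkM, hk⟩ := Finset.mem_erase.1 hk
    rw [hB r hrM, hB k hkM] at e
    exact h.inj_H hr hk e
  · intro r hr k hk e
    replace hr : r ∈ insert M A.BR := hr
    replace hk : k ∈ insert M A.BR := hk
    rcases Finset.mem_insert.1 hr with rfl | hr' <;> rcases Finset.mem_insert.1 hk with rfl | hk'
    · rfl
    · rw [hB0, hB k (hBR k hk')] at e
      have := h.birth_le (BR_subset hk')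
      omega
    · rw [hB0, hB r (hBR r hr')] at e
      have := h.birth_le (BR_subset hr')
      omega
    · rw [hB r (hBR r hr'), hB k (hBR k hk')] at e
      exact h.inj_B hr' hk' e

theorem insertDeath_isHomologyRep (h : A.Valid F i) (hi : i < F.m) (hd : F.dir i = true) {M : ℕ}
    (hM : M ∈ A.hitH (F.σ i))
    (hkey : ∀ r ∈ A.hitH (F.σ i), F.key (A.birth r) ≤ F.key (A.birth M)) :
    F.IsHomologyRep (A.birth M) i (fun α => PartialRep.toCycle (F.K α)
      (∑ r ∈ A.hitH (F.σ i), A.rep r α)) := by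
  have hs := F.adds_of_fwd hi hd
  refine (h.insertDeath_rep hi hM hkey).isHomologyRep ?_ (fun _ h' => by simp [hd] at h')
    fun _ _ => ?_
  · rw [homologyDeath_iff hi, h.bounds_iff_insert hi hd]
    simp [hd, Finset.ne_empty_of_mem hM]
  · rw [h.sum_hitH_rep]
    exact ⟨h.sum_hitH_notMem hM, mem_boundaries.2 ⟨_, h.cone_mem hs, h.boundary_cone hs⟩⟩

/-! ### Deletions -/

section Deletion

variable {s : Finset ℕ}

theorem card_of_x (h : A.Valid F i) {r : ℕ} (hr : r ∈ A.rows) (h1 : A.x r s = 1) :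
    s.card = A.deg r + 1 :=
  IsHomogeneous_iff.1 (h.deg_x hr) s (by rw [h1]; decide)

theorem card_of_y (h : A.Valid F i) {r : ℕ} (hr : r ∈ A.BR) (h1 : A.y r s = 1) :
    s.card = A.deg r + 2 :=
  IsHomogeneous_iff.1 (h.deg_y r hr) s (by rw [h1]; decide)

theorem x_apply_BR (h : A.Valid F i) (hs : Adds (F.K (i + 1)) (F.K i) s) {r : ℕ} (hr : r ∈ A.BR) :
    A.x r s = 0 :=
  hs.boundary_apply ((h.bd r hr).mem i (h.bd r hr).le le_rfl)

/-- If `∂s` did not bound without `s`, no cycle could contain `s`. -/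
theorem bounds_of_delete (h : A.Valid F i) (hi : i < F.m) (hd : F.dir i = false) {M : ℕ}
    (hM : M ∈ A.HR) (hM1 : A.x M (F.σ i) = 1) : F.Bounds i := by
  have hs := F.adds_of_bwd hi hd
  rw [bounds_of_bwd hd]
  by_contra hb
  have h1 := h.x_mem (HR_subset hM)
  rw [hs.cycles_eq hb] at h1
  rw [hs.apply_eq_zero (mem_cycles.1 h1).1] at hM1
  exact absurd hM1 (by decide)

/-- If `∂s` did bound, some cycle would contain `s`. But every cycle is a combination of the `x_r`;
those in `HR` avoid `s` by hypothesis, and those in `BR` because `s` is a facet of no simplex. -/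
theorem not_bounds_of_delete (h : A.Valid F i) (hi : i < F.m) (hd : F.dir i = false)
    (hx : ∀ r ∈ A.HR, A.x r (F.σ i) = 0) : ¬ F.Bounds i := by
  have hs := F.adds_of_bwd hi hd
  rw [bounds_of_bwd hd]
  intro hb
  obtain ⟨u, hu, hu'⟩ := hs.exists_cycle hb
  refine hu' (mem_cycles.2 ⟨hs.mem_chains_of_apply (mem_cycles.1 hu).1 ?_, (mem_cycles.1 hu).2⟩)
  rw [h.cycle_eq hu, Finsupp.finsetSum_apply]
  refine Finset.sum_eq_zero fun r hr => ?_
  rw [Finsupp.smul_apply]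
  rcases Finset.mem_union.1 hr with hr | hr
  · rw [hx r hr, smul_zero]
  · rw [h.x_apply_BR hs hr, smul_zero]

/-- The simplex `s` itself is a combination of basis chains, so one of them contains it, and the
`x_r` do not. -/
theorem exists_y_of_delete (h : A.Valid F i) (hi : i < F.m) (hd : F.dir i = false)
    (hx : ∀ r ∈ A.HR, A.x r (F.σ i) = 0) : ∃ r ∈ A.BR, A.y r (F.σ i) = 1 := by
  have hs := F.adds_of_bwd hi hd
  by_contra hn
  obtain ⟨a, b, e⟩ := h.exists_coeff hs.simplexChain_mem
  have := DFunLike.congr_fun e (F.σ i)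
  rw [Finsupp.single_eq_same, Finsupp.add_apply, Finsupp.finsetSum_apply, Finsupp.finsetSum_apply,
    Finset.sum_eq_zero, Finset.sum_eq_zero] at this
  · exact absurd this (by decide)
  · intro r hr
    rw [Finsupp.smul_apply]
    rcases zmod_two_cases (A.y r (F.σ i)) with h1 | h1
    · rw [h1, smul_zero]
    · exact absurd ⟨r, hr, h1⟩ hn
  · intro r hr
    rw [Finsupp.smul_apply]
    rcases Finset.mem_union.1 hr with hr | hr
    · rw [hx r hr, smul_zero]
    · rw [h.x_apply_BR hs hr, smul_zero]

theorem deleteDeath_isHomologyRep (h : A.Valid F i) (hi : i < F.m) (hd : F.dir i = false) {M : ℕ}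
    (hM : M ∈ A.HR) (hM1 : A.x M (F.σ i) = 1) :
    F.IsHomologyRep (A.birth M) i (fun α => PartialRep.toCycle (F.K α) (A.rep M α)) := by
  have hs := F.adds_of_bwd hi hd
  refine (h.hom M hM).isHomologyRep ?_ (fun _ _ hn => ?_) (fun _ h' => by simp [hd] at h')
  · rw [homologyDeath_iff hi]
    simp [hd, h.bounds_of_delete hi hd hM hM1]
  · rw [h.rep_self M hM] at hn
    rw [hs.apply_eq_zero (mem_cycles.1 hn).1] at hM1
    exact absurd hM1 (by decide)

/-- Adding the cycle `x_M` clears the coefficient at `s` in all other basis chains and does not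
alter boundaries. The functionals need no change, because those of the remaining rows vanish on
`x_M`. The smallest key makes the representative of `M` addable to all the others. -/
theorem deleteDeath (h : A.Valid F i) (hi : i < F.m) (hd : F.dir i = false) {M : ℕ}
    (hM : M ∈ A.HR) (hM1 : A.x M (F.σ i) = 1)
    (hkey : ∀ r ∈ A.HR, A.x r (F.σ i) = 1 → F.key (A.birth M) ≤ F.key (A.birth r)) :
    (A.deleteDeath (F.σ i) M).Valid F (i + 1) := by
  set s := F.σ i with hsdef
  have hs : Adds (F.K (i + 1)) (F.K i) s := F.adds_of_bwd hi hd
  have hMr := HR_subset hM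
  have hMB := h.notMem_BR hM
  set A' := A.deleteDeath s M with hA'
  have hrows : A'.rows = A.rows.erase M := by
    ext r
    simp only [rows, A', Decomp.deleteDeath, Finset.mem_union, Finset.mem_erase]
    by_cases hr : r = M
    · simp [hr, hMB]
    · simp [hr]
  have hxB : ∀ r ∈ A.BR, A'.x r = A.x r := fun r hr => if_neg fun hn => h.notMem_HR hr hn.1
  have hxH : ∀ r ∈ A.HR, A'.x r = if A.x r s = 1 then A.x r + A.x M else A.x r := fun r hr => by
    simp [A', Decomp.deleteDeath, hr]
  have hxs : ∀ r ∈ A.rows, A'.x r s = 0 := by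
    intro r hr
    rcases Finset.mem_union.1 hr with hr | hr
    · rw [hxH r hr]
      split_ifs with h1
      · rw [Finsupp.add_apply, h1, hM1]
        rfl
      · exact (zmod_two_cases _).resolve_right h1
    · rw [hxB r hr, h.x_apply_BR hs hr]
  have hxc : ∀ r ∈ A.rows, A'.x r ∈ cycles (F.K (i + 1)) := by
    intro r hr
    have h1 : A'.x r ∈ cycles (F.K i) := by
      simp only [A', Decomp.deleteDeath]
      split_ifs
      · exact add_mem (h.x_mem hr) (h.x_mem hMr)
      · exact h.x_mem hr
    exact mem_cycles.2 ⟨hs.mem_chains_of_apply (mem_cycles.1 h1).1 (hxs r hr), (mem_cycles.1 h1).2⟩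
  have hyc : ∀ r ∈ A.BR, A'.y r ∈ chains (F.K (i + 1)) := by
    intro r hr
    refine hs.mem_chains_of_apply ?_ ?_ <;> simp only [A', Decomp.deleteDeath] <;>
      split_ifs with h1
    · exact add_mem (h.y_mem r hr) (mem_cycles.1 (h.x_mem hMr)).1
    · exact h.y_mem r hr
    · rw [Finsupp.add_apply, h1, hM1]
      rfl
    · exact (zmod_two_cases _).resolve_right h1
  have hyb : ∀ r ∈ A.BR, boundary (A'.y r) = A'.x r := by
    intro r hr
    rw [hxB r hr, ← h.boundary_y r hr]
    simp only [A', Decomp.deleteDeath]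
    split_ifs
    · rw [map_add, (mem_cycles.1 (h.x_mem hMr)).2, add_zero]
    · rfl
  have hrep : ∀ r, A'.rep r = if A.x r s = 1 then (fun α => A.rep r α + A.rep M α)
      else A.rep r := by
    intro r
    funext α
    simp only [rep, A', Decomp.deleteDeath]
    split_ifs
    · exact bundleChain_add _ _ _ _
    · rfl
  have hrepi : ∀ r ∈ A.HR, ∀ α, i ≤ α → A'.rep r α = A'.x r := by
    intro r hr α hα
    rw [hrep, hxH r hr]
    split_ifs
    · simp only [h.rep_eq hr hα, h.rep_eq hM hα]
    · exact h.rep_eq hr hα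
  refine ⟨?_, ?_, ?_, ?_, ?_, ?_, ?_, ?_, ?_, ?_, ?_, ?_, ?_, ?_, ?_, ?_⟩
  · exact h.disj.mono_left (Finset.erase_subset _ _)
  · have h0 := h.card
    rw [ncard_of_adds hs (F.finite_faces hi)] at h0
    have h1 : A'.HR.card + 1 = A.HR.card := Finset.card_erase_add_one hM
    change _ + 2 * A.BR.card = _
    omega
  · intro r hr
    rw [hrows] at hr
    exact h.lt_n r (Finset.mem_of_mem_erase hr)
  · exact hyc
  · exact hyb
  · intro r hr k hk
    rw [hrows] at hr hk
    obtain ⟨hrM, hr⟩ := Finset.mem_erase.1 hr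
    have hk := Finset.mem_of_mem_erase hk
    change pair (A.φ r) _ = _
    simp only [A', Decomp.deleteDeath]
    by_cases hc : k ∈ A.HR ∧ A.x k (F.σ i) = 1
    · rw [if_pos hc, map_add, h.pair_x r hr k hk, h.pair_x r hr M hMr, if_neg hrM, add_zero]
    · rw [if_neg hc]
      exact h.pair_x r hr k hk
  · intro r hr k hk
    rw [hrows] at hr
    obtain ⟨hrM, hr⟩ := Finset.mem_erase.1 hr
    change pair (A.φ r) _ = _
    simp only [A', Decomp.deleteDeath]
    split_ifs
    · rw [map_add, h.pair_y r hr k hk, h.pair_x r hr M hMr, if_neg hrM, add_zero]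
    · exact h.pair_y r hr k hk
  · have hxm : A.x M ∈ A'.spn ⊔ Submodule.span (ZMod 2) {A.x M} :=
      Submodule.mem_sup_right (Submodule.mem_span_singleton_self _)
    refine chains_le_of_le_sup hs (h.span.trans (spn_le (fun r hr => ?_) fun r hr => ?_))
      (spn_le (fun r hr => ?_) hyc) hM1
    · by_cases hrM : r = M
      · rw [hrM]
        exact hxm
      · have h1 : A'.x r ∈ A'.spn ⊔ Submodule.span (ZMod 2) {A.x M} :=
          Submodule.mem_sup_left (x_mem_spn (by rw [hrows]; exact Finset.mem_erase.2 ⟨hrM, hr⟩))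
        simp only [A', Decomp.deleteDeath] at h1
        split_ifs at h1
        · exact (Submodule.add_mem_iff_left _ hxm).1 h1
        · exact h1
    · have h1 : A'.y r ∈ A'.spn ⊔ Submodule.span (ZMod 2) {A.x M} :=
        Submodule.mem_sup_left (y_mem_spn hr)
      simp only [A', Decomp.deleteDeath] at h1
      split_ifs at h1
      · exact (Submodule.add_mem_iff_left _ hxm).1 h1
      · exact h1
    · rw [hrows] at hr
      exact (mem_cycles.1 (hxc r (Finset.mem_of_mem_erase hr))).1
  · intro r hr
    obtain ⟨hrM, hr⟩ := Finset.mem_erase.1 hr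
    have h1 : F.PartialRep i (A.birth r) (A.deg r) (A'.rep r) := by
      rw [hrep]
      split_ifs with hr1
      · refine (h.hom r hr).add (b' := A.birth M) ?_ (h.key_lt hi.le hM hr (Ne.symm hrM) (hkey r hr hr1))
        have h2 := h.card_of_x (HR_subset hr) hr1
        have h3 := h.card_of_x hMr hM1
        rw [show A.deg r = A.deg M by omega]
        exact h.hom M hM
      · exact h.hom r hr
    refine h1.extend ?_ ?_
    · rw [hrepi r hr _ (Nat.le_succ i), hrepi r hr _ le_rfl]
    · rw [hrepi r hr _ le_rfl]
      exact hxc r (HR_subset hr)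
  · intro r hr
    exact hrepi r (Finset.mem_of_mem_erase hr) _ (Nat.le_succ i)
  · intro r hr w hw
    have hr := Finset.mem_of_mem_erase hr
    have h1 : A.U r w ≠ 0 ∨ A.U M w ≠ 0 := by
      by_contra! hn
      refine hw ?_
      simp only [A', Decomp.deleteDeath]
      split_ifs <;> simp [hn.1, hn.2]
    rcases h1 with h1 | h1
    · obtain ⟨h2, h3⟩ := h.wire_mem r hr w h1
      exact ⟨by omega, h3⟩
    · obtain ⟨h2, h3⟩ := h.wire_mem M hM w h1
      exact ⟨by omega, h3⟩
  · intro r hr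
    have h1 : A'.x r ∈ boundaries (F.K (i + 1)) := mem_boundaries.2 ⟨_, hyc r hr, hyb r hr⟩
    rw [hxB r hr] at h1 ⊢
    exact (h.bd r hr).extend h1
  · intro r hr
    change IsHomogeneous (A.deg r + 1) _
    simp only [A', Decomp.deleteDeath]
    split_ifs with h1
    · refine (h.deg_y r hr).add ?_
      have h2 := h.card_of_y hr h1
      have h3 := h.card_of_x hMr hM1
      rw [show A.deg r + 1 = A.deg M by omega]
      exact h.deg_x hMr
    · exact h.deg_y r hr
  · intro r hr
    rw [hrows] at hr
    exact h.deg_φ r (Finset.mem_of_mem_erase hr)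
  · exact h.inj_H.mono (Finset.coe_subset.2 (Finset.erase_subset _ _))
  · exact h.inj_B

/-- If `x_M` were the boundary of a chain `c` without `s`, then `c + y_M` would be a cycle
containing `s`, but in this case no cycle contains `s`. -/
theorem deleteBirth_isBoundaryRep (h : A.Valid F i) (hi : i < F.m) (hd : F.dir i = false)
    (hx : ∀ r ∈ A.HR, A.x r (F.σ i) = 0) {M : ℕ} (hM : M ∈ A.BR) (hM1 : A.y M (F.σ i) = 1) :
    A.x M ∉ boundaries (F.K (i + 1)) ∧
    F.IsBoundaryRep (A.birth M) i (fun α => PartialBoundaryRep.toBoundary (F.K α) (A.x M)) := by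
  have hs := F.adds_of_bwd hi hd
  have hnb := h.not_bounds_of_delete hi hd hx
  have hn : A.x M ∉ boundaries (F.K (i + 1)) := by
    intro hb
    obtain ⟨c, hc, e⟩ := mem_boundaries.1 hb
    have h1 : c + A.y M ∈ cycles (F.K i) := mem_cycles.2
      ⟨add_mem (chains_mono hs.subset hc) (h.y_mem M hM), by
        rw [map_add, e, h.boundary_y M hM]
        exact add_self_eq_zero_of_module _⟩
    rw [hs.cycles_eq (fun hb => hnb ((bounds_of_bwd hd).2 hb))] at h1
    have h2 := hs.apply_eq_zero (mem_cycles.1 h1).1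
    rw [Finsupp.add_apply, hs.apply_eq_zero hc, hM1] at h2
    exact absurd h2 (by decide)
  exact ⟨hn, (h.bd M hM).isBoundaryRep ((boundaryDeath_iff hi).2 ⟨hd, hnb⟩) fun _ => hn⟩

/-- The chain `y_M` is added to the other `y_r` that contain `s` and is then dropped; accordingly
`x_M` is added to the matching `x_r`. The dual base change replaces `φ_M` by the sum of the
functionals of all these rows. The earliest birth makes the boundary bar of `M` addable to the
others. -/
theorem deleteBirth (h : A.Valid F i) (hi : i < F.m) (hd : F.dir i = false)
    (hx : ∀ r ∈ A.HR, A.x r (F.σ i) = 0) {M : ℕ} (hM : M ∈ A.BR) (hM1 : A.y M (F.σ i) = 1)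
    (hmin : ∀ r ∈ A.BR, A.y r (F.σ i) = 1 → A.birth M ≤ A.birth r) :
    (A.deleteBirth i (F.σ i) M).Valid F (i + 1) := by
  have hnot := (h.deleteBirth_isBoundaryRep hi hd hx hM hM1).1
  set s := F.σ i with hsdef
  have hs : Adds (F.K (i + 1)) (F.K i) s := F.adds_of_bwd hi hd
  have hnb := h.not_bounds_of_delete hi hd hx
  have hMr := BR_subset hM
  have hMH := h.notMem_HR hM
  set A' := A.deleteBirth i s M with hA'
  have hrows : A'.rows = A.rows := by
    ext r
    simp only [rows, A', Decomp.deleteBirth, Finset.mem_union, Finset.mem_erase, Finset.mem_insert]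
    by_cases hr : r = M
    · simp [hr, hM]
    · simp [hr]
  have hHR : ∀ r ∈ A.HR, r ≠ M := fun r hr e => hMH (e ▸ hr)
  have hxM : A'.x M = A.x M := if_neg fun hn => Finset.notMem_erase _ _ hn.1
  have hxH : ∀ r ∈ A.HR, A'.x r = A.x r := fun r hr =>
    if_neg fun hn => h.notMem_BR hr (Finset.mem_of_mem_erase hn.1)
  have hφM : A'.φ M = ∑ r ∈ A.BR.filter (fun r => A.y r s = 1), A.φ r := Function.update_self _ _ _
  have hφ : ∀ r, r ≠ M → A'.φ r = A.φ r := fun r hr => Function.update_of_ne hr _ _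
  have hB0 : A'.birth M = i + 1 := Function.update_self _ _ _
  have hB : ∀ r, r ≠ M → A'.birth r = A.birth r := fun r hr => Function.update_of_ne hr _ _
  have hU0 : A'.U M = Pi.single (i + 1) 1 := Function.update_self _ _ _
  have hU : ∀ r, r ≠ M → A'.U r = A.U r := fun r hr => Function.update_of_ne hr _ _
  have hxs : ∀ r ∈ A.rows, A.x r s = 0 := fun r hr => by
    rcases Finset.mem_union.1 hr with hr | hr
    · exact hx r hr
    · exact h.x_apply_BR hs hr
  have hxc0 : ∀ r ∈ A.rows, A.x r ∈ cycles (F.K (i + 1)) := fun r hr =>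
    mem_cycles.2 ⟨hs.mem_chains_of_apply (mem_cycles.1 (h.x_mem hr)).1 (hxs r hr),
      (mem_cycles.1 (h.x_mem hr)).2⟩
  have hxc : ∀ r ∈ A.rows, A'.x r ∈ cycles (F.K (i + 1)) := by
    intro r hr
    simp only [A', Decomp.deleteBirth]
    split_ifs
    · exact add_mem (hxc0 r hr) (hxc0 M hMr)
    · exact hxc0 r hr
  have hyc : ∀ r ∈ A.BR, A'.y r ∈ chains (F.K (i + 1)) := by
    intro r hr
    refine hs.mem_chains_of_apply ?_ ?_ <;> simp only [A', Decomp.deleteBirth] <;>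
      split_ifs with h1
    · exact add_mem (h.y_mem r hr) (h.y_mem M hM)
    · exact h.y_mem r hr
    · rw [Finsupp.add_apply, h1, hM1]
      rfl
    · exact (zmod_two_cases _).resolve_right h1
  have hyb : ∀ r ∈ A.BR.erase M, boundary (A'.y r) = A'.x r := by
    intro r hr
    have hrB := Finset.mem_of_mem_erase hr
    simp only [A', Decomp.deleteBirth]
    by_cases h1 : A.y r s = 1
    · rw [if_pos h1, if_pos ⟨hr, h1⟩, map_add, h.boundary_y r hrB, h.boundary_y M hM]
    · rw [if_neg h1, if_neg fun hn => h1 hn.2, h.boundary_y r hrB]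
  have hrep0 : ∀ α, A'.rep M α = if i + 1 ≤ α then A.x M else 0 := fun α => by
    rw [rep, hU0]
    exact bundleChain_single _ _ _ _
  have hrep : ∀ r ∈ A.HR, A'.rep r = A.rep r := fun r hr => by
    funext α
    rw [rep, hU r (hHR r hr)]
    refine bundleChain_update ?_ _ _
    by_contra hne
    have := (h.wire_mem r hr _ hne).1
    omega
  have hdeg : ∀ r ∈ A.BR, A.y r s = 1 → A.deg r = A.deg M := fun r hr hr1 => by
    have h1 := h.card_of_y hr hr1
    have h2 := h.card_of_y hM hM1
    omega
  have hpx : ∀ r ∈ A.rows, ∀ k ∈ A.rows, pair (A.φ r) (A'.x k) =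
      (if r = k then 1 else 0) + if r = M ∧ k ∈ A.BR.erase M ∧ A.y k s = 1 then 1 else 0 := by
    intro r hr k hk
    simp only [A', Decomp.deleteBirth]
    by_cases h1 : k ∈ A.BR.erase M ∧ A.y k s = 1
    · rw [if_pos h1, map_add, h.pair_x r hr k hk, h.pair_x r hr M hMr]
      simp [h1]
    · rw [if_neg h1, h.pair_x r hr k hk, if_neg (c := r = M ∧ _) (fun hn => h1 hn.2), add_zero]
  have hpy : ∀ r ∈ A.rows, ∀ k ∈ A.BR, pair (A.φ r) (A'.y k) = 0 := by
    intro r hr k hk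
    simp only [A', Decomp.deleteBirth]
    split_ifs
    · rw [map_add, h.pair_y r hr k hk, h.pair_y r hr M hM, add_zero]
    · exact h.pair_y r hr k hk
  have hT : ∀ t ∈ A.BR.filter (fun r => A.y r s = 1), t ∈ A.rows := fun t ht =>
    BR_subset (Finset.mem_filter.1 ht).1
  refine ⟨?_, ?_, ?_, ?_, ?_, ?_, ?_, ?_, ?_, ?_, ?_, ?_, ?_, ?_, ?_, ?_⟩
  · refine Finset.disjoint_insert_left.2 ⟨Finset.notMem_erase _ _, ?_⟩
    exact h.disj.mono_right (Finset.erase_subset _ _)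
  · have h0 := h.card
    rw [ncard_of_adds hs (F.finite_faces hi)] at h0
    have h1 : A'.BR.card + 1 = A.BR.card := Finset.card_erase_add_one hM
    have h2 : A'.HR.card = A.HR.card + 1 := Finset.card_insert_of_notMem hMH
    omega
  · rw [hrows]
    exact h.lt_n
  · exact fun r hr => hyc r (Finset.mem_of_mem_erase hr)
  · exact hyb
  · intro r hr k hk
    rw [hrows] at hr hk
    by_cases hrM : r = M
    · subst hrM
      rw [hφM, pair_sum, Finset.sum_congr rfl (fun t ht => hpx t (hT t ht) k hk),
        Finset.sum_add_distrib, Finset.sum_ite_eq']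
      simp only [Finset.mem_filter, Finset.mem_erase]
      by_cases hkr : k = r
      · subst hkr
        simp [hM, hM1]
      · by_cases hk1 : k ∈ A.BR ∧ A.y k s = 1
        -- Two terms of the sum are one on `x_k + x_M`, those of the rows `k` and `M`; they cancel.
        · rw [if_pos hk1, if_neg (Ne.symm hkr), Finset.sum_congr rfl
            (g := fun t => if t = r then (1 : ZMod 2) else 0) fun t _ => by simp [hkr, hk1],
            Finset.sum_ite_eq', if_pos (Finset.mem_filter.2 ⟨hM, hM1⟩)]
          decide
        · rw [if_neg hk1, if_neg (Ne.symm hkr), zero_add]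
          refine Finset.sum_eq_zero fun t _ => if_neg fun hn => hk1 ⟨hn.2.1.2, hn.2.2⟩
    · rw [hφ r hrM, hpx r hr k hk, if_neg (c := _ ∧ _) (fun hn => hrM hn.1), add_zero]
  · intro r hr k hk
    rw [hrows] at hr
    have hkB : k ∈ A.BR := Finset.mem_of_mem_erase hk
    by_cases hrM : r = M
    · subst hrM
      rw [hφM, pair_sum]
      exact Finset.sum_eq_zero fun t ht => hpy t (hT t ht) k hkB
    · rw [hφ r hrM, hpy r hr k hkB]
  · have hym : A.y M ∈ A'.spn ⊔ Submodule.span (ZMod 2) {A.y M} :=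
      Submodule.mem_sup_right (Submodule.mem_span_singleton_self _)
    have hxm : A.x M ∈ A'.spn := hxM ▸ x_mem_spn (by rwa [hrows])
    refine chains_le_of_le_sup hs (h.span.trans (spn_le (fun r hr => ?_) fun r hr => ?_))
      (spn_le (fun r hr => ?_) fun r hr => hyc r (Finset.mem_of_mem_erase hr)) hM1
    · refine Submodule.mem_sup_left ?_
      have h1 : A'.x r ∈ A'.spn := x_mem_spn (by rwa [hrows])
      simp only [A', Decomp.deleteBirth] at h1
      split_ifs at h1
      · exact (Submodule.add_mem_iff_left _ hxm).1 h1
      · exact h1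
    · by_cases hrM : r = M
      · rw [hrM]
        exact hym
      · have h1 : A'.y r ∈ A'.spn ⊔ Submodule.span (ZMod 2) {A.y M} :=
          Submodule.mem_sup_left (y_mem_spn (Finset.mem_erase.2 ⟨hrM, hr⟩))
        simp only [A', Decomp.deleteBirth] at h1
        split_ifs at h1
        · exact (Submodule.add_mem_iff_left _ hym).1 h1
        · exact h1
    · rw [hrows] at hr
      exact (mem_cycles.1 (hxc r hr)).1
  · intro r hr
    rcases Finset.mem_insert.1 hr with rfl | hr
    · rw [hB0, show A'.rep r = _ from funext hrep0]
      exact PartialRep.of_birth ((homologyBirth_iff hi).2 (by simp [hd, hnb])) (hxc0 r hMr)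
        (h.deg_x hMr) (fun h' => by simp [hd] at h')
        (fun _ => ⟨hnot, (h.bd r hM).mem i (h.bd r hM).le le_rfl⟩)
    · rw [hB r (hHR r hr), hrep r hr]
      refine (h.hom r hr).extend ?_ ?_
      · rw [h.rep_eq hr (Nat.le_succ i), h.rep_self r hr]
      · rw [h.rep_self r hr]
        exact hxc0 r (HR_subset hr)
  · intro r hr
    rcases Finset.mem_insert.1 hr with rfl | hr
    · rw [hrep0, if_pos le_rfl, hxM]
    · rw [hrep r hr, hxH r hr]
      exact h.rep_eq hr (Nat.le_succ i)
  · intro r hr w hw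
    rcases Finset.mem_insert.1 hr with rfl | hr
    · rw [hU0] at hw
      obtain rfl : w = i + 1 := by
        by_contra hne
        exact hw (by rw [Pi.single_apply, if_neg hne])
      refine ⟨le_rfl, ?_⟩
      rw [show A'.wire (i + 1) = A.x r from Function.update_self _ _ _]
      exact (mem_cycles.1 (hxc0 r hMr)).1
    · rw [hU r (hHR r hr)] at hw
      obtain ⟨h1, h2⟩ := h.wire_mem r hr w hw
      refine ⟨by omega, ?_⟩
      rw [show A'.wire w = A.wire w from Function.update_of_ne (by omega) _ _]
      exact h2
  · intro r hr
    have h1 : A'.x r ∈ boundaries (F.K (i + 1)) :=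
      mem_boundaries.2 ⟨_, hyc r (Finset.mem_of_mem_erase hr), hyb r hr⟩
    obtain ⟨hrM, hrB⟩ := Finset.mem_erase.1 hr
    rw [hB r hrM]
    refine PartialBoundaryRep.extend ?_ h1
    simp only [A', Decomp.deleteBirth]
    split_ifs with hr1
    · refine (h.bd r hrB).add (b' := A.birth M) ?_
        (lt_of_le_of_ne (hmin r hrB hr1.2) fun e => hrM (h.inj_B hM hrB e).symm)
      rw [hdeg r hrB hr1.2]
      exact h.bd M hM
    · exact h.bd r hrB
  · intro r hr
    have hrB := Finset.mem_of_mem_erase hr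
    change IsHomogeneous (A.deg r + 1) _
    simp only [A', Decomp.deleteBirth]
    split_ifs with h1
    · refine (h.deg_y r hrB).add ?_
      rw [hdeg r hrB h1]
      exact h.deg_y M hM
    · exact h.deg_y r hrB
  · intro r hr t ht
    rw [hrows] at hr
    by_cases hrM : r = M
    · subst hrM
      rw [hφM, Finset.sum_apply] at ht
      obtain ⟨k, hk, hne⟩ := Finset.exists_ne_zero_of_sum_ne_zero ht
      obtain ⟨h1, h2⟩ := Finset.mem_filter.1 hk
      rw [h.deg_φ k (BR_subset h1) t hne, hdeg k h1 h2]
      rfl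
    · rw [hφ r hrM] at ht
      exact h.deg_φ r hr t ht
  · intro r hr k hk e
    replace hr : r ∈ insert M A.HR := hr
    replace hk : k ∈ insert M A.HR := hk
    rcases Finset.mem_insert.1 hr with rfl | hr' <;> rcases Finset.mem_insert.1 hk with rfl | hk'
    · rfl
    · rw [hB0, hB k (hHR k hk')] at e
      have := h.birth_le (HR_subset hk')
      omega
    · rw [hB0, hB r (hHR r hr')] at e
      have := h.birth_le (HR_subset hr')
      omega
    · rw [hB r (hHR r hr'), hB k (hHR k hk')] at e
      exact h.inj_H hr' hk' e
  · intro r hr k hk e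
    obtain ⟨hrM, hr⟩ := Finset.mem_erase.1 hr
    obtain ⟨hkM, hk⟩ := Finset.mem_erase.1 hk
    rw [hB r hrM, hB k hkM] at e
    exact h.inj_B hr hk e

end Deletion
end Valid
end Decomp

/-! ## Rules for loops -/

namespace Ex

instance : Add Ex := ⟨Ex.add⟩
instance : Sub Ex := ⟨Ex.sub⟩
instance : Mul Ex := ⟨Ex.mul⟩

/-- The indicator of `a = b`. -/
def eqb (a b : Ex) : Ex := lit 1 - ((a - b) + (b - a))

/-- The indicator of `a ≠ b`. -/
def neb (a b : Ex) : Ex := lit 1 - eqb a b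

variable {S : ℕ} {ρ : List ℕ} {μ : ℕ → ℕ → ℕ}

@[simp] theorem eval_var (i : ℕ) : (var i).eval ρ μ = ρ.getD i 0 := rfl
@[simp] theorem eval_load (A : ℕ) (a : Ex) : (load A a).eval ρ μ = μ A (a.eval ρ μ) := rfl
@[simp] theorem eval_add (a b : Ex) : (a + b).eval ρ μ = a.eval ρ μ + b.eval ρ μ := rfl
@[simp] theorem eval_sub (a b : Ex) : (a - b).eval ρ μ = a.eval ρ μ - b.eval ρ μ := rfl
@[simp] theorem eval_mul (a b : Ex) : (a * b).eval ρ μ = a.eval ρ μ * b.eval ρ μ := rfl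
@[simp] theorem eval_lit (n : ℕ) : (lit n).eval ρ μ = n := rfl

@[simp] theorem eval_eqb (a b : Ex) :
    (eqb a b).eval ρ μ = if a.eval ρ μ = b.eval ρ μ then 1 else 0 := by
  simp only [eqb, eval_sub, eval_add, eval_lit]
  split_ifs <;> omega

@[simp] theorem eval_neb (a b : Ex) :
    (neb a b).eval ρ μ = if a.eval ρ μ = b.eval ρ μ then 0 else 1 := by
  simp only [neb, eval_sub, eval_eqb, eval_lit]
  split_ifs <;> rfl

@[simp] theorem ok_var (i : ℕ) : (var i).Ok S ρ μ ↔ i < ρ.length := Iff.rfl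
@[simp] theorem ok_load (A : ℕ) (a : Ex) :
    (load A a).Ok S ρ μ ↔ a.Ok S ρ μ ∧ a.eval ρ μ < S := Iff.rfl
@[simp] theorem ok_add (a b : Ex) : (a + b).Ok S ρ μ ↔ a.Ok S ρ μ ∧ b.Ok S ρ μ := Iff.rfl
@[simp] theorem ok_sub (a b : Ex) : (a - b).Ok S ρ μ ↔ a.Ok S ρ μ ∧ b.Ok S ρ μ := Iff.rfl
@[simp] theorem ok_mul (a b : Ex) : (a * b).Ok S ρ μ ↔ a.Ok S ρ μ ∧ b.Ok S ρ μ := Iff.rfl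
@[simp] theorem ok_lit (n : ℕ) : (lit n).Ok S ρ μ := trivial

@[simp] theorem ok_eqb (a b : Ex) : (eqb a b).Ok S ρ μ ↔ a.Ok S ρ μ ∧ b.Ok S ρ μ := by
  simp only [eqb, ok_sub, ok_add, ok_lit, true_and]
  tauto

@[simp] theorem ok_neb (a b : Ex) : (neb a b).Ok S ρ μ ↔ a.Ok S ρ μ ∧ b.Ok S ρ μ := by
  simp only [neb, ok_sub, ok_lit, ok_eqb, true_and]

end Ex

theorem upd_apply (μ : ℕ → ℕ → ℕ) (A : ℕ) (g : ℕ → ℕ) (B : ℕ) :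
    upd μ A g B = if B = A then g else μ B := by
  simp only [upd, Function.update_apply]

@[simp] theorem upd_self (μ : ℕ → ℕ → ℕ) (A : ℕ) (g : ℕ → ℕ) : upd μ A g A = g :=
  Function.update_self _ _ _

@[simp] theorem upd_upd (μ : ℕ → ℕ → ℕ) (A : ℕ) (g g' : ℕ → ℕ) :
    upd (upd μ A g) A g' = upd μ A g' :=
  Function.update_idem _ _ _

@[simp] theorem upd_eq (μ : ℕ → ℕ → ℕ) (A : ℕ) : upd μ A (μ A) = μ :=
  Function.update_eq_self _ _

/-- Addition modulo two of bits. -/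
theorem zmod_add_val (u v : ZMod 2) : (u + v).val = if u.val = v.val then 0 else 1 := by
  revert u v
  decide

theorem zmod_val_le (u : ZMod 2) : u.val ≤ 1 := Nat.lt_succ_iff.1 (ZMod.val_lt u)

theorem row_lt {R L r s : ℕ} (hr : r < R) (hs : s < L) : r * L + s < R * L :=
  calc r * L + s < r * L + L := by omega
    _ = (r + 1) * L := by ring
    _ ≤ R * L := Nat.mul_le_mul_right _ hr

/-- Addresses of a matrix stored row by row determine row and column, provided that the column is
below the row length. -/
theorem row_inj {L r s r' s' : ℕ} (hs : s < L) (hs' : s' < L) (h : r * L + s = r' * L + s') :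
    r = r' ∧ s = s' := by
  rcases lt_trichotomy r r' with hlt | rfl | hlt
  · have := row_lt hlt hs
    omega
  · exact ⟨rfl, by omega⟩
  · have := row_lt hlt hs'
    omega

namespace Cmd

variable {X : Limits} {tag A : ℕ} {N : Ex} {body : Cmd} {ρ : List ℕ} {μ : ℕ → ℕ → ℕ} {o : List ℕ}
  {Q : (ℕ → ℕ → ℕ) → List ℕ → Prop} {n : ℕ}

/-- The body sets one word after the other. -/
theorem wp_each (adr val : ℕ → ℕ) (hN : N.Ok X.S ρ μ) (hn : N.eval ρ μ = n) (hβ : n ≤ X.β tag)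
    (hinj : ∀ j k, j < k → k < n → adr j ≠ adr k)
    (hbody : ∀ k < n, ∀ g : ℕ → ℕ, (∀ j < k, g (adr j) = val j) →
      (∀ a, (∀ j < k, a ≠ adr j) → g a = μ A a) → body.wp X (ρ ++ [n, k]) (upd μ A g) o
        fun μ' o' => μ' = upd μ A (Function.update g (adr k) (val k)) ∧ o' = o)
    (hQ : ∀ g : ℕ → ℕ, (∀ j < n, g (adr j) = val j) →
      (∀ a, (∀ j < n, a ≠ adr j) → g a = μ A a) → Q (upd μ A g) o) :
    (loop tag N body).wp X ρ μ o Q := by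
  subst hn
  refine ⟨hN, hβ, fun k μ' o' => o' = o ∧ ∃ g : ℕ → ℕ, μ' = upd μ A g ∧
    (∀ j < k, g (adr j) = val j) ∧ ∀ a, (∀ j < k, a ≠ adr j) → g a = μ A a,
    ⟨rfl, μ A, (upd_eq _ _).symm, fun _ h => absurd h (Nat.not_lt_zero _), fun _ _ => rfl⟩, ?_, ?_⟩
  · rintro k hk μ' o' ⟨rfl, g, rfl, h1, h2⟩
    refine wp_mono _ (hbody k hk g h1 h2) ?_
    rintro μ'' o'' ⟨rfl, rfl⟩
    refine ⟨rfl, _, rfl, fun j hj => ?_, fun a ha => ?_⟩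
    · rcases Nat.lt_succ_iff_lt_or_eq.1 hj with hj | rfl
      · rw [Function.update_of_ne (hinj j k hj hk), h1 j hj]
      · rw [Function.update_self]
    · rw [Function.update_of_ne (ha k (Nat.lt_succ_self k)), h2 a fun j hj => ha j (by omega)]
  · rintro μ' o' ⟨rfl, g, rfl, h1, h2⟩
    exact hQ g h1 h2

/-- A loop of stores. -/
theorem wp_fill {ad e : Ex} (adr val : ℕ → ℕ) (hN : N.Ok X.S ρ μ) (hn : N.eval ρ μ = n)
    (hβ : n ≤ X.β tag) (hinj : ∀ j k, j < k → k < n → adr j ≠ adr k)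
    -- While the loop runs, a word of the range holds its old or its new value, and only the word
    -- about to be written is known to be old. This is enough for loops that update a matrix in
    -- place while reading another row of it.
    (hbody : ∀ k < n, ∀ g : ℕ → ℕ, (∀ j < n, g (adr j) = μ A (adr j) ∨ g (adr j) = val j) →
      g (adr k) = μ A (adr k) → (∀ a, (∀ j < n, a ≠ adr j) → g a = μ A a) →
      (ad.Ok X.S (ρ ++ [n, k]) (upd μ A g) ∧ ad.eval (ρ ++ [n, k]) (upd μ A g) = adr k ∧
        adr k < X.S) ∧ e.Ok X.S (ρ ++ [n, k]) (upd μ A g) ∧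
        e.eval (ρ ++ [n, k]) (upd μ A g) = val k ∧ val k ≤ X.B)
    (hQ : ∀ g : ℕ → ℕ, (∀ j < n, g (adr j) = val j) →
      (∀ a, (∀ j < n, a ≠ adr j) → g a = μ A a) → Q (upd μ A g) o) :
    (loop tag N (store A ad e)).wp X ρ μ o Q := by
  refine wp_each adr val hN hn hβ hinj (fun k hk g h1 h2 => ?_) hQ
  have h3 : ∀ j < n, k ≤ j → g (adr j) = μ A (adr j) := fun j hj hkj =>
    h2 _ fun l hl e => hinj l j (by omega) hj e.symm
  obtain ⟨⟨a1, a2, a3⟩, b1, b2, b3⟩ := hbody k hk g (fun j hj => by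
    rcases lt_or_ge j k with h | h
    · exact Or.inr (h1 j h)
    · exact Or.inl (h3 j hj h)) (h3 k hk le_rfl) fun a ha => h2 a fun j hj => ha j (by omega)
  exact ⟨a1, b1, a2 ▸ a3, b2 ▸ b3, by rw [a2, b2, upd_upd, upd_self], rfl⟩

/-- A double loop of stores. -/
theorem wp_fill2 {tag' : ℕ} {N' ad e : Ex} {n' : ℕ} (adr val : ℕ → ℕ → ℕ) (hN : N.Ok X.S ρ μ)
    (hn : N.eval ρ μ = n) (hβ : n ≤ X.β tag)
    (hN' : ∀ k < n, ∀ g : ℕ → ℕ, N'.Ok X.S (ρ ++ [n, k]) (upd μ A g) ∧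
      N'.eval (ρ ++ [n, k]) (upd μ A g) = n') (hβ' : n' ≤ X.β tag')
    (hinj : ∀ j k j' k', j < n → k < n' → j' < n → k' < n' → adr j k = adr j' k' → j = j' ∧ k = k')
    (hbody : ∀ j < n, ∀ k < n', ∀ g : ℕ → ℕ,
      (∀ j' < n, ∀ k' < n', g (adr j' k') = μ A (adr j' k') ∨ g (adr j' k') = val j' k') →
      g (adr j k) = μ A (adr j k) →
      (ad.Ok X.S (ρ ++ [n, j] ++ [n', k]) (upd μ A g) ∧
        ad.eval (ρ ++ [n, j] ++ [n', k]) (upd μ A g) = adr j k ∧ adr j k < X.S) ∧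
        e.Ok X.S (ρ ++ [n, j] ++ [n', k]) (upd μ A g) ∧
        e.eval (ρ ++ [n, j] ++ [n', k]) (upd μ A g) = val j k ∧ val j k ≤ X.B)
    (hQ : ∀ g : ℕ → ℕ, (∀ j < n, ∀ k < n', g (adr j k) = val j k) →
      (∀ a, (∀ j < n, ∀ k < n', a ≠ adr j k) → g a = μ A a) → Q (upd μ A g) o) :
    (loop tag N (loop tag' N' (store A ad e))).wp X ρ μ o Q := by
  subst hn
  refine ⟨hN, hβ, fun j μ' o' => o' = o ∧ ∃ g : ℕ → ℕ, μ' = upd μ A g ∧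
    (∀ j' < j, ∀ k < n', g (adr j' k) = val j' k) ∧
      ∀ a, (∀ j' < j, ∀ k < n', a ≠ adr j' k) → g a = μ A a,
    ⟨rfl, μ A, (upd_eq _ _).symm, fun _ h => absurd h (Nat.not_lt_zero _), fun _ _ => rfl⟩, ?_, ?_⟩
  · rintro j hj μ' o' ⟨rfl, g, rfl, h1, h2⟩
    have h3 : ∀ j' < N.eval ρ μ, ∀ k' < n', j ≤ j' → g (adr j' k') = μ A (adr j' k') :=
      fun j' hj' k' hk' hjj => h2 _ fun l hl k hk e => by
        have := (hinj l k j' k' (by omega) hk hj' hk' e.symm).1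
        omega
    refine wp_fill (adr j) (val j) (hN' j hj g).1 (hN' j hj g).2 hβ'
      (fun a b hab hb e => by have := (hinj j a j b hj (by omega) hj hb e).2; omega)
      (fun k hk g' ho hk' ho' => ?_) fun g' h1' h2' => ?_
    · rw [upd_self] at ho hk' ho'
      rw [upd_upd]
      refine hbody j hj k hk g' (fun j' hj' l hl => ?_) (hk'.trans (h3 j hj k hk le_rfl))
      by_cases hjj : j' = j
      · subst hjj
        rw [← h3 j' hj l hl le_rfl]
        exact ho l hl
      · rw [ho' _ fun l' hl' e => hjj (hinj j' l j l' hj' hl hj hl' e).1]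
        rcases lt_or_ge j' j with hlt | hge
        · exact Or.inr (h1 j' hlt l hl)
        · exact Or.inl (h3 j' hj' l hl hge)
    · rw [upd_self] at h2'
      refine ⟨rfl, g', by rw [upd_upd], fun j' hj' k hk => ?_, fun a ha => ?_⟩
      · rcases Nat.lt_succ_iff_lt_or_eq.1 hj' with hj' | rfl
        · rw [h2' _ fun k' hk' e => ?_, h1 j' hj' k hk]
          have := (hinj j' k j k' (by omega) hk hj hk' e).1
          omega
        · exact h1' k hk
      · rw [h2' a fun k hk => ha j (Nat.lt_succ_self j) k hk,
          h2 a fun j' hj' k hk => ha j' (by omega) k hk]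
  · rintro μ' o' ⟨rfl, g, rfl, h1, h2⟩
    exact hQ g h1 h2

/-- The body updates one word. -/
theorem wp_iterate (adr : ℕ) (v : ℕ → ℕ) (hN : N.Ok X.S ρ μ) (hn : N.eval ρ μ = n)
    (hβ : n ≤ X.β tag) (hv : v 0 = μ A adr)
    (hbody : ∀ k < n, body.wp X (ρ ++ [n, k]) (upd μ A (Function.update (μ A) adr (v k))) o
      fun μ' o' => μ' = upd μ A (Function.update (μ A) adr (v (k + 1))) ∧ o' = o)
    (hQ : Q (upd μ A (Function.update (μ A) adr (v n))) o) :
    (loop tag N body).wp X ρ μ o Q := by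
  subst hn
  refine ⟨hN, hβ, fun k μ' o' => μ' = upd μ A (Function.update (μ A) adr (v k)) ∧ o' = o,
    ⟨by rw [hv, Function.update_eq_self, upd_eq], rfl⟩, ?_, ?_⟩
  · rintro k hk μ' o' ⟨rfl, rfl⟩
    exact hbody k hk
  · rintro μ' o' ⟨rfl, rfl⟩
    exact hQ

/-- Sums modulo two, one for each word. -/
def sumBits (tag : ℕ) (N : Ex) (tag' : ℕ) (K : Ex) (A : ℕ) (ad e : Ex) : Cmd :=
  loop tag N (seq (store A ad (.lit 0)) (loop tag' K (store A ad (Ex.neb (.load A ad) e))))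

/-- On bits, the test for inequality is addition modulo two; the word holds the partial sum. -/
theorem wp_sumBits {tag' : ℕ} {K ad e : Ex} {n' : ℕ} (adr : ℕ → ℕ) (t : ℕ → ℕ → ZMod 2)
    (hN : N.Ok X.S ρ μ) (hn : N.eval ρ μ = n) (hβ : n ≤ X.β tag)
    (hK : ∀ k < n, ∀ g : ℕ → ℕ, K.Ok X.S (ρ ++ [n, k]) (upd μ A g) ∧
      K.eval (ρ ++ [n, k]) (upd μ A g) = n') (hβ' : n' ≤ X.β tag') (hB : 1 ≤ X.B)
    (hinj : ∀ j k, j < k → k < n → adr j ≠ adr k)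
    (had : ∀ j < n, ∀ l g, ad.Ok X.S (ρ ++ [n, j] ++ l) (upd μ A g) ∧
      ad.eval (ρ ++ [n, j] ++ l) (upd μ A g) = adr j ∧ adr j < X.S)
    (he : ∀ j < n, ∀ k < n', ∀ g, e.Ok X.S (ρ ++ [n, j] ++ [n', k]) (upd μ A g) ∧
      e.eval (ρ ++ [n, j] ++ [n', k]) (upd μ A g) = (t j k).val)
    (hQ : ∀ g : ℕ → ℕ, (∀ j < n, g (adr j) = (∑ k ∈ Finset.range n', t j k).val) →
      (∀ a, (∀ j < n, a ≠ adr j) → g a = μ A a) → Q (upd μ A g) o) :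
    (sumBits tag N tag' K A ad e).wp X ρ μ o Q := by
  refine wp_each adr _ hN hn hβ hinj (fun j hj g _ _ => ?_) hQ
  obtain ⟨a1, a2, a3⟩ := had j hj [] g
  rw [List.append_nil] at a1 a2
  refine ⟨a1, Ex.ok_lit 0, a2 ▸ a3, Nat.zero_le _, ?_⟩
  rw [a2, Ex.eval_lit, upd_upd, upd_self]
  refine wp_iterate (A := A) (adr j) (fun k => (∑ k ∈ Finset.range k, t j k).val) (hK j hj _).1 (hK j hj _).2
    hβ' (by rw [upd_self, Function.update_self]; rfl) (fun k hk => ?_) ?_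
  · rw [upd_upd, upd_self, Function.update_idem]
    obtain ⟨b1, b2, b3⟩ := had j hj [n', k]
      (Function.update g (adr j) ((∑ k ∈ Finset.range k, t j k).val))
    obtain ⟨e1, e2⟩ := he j hj k hk (Function.update g (adr j) ((∑ k ∈ Finset.range k, t j k).val))
    have e3 : ∀ a, (Ex.neb (.load A ad) e).eval (ρ ++ [n, j] ++ [n', k])
        (upd μ A (Function.update g (adr j) ((∑ k ∈ Finset.range k, t j k).val))) = a ↔
        (∑ k ∈ Finset.range (k + 1), t j k).val = a := fun a => by
      rw [Ex.eval_neb, Ex.eval_load, b2, e2, upd_self, Function.update_self, Finset.sum_range_succ,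
        zmod_add_val]
    refine ⟨b1, ?_, b2.trans_lt b3, ?_, ?_, rfl⟩
    · simp only [Ex.ok_neb, Ex.ok_load]
      exact ⟨⟨b1, b2.trans_lt b3⟩, e1⟩
    · rw [(e3 _).2 rfl]
      exact (zmod_val_le _).trans hB
    · rw [(e3 _).2 rfl, b2, upd_upd, upd_self, Function.update_idem, upd_upd, Function.update_idem]
  · rw [upd_upd, upd_self, Function.update_idem]
    exact ⟨rfl, rfl⟩

/-- Find the index with the largest score: the score is stored in the array `A`, and the index in
the array `A'`. -/
def argmax (tag : ℕ) (N : Ex) (A A' : ℕ) (k e : Ex) : Cmd :=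
  seq (store A (.lit 0) (.lit 0)) (seq (store A' (.lit 0) (.lit 0))
    (loop tag N (ite (.load A (.lit 0)) e (seq (store A' (.lit 0) k) (store A (.lit 0) e)) skip)))

/-- The search starts from score zero and compares strictly, so a final score of zero says that no
index qualifies. Candidates are given positive scores and all others score zero. -/
theorem wp_argmax {A' : ℕ} {k e : Ex} (sc : ℕ → ℕ) (hA : A ≠ A') (hS : 0 < X.S) (hβB : n ≤ X.B)
    (hN : ∀ g g', N.Ok X.S ρ (upd (upd μ A g) A' g') ∧ N.eval ρ (upd (upd μ A g) A' g') = n)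
    (hβ : n ≤ X.β tag) (hk : k = .var (ρ.length + 1))
    (he : ∀ j < n, ∀ g g', e.Ok X.S (ρ ++ [n, j]) (upd (upd μ A g) A' g') ∧
      e.eval (ρ ++ [n, j]) (upd (upd μ A g) A' g') = sc j ∧ sc j ≤ X.B)
    (hQ : ∀ g g' : ℕ → ℕ, (g 0 = 0 ∧ ∀ j < n, sc j = 0) ∨
      (0 < g 0 ∧ g' 0 < n ∧ sc (g' 0) = g 0 ∧ ∀ j < n, sc j ≤ g 0) →
      Q (upd (upd μ A g) A' g') o) : (argmax tag N A A' k e).wp X ρ μ o Q := by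
  subst hk
  refine ⟨Ex.ok_lit 0, Ex.ok_lit 0, hS, Nat.zero_le _, Ex.ok_lit 0, Ex.ok_lit 0, hS,
    Nat.zero_le _, ?_⟩
  simp only [Ex.eval_lit]
  rw [upd_apply _ A _ A', if_neg hA.symm]
  refine ⟨(hN _ _).1, (hN _ _).2 ▸ hβ, fun j μ' o' => o' = o ∧ ∃ g g' : ℕ → ℕ,
    μ' = upd (upd μ A g) A' g' ∧ ((g 0 = 0 ∧ ∀ i < j, sc i = 0) ∨
      (0 < g 0 ∧ g' 0 < n ∧ sc (g' 0) = g 0 ∧ ∀ i < j, sc i ≤ g 0)),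
    ⟨rfl, _, _, rfl, Or.inl ⟨Function.update_self _ _ _, fun _ h => absurd h (Nat.not_lt_zero _)⟩⟩,
    ?_, ?_⟩
  · rw [(hN _ _).2]
    rintro j hj μ' o' ⟨rfl, g, g', rfl, h⟩
    have hAA : upd (upd μ A g) A' g' A = g := by rw [upd_apply, if_neg hA, upd_self]
    have hlen : (ρ ++ [n, j]).getD (ρ.length + 1) 0 = j := by simp
    obtain ⟨e1, e2, e3⟩ := he j hj g g'
    refine ⟨⟨Ex.ok_lit 0, hS⟩, e1, fun hlt => ?_, fun hlt => ?_⟩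
    · rw [Ex.eval_load, hAA, Ex.eval_lit, e2] at hlt
      obtain ⟨e4, e5, -⟩ := he j hj g (Function.update g' 0 j)
      have hu : upd (upd (upd μ A g) A' g') A' (Function.update (upd (upd μ A g) A' g' A') 0 j) =
        upd (upd μ A g) A' (Function.update g' 0 j) := by rw [upd_upd, upd_self]
      refine ⟨Ex.ok_lit 0, by simp, hS, by rw [Ex.eval_var, hlen]; omega, ?_⟩
      rw [Ex.eval_var, hlen, Ex.eval_lit, hu]
      refine ⟨Ex.ok_lit 0, e4, hS, e5 ▸ e3, rfl, Function.update g 0 (sc j),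
        Function.update g' 0 j, ?_, Or.inr ?_⟩
      -- The two stores go to different arrays and commute, which brings the memory back to the
      -- normal form of the invariant.
      · rw [e5, Ex.eval_lit, upd_apply _ A' _ A, if_neg hA, upd_self]
        unfold upd
        rw [Function.update_comm hA.symm, Function.update_idem]
      · simp only [Function.update_self]
        refine ⟨by omega, hj, trivial, fun i hi => ?_⟩
        rcases Nat.lt_succ_iff_lt_or_eq.1 hi with hi | rfl
        · rcases h with ⟨-, h⟩ | ⟨-, -, -, h⟩
          · rw [h i hi]
            exact Nat.zero_le _
          · exact (h i hi).trans hlt.le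
        · exact le_rfl
    · rw [Ex.eval_load, hAA, Ex.eval_lit, e2] at hlt
      refine ⟨rfl, g, g', rfl, ?_⟩
      rcases h with ⟨h1, h⟩ | ⟨h1, h2, h3, h⟩
      · refine Or.inl ⟨h1, fun i hi => ?_⟩
        rcases Nat.lt_succ_iff_lt_or_eq.1 hi with hi | rfl
        · exact h i hi
        · omega
      · refine Or.inr ⟨h1, h2, h3, fun i hi => ?_⟩
        rcases Nat.lt_succ_iff_lt_or_eq.1 hi with hi | rfl
        · exact h i hi
        · omega
  · rw [(hN _ _).2]
    rintro μ' o' ⟨rfl, g, g', rfl, h⟩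
    exact hQ g g' h

/-- A sum, computed in the word `0` of the array `A`. -/
def count (tag : ℕ) (N : Ex) (A : ℕ) (e : Ex) : Cmd :=
  seq (store A (.lit 0) (.lit 0)) (loop tag N (store A (.lit 0) (.load A (.lit 0) + e)))

theorem wp_count {e : Ex} (t : ℕ → ℕ) (hS : 0 < X.S)
    (hN : ∀ g, N.Ok X.S ρ (upd μ A g) ∧ N.eval ρ (upd μ A g) = n) (hβ : n ≤ X.β tag)
    (he : ∀ j < n, ∀ g, e.Ok X.S (ρ ++ [n, j]) (upd μ A g) ∧
      e.eval (ρ ++ [n, j]) (upd μ A g) = t j)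
    (hB : ∀ j < n, ∑ k ∈ Finset.range (j + 1), t k ≤ X.B)
    (hQ : ∀ g : ℕ → ℕ, g 0 = ∑ k ∈ Finset.range n, t k → Q (upd μ A g) o) :
    (count tag N A e).wp X ρ μ o Q := by
  refine ⟨Ex.ok_lit 0, Ex.ok_lit 0, hS, Nat.zero_le _, ?_⟩
  refine wp_iterate (A := A) 0 (fun k => ∑ k ∈ Finset.range k, t k) (hN _).1 (hN _).2 hβ (by simp)
    (fun k hk => ?_) ?_
  · rw [upd_upd, upd_self]
    obtain ⟨e1, e2⟩ := he k hk (Function.update (Function.update (μ A) 0 0) 0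
      (∑ k ∈ Finset.range k, t k))
    have e3 : (Ex.load A (.lit 0) + e).eval (ρ ++ [n, k]) (upd μ A (Function.update
        (Function.update (μ A) 0 0) 0 (∑ k ∈ Finset.range k, t k))) =
        ∑ k ∈ Finset.range (k + 1), t k := by
      simp only [Ex.eval_add, e2, Ex.eval_load, Ex.eval_lit, upd_self, Function.update_self,
        Finset.sum_range_succ]
    refine ⟨Ex.ok_lit 0, ⟨⟨Ex.ok_lit 0, hS⟩, e1⟩, hS, ?_, ?_, rfl⟩
    · exact e3.trans_le (hB k hk)
    · simp only [Ex.eval_lit] at e3 ⊢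
      rw [e3, upd_upd, upd_self, Function.update_idem, upd_upd]
  · rw [upd_upd, upd_self]
    exact hQ _ (Function.update_self _ _ _)

theorem wp_emits {t e : Ex} (p val : ℕ → ℕ) (hN : N.Ok X.S ρ μ) (hn : N.eval ρ μ = n)
    (hβ : n ≤ X.β tag)
    (hbody : ∀ j < n, (t.Ok X.S (ρ ++ [n, j]) μ ∧ t.eval (ρ ++ [n, j]) μ = p j) ∧
      e.Ok X.S (ρ ++ [n, j]) μ ∧ e.eval (ρ ++ [n, j]) μ = val j)
    (hQ : Q μ (o ++ ((List.range n).filter fun j => 0 < p j).map val)) :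
    (loop tag N (ite (.lit 0) t (emit e) skip)).wp X ρ μ o Q := by
  subst hn
  refine ⟨hN, hβ, fun j μ' o' => μ' = μ ∧
    o' = o ++ ((List.range j).filter fun j => 0 < p j).map val, ⟨rfl, by simp⟩, ?_, ?_⟩
  · rintro j hj μ' o' ⟨rfl, rfl⟩
    obtain ⟨⟨a1, a2⟩, b1, b2⟩ := hbody j hj
    refine ⟨Ex.ok_lit 0, a1, fun hlt => ?_, fun hlt => ?_⟩ <;> rw [Ex.eval_lit, a2] at hlt
    · exact ⟨b1, rfl, by simp [List.range_succ, List.filter_append, hlt, b2]⟩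
    · exact ⟨rfl, by simp [List.range_succ, List.filter_append, hlt]⟩
  · rintro μ' o' ⟨rfl, rfl⟩
    exact hQ

end Cmd

namespace Cmd

/-! ## Operations on rows -/

/-- Run the commands one after the other. -/
def block : List Cmd → Cmd
  | [] => skip
  | c :: l => seq c (block l)

section Block

variable {X : Limits} {A : ℕ} {ρ : List ℕ} {μ : ℕ → ℕ → ℕ} {o : List ℕ}
  {Q : (ℕ → ℕ → ℕ) → List ℕ → Prop}

theorem wp_block_cons {c : Cmd} {l : List Cmd}
    (h : c.wp X ρ μ o fun μ' o' => (block l).wp X ρ μ' o' Q) : (block (c :: l)).wp X ρ μ o Q := h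

theorem wp_block_nil (h : Q μ o) : (block []).wp X ρ μ o Q := h

theorem wp_call {args : List Ex} {c : Cmd} (ρ' : List ℕ) (h : args.map (Ex.eval ρ μ) = ρ')
    (hok : ∀ e ∈ args, e.Ok X.S ρ μ) (hB : ∀ v ∈ ρ', v ≤ X.B) (hc : c.wp X ρ' μ o Q) :
    (call args c).wp X ρ μ o Q := by
  subst h
  exact ⟨fun e he => ⟨hok e he, hB _ (List.mem_map_of_mem he)⟩, hc⟩

theorem wp_store {a v : Ex} (adr val : ℕ) (oka : a.Ok X.S ρ μ) (okv : v.Ok X.S ρ μ)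
    (ha : a.eval ρ μ = adr) (hv : v.eval ρ μ = val) (hS : adr < X.S) (hB : val ≤ X.B)
    (hQ : Q (upd μ A (Function.update (μ A) adr val)) o) : (store A a v).wp X ρ μ o Q := by
  subst ha hv
  exact ⟨oka, okv, hS, hB, hQ⟩

theorem wp_letv {e : Ex} {c : Cmd} (v : ℕ) (ok : e.Ok X.S ρ μ) (he : e.eval ρ μ = v) (hB : v ≤ X.B)
    (hc : c.wp X (ρ ++ [v]) μ o Q) : (letv e c).wp X ρ μ o Q := by
  subst he
  exact ⟨ok, hB, hc⟩

end Block

/-- Overwrite `L` words of the array `A` from the address `a` on; the environment is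
`[L, a, p, q, t]`, and the offset is the variable `6`. -/
def fillRow (tag A : ℕ) (e : Ex) : Cmd :=
  loop tag (.var 0) (store A (.var 1 + .var 6) e)

/-- The entries of the array `B` become the sums modulo two of the entries of the rows of `A` that
are marked in the array `15`; the environment is `[n, L]`. -/
def sumRows (tag A B : ℕ) : Cmd :=
  sumBits tag (.var 1) 0 (.var 0) B (.var 3)
    (.load 15 (.var 5) * .load A (.var 5 * .var 1 + .var 3))

/-- Add the row `M` of the array `A'` to the rows of `A` that are marked in the array `15`; the
environment is `[n, L, M]`. -/
def addRows (tag A A' : ℕ) : Cmd :=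
  loop 0 (.var 0) (loop tag (.var 1) (store A (.var 4 * .var 1 + .var 6)
    (Ex.neb (.load A (.var 4 * .var 1 + .var 6))
      (.load 15 (.var 4) * .load A' (.var 2 * .var 1 + .var 6)))))

/-- Find the row with the largest score; the environment is `[n, p, q]`, and the row is the variable
`4`. -/
def select (e : Ex) : Cmd :=
  argmax 0 (.var 0) 17 18 (.var 4) e

section Rows

variable {X : Limits} {tag A : ℕ} {μ : ℕ → ℕ → ℕ} {o : List ℕ}
  {Q : (ℕ → ℕ → ℕ) → List ℕ → Prop} {n L M f : ℕ}

theorem wp_fillRow {a p q t : ℕ} {e : Ex} (val : ℕ → ℕ) (hβ : L ≤ X.β tag) (hS : a + L ≤ X.S)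
    (he : ∀ k < L, ∀ g : ℕ → ℕ, g (a + k) = μ A (a + k) →
      (∀ b, b < a ∨ a + L ≤ b → g b = μ A b) → e.Ok X.S [L, a, p, q, t, L, k] (upd μ A g) ∧
        e.eval [L, a, p, q, t, L, k] (upd μ A g) = val k ∧ val k ≤ X.B)
    (hQ : ∀ g : ℕ → ℕ, (∀ k < L, g (a + k) = val k) →
      (∀ b, b < a ∨ a + L ≤ b → g b = μ A b) → Q (upd μ A g) o) :
    (fillRow tag A e).wp X [L, a, p, q, t] μ o Q := by
  have hout : ∀ g : ℕ → ℕ, (∀ b, (∀ j < L, b ≠ a + j) → g b = μ A b) →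
      ∀ b, b < a ∨ a + L ≤ b → g b = μ A b := fun g h b hb => h b fun j hj => by omega
  refine wp_fill (fun k => a + k) val (by simp) (by simp) hβ (fun j k h1 h2 => by omega)
    (fun k hk g _ h1 h2 => ⟨⟨by simp, by simp, by omega⟩, he k hk g h1 (hout g h2)⟩)
    fun g h1 h2 => hQ g h1 (hout g h2)

theorem wp_sumRows {B : ℕ} (t : ℕ → ℕ → ZMod 2) (hn : n ≤ X.β 0) (hL : L ≤ X.β tag)
    (hB : 1 ≤ X.B) (hS : n * L ≤ X.S) (hnS : n ≤ X.S) (hLS : L ≤ X.S) (h15 : B ≠ 15) (hA : B ≠ A)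
    (ht : ∀ k < n, ∀ s < L, μ 15 k * μ A (k * L + s) = (t k s).val)
    (hQ : ∀ g : ℕ → ℕ, (∀ s < L, g s = (∑ k ∈ Finset.range n, t k s).val) → Q (upd μ B g) o) :
    (sumRows tag A B).wp X [n, L] μ o Q := by
  refine wp_sumBits (fun s => s) (fun s k => t k s) (by simp) (by simp) hL
    (fun s hs g => by simp) hn hB (fun j k h _ => by omega) (fun j hj l g => ?_)
    (fun s hs k hk g => ?_) fun g h1 _ => hQ g h1
  · exact ⟨by simp, by simp, by omega⟩
  · have h1 := row_lt hk hs
    simp [upd_apply, h15.symm, hA.symm, ht k hk s hs]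
    omega

/-- If source and target are the same array, the source row must survive the loop: it is unmarked
and consists of bits, so writing it back changes nothing. -/
theorem wp_addRows {A' : ℕ} (hn : n ≤ X.β 0) (hL : L ≤ X.β tag) (hB : 1 ≤ X.B) (hS : n * L ≤ X.S)
    (hnS : n ≤ X.S) (hM : M < n) (h15 : A ≠ 15)
    (hA : A' = A → μ 15 M = 0 ∧ ∀ s < L, μ A (M * L + s) ≤ 1)
    (hQ : ∀ g : ℕ → ℕ, (∀ r < n, ∀ s < L, g (r * L + s) =
      if μ A (r * L + s) = μ 15 r * μ A' (M * L + s) then 0 else 1) → Q (upd μ A g) o) :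
    (addRows tag A A').wp X [n, L, M] μ o Q := by
  refine wp_fill2 (fun r s => r * L + s) _ (by simp) (by simp) hn (fun k _ g => by simp) hL
    (fun j k j' k' _ h1 _ h2 h => row_inj h1 h2 h) (fun r hr s hs g h1 h2 => ?_) fun g h1 _ => hQ g h1
  have e1 := row_lt hr hs
  have e2 := row_lt hM hs
  have e3 : upd μ A g A' (M * L + s) = μ A' (M * L + s) := by
    by_cases e : A' = A
    · subst e
      obtain ⟨h3, h4⟩ := hA rfl
      have h4 := h4 s hs
      rcases h1 M hM s hs with h5 | h5
      · rw [upd_self, h5]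
      -- The source row has been processed already; being unmarked, it was rewritten with its own
      -- bits.
      · rw [upd_self, h5, h3, zero_mul]
        split_ifs <;> omega
    · rw [upd_apply, if_neg e]
  refine ⟨⟨by simp, by simp, by omega⟩, ?_, ?_, ?_⟩
  · simp
    omega
  · simp [upd_apply μ A g 15, h15.symm, e3, h2]
  · split_ifs <;> omega

theorem wp_select {p q : ℕ} {e : Ex} (sc : ℕ → ℕ) (hn : n ≤ X.β 0) (hnB : n ≤ X.B) (hS : 0 < X.S)
    (he : ∀ r < n, ∀ g g', e.Ok X.S [n, p, q, n, r] (upd (upd μ 17 g) 18 g') ∧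
      e.eval [n, p, q, n, r] (upd (upd μ 17 g) 18 g') = sc r ∧ sc r ≤ X.B)
    (hQ : ∀ g g' : ℕ → ℕ, (g 0 = 0 ∧ ∀ j < n, sc j = 0) ∨
      (0 < g 0 ∧ g' 0 < n ∧ 0 < sc (g' 0) ∧ ∀ j < n, sc j ≤ sc (g' 0)) →
      Q (upd (upd μ 17 g) 18 g') o) : (select e).wp X [n, p, q] μ o Q := by
  refine wp_argmax sc (by decide) hS hnB (fun g g' => by simp) hn rfl he fun g g' h => hQ g g' ?_
  rcases h with h | ⟨h1, h2, h3, h4⟩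
  · exact Or.inl h
  · exact Or.inr ⟨h1, h2, h3 ▸ h1, h3 ▸ h4⟩

end Rows

end Cmd

/-! ## Chains as bit vectors

The simplices of the current complex are kept in `n` slots.  A slot holds `0` if it is free, and
`j + 1` if it is occupied by the simplex `σ j`. -/

/-- The coefficient of the chain `c` at the simplex in a slot with content `q`. -/
noncomputable def bitAt (F : Filtration) (q : ℕ) (c : Chain) : ZMod 2 :=
  if q = 0 then 0 else c (F.σ (q - 1))

section Bits

variable {F : Filtration} {q : ℕ} {c c' : Chain}

@[simp] theorem bitAt_zero_left : bitAt F 0 c = 0 := if_pos rfl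

@[simp] theorem bitAt_zero : bitAt F q 0 = 0 := by simp [bitAt]

theorem bitAt_of_ne (h : q ≠ 0) : bitAt F q c = c (F.σ (q - 1)) := if_neg h

theorem bitAt_add : bitAt F q (c + c') = bitAt F q c + bitAt F q c' := by
  unfold bitAt
  split_ifs <;> simp

theorem bitAt_smul (a : ZMod 2) : bitAt F q (a • c) = a * bitAt F q c := by
  unfold bitAt
  split_ifs <;> simp

theorem bitAt_sum {ι : Type} (S : Finset ι) (x : ι → Chain) :
    bitAt F q (∑ k ∈ S, x k) = ∑ k ∈ S, bitAt F q (x k) := by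
  unfold bitAt
  split_ifs
  · simp
  · rw [Finsupp.finsetSum_apply]

end Bits

/-- The slots hold the simplices of the complex at the index `α`. -/
structure SlotsAt (F : Filtration) (α : ℕ) (q : ℕ → ℕ) : Prop where
  le : ∀ s < F.n, q s ≤ F.m
  mem : ∀ s < F.n, q s ≠ 0 → F.σ (q s - 1) ∈ (F.K α).faces
  surj : ∀ τ ∈ (F.K α).faces, ∃ s < F.n, q s ≠ 0 ∧ F.σ (q s - 1) = τ
  inj : ∀ s < F.n, ∀ t < F.n, q s ≠ 0 → q t ≠ 0 → F.σ (q s - 1) = F.σ (q t - 1) → s = t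

/-- The change of the slots when the complex changes. -/
structure SlotStep (F : Filtration) (α : ℕ) (q q' : ℕ → ℕ) (f : ℕ) : Prop where
  lt : f < F.n
  same : ∀ s < F.n, s ≠ f → q' s = q s
  fwd : F.dir α = true → q f = 0 ∧ q' f = α + 1
  bwd : F.dir α = false → q f ≠ 0 ∧ F.σ (q f - 1) = F.σ α ∧ q' f = 0

section Slots

variable {F : Filtration} {α f : ℕ} {q q' : ℕ → ℕ}

theorem slotsAt_zero (h : ∀ s < F.n, q s = 0) : SlotsAt F 0 q where
  le s hs := by rw [h s hs]; exact Nat.zero_le _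
  mem s hs hne := absurd (h s hs) hne
  surj τ hτ := by
    rw [F.K_zero] at hτ
    exact absurd hτ (Set.notMem_empty τ)
  inj s hs _ _ hne := absurd (h s hs) hne

/-- The inserted simplex takes a free slot, and no other slot holds it because it was not in the
complex; a deletion empties the only slot that held the simplex. -/
theorem SlotsAt.step (h : SlotsAt F α q) (hα : α < F.m) (hs : SlotStep F α q q' f) :
    SlotsAt F (α + 1) q' := by
  rcases Bool.eq_false_or_eq_true (F.dir α) with hd | hd
  · obtain ⟨h1, h2⟩ := F.insertion α hα hd
    obtain ⟨h3, h4⟩ := hs.fwd hd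
    have key : ∀ s < F.n, q' s ≠ 0 → s ≠ f → q s ≠ 0 ∧ F.σ (q' s - 1) = F.σ (q s - 1) ∧
        F.σ (q' s - 1) ≠ F.σ α := fun s hsn h0 hsf => by
      rw [hs.same s hsn hsf] at h0 ⊢
      exact ⟨h0, rfl, fun e => h1 (e ▸ h.mem s hsn h0)⟩
    have hf : F.σ (q' f - 1) = F.σ α := by rw [h4]; rfl
    refine ⟨fun s hsn => ?_, fun s hsn h0 => ?_, fun τ hτ => ?_, fun s hsn t htn h0 h0' e => ?_⟩
    · by_cases hsf : s = f
      · rw [hsf, h4]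
        exact hα
      · rw [hs.same s hsn hsf]
        exact h.le s hsn
    · rw [h2]
      by_cases hsf : s = f
      · rw [hsf, hf]
        exact Set.mem_insert _ _
      · obtain ⟨a, b, -⟩ := key s hsn h0 hsf
        rw [b]
        exact Set.mem_insert_of_mem _ (h.mem s hsn a)
    · rw [h2] at hτ
      rcases hτ with rfl | hτ
      · exact ⟨f, hs.lt, by omega, hf⟩
      · obtain ⟨s, hsn, a, b⟩ := h.surj τ hτ
        have hsf : s ≠ f := fun e => a (e ▸ h3)
        exact ⟨s, hsn, by rwa [hs.same s hsn hsf], by rwa [hs.same s hsn hsf]⟩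
    · by_cases hsf : s = f <;> by_cases htf : t = f
      · rw [hsf, htf]
      · rw [hsf, hf] at e
        exact absurd e.symm (key t htn h0' htf).2.2
      · rw [htf, hf] at e
        exact absurd e (key s hsn h0 hsf).2.2
      · obtain ⟨a, b, -⟩ := key s hsn h0 hsf
        obtain ⟨a', b', -⟩ := key t htn h0' htf
        exact h.inj s hsn t htn a a' (b ▸ b' ▸ e)
  · obtain ⟨h1, h2⟩ := F.deletion α hα hd
    obtain ⟨h3, h4, h5⟩ := hs.bwd hd
    have key : ∀ s < F.n, q' s ≠ 0 → s ≠ f ∧ q' s = q s ∧ q s ≠ 0 := fun s hsn h0 => by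
      have hsf : s ≠ f := fun e => h0 (e ▸ h5)
      rw [hs.same s hsn hsf] at h0 ⊢
      exact ⟨hsf, rfl, h0⟩
    refine ⟨fun s hsn => ?_, fun s hsn h0 => ?_, fun τ hτ => ?_, fun s hsn t htn h0 h0' e => ?_⟩
    · by_cases hsf : s = f
      · rw [hsf, h5]
        exact Nat.zero_le _
      · rw [hs.same s hsn hsf]
        exact h.le s hsn
    · obtain ⟨a, b, c⟩ := key s hsn h0
      rw [h2, b]
      exact ⟨h.mem s hsn c, fun e => a (h.inj s hsn f hs.lt c h3 (e.trans h4.symm))⟩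
    · rw [h2] at hτ
      obtain ⟨s, hsn, a, b⟩ := h.surj τ hτ.1
      have hsf : s ≠ f := fun e => hτ.2 (by rw [← b, e]; exact h4)
      exact ⟨s, hsn, by rwa [hs.same s hsn hsf], by rwa [hs.same s hsn hsf]⟩
    · obtain ⟨-, b, c⟩ := key s hsn h0
      obtain ⟨-, b', c'⟩ := key t htn h0'
      rw [b, b'] at e
      exact h.inj s hsn t htn c c' e

/-- Only the slot of `σ α` changes, and a chain that avoids `σ α` has a zero bit there before and
after. Bit rows thus need not be rewritten when the complex changes. -/
theorem SlotStep.bitAt_eq (hs : SlotStep F α q q' f) {c : Chain} (hc : c (F.σ α) = 0) {s : ℕ}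
    (hsn : s < F.n) : bitAt F (q' s) c = bitAt F (q s) c := by
  by_cases hsf : s = f
  · rw [hsf]
    rcases Bool.eq_false_or_eq_true (F.dir α) with hd | hd
    · obtain ⟨h3, h4⟩ := hs.fwd hd
      rw [h3, h4, bitAt_zero_left, bitAt_of_ne (Nat.succ_ne_zero α)]
      exact hc
    · obtain ⟨h3, h4, h5⟩ := hs.bwd hd
      rw [h5, bitAt_zero_left, bitAt_of_ne h3, h4, hc]
  · rw [hs.same s hsn hsf]

theorem SlotStep.apply_eq_bit (hs : SlotStep F α q q' f) (hd : F.dir α = false) (c : Chain) :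
    bitAt F (q f) c = c (F.σ α) := by
  obtain ⟨h3, h4, -⟩ := hs.bwd hd
  rw [bitAt_of_ne h3, h4]

namespace SlotsAt

/-- Occupied slots hold different simplices of the complex, so not all `n` of them can be occupied.
-/
theorem exists_free (h : SlotsAt F α q) (hn : (F.K α).faces.ncard < F.n)
    (hfin : (F.K α).faces.Finite) : ∃ s < F.n, q s = 0 := by
  by_contra hc
  push Not at hc
  have h1 : (Finset.range F.n).card ≤ hfin.toFinset.card := by
    refine Finset.card_le_card_of_injOn (fun s => F.σ (q s - 1)) (fun s hs => ?_)
      fun s hs t ht e => ?_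
    · have hs := Finset.mem_range.1 hs
      simpa using h.mem s hs (hc s hs)
    · have hs := Finset.mem_range.1 hs
      have ht := Finset.mem_range.1 ht
      exact h.inj s hs t ht (hc s hs) (hc t ht) e
  rw [Finset.card_range, ← Set.ncard_eq_toFinset_card _ hfin] at h1
  omega

/-- Occupied slots correspond to the simplices of the complex, so the pairing is a scalar product of
bit rows. Empty slots contribute zero whatever is stored for the functional. -/
theorem sum_bits (h : SlotsAt F α q) {c : Chain} (hc : c ∈ chains (F.K α)) (φ : Finset ℕ → ZMod 2) :
    pair φ c = ∑ s ∈ Finset.range F.n, (if q s = 0 then 0 else φ (F.σ (q s - 1))) *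
      bitAt F (q s) c := by
  classical
  rw [pair_apply, Finsupp.sum]
  have h1 : ∀ s ∈ Finset.range F.n, (if q s = 0 then 0 else φ (F.σ (q s - 1))) * bitAt F (q s) c =
      if q s ≠ 0 then c (F.σ (q s - 1)) * φ (F.σ (q s - 1)) else 0 := by
    intro s _
    by_cases h0 : q s = 0
    · simp [h0]
    · rw [if_neg h0, bitAt_of_ne h0, if_pos h0, mul_comm]
  rw [Finset.sum_congr rfl h1, ← Finset.sum_filter]
  symm
  refine Finset.sum_bij_ne_zero (fun s _ _ => F.σ (q s - 1)) (fun s hs hne => ?_)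
    (fun s hs _ t ht _ e => ?_) (fun τ hτ hne => ?_) fun _ _ _ => rfl
  · exact Finsupp.mem_support_iff.2 fun e => hne (by rw [e, zero_mul])
  · obtain ⟨a, b⟩ := Finset.mem_filter.1 hs
    obtain ⟨a', b'⟩ := Finset.mem_filter.1 ht
    exact h.inj s (Finset.mem_range.1 a) t (Finset.mem_range.1 a') b b' e
  · obtain ⟨s, hs, h0, rfl⟩ := h.surj τ ((mem_chains.1 hc) τ (Finsupp.mem_support_iff.1 hτ))
    exact ⟨s, Finset.mem_filter.2 ⟨Finset.mem_range.2 hs, h0⟩, hne, rfl⟩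

/-- Slots hold indices shifted by one, so `q s - 1` names the simplex. The names are pairwise
different as simplices because slots are, although one simplex may occur at several indices of the
filtration. -/
theorem denotes (h : SlotsAt F α q) {c : Chain} (hc : c ∈ chains (F.K α)) {Z : ℕ → ℕ}
    (hZ : ∀ s < F.n, Z s = (bitAt F (q s) c).val) :
    F.Denotes (((List.range F.n).filter fun s => 0 < Z s).map fun s => q s - 1) c := by
  classical
  have key : ∀ s, s ∈ (List.range F.n).filter (fun s => 0 < Z s) →
      s < F.n ∧ q s ≠ 0 ∧ c (F.σ (q s - 1)) = 1 := by
    intro s hs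
    obtain ⟨h1, h2⟩ := List.mem_filter.1 hs
    have h1 := List.mem_range.1 h1
    rw [decide_eq_true_eq, hZ s h1] at h2
    have h0 : q s ≠ 0 := fun e => by
      rw [e, bitAt_zero_left] at h2
      exact absurd h2 (by decide)
    rw [bitAt_of_ne h0] at h2
    refine ⟨h1, h0, (zmod_two_cases _).resolve_left fun e => ?_⟩
    rw [e] at h2
    exact absurd h2 (by decide)
  refine ⟨fun j hj => ?_, ?_, ?_⟩
  · obtain ⟨s, hs, rfl⟩ := List.mem_map.1 hj
    obtain ⟨h1, h2, -⟩ := key s hs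
    have := h.le s h1
    omega
  · rw [List.map_map]
    refine List.Nodup.map_on (fun s hs t ht e => ?_) (List.Nodup.filter _ List.nodup_range)
    obtain ⟨h1, h2, -⟩ := key s hs
    obtain ⟨h1', h2', -⟩ := key t ht
    exact h.inj s h1 t h1' h2 h2' e
  · rw [List.map_map, ← List.sum_toFinset _ (List.Nodup.filter _ List.nodup_range)]
    ext τ
    rw [Finsupp.finsetSum_apply]
    have h1 : ∀ s ∈ ((List.range F.n).filter fun s => 0 < Z s).toFinset,
        ((fun j => Finsupp.single (F.σ j) (1 : ZMod 2)) ∘ fun s => q s - 1) s τ =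
          if F.σ (q s - 1) = τ then 1 else 0 := fun s _ => Finsupp.single_apply
    rw [Finset.sum_congr rfl h1]
    rcases zmod_two_cases (c τ) with h0 | h0
    · rw [h0]
      refine (Finset.sum_eq_zero fun s hs => if_neg fun e => ?_).symm
      have := (key s (List.mem_toFinset.1 hs)).2.2
      rw [e, h0] at this
      exact absurd this (by decide)
    · obtain ⟨s, hs, hq, e⟩ := h.surj τ ((mem_chains.1 hc) τ (by rw [h0]; decide))
      have hsm : s ∈ ((List.range F.n).filter fun s => 0 < Z s).toFinset := by
        rw [List.mem_toFinset, List.mem_filter, decide_eq_true_eq, hZ s hs, bitAt_of_ne hq, e, h0]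
        exact ⟨List.mem_range.2 hs, by decide⟩
      rw [Finset.sum_eq_single_of_mem s hsm fun t ht hts => if_neg fun e' => hts ?_, if_pos e, h0]
      obtain ⟨h1, h2, -⟩ := key t (List.mem_toFinset.1 ht)
      exact h.inj t h1 s hs h2 hq (e'.trans e.symm)

end SlotsAt

theorem length_filter_bits {Z : ℕ → ℕ} (n : ℕ) (hZ : ∀ s < n, Z s ≤ 1) :
    ((List.range n).filter fun s => 0 < Z s).length = ∑ s ∈ Finset.range n, Z s := by
  induction n with
  | zero => rfl
  | succ n ih =>
    rw [List.range_succ, List.filter_append, List.length_append, Finset.sum_range_succ,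
      ih fun s hs => hZ s (by omega)]
    have := hZ n (Nat.lt_succ_self n)
    by_cases h : 0 < Z n
    · simp [h]
      omega
    · simp [h]
      omega

end Slots

/-! ## The decomposition in the memory -/

/-- The kind of a row: `0` if it is free, `1` if it holds a homology representative and `2` if it
holds a boundary. -/
def Decomp.kind (A : Decomp) (r : ℕ) : ℕ := if r ∈ A.HR then 1 else if r ∈ A.BR then 2 else 0

/-- The memory `μ` holds the decomposition `A` at the index `i`; the contents of the slots at the
index `α` are `nm α`. -/
structure Stores (F : Filtration) (i : ℕ) (A : Decomp) (nm : ℕ → ℕ → ℕ) (μ : ℕ → ℕ → ℕ) : Prop where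
  slots : ∀ α ≤ i, SlotsAt F α (nm α)
  step : ∀ α < i, ∃ f, SlotStep F α (nm α) (nm (α + 1)) f
  tab : ∀ α ≤ i, ∀ s < F.n, μ 2 (α * F.n + s) = nm α s
  kind : ∀ r < F.n, μ 3 r = A.kind r
  birth : ∀ r ∈ A.rows, μ 4 r = A.birth r
  key : ∀ r ∈ A.HR, μ 5 r = F.key (A.birth r)
  x : ∀ r ∈ A.rows, ∀ s < F.n, μ 6 (r * F.n + s) = (bitAt F (nm i s) (A.x r)).val
  y : ∀ r ∈ A.BR, ∀ s < F.n, μ 7 (r * F.n + s) = (bitAt F (nm i s) (A.y r)).val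
  -- At an empty slot the stored entry is unconstrained: a deletion leaves the column of the freed
  -- slot as it is.
  φ : ∀ r ∈ A.rows, ∀ s < F.n, nm i s ≠ 0 →
    μ 8 (r * F.n + s) = (A.φ r (F.σ (nm i s - 1))).val
  U : ∀ r ∈ A.HR, ∀ w ≤ F.m, μ 9 (r * (F.m + 1) + w) = (A.U r w).val
  -- A wire is kept as a bit row over the slots of its own index `w`, not of the current one, and it
  -- matters only if some bundle uses it.
  wire : ∀ r ∈ A.HR, ∀ w, A.U r w ≠ 0 → ∀ s < F.n,
    μ 10 (w * F.n + s) = (bitAt F (nm w s) (A.wire w)).val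

theorem row_apply {L r₀ : ℕ} {g h val : ℕ → ℕ} (h1 : ∀ k < L, g (r₀ * L + k) = val k)
    (h2 : ∀ b, b < r₀ * L ∨ r₀ * L + L ≤ b → g b = h b) (r s : ℕ) (hs : s < L) :
    g (r * L + s) = if r = r₀ then val s else h (r * L + s) := by
  split_ifs with e
  · rw [e, h1 s hs]
  · refine h2 _ ?_
    rcases lt_or_gt_of_ne e with hlt | hlt
    · exact Or.inl (row_lt hlt hs)
    · refine Or.inr ?_
      calc r₀ * L + L = (r₀ + 1) * L := by ring
        _ ≤ r * L := Nat.mul_le_mul_right _ hlt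
        _ ≤ r * L + s := Nat.le_add_right _ _

theorem zmod_val_ite (u : ZMod 2) : (if u.val = 0 then 0 else 1) = u.val := by
  revert u
  decide

/-- The effect of the program's conditional row addition on one bit, with the mask as a factor. -/
theorem masked_add {a b c : ℕ} {u v : ZMod 2} {p : Prop} [Decidable p] (ha : a = u.val) (hb : b = v.val)
    (h : c = if a = (if p then 1 else 0) * b then 0 else 1) : c = (if p then u + v else u).val := by
  rw [h, ha, hb]
  split_ifs with _ e e
  all_goals
    first
    | rw [zmod_add_val, ← one_mul v.val, if_pos e]
    | rw [zmod_add_val, ← one_mul v.val, if_neg e]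
    | rw [zero_mul] at e
      rw [← zmod_val_ite u, if_pos e]
    | rw [zero_mul] at e
      rw [← zmod_val_ite u, if_neg e]

namespace Stores

variable {F : Filtration} {i f : ℕ} {A A' : Decomp} {nm : ℕ → ℕ → ℕ} {μ μ' : ℕ → ℕ → ℕ}
  {q' : ℕ → ℕ}

theorem slots_succ (h : Stores F i A nm μ) (hi : i < F.m) (hs : SlotStep F i (nm i) q' f) :
    (∀ α ≤ i + 1, SlotsAt F α (Function.update nm (i + 1) q' α)) ∧
    ∀ α < i + 1, ∃ f, SlotStep F α (Function.update nm (i + 1) q' α)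
      (Function.update nm (i + 1) q' (α + 1)) f := by
  constructor
  · intro α hα
    by_cases e : α = i + 1
    · rw [e, Function.update_self]
      exact (h.slots i le_rfl).step hi hs
    · rw [Function.update_of_ne e]
      exact h.slots α (by omega)
  · intro α hα
    rw [Function.update_of_ne (by omega)]
    by_cases e : α = i
    · rw [e, Function.update_self]
      exact ⟨f, hs⟩
    · rw [Function.update_of_ne (by omega)]
      exact h.step α (by omega)

theorem tab_succ (h : Stores F i A nm μ) {g : ℕ → ℕ}
    (h1 : ∀ s < F.n, g ((i + 1) * F.n + s) = q' s)
    (h2 : ∀ b, b < (i + 1) * F.n ∨ (i + 1) * F.n + F.n ≤ b → g b = μ 2 b) :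
    ∀ α ≤ i + 1, ∀ s < F.n, g (α * F.n + s) = Function.update nm (i + 1) q' α s := by
  intro α hα s hs
  rw [row_apply h1 h2 α s hs]
  split_ifs with e
  · rw [e, Function.update_self]
  · rw [Function.update_of_ne e, h.tab α (by omega) s hs]

/-- Bundles only use wires up to the current index, so writing the row `i + 1` disturbs none of
them. -/
theorem wire_succ (h : Stores F i A nm μ) (hv : A.Valid F i) {g : ℕ → ℕ} {c : Chain}
    (hg : ∀ b < (i + 1) * F.n, g b = μ 10 b) {r : ℕ} (hr : r ∈ A.HR) {w : ℕ} (hw : A.U r w ≠ 0)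
    {s : ℕ} (hs : s < F.n) : g (w * F.n + s) =
      (bitAt F (Function.update nm (i + 1) q' w s) (Function.update A.wire (i + 1) c w)).val := by
  have h1 := (hv.wire_mem r hr w hw).1
  rw [Function.update_of_ne (by omega), Function.update_of_ne (by omega), ← h.wire r hr w hw s hs]
  exact hg _ (row_lt (by omega) hs)

/-- The new birth in the row `M`. -/
theorem wire_newborn {g : ℕ → ℕ} {c : Chain}
    (hg : ∀ s < F.n, g ((i + 1) * F.n + s) = (bitAt F (q' s) c).val) {w : ℕ}
    (hw : (Pi.single (i + 1) 1 : ℕ → ZMod 2) w ≠ 0) {s : ℕ} (hs : s < F.n) : g (w * F.n + s) =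
      (bitAt F (Function.update nm (i + 1) q' w s) (Function.update A.wire (i + 1) c w)).val := by
  obtain rfl : w = i + 1 := by
    by_contra hne
    exact hw (by rw [Pi.single_apply, if_neg hne])
  rw [Function.update_self, Function.update_self, hg s hs]

theorem single_val (w : ℕ) : ((Pi.single (i + 1) 1 : ℕ → ZMod 2) w).val = if w = i + 1 then 1 else 0 := by
  rw [Pi.single_apply]
  split_ifs <;> rfl

theorem slot_ne (h : Stores F i A nm μ) (hi : i < F.m) (hd : F.dir i = true)
    (hs : SlotStep F i (nm i) q' f) {s : ℕ} (hsn : s < F.n) (hsf : s ≠ f) (h0 : q' s ≠ 0) :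
    q' s = nm i s ∧ F.σ (q' s - 1) ≠ F.σ i := by
  have e := hs.same s hsn hsf
  refine ⟨e, fun e' => (F.insertion i hi hd).1 (e' ▸ ?_)⟩
  rw [e] at h0 ⊢
  exact (h.slots i le_rfl).mem s hsn h0

/-- Clearing the column of the slot that is filled is the same as clearing the functional at the
inserted simplex. -/
theorem phi_succ (h : Stores F i A nm μ) (hi : i < F.m) (hd : F.dir i = true)
    (hs : SlotStep F i (nm i) q' f) {r s : ℕ} (hr : r ∈ A.rows) (hsn : s < F.n) (h0 : q' s ≠ 0) :
    (if s = f then 0 else μ 8 (r * F.n + s)) =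
      (Function.update (A.φ r) (F.σ i) 0 (F.σ (q' s - 1))).val := by
  split_ifs with e
  · rw [e, (hs.fwd hd).2]
    exact (congrArg ZMod.val (Function.update_self (F.σ i) 0 (A.φ r))).symm
  · obtain ⟨h1, h2⟩ := h.slot_ne hi hd hs hsn e h0
    rw [Function.update_of_ne h2, h1, h.φ r hr s hsn (h1 ▸ h0)]

/-- The hypotheses are the contents of the arrays after the program. Deducing the new correspondence
from such equations, here and in the next three lemmas, keeps chains out of most of the reasoning
about the program. -/
theorem insertBirth (h : Stores F i A nm μ) (hv : A.Valid F i) (hi : i < F.m)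
    (hd : F.dir i = true) (hs : SlotStep F i (nm i) q' f) {r₀ : ℕ} (h₀ : r₀ ∉ A.rows)
    (hr₀ : r₀ < F.n)
    (htab : ∀ s < F.n, μ' 2 ((i + 1) * F.n + s) = q' s)
    (htab' : ∀ b, b < (i + 1) * F.n ∨ (i + 1) * F.n + F.n ≤ b → μ' 2 b = μ 2 b)
    (hkind : ∀ r < F.n, μ' 3 r = if r = r₀ then 1 else μ 3 r)
    (hbirth : ∀ r, μ' 4 r = if r = r₀ then i + 1 else μ 4 r)
    (hkey : ∀ r, μ' 5 r = if r = r₀ then F.m + 1 + (i + 1) else μ 5 r)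
    (hx : ∀ r, ∀ s < F.n, μ' 6 (r * F.n + s) =
      if r = r₀ then (bitAt F (q' s) (A.cone (F.σ i))).val else μ 6 (r * F.n + s))
    (hy : μ' 7 = μ 7)
    (hφ : ∀ r < F.n, ∀ s < F.n, μ' 8 (r * F.n + s) = if r = r₀ then (if s = f then 1 else 0)
      else if s = f then 0 else μ 8 (r * F.n + s))
    (hU : ∀ r, ∀ w < F.m + 1, μ' 9 (r * (F.m + 1) + w) =
      if r = r₀ then (if w = i + 1 then 1 else 0) else μ 9 (r * (F.m + 1) + w))
    (hw : ∀ s < F.n, μ' 10 ((i + 1) * F.n + s) = (bitAt F (q' s) (A.cone (F.σ i))).val)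
    (hw' : ∀ b < (i + 1) * F.n, μ' 10 b = μ 10 b) :
    Stores F (i + 1) (A.insertBirth i (F.σ i) r₀) (Function.update nm (i + 1) q') μ' := by
  have ha := F.adds_of_fwd hi hd
  have hne : ∀ r ∈ A.rows, r ≠ r₀ := fun r hr e => h₀ (e ▸ hr)
  have hB : r₀ ∉ A.BR := fun e => h₀ (Decomp.BR_subset e)
  have hrows : (A.insertBirth i (F.σ i) r₀).rows = insert r₀ A.rows := Finset.insert_union _ _ _
  obtain ⟨hf1, hf2⟩ := hs.fwd hd
  refine ⟨(h.slots_succ hi hs).1, (h.slots_succ hi hs).2, h.tab_succ htab htab', ?_, ?_, ?_, ?_, ?_,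
    ?_, ?_, ?_⟩
  · intro r hr
    rw [hkind r hr]
    by_cases e : r = r₀
    · simp [e, Decomp.kind, Decomp.insertBirth]
    · rw [if_neg e, h.kind r hr]
      simp only [Decomp.kind, Decomp.insertBirth, Finset.mem_insert, e, false_or]
      congr
  · intro r hr
    rw [hbirth r]
    change _ = Function.update A.birth r₀ (i + 1) r
    rw [Function.update_apply]
    split_ifs with e
    · rfl
    · rw [hrows] at hr
      exact h.birth r (Finset.mem_of_mem_insert_of_ne hr e)
  · intro r hr
    rw [hkey r]
    change _ = F.key (Function.update A.birth r₀ (i + 1) r)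
    rw [Function.update_apply]
    split_ifs with e
    · rw [Filtration.key, Nat.add_sub_cancel, if_pos hd]
    · exact h.key r (Finset.mem_of_mem_insert_of_ne hr e)
  · intro r hr s hsn
    rw [hx r s hsn, Function.update_self]
    change _ = (bitAt F (q' s) (Function.update A.x r₀ (A.cone (F.σ i)) r)).val
    rw [Function.update_apply]
    split_ifs with e
    · rfl
    · rw [hrows] at hr
      have hr := Finset.mem_of_mem_insert_of_ne hr e
      rw [h.x r hr s hsn, hs.bitAt_eq (hv.x_apply ha hr) hsn]
  · intro r hr s hsn
    rw [hy, Function.update_self, h.y r hr s hsn]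
    change _ = (bitAt F (q' s) (A.y r)).val
    rw [hs.bitAt_eq (hv.y_apply ha hr) hsn]
  · intro r hr s hsn h0
    rw [Function.update_self] at h0 ⊢
    rw [hrows] at hr
    have hrn : r < F.n := by
      rcases Finset.mem_insert.1 hr with e | e
      · exact e ▸ hr₀
      · exact hv.lt_n r e
    change _ = ((if r = r₀ then Pi.single (F.σ i) 1 else Function.update (A.φ r) (F.σ i) 0)
      (F.σ (q' s - 1))).val
    rw [hφ r hrn s hsn]
    split_ifs with e e' e'
    · rw [e', hf2]
      exact (congrArg ZMod.val (Pi.single_eq_same (M := fun _ => ZMod 2) (F.σ i) 1)).symm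
    · rw [Pi.single_apply, if_neg (h.slot_ne hi hd hs hsn e' h0).2]
      rfl
    all_goals
      rw [← h.phi_succ hi hd hs (Finset.mem_of_mem_insert_of_ne hr e) hsn h0]
    · rw [if_pos e']
    · rw [if_neg e']
  · intro r hr w hwm
    rw [hU r w (by omega)]
    change _ = (Function.update A.U r₀ (Pi.single (i + 1) 1) r w).val
    rw [Function.update_apply]
    by_cases e : r = r₀
    · rw [if_pos e, if_pos e, single_val]
    · rw [if_neg e, if_neg e]
      exact h.U r (Finset.mem_of_mem_insert_of_ne hr e) w hwm
  · intro r hr w hw0 s hsn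
    change Function.update A.U r₀ (Pi.single (i + 1) 1) r w ≠ 0 at hw0
    rw [Function.update_apply] at hw0
    split_ifs at hw0 with e
    · exact wire_newborn hw hw0 hsn
    · exact h.wire_succ hv hw' (Finset.mem_of_mem_insert_of_ne hr e) hw0 hsn

theorem insertDeath (h : Stores F i A nm μ) (hv : A.Valid F i) (hi : i < F.m)
    (hd : F.dir i = true) (hs : SlotStep F i (nm i) q' f) {M : ℕ} (hM : M ∈ A.hitH (F.σ i))
    (htab : ∀ s < F.n, μ' 2 ((i + 1) * F.n + s) = q' s)
    (htab' : ∀ b, b < (i + 1) * F.n ∨ (i + 1) * F.n + F.n ≤ b → μ' 2 b = μ 2 b)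
    (hkind : ∀ r < F.n, μ' 3 r = if r = M then 2 else μ 3 r)
    (hbirth : ∀ r, μ' 4 r = if r = M then i + 1 else μ 4 r)
    (hkey : μ' 5 = μ 5)
    (hx : ∀ r, ∀ s < F.n, μ' 6 (r * F.n + s) =
      if r = M then (bitAt F (nm i s) (∑ k ∈ A.hitH (F.σ i), A.x k)).val else μ 6 (r * F.n + s))
    (hy : ∀ r, ∀ s < F.n, μ' 7 (r * F.n + s) =
      if r = M then (bitAt F (q' s) (A.cone (F.σ i))).val else μ 7 (r * F.n + s))
    (hφ : ∀ r < F.n, ∀ s < F.n, μ' 8 (r * F.n + s) =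
      if (if s = f then 0 else μ 8 (r * F.n + s)) =
        (if r ∈ (A.hitH (F.σ i)).erase M then 1 else 0) * (if s = f then 0 else μ 8 (M * F.n + s))
      then 0 else 1)
    (hU : ∀ r, r ≠ M → ∀ w < F.m + 1, μ' 9 (r * (F.m + 1) + w) = μ 9 (r * (F.m + 1) + w))
    (hw : μ' 10 = μ 10) :
    Stores F (i + 1) (A.insertDeath i (F.σ i) M) (Function.update nm (i + 1) q') μ' := by
  have ha := F.adds_of_fwd hi hd
  obtain ⟨hMH, hM1⟩ := Finset.mem_filter.1 hM
  have hMr := Decomp.HR_subset hMH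
  have hrows : (A.insertDeath i (F.σ i) M).rows = A.rows := by
    ext r
    simp only [Decomp.rows, Decomp.insertDeath, Finset.mem_union, Finset.mem_erase,
      Finset.mem_insert]
    by_cases e : r = M <;> simp [e, hMH]
  have hsub : ∀ {r}, r ∈ (A.hitH (F.σ i)) → r ∈ A.rows := fun hr =>
    Decomp.HR_subset (Finset.mem_filter.1 hr).1
  have hx0 : (∑ k ∈ A.hitH (F.σ i), A.x k) (F.σ i) = 0 := by
    rw [Finsupp.finsetSum_apply]
    exact Finset.sum_eq_zero fun k hk => hv.x_apply ha (hsub hk)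
  refine ⟨(h.slots_succ hi hs).1, (h.slots_succ hi hs).2, h.tab_succ htab htab', ?_, ?_, ?_, ?_, ?_,
    ?_, ?_, ?_⟩
  · intro r hr
    rw [hkind r hr]
    by_cases e : r = M
    · simp [e, Decomp.kind, Decomp.insertDeath]
    · rw [if_neg e, h.kind r hr]
      simp only [Decomp.kind, Decomp.insertDeath, Finset.mem_insert, Finset.mem_erase, e, false_or,
        ne_eq, not_false_eq_true, true_and]
  · intro r hr
    rw [hrows] at hr
    rw [hbirth r]
    change _ = Function.update A.birth M (i + 1) r
    rw [Function.update_apply]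
    split_ifs with e
    · rfl
    · exact h.birth r hr
  · intro r hr
    obtain ⟨e, hr⟩ := Finset.mem_erase.1 hr
    rw [hkey]
    change _ = F.key (Function.update A.birth M (i + 1) r)
    rw [Function.update_of_ne e, h.key r hr]
  · intro r hr s hsn
    rw [hrows] at hr
    rw [hx r s hsn, Function.update_self]
    change _ = (bitAt F (q' s) (Function.update A.x M (∑ k ∈ A.hitH (F.σ i), A.x k) r)).val
    rw [Function.update_apply]
    split_ifs with e
    -- The sum was formed over the old slots; it vanishes at the inserted simplex, so its bits over
    -- the new slots are the same.
    · rw [hs.bitAt_eq hx0 hsn]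
    · rw [h.x r hr s hsn, hs.bitAt_eq (hv.x_apply ha hr) hsn]
  · intro r hr s hsn
    rw [hy r s hsn, Function.update_self]
    change _ = (bitAt F (q' s) (Function.update A.y M (A.cone (F.σ i)) r)).val
    rw [Function.update_apply]
    split_ifs with e
    · rfl
    · have hr := Finset.mem_of_mem_insert_of_ne hr e
      rw [h.y r hr s hsn, hs.bitAt_eq (hv.y_apply ha hr) hsn]
  · intro r hr s hsn h0
    rw [Function.update_self] at h0 ⊢
    rw [hrows] at hr
    change _ = ((if r ∈ (A.hitH (F.σ i)).erase M then Function.update (A.φ r) (F.σ i) 0 +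
      Function.update (A.φ M) (F.σ i) 0 else Function.update (A.φ r) (F.σ i) 0)
      (F.σ (q' s - 1))).val
    rw [hφ r (hv.lt_n r hr) s hsn, h.phi_succ hi hd hs hr hsn h0, h.phi_succ hi hd hs hMr hsn h0]
    by_cases e : r ∈ (A.hitH (F.σ i)).erase M
    · rw [if_pos e, if_pos e, one_mul, Pi.add_apply, zmod_add_val]
    · rw [if_neg e, if_neg e, zero_mul, zmod_val_ite]
  · intro r hr w hwm
    obtain ⟨e, hr⟩ := Finset.mem_erase.1 hr
    rw [hU r e w (by omega)]
    exact h.U r hr w hwm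
  · intro r hr w hw0 s hsn
    obtain ⟨e, hr⟩ := Finset.mem_erase.1 hr
    have := h.wire_succ (q' := q') (c := A.wire (i + 1)) hv (g := μ' 10) (fun b _ => by rw [hw]) hr hw0 hsn
    rwa [Function.update_eq_self] at this

theorem deleteDeath (h : Stores F i A nm μ) (hv : A.Valid F i) (hi : i < F.m)
    (hd : F.dir i = false) (hs : SlotStep F i (nm i) q' f) {M : ℕ} (hM : M ∈ A.HR)
    (hv' : (A.deleteDeath (F.σ i) M).Valid F (i + 1))
    (htab : ∀ s < F.n, μ' 2 ((i + 1) * F.n + s) = q' s)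
    (htab' : ∀ b, b < (i + 1) * F.n ∨ (i + 1) * F.n + F.n ≤ b → μ' 2 b = μ 2 b)
    (hkind : ∀ r < F.n, μ' 3 r = if r = M then 0 else μ 3 r)
    (hbirth : μ' 4 = μ 4) (hkey : μ' 5 = μ 5)
    (hx : ∀ r < F.n, r ≠ M → ∀ s < F.n, μ' 6 (r * F.n + s) = if μ 6 (r * F.n + s) =
      (if r ∈ A.HR ∧ A.x r (F.σ i) = 1 then 1 else 0) * μ 6 (M * F.n + s) then 0 else 1)
    (hy : ∀ r < F.n, ∀ s < F.n, μ' 7 (r * F.n + s) = if μ 7 (r * F.n + s) =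
      (if r ∈ A.BR ∧ A.y r (F.σ i) = 1 then 1 else 0) * μ 6 (M * F.n + s) then 0 else 1)
    (hφ : μ' 8 = μ 8)
    (hU : ∀ r < F.n, r ≠ M → ∀ w < F.m + 1, μ' 9 (r * (F.m + 1) + w) =
      if μ 9 (r * (F.m + 1) + w) = (if r ∈ A.HR ∧ A.x r (F.σ i) = 1 then 1 else 0) *
        μ 9 (M * (F.m + 1) + w) then 0 else 1)
    (hw : μ' 10 = μ 10) :
    Stores F (i + 1) (A.deleteDeath (F.σ i) M) (Function.update nm (i + 1) q') μ' := by
  have ha := F.adds_of_bwd hi hd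
  have hMr := Decomp.HR_subset hM
  have hMB := hv.notMem_BR hM
  have hrows : ∀ {r}, r ∈ (A.deleteDeath (F.σ i) M).rows → r ≠ M ∧ r ∈ A.rows := fun {r} hr => by
    rcases Finset.mem_union.1 hr with hr | hr
    · exact ⟨(Finset.mem_erase.1 hr).1, Decomp.HR_subset (Finset.mem_erase.1 hr).2⟩
    · exact ⟨fun e => hMB (e ▸ hr), Decomp.BR_subset hr⟩
  have hsf : ∀ {s}, s < F.n → q' s ≠ 0 → q' s = nm i s := fun {s} hsn h0 => by
    refine hs.same s hsn fun e => h0 ?_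
    rw [e, (hs.bwd hd).2.2]
  refine ⟨(h.slots_succ hi hs).1, (h.slots_succ hi hs).2, h.tab_succ htab htab', ?_, ?_, ?_, ?_, ?_,
    ?_, ?_, ?_⟩
  · intro r hr
    rw [hkind r hr]
    by_cases e : r = M
    · simp [e, Decomp.kind, Decomp.deleteDeath, hMB]
    · rw [if_neg e, h.kind r hr]
      simp only [Decomp.kind, Decomp.deleteDeath, Finset.mem_erase, e, ne_eq, not_false_eq_true,
        true_and]
      congr
  · intro r hr
    rw [hbirth, h.birth r (hrows hr).2]
    rfl
  · intro r hr
    rw [hkey, h.key r (Finset.mem_of_mem_erase hr)]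
    rfl
  · intro r hr s hsn
    obtain ⟨e, hr'⟩ := hrows hr
    rw [Function.update_self, hs.bitAt_eq (ha.apply_eq_zero (mem_cycles.1 (hv'.x_mem hr)).1) hsn,
      masked_add (h.x r hr' s hsn) (h.x M hMr s hsn) (hx r (hv.lt_n r hr') e s hsn)]
    simp only [Decomp.deleteDeath]
    split_ifs
    · rw [bitAt_add]
    · rfl
  · intro r hr s hsn
    have hr' : r ∈ A.BR := hr
    rw [Function.update_self, hs.bitAt_eq (ha.apply_eq_zero (hv'.y_mem r hr)) hsn,
      masked_add (h.y r hr' s hsn) (h.x M hMr s hsn)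
      (hy r (hv.lt_n r (Decomp.BR_subset hr')) s hsn)]
    simp only [Decomp.deleteDeath, hr', true_and]
    split_ifs
    · rw [bitAt_add]
    · rfl
  · intro r hr s hsn h0
    rw [Function.update_self] at h0 ⊢
    have e := hsf hsn h0
    rw [e] at h0 ⊢
    rw [hφ, h.φ r (hrows hr).2 s hsn h0]
    rfl
  · intro r hr w hwm
    obtain ⟨e, hr⟩ := Finset.mem_erase.1 hr
    rw [masked_add (h.U r hr w hwm) (h.U M hM w hwm)
      (hU r (hv.lt_n r (Decomp.HR_subset hr)) e w (by omega))]
    simp only [Decomp.deleteDeath, hr, true_and]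
    split_ifs <;> rfl
  · intro r hr w hw0 s hsn
    obtain ⟨e, hr⟩ := Finset.mem_erase.1 hr
    -- A wire used after the addition was used by one of the two summands, hence its row in the
    -- memory is correct.
    have key : ∃ k ∈ A.HR, A.U k w ≠ 0 := by
      simp only [Decomp.deleteDeath] at hw0
      split_ifs at hw0
      · by_contra hn
        push Not at hn
        rw [Pi.add_apply, hn r hr, hn M hM] at hw0
        exact hw0 rfl
      · exact ⟨r, hr, hw0⟩
    obtain ⟨k, hk, hkw⟩ := key
    have := h.wire_succ (q' := q') (c := A.wire (i + 1)) hv (g := μ' 10) (fun b _ => by rw [hw]) hk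
      hkw hsn
    rwa [Function.update_eq_self] at this

theorem deleteBirth (h : Stores F i A nm μ) (hv : A.Valid F i) (hi : i < F.m)
    (hd : F.dir i = false) (hs : SlotStep F i (nm i) q' f) {M : ℕ} (hM : M ∈ A.BR)
    (hv' : (A.deleteBirth i (F.σ i) M).Valid F (i + 1))
    (htab : ∀ s < F.n, μ' 2 ((i + 1) * F.n + s) = q' s)
    (htab' : ∀ b, b < (i + 1) * F.n ∨ (i + 1) * F.n + F.n ≤ b → μ' 2 b = μ 2 b)
    (hkind : ∀ r < F.n, μ' 3 r = if r = M then 1 else μ 3 r)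
    (hbirth : ∀ r, μ' 4 r = if r = M then i + 1 else μ 4 r)
    (hkey : ∀ r, μ' 5 r = if r = M then F.m + 1 - (i + 1) else μ 5 r)
    (hx : ∀ r < F.n, ∀ s < F.n, μ' 6 (r * F.n + s) = if μ 6 (r * F.n + s) =
      (if r ∈ A.BR.erase M ∧ A.y r (F.σ i) = 1 then 1 else 0) * μ 6 (M * F.n + s) then 0 else 1)
    (hy : ∀ r < F.n, ∀ s < F.n, μ' 7 (r * F.n + s) = if μ 7 (r * F.n + s) =
      (if r ∈ A.BR.erase M ∧ A.y r (F.σ i) = 1 then 1 else 0) * μ 7 (M * F.n + s) then 0 else 1)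
    (hφ : ∀ r, ∀ s < F.n, nm i s ≠ 0 → μ' 8 (r * F.n + s) = if r = M then
      (∑ k ∈ A.BR.filter (fun r => A.y r (F.σ i) = 1), A.φ k (F.σ (nm i s - 1))).val
        else μ 8 (r * F.n + s))
    (hU : ∀ r, ∀ w < F.m + 1, μ' 9 (r * (F.m + 1) + w) =
      if r = M then (if w = i + 1 then 1 else 0) else μ 9 (r * (F.m + 1) + w))
    (hw : ∀ s < F.n, μ' 10 ((i + 1) * F.n + s) = μ' 6 (M * F.n + s))
    (hw' : ∀ b < (i + 1) * F.n, μ' 10 b = μ 10 b) :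
    Stores F (i + 1) (A.deleteBirth i (F.σ i) M) (Function.update nm (i + 1) q') μ' := by
  have ha := F.adds_of_bwd hi hd
  have hMr := Decomp.BR_subset hM
  have hMH := hv.notMem_HR hM
  have hrows : (A.deleteBirth i (F.σ i) M).rows = A.rows := by
    ext r
    simp only [Decomp.rows, Decomp.deleteBirth, Finset.mem_union, Finset.mem_erase,
      Finset.mem_insert]
    by_cases e : r = M <;> simp [e, hM]
  have hsf : ∀ {s}, s < F.n → q' s ≠ 0 → q' s = nm i s := fun {s} hsn h0 => by
    refine hs.same s hsn fun e => h0 ?_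
    rw [e, (hs.bwd hd).2.2]
  have hxx : ∀ r ∈ A.rows, ∀ s < F.n, μ' 6 (r * F.n + s) =
      (bitAt F (q' s) ((A.deleteBirth i (F.σ i) M).x r)).val := by
    intro r hr s hsn
    rw [hs.bitAt_eq (ha.apply_eq_zero (mem_cycles.1 (hv'.x_mem (hrows ▸ hr))).1) hsn,
      masked_add (h.x r hr s hsn) (h.x M hMr s hsn) (hx r (hv.lt_n r hr) s hsn)]
    simp only [Decomp.deleteBirth]
    split_ifs
    · rw [bitAt_add]
    · rfl
  have hne : ∀ {r}, r ∈ A.HR → r ≠ M := fun hr e => hMH (e ▸ hr)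
  refine ⟨(h.slots_succ hi hs).1, (h.slots_succ hi hs).2, h.tab_succ htab htab', ?_, ?_, ?_, ?_, ?_,
    ?_, ?_, ?_⟩
  · intro r hr
    rw [hkind r hr]
    by_cases e : r = M
    · simp [e, Decomp.kind, Decomp.deleteBirth]
    · rw [if_neg e, h.kind r hr]
      simp only [Decomp.kind, Decomp.deleteBirth, Finset.mem_erase, Finset.mem_insert, e, ne_eq,
        not_false_eq_true, true_and, false_or]
  · intro r hr
    rw [hrows] at hr
    rw [hbirth r]
    change _ = Function.update A.birth M (i + 1) r
    rw [Function.update_apply]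
    split_ifs with e
    · rfl
    · exact h.birth r hr
  · intro r hr
    rw [hkey r]
    change _ = F.key (Function.update A.birth M (i + 1) r)
    rw [Function.update_apply]
    split_ifs with e
    · rw [Filtration.key, Nat.add_sub_cancel, if_neg (by simp [hd])]
    · exact h.key r (Finset.mem_of_mem_insert_of_ne hr e)
  · intro r hr s hsn
    rw [Function.update_self]
    exact hxx r (hrows ▸ hr) s hsn
  · intro r hr s hsn
    obtain ⟨e, hr'⟩ := Finset.mem_erase.1 hr
    rw [Function.update_self, hs.bitAt_eq (ha.apply_eq_zero (hv'.y_mem r hr)) hsn,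
      masked_add (h.y r hr' s hsn) (h.y M hM s hsn)
      (hy r (hv.lt_n r (Decomp.BR_subset hr')) s hsn)]
    have hr'' : r ∈ A.BR.erase M := hr
    simp only [Decomp.deleteBirth, hr'', true_and]
    split_ifs
    · rw [bitAt_add]
    · rfl
  · intro r hr s hsn h0
    rw [Function.update_self] at h0 ⊢
    have e := hsf hsn h0
    rw [e] at h0 ⊢
    rw [hrows] at hr
    change _ = (Function.update A.φ M (∑ r ∈ A.BR.filter (fun r => A.y r (F.σ i) = 1), A.φ r) r
      (F.σ (nm i s - 1))).val
    rw [hφ r s hsn h0, Function.update_apply]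
    split_ifs
    · rw [Finset.sum_apply]
    · exact h.φ r hr s hsn h0
  · intro r hr w hwm
    rw [hU r w (by omega)]
    change _ = (Function.update A.U M (Pi.single (i + 1) 1) r w).val
    rw [Function.update_apply]
    by_cases e : r = M
    · rw [if_pos e, if_pos e, single_val]
    · rw [if_neg e, if_neg e]
      exact h.U r (Finset.mem_of_mem_insert_of_ne hr e) w hwm
  · intro r hr w hw0 s hsn
    change Function.update A.U M (Pi.single (i + 1) 1) r w ≠ 0 at hw0
    rw [Function.update_apply] at hw0
    split_ifs at hw0 with e
    · refine wire_newborn (c := A.x M) (fun s hsn => ?_) hw0 hsn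
      rw [hw s hsn, hxx M hMr s hsn]
      simp [Decomp.deleteBirth]
    · exact h.wire_succ hv hw' (Finset.mem_of_mem_insert_of_ne hr e) hw0 hsn

end Stores

/-- The parameters of a run leave enough room for the filtration. -/
structure Room (F : Filtration) (X : Limits) : Prop where
  n_le : F.n ≤ F.m
  β0 : X.β 0 = F.n
  β1 : X.β 1 = F.m
  β2 : X.β 2 = F.m + 1
  β3 : ∀ i < F.m, (F.σ i).card ≤ X.β 3
  tab : (F.m + 1) * F.n ≤ X.S
  input : F.encode.length ≤ X.S
  m_lt : F.m + 2 ≤ X.S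
  S_le : X.S ≤ X.B
  B_ge : 2 * F.m + 3 ≤ X.B
  input_le : ∀ v ∈ F.encode, v ≤ X.B
  mul_le : ∀ j < F.m, ∀ i < F.m, (F.σ j).card * (F.σ i).card ≤ X.B

theorem Room.sq_le {F : Filtration} {X : Limits} (hX : Room F X) : F.n * F.n ≤ X.S :=
  (Nat.mul_le_mul_right _ (hX.n_le.trans (Nat.le_succ _))).trans hX.tab

theorem Room.tab' {F : Filtration} {X : Limits} (hX : Room F X) : F.n * (F.m + 1) ≤ X.S :=
  (Nat.mul_comm _ _).trans_le hX.tab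

namespace Cmd

/-! ## Writing a bar -/

/-- Write the cycle in the array `11` as one of the complex at the index `α`; the environment is
`[n, α]`. -/
def emitCycle : Cmd :=
  block [count 0 (.var 0) 19 (.load 11 (.var 3)), emit (.load 19 (.lit 0)),
    loop 0 (.var 0) (ite (.lit 0) (.load 11 (.var 3))
      (emit (.load 2 (.var 1 * .var 0 + .var 3) - .lit 1)) skip)]

/-- Write the cycles at the indices up to `d`; the environment is `[m, n, r, d]`, and the cycle at
the index `α`, the variable `5`, is computed by `pre`. -/
def emitCycles (pre : Cmd) : Cmd :=
  loop 2 (.var 3 + .lit 1) (block [pre,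
    ite (.var 5) (.load 4 (.var 2)) skip (call [.var 1, .var 5] emitCycle)])

/-- Write the homology bar of the row `r` with the death index `d`; the environment is
`[m, n, r, d]`. -/
def emitHomology : Cmd :=
  block [emit (.lit 0), emit (.load 4 (.var 2)), emit (.var 3),
    call [.var 1, .lit 0, .lit 0, .lit 0, .lit 0] (fillRow 0 11 (.lit 0)),
    emitCycles (call [.var 1, .lit 0, .var 2 * (.var 0 + .lit 1) + .var 5, .var 5 * .var 1, .lit 0]
      (fillRow 0 11 (Ex.neb (.load 11 (.var 6)) (.load 9 (.var 2) * .load 10 (.var 3 + .var 6)))))]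

/-- Write the boundary bar of the row `r` with the death index `d`; the environment is
`[m, n, r, d]`. -/
def emitBoundary : Cmd :=
  block [emit (.lit 1), emit (.load 4 (.var 2)), emit (.var 3),
    call [.var 1, .lit 0, .var 2 * .var 1, .lit 0, .lit 0] (fillRow 0 11 (.load 6 (.var 2 + .var 6))),
    emitCycles skip]

variable {F : Filtration} {X : Limits} {μ : ℕ → ℕ → ℕ} {o : List ℕ}
  {Q : (ℕ → ℕ → ℕ) → List ℕ → Prop} {q : ℕ → ℕ} {α : ℕ} {c : Chain}

theorem wp_emitCycle (hX : Room F X) (hα : α ≤ F.m) (hq : SlotsAt F α q)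
    (htab : ∀ s < F.n, μ 2 (α * F.n + s) = q s) (hc : c ∈ chains (F.K α))
    (hZ : ∀ s < F.n, μ 11 s = (bitAt F (q s) c).val)
    (hQ : ∀ g js, F.Denotes js c → Q (upd μ 19 g) (o ++ js.length :: js)) :
    emitCycle.wp X [F.n, α] μ o Q := by
  have hn := hX.n_le
  have hS := hX.m_lt
  have hSB := hX.S_le
  have hB := hX.B_ge
  have hbit : ∀ s < F.n, μ 11 s ≤ 1 := fun s hs => hZ s hs ▸ zmod_val_le _
  refine wp_block_cons (wp_count (fun s => μ 11 s) (by omega) (fun g => by simp) hX.β0.ge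
    (fun j hj g => ⟨by simp; omega, by simp [upd_apply]⟩) (fun j hj => ?_) fun g hg => ?_)
  · calc ∑ k ∈ Finset.range (j + 1), μ 11 k ≤ ∑ k ∈ Finset.range (j + 1), 1 :=
          Finset.sum_le_sum fun k hk => hbit k (by have := Finset.mem_range.1 hk; omega)
      _ ≤ X.B := by simp; omega
  · refine wp_block_cons ⟨by simp; omega, ?_⟩
    refine wp_block_cons (wp_emits (fun s => μ 11 s) (fun s => q s - 1) (by simp) (by simp)
      hX.β0.ge (fun j hj => ?_) ?_)
    · have h1 := row_lt (show α < F.m + 1 by omega) hj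
      have h2 := hX.tab
      refine ⟨⟨by simp; omega, by simp [upd_apply]⟩, by simp; omega, ?_⟩
      simp [upd_apply, htab j hj]
    · refine wp_block_nil ?_
      have hd := hq.denotes hc hZ
      have hl : (((List.range F.n).filter fun s => 0 < μ 11 s).map fun s => q s - 1).length =
          (Ex.load 19 (.lit 0)).eval [F.n, α] (upd μ 19 g) := by
        rw [List.length_map, length_filter_bits _ hbit]
        simp [hg]
      have := hQ g _ hd
      rw [hl] at this
      simpa using this

/-- The cycles `z α` at the indices from `b` to `d` are listed in `cyc`. -/
def Lists (F : Filtration) (b d : ℕ) (z : ℕ → Chain) (cyc : List (List ℕ)) : Prop :=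
  cyc.length = d + 1 - b ∧ ∀ α, b ≤ α → α ≤ d → F.Denotes (cyc.getD (α - b) []) (z α)

/-- `J α` describes the memory before `pre` runs at `α` and `J' α` the memory afterwards. Array `19`
holds the length counter, so the invariant must tolerate its being overwritten. The loop starts at
index zero and writes nothing before `b`. -/
theorem wp_emitCycles {pre : Cmd} {r b d : ℕ} {nm : ℕ → ℕ → ℕ} {z : ℕ → Chain}
    (J J' : ℕ → (ℕ → ℕ → ℕ) → Prop) (hX : Room F X) (hd : d ≤ F.m) (hr : r < F.n)
    (hq : ∀ α ≤ d, SlotsAt F α (nm α)) (hz : ∀ α, b ≤ α → α ≤ d → z α ∈ chains (F.K α))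
    (h0 : J 0 μ)
    (hpre : ∀ α ≤ d, ∀ μ', J α μ' → ∀ o, pre.wp X [F.m, F.n, r, d, d + 1, α] μ' o
      fun μ'' o' => o' = o ∧ J' α μ'')
    (hJ' : ∀ α ≤ d, ∀ μ', J' α μ' → J (α + 1) μ' ∧ ∀ g, J (α + 1) (upd μ' 19 g))
    (hJ : ∀ α ≤ d, ∀ μ', J' α μ' → μ' 4 r = b ∧ (∀ s < F.n, μ' 2 (α * F.n + s) = nm α s) ∧
      (b ≤ α → ∀ s < F.n, μ' 11 s = (bitAt F (nm α s) (z α)).val))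
    (hQ : ∀ μ' cyc, J (d + 1) μ' → Lists F b d z cyc →
      Q μ' (o ++ cyc.flatMap fun js => js.length :: js)) :
    (emitCycles pre).wp X [F.m, F.n, r, d] μ o Q := by
  have hn := hX.n_le
  have hS := hX.m_lt
  have hSB := hX.S_le
  have hB := hX.B_ge
  refine ⟨by simp, by simp [hX.β2]; omega, fun k μ' o' => J k μ' ∧ ∃ cyc : List (List ℕ),
    o' = o ++ cyc.flatMap (fun js => js.length :: js) ∧ cyc.length = k - b ∧
      ∀ α, b ≤ α → α < k → F.Denotes (cyc.getD (α - b) []) (z α),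
    ⟨h0, [], by simp, by simp, fun α _ h => absurd h (Nat.not_lt_zero _)⟩, ?_, ?_⟩
  · rintro α hα μ' o' ⟨hj, cyc, rfl, hlen, hden⟩
    have hα' : α ≤ d := by
      simp at hα
      omega
    refine wp_block_cons (wp_mono _ (hpre α hα' μ' hj _) ?_)
    rintro μ'' o' ⟨rfl, hj'⟩
    obtain ⟨h4, h2, h11⟩ := hJ α hα' μ'' hj'
    refine wp_block_cons ⟨by simp, by simp; omega, fun hlt => ?_, fun hlt => ?_⟩
    · simp [h4] at hlt
      refine wp_block_nil ⟨(hJ' α hα' _ hj').1, cyc, rfl, by omega, fun β h1 h2 => by omega⟩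
    · simp [h4] at hlt
      refine wp_call [F.n, α] (by simp) (by simp) (by simp; omega) ?_
      refine wp_emitCycle hX (by omega) (hq α hα') h2 (hz α hlt hα') (h11 hlt) fun g js hjs => ?_
      refine wp_block_nil ⟨(hJ' α hα' _ hj').2 g, cyc ++ [js], by simp, ?_, fun β h1 h2 => ?_⟩
      · simp
        omega
      · rcases Nat.lt_succ_iff_lt_or_eq.1 h2 with h3 | rfl
        · rw [List.getD_append _ _ _ _ (by omega)]
          exact hden β h1 h3
        · rw [List.getD_append_right _ _ _ _ (by omega), hlen, Nat.sub_self]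
          exact hjs
  · rintro μ' o' ⟨hj, cyc, rfl, hlen, hden⟩
    simp at hj hlen hden
    exact hQ μ' cyc hj ⟨hlen, fun α h1 h2 => hden α h1 (by omega)⟩

/-- Array `11` carries the running sum of the wires: at `α` the wire `α` is added if the bundle
contains it. A term then costs `O(n)`, which is what makes a bar cost `O(mn)`. -/
theorem wp_emitHomology {r b d : ℕ} {nm : ℕ → ℕ → ℕ} {u : ℕ → ZMod 2} {wire : ℕ → Chain}
    (hX : Room F X) (hd : d ≤ F.m) (hr : r < F.n)
    (hq : ∀ α ≤ d, SlotsAt F α (nm α)) (hstep : ∀ α < d, ∃ f, SlotStep F α (nm α) (nm (α + 1)) f)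
    (htab : ∀ α ≤ d, ∀ s < F.n, μ 2 (α * F.n + s) = nm α s) (hb : μ 4 r = b)
    (hu : ∀ w ≤ F.m, μ 9 (r * (F.m + 1) + w) = (u w).val)
    (hw : ∀ w ≤ d, u w ≠ 0 → ∀ s < F.n, μ 10 (w * F.n + s) = (bitAt F (nm w s) (wire w)).val)
    (hwire : ∀ w, u w ≠ 0 → wire w ∈ chains (F.K w))
    (hz : ∀ α ≤ d, bundleChain wire u α ∈ chains (F.K α))
    (hQ : ∀ μ' cyc, (∀ A, A ≠ 11 → A ≠ 19 → μ' A = μ A) → Lists F b d (bundleChain wire u) cyc →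
      Q μ' (o ++ ([0, b, d] ++ cyc.flatMap fun js => js.length :: js))) :
    emitHomology.wp X [F.m, F.n, r, d] μ o Q := by
  have hn := hX.n_le
  have hS := hX.m_lt
  have hSB := hX.S_le
  have hB := hX.B_ge
  -- The running sum has to be reinterpreted over the slots at `α + 1`, so it must avoid `σ α`. At
  -- an insertion this is clear; at a deletion the next term and the wire `α + 1` avoid `σ α`, hence
  -- so does their difference.
  have hstep0 : ∀ α < d, bundleChain wire u α (F.σ α) = 0 := by
    intro α hα
    have hαm : α < F.m := by omega
    rcases Bool.eq_false_or_eq_true (F.dir α) with hdir | hdir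
    · exact (F.adds_of_fwd hαm hdir).apply_eq_zero (hz α hα.le)
    · have ha := F.adds_of_bwd hαm hdir
      have h1 : bundleChain wire u (α + 1) = bundleChain wire u α + u (α + 1) • wire (α + 1) :=
        Finset.sum_range_succ _ _
      have h2 := ha.apply_eq_zero (hz (α + 1) hα)
      have h3 : (u (α + 1) • wire (α + 1)) (F.σ α) = 0 := by
        rcases zmod_two_cases (u (α + 1)) with h0 | h0
        · simp [h0]
        · rw [h0, one_smul]
          exact ha.apply_eq_zero (hwire _ (by rw [h0]; decide))
      rwa [h1, Finsupp.add_apply, h3, add_zero] at h2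
  refine wp_block_cons ⟨by simp, wp_block_cons ⟨by simp; omega, wp_block_cons ⟨by simp, ?_⟩⟩⟩
  refine wp_block_cons (wp_call [F.n, 0, 0, 0, 0] (by simp) (by simp) (by simp; omega) ?_)
  refine wp_fillRow (fun _ => 0) hX.β0.ge (by omega) (fun k hk g _ _ => by simp) fun g hg _ => ?_
  refine wp_block_cons (wp_emitCycles (nm := nm) (z := bundleChain wire u) (b := b)
    (fun k μ' => (∀ A, A ≠ 11 → A ≠ 19 → μ' A = μ A) ∧
      (k ≤ d → ∀ s < F.n, μ' 11 s = (bitAt F (nm k s) (∑ w ∈ Finset.range k, u w • wire w)).val))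
    (fun k μ' => (∀ A, A ≠ 11 → A ≠ 19 → μ' A = μ A) ∧
      (∀ s < F.n, μ' 11 s = (bitAt F (nm k s) (bundleChain wire u k)).val))
    hX hd hr hq (fun α _ h => hz α h) ⟨fun A h1 _ => by rw [upd_apply, if_neg h1], fun _ s hs => ?_⟩
    ?_ ?_ ?_ ?_)
  · have := hg s hs
    rw [zero_add] at this
    simp [this]
  · rintro α hα μ' ⟨h1, h2⟩ o'
    refine wp_call [F.n, 0, r * (F.m + 1) + α, α * F.n, 0] (by simp) (by simp) ?_ ?_
    · have e1 := row_lt hr (show α < F.m + 1 by omega)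
      have e2 : α * F.n ≤ (F.m + 1) * F.n := Nat.mul_le_mul_right _ (by omega)
      have e3 := hX.tab
      have e4 := hX.tab'
      simp
      omega
    · refine wp_fillRow (fun s => (bitAt F (nm α s) (bundleChain wire u α)).val) hX.β0.ge (by omega)
        (fun s hs g e _ => ?_) fun g hg _ => ⟨rfl, fun A e1 e2 => ?_, fun s hs => ?_⟩
      · have e1 := row_lt hr (show α < F.m + 1 by omega)
        have e2 := row_lt (show α < F.m + 1 by omega) hs
        have e3 := hX.tab
        have e4 := hX.tab'
        refine ⟨by simp; omega, ?_, (zmod_val_le _).trans (by omega)⟩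
        rw [zero_add] at e
        have e5 : bundleChain wire u α =
          ∑ w ∈ Finset.range α, u w • wire w + u α • wire α := Finset.sum_range_succ _ _
        simp only [Ex.eval_neb, Ex.eval_load, Ex.eval_var, Ex.eval_mul, Ex.eval_add, upd_apply,
          List.getD_cons_zero, List.getD_cons_succ]
        simp only [Nat.reduceEqDiff, if_false, if_true, e, h2 hα s hs, h1 9 (by decide) (by decide),
          h1 10 (by decide) (by decide), hu α (by omega)]
        rw [e5, bitAt_add, zmod_add_val, bitAt_smul]
        rcases zmod_two_cases (u α) with h0 | h0
        · simp [h0]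
        · rw [hw α hα (by rw [h0]; decide) s hs, h0, one_mul,
            show (1 : ZMod 2).val = 1 from rfl, one_mul]
      · rw [upd_apply, if_neg e1, h1 A e1 e2]
      · have := hg s hs
        rw [zero_add] at this
        rw [upd_self, this]
  · rintro α hα μ' ⟨h1, h2⟩
    have h3 : α + 1 ≤ d → ∀ s < F.n, μ' 11 s =
        (bitAt F (nm (α + 1) s) (∑ w ∈ Finset.range (α + 1), u w • wire w)).val := by
      intro hαd s hs
      obtain ⟨f, hf⟩ := hstep α hαd
      rw [h2 s hs, ← hf.bitAt_eq (hstep0 α hαd) hs]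
      rfl
    refine ⟨⟨h1, h3⟩, fun g => ⟨fun A e1 e2 => ?_, fun e s hs => ?_⟩⟩
    · rw [upd_apply, if_neg e2, h1 A e1 e2]
    · rw [upd_apply, if_neg (by decide), h3 e s hs]
  · rintro α hα μ' ⟨h1, h2⟩
    rw [h1 4 (by decide) (by decide), h1 2 (by decide) (by decide)]
    exact ⟨hb, htab α hα, fun _ => h2⟩
  · rintro μ' cyc ⟨h1, -⟩ hl
    have := hQ μ' cyc h1 hl
    refine wp_block_nil ?_
    simpa [hb] using this

/-- All terms are the same chain, so one bit row serves all indices. -/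
theorem wp_emitBoundary {r b d : ℕ} {nm : ℕ → ℕ → ℕ} {x : Chain}
    (hX : Room F X) (hd : d ≤ F.m) (hr : r < F.n)
    (hq : ∀ α ≤ d, SlotsAt F α (nm α)) (hstep : ∀ α < d, ∃ f, SlotStep F α (nm α) (nm (α + 1)) f)
    (htab : ∀ α ≤ d, ∀ s < F.n, μ 2 (α * F.n + s) = nm α s) (hb : μ 4 r = b)
    (hx : ∀ s < F.n, μ 6 (r * F.n + s) = (bitAt F (nm d s) x).val)
    (hz : ∀ α, b ≤ α → α ≤ d → x ∈ chains (F.K α))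
    (hQ : ∀ μ' cyc, (∀ A, A ≠ 11 → A ≠ 19 → μ' A = μ A) → Lists F b d (fun _ => x) cyc →
      Q μ' (o ++ ([1, b, d] ++ cyc.flatMap fun js => js.length :: js))) :
    emitBoundary.wp X [F.m, F.n, r, d] μ o Q := by
  have hn := hX.n_le
  have hS := hX.m_lt
  have hSB := hX.S_le
  have hB := hX.B_ge
  -- Downward induction from `d` to `α`: the chain lies in all complexes between, so it avoids every
  -- simplex that is changed on the way.
  have key : ∀ k α, α + k = d → b ≤ α → ∀ s < F.n, bitAt F (nm d s) x = bitAt F (nm α s) x := by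
    intro k
    induction k with
    | zero =>
      rintro α rfl _ s _
      rfl
    | succ k ih =>
      intro α hα hbα s hs
      rw [ih (α + 1) (by omega) (by omega) s hs]
      obtain ⟨f, hf⟩ := hstep α (by omega)
      refine hf.bitAt_eq ?_ hs
      have hαm : α < F.m := by omega
      rcases Bool.eq_false_or_eq_true (F.dir α) with hdir | hdir
      · exact (F.adds_of_fwd hαm hdir).apply_eq_zero (hz α hbα (by omega))
      · exact (F.adds_of_bwd hαm hdir).apply_eq_zero (hz (α + 1) (by omega) (by omega))
  refine wp_block_cons ⟨by simp, wp_block_cons ⟨by simp; omega, wp_block_cons ⟨by simp, ?_⟩⟩⟩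
  have e0 := Nat.mul_le_mul_right F.n hr.le
  have e1 := hX.sq_le
  refine wp_block_cons (wp_call [F.n, 0, r * F.n, 0, 0] (by simp) (by simp) (by simp; omega) ?_)
  refine wp_fillRow (fun s => (bitAt F (nm d s) x).val) hX.β0.ge (by omega) (fun s hs g _ _ => ?_)
    fun g hg _ => ?_
  · have := row_lt hr hs
    exact ⟨by simp; omega, by simp [upd_apply, hx s hs], (zmod_val_le _).trans (by omega)⟩
  refine wp_block_cons (wp_emitCycles (nm := nm) (z := fun _ => x) (b := b)
    (fun k μ' => (∀ A, A ≠ 11 → A ≠ 19 → μ' A = μ A) ∧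
      ∀ s < F.n, μ' 11 s = (bitAt F (nm d s) x).val)
    (fun k μ' => (∀ A, A ≠ 11 → A ≠ 19 → μ' A = μ A) ∧
      ∀ s < F.n, μ' 11 s = (bitAt F (nm d s) x).val)
    hX hd hr hq hz ⟨fun A h1 _ => by rw [upd_apply, if_neg h1], fun s hs => ?_⟩
    ?_ ?_ ?_ ?_)
  · have := hg s hs
    rw [zero_add] at this
    rw [upd_self, this]
  · exact fun α hα μ' h o' => ⟨rfl, h⟩
  · rintro α hα μ' ⟨h1, h2⟩
    refine ⟨⟨h1, h2⟩, fun g => ⟨fun A e1 e2 => ?_, fun s hs => ?_⟩⟩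
    · rw [upd_apply, if_neg e2, h1 A e1 e2]
    · rw [upd_apply, if_neg (by decide), h2 s hs]
  · rintro α hα μ' ⟨h1, h2⟩
    rw [h1 4 (by decide) (by decide), h1 2 (by decide) (by decide)]
    refine ⟨hb, htab α hα, fun hbα s hs => ?_⟩
    rw [h2 s hs, key (d - α) α (by omega) hbα s hs]
  · rintro μ' cyc ⟨h1, -⟩ hl
    have := hQ μ' cyc h1 hl
    refine wp_block_nil ?_
    simpa [hb] using this

end Cmd

/-! ## Reading the input -/

theorem length_flatMap_range (f : ℕ → List ℕ) (m : ℕ) :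
    ((List.range m).flatMap f).length = ∑ j ∈ Finset.range m, (f j).length := by
  induction m with
  | zero => rfl
  | succ m ih => simp [List.range_succ, Finset.sum_range_succ, ih]

theorem getD_flatMap_range (f : ℕ → List ℕ) {m i a : ℕ} (hi : i < m) (ha : a < (f i).length) :
    ((List.range m).flatMap f).getD (∑ j ∈ Finset.range i, (f j).length + a) 0 = (f i).getD a 0 := by
  induction m with
  | zero => omega
  | succ m ih =>
    rw [List.range_succ, List.flatMap_append]
    rcases Nat.lt_succ_iff_lt_or_eq.1 hi with h | rfl
    · rw [List.getD_append _ _ _ _ ?_]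
      · exact ih h
      · rw [length_flatMap_range]
        calc _ < ∑ j ∈ Finset.range i, (f j).length + (f i).length := by omega
          _ = ∑ j ∈ Finset.range (i + 1), (f j).length := (Finset.sum_range_succ _ _).symm
          _ ≤ _ := Finset.sum_le_sum_of_subset (Finset.range_mono h)
    · rw [List.getD_append_right _ _ _ _ (by rw [length_flatMap_range]; omega), length_flatMap_range,
        Nat.add_sub_cancel_left]
      simp

namespace Filtration

variable (F : Filtration)

/-- The address of the record of the simplex `σ i` in the input. -/
def offset (i : ℕ) : ℕ := 1 + ∑ j ∈ Finset.range i, ((F.σ j).card + 2)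

theorem offset_succ (i : ℕ) : F.offset (i + 1) = F.offset i + 2 + (F.σ i).card := by
  rw [offset, offset, Finset.sum_range_succ]
  omega

theorem encode_getD {i a : ℕ} (hi : i < F.m) (ha : a < (F.σ i).card + 2) :
    F.encode.getD (F.offset i + a) 0 =
      ((if F.dir i then 1 else 0) :: (F.σ i).card :: (F.σ i).sort (· ≤ ·)).getD a 0 := by
  rw [offset, add_assoc, add_comm, encode, List.getD_cons_succ]
  have := getD_flatMap_range (fun i => (if F.dir i then 1 else 0) :: (F.σ i).card ::
    (F.σ i).sort (· ≤ ·)) hi (a := a) (by simp; omega)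
  simpa using this

theorem length_encode : F.encode.length = F.offset F.m := by
  rw [encode, List.length_cons, length_flatMap_range, offset, add_comm]
  simp

theorem offset_mono {i j : ℕ} (h : i ≤ j) : F.offset i ≤ F.offset j :=
  Nat.add_le_add_left (Finset.sum_le_sum_of_subset (Finset.range_mono h)) 1

theorem offset_lt {i : ℕ} (hi : i < F.m) : F.offset i + 2 + (F.σ i).card ≤ F.encode.length := by
  rw [← F.offset_succ, length_encode]
  exact F.offset_mono hi

end Filtration

theorem sum_range_sort (s : Finset ℕ) (f : ℕ → ℕ) :
    ∑ a ∈ Finset.range s.card, f ((s.sort (· ≤ ·)).getD a 0) = ∑ x ∈ s, f x := by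
  have h1 : ∀ l : List ℕ, ∑ a ∈ Finset.range l.length, f (l.getD a 0) = (l.map f).sum := by
    intro l
    induction l with
    | nil => rfl
    | cons x l ih =>
      rw [List.length_cons, Finset.sum_range_succ']
      simp only [List.getD_cons_succ, List.getD_cons_zero, ih, List.map_cons, List.sum_cons]
      omega
  have h2 := h1 (s.sort (· ≤ ·))
  rw [Finset.length_sort] at h2
  rw [h2, ← List.sum_toFinset _ (Finset.sort_nodup _ _), Finset.sort_toFinset]

theorem sum_eq_card_inter (s t : Finset ℕ) :
    ∑ x ∈ s, ∑ y ∈ t, (if x = y then 1 else 0) = (s ∩ t).card := by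
  rw [Finset.card_eq_sum_ones, ← Finset.filter_mem_eq_inter, Finset.sum_filter]
  exact Finset.sum_congr rfl fun x _ => Finset.sum_ite_eq t x fun _ => 1

/-- The input, and the addresses of the records in it. -/
structure Input (F : Filtration) (μ : ℕ → ℕ → ℕ) : Prop where
  word : ∀ a, μ 0 a = F.encode.getD a 0
  pos : ∀ j < F.m, μ 1 j = F.offset j + 1

namespace Input

variable {F : Filtration} {μ : ℕ → ℕ → ℕ} {j a : ℕ}

theorem card (h : Input F μ) (hj : j < F.m) : μ 0 (F.offset j + 1) = (F.σ j).card := by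
  rw [h.word, F.encode_getD hj (by omega)]
  rfl

theorem dir (h : Input F μ) (hj : j < F.m) : μ 0 (F.offset j) = if F.dir j then 1 else 0 := by
  rw [h.word, ← add_zero (F.offset j), F.encode_getD hj (by omega)]
  rfl

theorem vertex (h : Input F μ) (hj : j < F.m) (ha : a < (F.σ j).card) :
    μ 0 (F.offset j + 1 + 1 + a) = ((F.σ j).sort (· ≤ ·)).getD a 0 := by
  rw [h.word, add_assoc, add_assoc, F.encode_getD hj (by omega), show 1 + (1 + a) = a + 2 by omega]
  rfl

end Input

namespace Cmd

/-- Compute the size of the intersection of the simplex in each slot with `σ i`; the environment is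
`[m, n, i]`. -/
def overlap : Cmd :=
  loop 0 (.var 1) (letv (.load 1 (.load 2 (.var 2 * .var 1 + .var 4) - .lit 1))
    (block [store 16 (.var 4) (.lit 0),
      loop 3 (.load 0 (.var 5)) (loop 3 (.load 0 (.load 1 (.var 2)))
        (store 16 (.var 4) (.load 16 (.var 4) + Ex.eqb (.load 0 (.var 5 + .lit 1 + .var 7))
          (.load 0 (.load 1 (.var 2) + .lit 1 + .var 9)))))]))

/-- Mark the slots with a face of `σ i` of codimension `t`; the environment is
`[n, 0, i * n, t, i]`. -/
def markFaces (A : ℕ) : Cmd :=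
  fillRow 0 A (Ex.neb (.load 2 (.var 2 + .var 6)) (.lit 0) *
    (Ex.eqb (.load 16 (.var 6)) (.load 0 (.load 1 (.load 2 (.var 2 + .var 6) - .lit 1))) *
    Ex.eqb (.load 0 (.load 1 (.load 2 (.var 2 + .var 6) - .lit 1)) + .var 3)
      (.load 0 (.load 1 (.var 4)))))

/-- Mark the slots with the facets of `σ i` in the array `12` and the slot with `σ i` in the array
`13`; the environment is `[m, n, i]`. -/
def scan : Cmd :=
  block [overlap, call [.var 1, .lit 0, .var 2 * .var 1, .lit 1, .var 2] (markFaces 12),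
    call [.var 1, .lit 0, .var 2 * .var 1, .lit 0, .var 2] (markFaces 13)]

variable {F : Filtration} {X : Limits} {μ : ℕ → ℕ → ℕ} {o : List ℕ}
  {Q : (ℕ → ℕ → ℕ) → List ℕ → Prop} {q : ℕ → ℕ} {i : ℕ}

/-- The intersection is counted by comparing all pairs of vertices. With `k` the largest number of
vertices this takes at most `k ^ 2` comparisons per slot, and `k ^ 2 ≤ 2 n`. -/
theorem wp_overlap (hX : Room F X) (hi : i < F.m) (hin : Input F μ) (hq : ∀ s < F.n, q s ≤ F.m)
    (htab : ∀ s < F.n, μ 2 (i * F.n + s) = q s)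
    (hQ : ∀ g : ℕ → ℕ, (∀ s < F.n, g s = (F.σ (q s - 1) ∩ F.σ i).card) → Q (upd μ 16 g) o) :
    overlap.wp X [F.m, F.n, i] μ o Q := by
  have hn := hX.n_le
  have hS := hX.m_lt
  have hSB := hX.S_le
  have hB := hX.B_ge
  have hin' := hX.input
  have hoi := F.offset_lt hi
  have hci := hX.β3 i hi
  refine wp_each (A := 16) (fun s => s) (fun s => (F.σ (q s - 1) ∩ F.σ i).card) (by simp) (by simp)
    hX.β0.ge (fun j k h _ => by omega) (fun s hs g _ _ => ?_) fun g h1 _ => hQ g h1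
  -- An empty slot is treated as if it held `σ 0`, which exists because `i < m`; `markFaces`
  -- discards the result.
  have hjm : q s - 1 < F.m := by
    have := hq s hs
    omega
  have hoj := F.offset_lt hjm
  have hcj := hX.β3 _ hjm
  set j := q s - 1 with hj
  have e1 := row_lt (show i < F.m + 1 by omega) hs
  have e2 := hX.tab
  refine wp_letv (F.offset j + 1) (by simp [upd_apply, htab s hs, ← hj]; omega)
    (by simp [upd_apply, htab s hs, ← hj, hin.pos j hjm]) (by omega) ?_
  refine wp_block_cons (wp_store s 0 (by simp) (by simp) (by simp) rfl (by omega) (Nat.zero_le _) ?_)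
  rw [upd_upd, upd_self]
  -- Every partial count is bounded by the number of pairs of vertices.
  have hle : ∀ a < (F.σ j).card, ∀ b ≤ (F.σ i).card, ∀ f : ℕ → ℕ → ℕ, (∀ x y, f x y ≤ 1) →
      ∑ x ∈ Finset.range a, ∑ y ∈ Finset.range (F.σ i).card, f x y +
        ∑ y ∈ Finset.range b, f a y ≤ X.B := by
    intro a ha b hb f hf
    calc _ ≤ ∑ x ∈ Finset.range a, ∑ y ∈ Finset.range (F.σ i).card, 1 +
          ∑ y ∈ Finset.range b, 1 := Nat.add_le_add (Finset.sum_le_sum fun x _ =>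
            Finset.sum_le_sum fun y _ => hf x y) (Finset.sum_le_sum fun y _ => hf a y)
      _ = a * (F.σ i).card + b := by simp
      _ ≤ (a + 1) * (F.σ i).card := by rw [Nat.add_mul]; omega
      _ ≤ (F.σ j).card * (F.σ i).card := Nat.mul_le_mul_right _ ha
      _ ≤ _ := hX.mul_le j hjm i hi
  obtain ⟨t, ht⟩ : ∃ t : ℕ → ℕ → ℕ, ∀ a b, t a b =
      if ((F.σ j).sort (· ≤ ·)).getD a 0 = ((F.σ i).sort (· ≤ ·)).getD b 0 then 1 else 0 :=
    ⟨_, fun _ _ => rfl⟩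
  have ht1 : ∀ a b, t a b ≤ 1 := fun a b => by
    rw [ht]
    split_ifs <;> omega
  refine wp_block_cons (wp_iterate (A := 16) s
    (fun a => ∑ x ∈ Finset.range a, ∑ y ∈ Finset.range (F.σ i).card, t x y)
    (by simp; omega) (by simp [upd_apply, hin.card hjm]) hcj (by simp) (fun a ha => ?_) ?_)
  · rw [upd_upd, upd_self, Function.update_idem]
    refine wp_iterate (A := 16) s (fun b => ∑ x ∈ Finset.range a, ∑ y ∈ Finset.range (F.σ i).card, t x y
      + ∑ y ∈ Finset.range b, t a y) (by simp [upd_apply, hin.pos i hi]; omega)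
      (by simp [upd_apply, hin.pos i hi, hin.card hi]) hci (by simp) (fun b hb => ?_) ?_
    · rw [upd_upd, upd_self, Function.update_idem]
      refine wp_store s (∑ x ∈ Finset.range a, ∑ y ∈ Finset.range (F.σ i).card, t x y
        + ∑ y ∈ Finset.range (b + 1), t a y) (by simp) ?_ (by simp) ?_ (by omega) ?_ ?_
      · simp [upd_apply, hin.pos i hi]
        omega
      · have v1 := hin.vertex hjm ha
        have v2 := hin.vertex hi hb
        simp only [Ex.eval_add, Ex.eval_load, Ex.eval_eqb, Ex.eval_var, Ex.eval_lit, upd_self,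
          List.cons_append, List.nil_append, List.getD_cons_zero, List.getD_cons_succ,
          Function.update_self]
        simp only [upd_apply, Nat.reduceEqDiff, if_false, hin.pos i hi, v1, v2, ← ht]
        rw [Finset.sum_range_succ _ b, add_assoc]
      · exact hle a ha (b + 1) hb t ht1
      · simp only [upd_upd, upd_self, Function.update_idem, and_self]
    · simp only [upd_upd, upd_self, Function.update_idem, Finset.sum_range_succ, and_self]
  · rw [upd_upd, upd_self, Function.update_idem]
    refine wp_block_nil ⟨?_, rfl⟩
    have h1 := sum_range_sort (F.σ j) fun x => ∑ y ∈ Finset.range (F.σ i).card,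
      if x = ((F.σ i).sort (· ≤ ·)).getD y 0 then 1 else 0
    have h2 : ∀ x, (∑ y ∈ Finset.range (F.σ i).card,
        if x = ((F.σ i).sort (· ≤ ·)).getD y 0 then 1 else 0) = ∑ y ∈ F.σ i, if x = y then 1 else 0 :=
      fun x => sum_range_sort (F.σ i) fun y => if x = y then 1 else 0
    rw [← sum_eq_card_inter, ← Finset.sum_congr rfl fun x _ => h2 x, ← h1]
    simp only [ht]

-- A set is contained in another one exactly if the intersection has its own size. With `t = 1` the
-- facets are marked, with `t = 0` the simplex itself.
open Classical in
theorem wp_markFaces {A t : ℕ} (hA : A ≠ 0 ∧ A ≠ 1 ∧ A ≠ 2 ∧ A ≠ 16) (hX : Room F X) (hi : i < F.m)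
    (hin : Input F μ) (hq : ∀ s < F.n, q s ≤ F.m)
    (htab : ∀ s < F.n, μ 2 (i * F.n + s) = q s)
    (h16 : ∀ s < F.n, μ 16 s = (F.σ (q s - 1) ∩ F.σ i).card)
    (hQ : ∀ g : ℕ → ℕ, (∀ s < F.n, g s = if q s ≠ 0 ∧ F.σ (q s - 1) ⊆ F.σ i ∧
      (F.σ (q s - 1)).card + t = (F.σ i).card then 1 else 0) → Q (upd μ A g) o) :
    (markFaces A).wp X [F.n, 0, i * F.n, t, i] μ o Q := by
  have hn := hX.n_le
  have hS := hX.m_lt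
  have hSB := hX.S_le
  have hB := hX.B_ge
  have hin' := hX.input
  have hoi := F.offset_lt hi
  obtain ⟨hA0, hA1, hA2, hA16⟩ := hA
  refine wp_fillRow (fun s => if q s ≠ 0 ∧ F.σ (q s - 1) ⊆ F.σ i ∧
    (F.σ (q s - 1)).card + t = (F.σ i).card then 1 else 0) hX.β0.ge (by omega)
    (fun s hs g _ _ => ?_) fun g hg _ => hQ g fun s hs => by rw [← hg s hs, zero_add]
  have hjm : q s - 1 < F.m := by
    have := hq s hs
    omega
  have hoj := F.offset_lt hjm
  have e1 := row_lt (show i < F.m + 1 by omega) hs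
  have e2 := hX.tab
  refine ⟨?_, ?_, ?_⟩
  · simp [upd_apply, hA1.symm, hA2.symm, htab s hs, hin.pos _ hjm, hin.pos i hi]
    omega
  · simp [upd_apply, hA0.symm, hA1.symm, hA2.symm, hA16.symm, htab s hs, hin.pos _ hjm, hin.pos i hi,
      hin.card hi, hin.card hjm, h16 s hs]
    have h1 : (F.σ (q s - 1) ∩ F.σ i).card = (F.σ (q s - 1)).card ↔ F.σ (q s - 1) ⊆ F.σ i := by
      constructor
      · intro h
        exact Finset.inter_eq_left.1 (Finset.eq_of_subset_of_card_le Finset.inter_subset_left h.ge)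
      · intro h
        rw [Finset.inter_eq_left.2 h]
    simp only [h1]
    by_cases a : q s = 0 <;> by_cases b : F.σ (q s - 1) ⊆ F.σ i <;> simp [a, b]
  · split_ifs <;> omega

open Classical in
theorem wp_scan (hX : Room F X) (hi : i < F.m) (hin : Input F μ) (hq : SlotsAt F i q)
    (htab : ∀ s < F.n, μ 2 (i * F.n + s) = q s)
    (hQ : ∀ g g' g'' : ℕ → ℕ,
      (∀ s < F.n, g' s = (bitAt F (q s) (boundary (simplexChain (F.σ i)))).val) →
      (∀ s < F.n, g'' s = if q s ≠ 0 ∧ F.σ (q s - 1) = F.σ i then 1 else 0) →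
      Q (upd (upd (upd μ 16 g) 12 g') 13 g'') o) :
    scan.wp X [F.m, F.n, i] μ o Q := by
  have hn := hX.n_le
  have hS := hX.m_lt
  have hSB := hX.S_le
  have hB := hX.B_ge
  have e1 : i * F.n ≤ (F.m + 1) * F.n := Nat.mul_le_mul_right _ (by omega)
  have e2 := hX.tab
  refine wp_block_cons (wp_overlap hX hi hin hq.le htab fun g hg => ?_)
  have hin1 : Input F (upd μ 16 g) := ⟨hin.word, hin.pos⟩
  refine wp_block_cons (wp_call [F.n, 0, i * F.n, 1, i] (by simp) (by simp) (by simp; omega) ?_)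
  refine wp_markFaces (by decide) hX hi hin1 hq.le htab hg fun g' hg' => ?_
  have hin2 : Input F (upd (upd μ 16 g) 12 g') := ⟨hin.word, hin.pos⟩
  refine wp_block_cons (wp_call [F.n, 0, i * F.n, 0, i] (by simp) (by simp) (by simp; omega) ?_)
  refine wp_markFaces (by decide) hX hi hin2 hq.le htab hg fun g'' hg'' => ?_
  refine wp_block_nil (hQ g g' g'' (fun s hs => ?_) fun s hs => ?_)
  · rw [hg' s hs, boundary_simplexChain]
    by_cases h0 : q s = 0
    · simp [h0]
    · have hne : (F.σ (q s - 1)).Nonempty := ((F.K i).isRelLowerSet_faces (hq.mem s hs h0)).1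
      rw [bitAt_of_ne h0, facetSum_apply]
      simp only [h0, hne, ne_eq, not_false_eq_true, true_and]
      split_ifs <;> rfl
  · rw [hg'' s hs]
    refine if_congr (and_congr_right fun _ => ⟨fun h => ?_, fun h => ?_⟩) rfl rfl
    · exact Finset.eq_of_subset_of_card_le h.1 h.2.ge
    · exact ⟨h.subset, by rw [h]; rfl⟩

end Cmd

/-! ## Insertions -/

namespace Decomp

variable {A : Decomp} {F : Filtration} {i r : ℕ}

theorem kind_eq_zero : A.kind r = 0 ↔ r ∉ A.rows := by
  unfold kind rows
  rw [Finset.mem_union]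
  split_ifs <;> simp_all

theorem kind_eq_one : A.kind r = 1 ↔ r ∈ A.HR := by
  unfold kind
  split_ifs <;> simp_all

theorem kind_eq_two (h : A.Valid F i) : A.kind r = 2 ↔ r ∈ A.BR := by
  unfold kind
  split_ifs with h1 h2
  · simp [h.notMem_BR h1]
  · simp [h2]
  · simp [h2]

theorem kind_le : A.kind r ≤ 2 := by
  unfold kind
  split_ifs <;> omega

end Decomp

theorem zmod_val_eq_ite (u : ZMod 2) : u.val = if u = 1 then 1 else 0 := by
  revert u
  decide

theorem zmod_mul_val (u v : ZMod 2) : (u * v).val = u.val * v.val := by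
  revert u v
  decide

theorem sum_range_ite {n : ℕ} {s : Finset ℕ} (hs : ∀ r ∈ s, r < n) (f : ℕ → ZMod 2) :
    ∑ k ∈ Finset.range n, (if k ∈ s then f k else 0) = ∑ k ∈ s, f k := by
  rw [Finset.sum_ite_mem, Finset.inter_eq_right.2 fun r hr => Finset.mem_range.2 (hs r hr)]

namespace Cmd

variable {F : Filtration} {X : Limits} {μ : ℕ → ℕ → ℕ} {o : List ℕ}
  {Q : (ℕ → ℕ → ℕ) → List ℕ → Prop} {q : ℕ → ℕ} {i f : ℕ} {A : Decomp} {nm : ℕ → ℕ → ℕ}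

/-- Copy a row of the table of slots to the next one and store `t` in the slot `f`; the environment is
`[n, (i + 1) * n, i * n, f, t]`. -/
def copySlots : Cmd :=
  fillRow 0 2 (Ex.eqb (.var 6) (.var 3) * .var 4 + Ex.neb (.var 6) (.var 3) * .load 2 (.var 2 + .var 6))

theorem wp_copySlots {t : ℕ} (hX : Room F X) (hi : i < F.m) (ht : t ≤ F.m)
    (hq : ∀ s < F.n, q s ≤ F.m) (htab : ∀ s < F.n, μ 2 (i * F.n + s) = q s)
    (hQ : ∀ g : ℕ → ℕ, (∀ s < F.n, g ((i + 1) * F.n + s) = if s = f then t else q s) →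
      (∀ b, b < (i + 1) * F.n ∨ (i + 1) * F.n + F.n ≤ b → g b = μ 2 b) → Q (upd μ 2 g) o) :
    copySlots.wp X [F.n, (i + 1) * F.n, i * F.n, f, t] μ o Q := by
  have e2 := hX.tab
  have hB := hX.B_ge
  have e3 : (i + 1) * F.n + F.n ≤ (F.m + 1) * F.n := by
    rw [← Nat.succ_mul]
    exact Nat.mul_le_mul_right _ (by omega)
  refine wp_fillRow (fun s => if s = f then t else q s) hX.β0.ge (by omega) (fun s hs g _ hg => ?_) hQ
  have e1 := row_lt (show i < i + 1 by omega) hs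
  refine ⟨?_, ?_, ?_⟩
  · simp
    omega
  · simp only [Ex.eval_add, Ex.eval_mul, Ex.eval_load, Ex.eval_eqb, Ex.eval_neb, Ex.eval_var,
      List.getD_cons_zero, List.getD_cons_succ, upd_self]
    rw [hg _ (Or.inl e1), htab s hs]
    split_ifs <;> simp
  · have := hq s hs
    split_ifs <;> omega

/-- Compute the coordinates of the chain in the array `12`; the environment is `[n]`. -/
def hits : Cmd :=
  sumBits 0 (.var 0) 0 (.var 0) 20 (.var 2) (Ex.neb (.load 3 (.var 2)) (.lit 0) *
    (.load 8 (.var 2 * .var 0 + .var 4) * .load 12 (.var 4)))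

/-- The coordinates of a chain at all rows are scalar products of bit rows, `n ^ 2` operations in
all; rows not in use are forced to zero. -/
theorem wp_hits (hX : Room F X) (h : Stores F i A nm μ) {c : Chain} (hc : c ∈ chains (F.K i))
    (h12 : ∀ s < F.n, μ 12 s = (bitAt F (nm i s) c).val)
    (hQ : ∀ g : ℕ → ℕ, (∀ r < F.n, g r = if r ∈ A.rows then (pair (A.φ r) c).val else 0) →
      Q (upd μ 20 g) o) : hits.wp X [F.n] μ o Q := by
  have hn := hX.n_le
  have hS := hX.m_lt
  have hB := hX.B_ge
  refine wp_sumBits (fun r => r) (fun r s => if r ∈ A.rows then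
    (if nm i s = 0 then 0 else A.φ r (F.σ (nm i s - 1))) * bitAt F (nm i s) c else 0) (by simp)
    (by simp) hX.β0.ge (fun s hs g => by simp) hX.β0.ge (by omega) (fun j k h _ => by omega)
    (fun j hj l g => ⟨by simp, by simp, by omega⟩) (fun r hr s hs g => ?_) fun g hg _ => hQ g fun r hr => ?_
  · have e1 := row_lt hr hs
    have e2 := hX.sq_le
    refine ⟨by simp; omega, ?_⟩
    simp [upd_apply, h.kind r hr, h12 s hs, Decomp.kind_eq_zero]
    by_cases h1 : r ∈ A.rows
    · by_cases h2 : nm i s = 0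
      · simp [h2]
      · simp [h1, h2, zmod_mul_val, h.φ r h1 s hs h2]
    · simp [h1]
  · rw [hg r hr]
    split_ifs with h1
    · rw [(h.slots i le_rfl).sum_bits hc]
    · simp

/-- Mark rows in the array `15`. -/
theorem wp_mask {p q t : ℕ} {e : Ex} (P : ℕ → Prop) [DecidablePred P] (hX : Room F X)
    (he : ∀ r < F.n, ∀ g, e.Ok X.S [F.n, 0, p, q, t, F.n, r] (upd μ 15 g) ∧
      e.eval [F.n, 0, p, q, t, F.n, r] (upd μ 15 g) = if P r then 1 else 0)
    (hQ : ∀ g : ℕ → ℕ, (∀ r < F.n, g r = if P r then 1 else 0) → Q (upd μ 15 g) o) :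
    (fillRow 0 15 e).wp X [F.n, 0, p, q, t] μ o Q := by
  have hn := hX.n_le
  have hS := hX.m_lt
  have hB := hX.B_ge
  refine wp_fillRow (fun r => if P r then 1 else 0) hX.β0.ge (by omega)
    (fun r hr g _ _ => ⟨(he r hr g).1, (he r hr g).2, ?_⟩) fun g hg _ => hQ g fun r hr => ?_
  · split_ifs <;> omega
  · rw [← hg r hr, zero_add]

/-- Make the entries of the array `8` bits and clear the column `f`; the environment is `[n, f]`. -/
def clean : Cmd :=
  loop 0 (.var 0) (loop 0 (.var 0) (store 8 (.var 3 * .var 0 + .var 5)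
    (Ex.neb (.var 5) (.var 1) * Ex.neb (.load 8 (.var 3 * .var 0 + .var 5)) (.lit 0))))

/-- Rows and columns out of use may hold leftovers. Normalizing all entries to bits makes row
addition legitimate, and clearing the column of the new slot implements the clearing of the
functionals at the inserted simplex. -/
theorem wp_clean (hX : Room F X) (hQ : ∀ g : ℕ → ℕ, (∀ r < F.n, ∀ s < F.n,
    g (r * F.n + s) = if s = f then 0 else if μ 8 (r * F.n + s) = 0 then 0 else 1) →
      Q (upd μ 8 g) o) : clean.wp X [F.n, f] μ o Q := by
  have hn := hX.n_le
  have hS := hX.sq_le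
  have hB := hX.B_ge
  refine wp_fill2 (fun r s => r * F.n + s) _ (by simp) (by simp) hX.β0.ge (fun k _ g => by simp)
    hX.β0.ge (fun j k j' k' _ h1 _ h2 h => row_inj h1 h2 h) (fun r hr s hs g h1 h2 => ?_)
    fun g h1 _ => hQ g h1
  have e1 := row_lt hr hs
  refine ⟨⟨by simp, by simp, by omega⟩, ?_, ?_, ?_⟩
  · simp
    omega
  · simp [h2]
    split_ifs <;> simp_all
  · split_ifs <;> omega

end Cmd

theorem Stores.congr {F : Filtration} {i : ℕ} {A : Decomp} {nm μ μ' : ℕ → ℕ → ℕ}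
    (h : Stores F i A nm μ) (h' : ∀ B, 2 ≤ B → B ≤ 10 → μ' B = μ B) : Stores F i A nm μ' where
  slots := h.slots
  step := h.step
  tab := by rw [h' 2 (by omega) (by omega)]; exact h.tab
  kind := by rw [h' 3 (by omega) (by omega)]; exact h.kind
  birth := by rw [h' 4 (by omega) (by omega)]; exact h.birth
  key := by rw [h' 5 (by omega) (by omega)]; exact h.key
  x := by rw [h' 6 (by omega) (by omega)]; exact h.x
  y := by rw [h' 7 (by omega) (by omega)]; exact h.y
  φ := by rw [h' 8 (by omega) (by omega)]; exact h.φ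
  U := by rw [h' 9 (by omega) (by omega)]; exact h.U
  wire := by rw [h' 10 (by omega) (by omega)]; exact h.wire

theorem Stores.upd {F : Filtration} {i : ℕ} {A : Decomp} {nm μ : ℕ → ℕ → ℕ}
    (h : Stores F i A nm μ) {B : ℕ} (hB : B < 2 ∨ 10 < B) (g : ℕ → ℕ) :
    Stores F i A nm (upd μ B g) :=
  h.congr fun C h1 h2 => by rw [upd_apply, if_neg (by omega)]

theorem Input.congr {F : Filtration} {μ μ' : ℕ → ℕ → ℕ} (h : Input F μ) (h0 : μ' 0 = μ 0)
    (h1 : μ' 1 = μ 1) : Input F μ' :=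
  ⟨by rw [h0]; exact h.word, by rw [h1]; exact h.pos⟩

theorem Input.upd {F : Filtration} {μ : ℕ → ℕ → ℕ} (h : Input F μ) {B : ℕ} (hB : 1 < B)
    (g : ℕ → ℕ) : Input F (upd μ B g) :=
  h.congr (by rw [upd_apply, if_neg (by omega)]) (by rw [upd_apply, if_neg (by omega)])

/-- The memory is prepared for the insertion of `σ i`: `f` is the slot for `σ i`, the cone over the
boundary is in the array `14`, and the rows that it hits are marked. -/
structure InsertReady (F : Filtration) (i : ℕ) (A : Decomp) (nm : ℕ → ℕ → ℕ) (q' : ℕ → ℕ) (f : ℕ)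
    (μ : ℕ → ℕ → ℕ) : Prop extends Stores F i A nm μ, Input F μ where
  change : SlotStep F i (nm i) q' f
  newtab : ∀ s < F.n, μ 2 ((i + 1) * F.n + s) = q' s
  φ_f : ∀ r < F.n, μ 8 (r * F.n + f) = 0
  φ_le : ∀ r < F.n, ∀ s < F.n, μ 8 (r * F.n + s) ≤ 1
  cone : ∀ s < F.n, μ 14 s = (bitAt F (q' s) (A.cone (F.σ i))).val
  mask : ∀ r < F.n, μ 15 r = if r ∈ A.hitH (F.σ i) then 1 else 0
  best : (μ 17 0 = 0 ∧ A.hitH (F.σ i) = ∅) ∨ (0 < μ 17 0 ∧ μ 18 0 ∈ A.hitH (F.σ i) ∧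
    ∀ r ∈ A.hitH (F.σ i), F.key (A.birth r) ≤ F.key (A.birth (μ 18 0)))

namespace Cmd

variable {F : Filtration} {X : Limits} {μ : ℕ → ℕ → ℕ} {o : List ℕ}
  {Q : (ℕ → ℕ → ℕ) → List ℕ → Prop} {q : ℕ → ℕ} {i f : ℕ} {A : Decomp} {nm : ℕ → ℕ → ℕ}

/-- Prepare the insertion of `σ i` into the slot `f`; the environment is `[m, n, i, f]`. -/
def prepareInsert : Cmd :=
  block [
    call [.var 1, (.var 2 + .lit 1) * .var 1, .var 2 * .var 1, .var 3, .var 2 + .lit 1] copySlots,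
    call [.var 1] hits,
    call [.var 1, .lit 0, .lit 0, .lit 0, .lit 0]
      (fillRow 0 15 (Ex.eqb (.load 3 (.var 6)) (.lit 2) * .load 20 (.var 6))),
    call [.var 1, .var 1] (sumRows 0 7 14),
    store 14 (.var 3) (.lit 1),
    call [.var 1, .lit 0, .lit 0, .lit 0, .lit 0]
      (fillRow 0 15 (Ex.eqb (.load 3 (.var 6)) (.lit 1) * .load 20 (.var 6))),
    call [.var 1, .var 3] clean,
    call [.var 1, .lit 0, .lit 0] (select (.load 15 (.var 4) * .load 5 (.var 4)))]

/-- This is the common part of the two kinds of insertion; whether the step is a birth or a death is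
known only after the search over the rows hit. -/
theorem wp_prepareInsert (hX : Room F X) (h : Stores F i A nm μ) (hin : Input F μ)
    (hv : A.Valid F i) (hi : i < F.m) (hd : F.dir i = true) (hf : f < F.n) (hf0 : nm i f = 0)
    (h12 : ∀ s < F.n, μ 12 s = (bitAt F (nm i s) (boundary (simplexChain (F.σ i)))).val)
    (hQ : ∀ μ', InsertReady F i A nm (Function.update (nm i) f (i + 1)) f μ' → Q μ' o) :
    prepareInsert.wp X [F.m, F.n, i, f] μ o Q := by
  have hn := hX.n_le
  have hS := hX.m_lt
  have hSB := hX.S_le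
  have hB := hX.B_ge
  have e1 := hX.tab
  have e2 : (i + 1) * F.n ≤ (F.m + 1) * F.n := Nat.mul_le_mul_right _ (by omega)
  have e3 : i * F.n ≤ (F.m + 1) * F.n := Nat.mul_le_mul_right _ (by omega)
  have ha := F.adds_of_fwd hi hd
  have hc := (mem_cycles.1 (Decomp.Valid.cycle_boundary ha)).1
  have hslot : SlotStep F i (nm i) (Function.update (nm i) f (i + 1)) f :=
    ⟨hf, fun s _ hs => Function.update_of_ne hs _ _, fun _ => ⟨hf0, Function.update_self _ _ _⟩,
      fun e => by simp [hd] at e⟩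
  refine wp_block_cons (wp_call [F.n, (i + 1) * F.n, i * F.n, f, i + 1] (by simp) (by simp)
    (by simp; omega) ?_)
  refine wp_copySlots hX hi hi (h.slots i le_rfl).le (h.tab i le_rfl) fun t1 ht1 ht1' => ?_
  have s1 : Stores F i A nm (upd μ 2 t1) := by
    refine ⟨h.slots, h.step, fun α hα s hs => ?_, h.kind, h.birth, h.key, h.x, h.y, h.φ, h.U, h.wire⟩
    rw [upd_self, ht1' _ (Or.inl (row_lt (by omega) hs)), h.tab α hα s hs]
  refine wp_block_cons (wp_call [F.n] (by simp) (by simp) (by simp; omega) ?_)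
  refine wp_hits hX s1 hc h12 fun g1 hg1 => ?_
  have s2 := s1.upd (B := 20) (by omega) g1
  refine wp_block_cons (wp_call [F.n, 0, 0, 0, 0] (by simp) (by simp) (by simp; omega) ?_)
  refine wp_mask (fun r => r ∈ A.hitB (F.σ i)) hX (fun r hr g => ⟨by simp; omega, ?_⟩) fun g2 hg2 => ?_
  · simp only [upd_apply, Ex.eval_mul, Ex.eval_eqb, Ex.eval_load, Ex.eval_var, Ex.eval_lit,
      List.getD_cons_zero, List.getD_cons_succ, Nat.reduceEqDiff, if_false, if_true, h.kind r hr,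
      hg1 r hr, Decomp.kind_eq_two hv, Decomp.hitB, Finset.mem_filter]
    by_cases h1 : r ∈ A.BR
    · simp [h1, Decomp.BR_subset h1, zmod_val_eq_ite]
    · simp [h1]
  have s3 := s2.upd (B := 15) (by omega) g2
  refine wp_block_cons (wp_call [F.n, F.n] (by simp) (by simp) (by simp; omega) ?_)
  refine wp_sumRows (fun k s => if k ∈ A.hitB (F.σ i) then bitAt F (nm i s) (A.y k) else 0)
    hX.β0.ge hX.β0.ge (by omega) hX.sq_le (by omega) (by omega) (by decide) (by decide)
    (fun k hk s hs => ?_) fun g3 hg3 => ?_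
  · simp only [upd_apply, Nat.reduceEqDiff, if_false, if_true, hg2 k hk]
    by_cases h1 : k ∈ A.hitB (F.σ i)
    · simp [h1, h.y k (Finset.mem_filter.1 h1).1 s hs]
    · simp [h1]
  have hVmem : ∀ r ∈ A.hitB (F.σ i), r < F.n := fun r hr =>
    hv.lt_n r (Decomp.BR_subset (Finset.mem_filter.1 hr).1)
  have s4 := s3.upd (B := 14) (by omega) g3
  refine wp_block_cons (wp_store f 1 (by simp) (by simp) (by simp) (by simp) (by omega) (by omega) ?_)
  rw [upd_upd, upd_self]
  set g4 := Function.update g3 f 1 with hg4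
  -- The bit at `f` stands for the inserted simplex; at all other slots the cone is the sum of the
  -- marked `y_r`.
  have hV : ∀ s < F.n, g4 s =
      (bitAt F (Function.update (nm i) f (i + 1) s) (A.cone (F.σ i))).val := by
    intro s hs
    by_cases e : s = f
    · rw [e, hg4, Function.update_self, Function.update_self, bitAt_of_ne (by omega),
        Nat.add_sub_cancel, hv.cone_apply ha]
      rfl
    · rw [hg4, Function.update_of_ne e, Function.update_of_ne e, hg3 s hs, sum_range_ite hVmem,
        Decomp.cone, bitAt_add, bitAt_sum]
      have h0 : bitAt F (nm i s) (simplexChain (F.σ i)) = 0 := by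
        unfold bitAt
        split_ifs with h0
        · rfl
        · refine Finsupp.single_eq_of_ne fun e' => ?_
          exact ha.notMem (e' ▸ (h.slots i le_rfl).mem s hs h0)
      rw [h0, zero_add]
  have s5 := s3.upd (B := 14) (by omega) g4
  refine wp_block_cons (wp_call [F.n, 0, 0, 0, 0] (by simp) (by simp) (by simp; omega) ?_)
  refine wp_mask (fun r => r ∈ A.hitH (F.σ i)) hX (fun r hr g => ⟨by simp; omega, ?_⟩) fun g5 hg5 => ?_
  · simp only [upd_apply, Ex.eval_mul, Ex.eval_eqb, Ex.eval_load, Ex.eval_var, Ex.eval_lit,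
      List.getD_cons_zero, List.getD_cons_succ, Nat.reduceEqDiff, if_false, if_true, h.kind r hr,
      hg1 r hr, Decomp.kind_eq_one, Decomp.hitH, Finset.mem_filter]
    by_cases h1 : r ∈ A.HR
    · simp [h1, Decomp.HR_subset h1, zmod_val_eq_ite]
    · simp [h1]
  have s6 := s5.upd (B := 15) (by omega) g5
  refine wp_block_cons (wp_call [F.n, f] (by simp) (by simp) (by simp; omega) ?_)
  refine wp_clean hX fun g6 hg6 => ?_
  have hφ : ∀ r ∈ A.rows, ∀ s < F.n, nm i s ≠ 0 →
      g6 (r * F.n + s) = (A.φ r (F.σ (nm i s - 1))).val := by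
    intro r hr s hs h0
    rw [hg6 r (hv.lt_n r hr) s hs, if_neg (by rintro rfl; exact h0 hf0), s6.φ r hr s hs h0, zmod_val_ite]
  have s7 := s6
  replace s7 : Stores F i A nm (upd _ 8 g6) := ⟨s6.slots, s6.step, s6.tab, s6.kind, s6.birth, s6.key,
    s6.x, s6.y, hφ, s6.U, s6.wire⟩
  refine wp_block_cons (wp_call [F.n, 0, 0] (by simp) (by simp) (by simp; omega) ?_)
  have hH : ∀ r ∈ A.hitH (F.σ i), r < F.n ∧ μ 5 r = F.key (A.birth r) ∧ 1 ≤ F.key (A.birth r) ∧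
      F.key (A.birth r) ≤ 2 * F.m + 3 := by
    intro r hr
    have h1 := (Finset.mem_filter.1 hr).1
    have h2 := Decomp.HR_subset h1
    have h3 := hv.birth_le h2
    refine ⟨hv.lt_n r h2, h.key r h1, ?_⟩
    unfold Filtration.key
    split_ifs <;> omega
  -- Keys are positive, so a vanishing maximum means that no homology row is hit.
  refine wp_select (fun r => if r ∈ A.hitH (F.σ i) then F.key (A.birth r) else 0) hX.β0.ge (by omega)
    (by omega) (fun r hr g g' => ⟨by simp; omega, ?_, ?_⟩) fun g g' hg => ?_
  · simp only [upd_apply, Ex.eval_mul, Ex.eval_load, Ex.eval_var,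
      List.getD_cons_zero, List.getD_cons_succ, Nat.reduceEqDiff, if_false, if_true, hg5 r hr]
    by_cases h1 : r ∈ A.hitH (F.σ i)
    · simp [h1, (hH r h1).2.1]
    · simp [h1]
  · split_ifs with h1
    · have := hH r h1
      omega
    · omega
  refine wp_block_nil (hQ _ ?_)
  have s8 := (s7.upd (B := 17) (by omega) g).upd (B := 18) (by omega) g'
  refine { s8 with
    word := hin.word
    pos := hin.pos
    change := hslot
    newtab := fun s hs => ?_
    φ_f := fun r hr => ?_
    φ_le := fun r hr s hs => ?_
    cone := hV
    mask := hg5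
    best := ?_ }
  · change t1 _ = _
    rw [ht1 s hs, Function.update_apply]
  · change g6 _ = _
    rw [hg6 r hr f hf, if_pos rfl]
  · change g6 _ ≤ _
    rw [hg6 r hr s hs]
    split_ifs <;> omega
  · change (g 0 = 0 ∧ _) ∨ (0 < g 0 ∧ g' 0 ∈ _ ∧ ∀ r ∈ _, _ ≤ F.key (A.birth (g' 0)))
    rcases hg with ⟨h1, h2⟩ | ⟨h1, h2, h3, h4⟩
    · refine Or.inl ⟨h1, Finset.eq_empty_of_forall_notMem fun r hr => ?_⟩
      have h3 := h2 r (hH r hr).1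
      have h4 := hH r hr
      rw [if_pos hr] at h3
      omega
    · have h5 : g' 0 ∈ A.hitH (F.σ i) := by
        by_contra hn
        rw [if_neg hn] at h3
        omega
      refine Or.inr ⟨h1, h5, fun r hr => ?_⟩
      have := h4 r (hH r hr).1
      rwa [if_pos hr, if_pos h5] at this

end Cmd

/-! ## The effect of one step -/

theorem map_insert_update {S : Finset ℕ} {r : ℕ} (hr : r ∉ S) (b : ℕ → ℕ) (v : ℕ) :
    (insert r S).val.map (Function.update b r v) = v ::ₘ S.val.map b := by
  rw [Finset.insert_val_of_notMem hr, Multiset.map_cons, Function.update_self]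
  exact congrArg _ (Multiset.map_congr rfl fun k hk =>
    Function.update_of_ne (by rintro rfl; exact hr hk) _ _)

theorem map_erase_add {S : Finset ℕ} {r : ℕ} (hr : r ∈ S) (b : ℕ → ℕ) :
    {b r} + (S.erase r).val.map b = S.val.map b := by
  conv_rhs => rw [← Finset.insert_erase hr, Finset.insert_val_of_notMem (Finset.notMem_erase r S),
    Multiset.map_cons]
  rfl

theorem map_update {S : Finset ℕ} {r : ℕ} (hr : r ∉ S) (b : ℕ → ℕ) (v : ℕ) :
    S.val.map (Function.update b r v) = S.val.map b :=
  Multiset.map_congr rfl fun k hk => Function.update_of_ne (by rintro rfl; exact hr hk) _ _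

/-- The births of the bars of one kind. -/
def birthsOf (k : Bool) (bars : List Bar) : Multiset ℕ := ((intervalsOf k bars).map Prod.fst : List ℕ)

/-- The deaths of the bars of one kind. -/
def deathsOf (k : Bool) (bars : List Bar) : Multiset ℕ := ((intervalsOf k bars).map Prod.snd : List ℕ)

theorem birthsOf_append (k : Bool) (l l' : List Bar) :
    birthsOf k (l ++ l') = birthsOf k l + birthsOf k l' := by
  simp [birthsOf, intervalsOf]

theorem deathsOf_append (k : Bool) (l l' : List Bar) :
    deathsOf k (l ++ l') = deathsOf k l + deathsOf k l' := by
  simp [deathsOf, intervalsOf]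

open Classical in
/-- The bars are the ones to write when `A` is replaced by `A'` in step `i`. -/
structure Advance (F : Filtration) (i : ℕ) (A A' : Decomp) (bars : List Bar) : Prop where
  valid : A'.Valid F (i + 1)
  rep : ∀ B ∈ bars, B.HasRep F
  birth_H : birthsOf false bars + A'.HR.val.map A'.birth =
    A.HR.val.map A.birth + if F.IsHomologyBirth (i + 1) then {i + 1} else 0
  birth_B : birthsOf true bars + A'.BR.val.map A'.birth =
    A.BR.val.map A.birth + if F.IsBoundaryBirth (i + 1) then {i + 1} else 0
  death_H : deathsOf false bars = if F.IsHomologyDeath i then {i} else 0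
  death_B : deathsOf true bars = if F.IsBoundaryDeath i then {i} else 0

theorem hasRep_of_isHomologyRep {F : Filtration} {b d : ℕ} {z : ℕ → Chain} {cyc : List (List ℕ)}
    (h : F.IsHomologyRep b d fun α => PartialRep.toCycle (F.K α) (z α))
    (hz : ∀ α ≤ d, z α ∈ cycles (F.K α)) (hl : Cmd.Lists F b d z cyc) :
    Bar.HasRep F ⟨false, b, d, cyc⟩ := by
  have := h.le
  refine ⟨hl.1.trans (by simp only; omega), fun _ => ⟨_, h, fun α h1 h2 => ?_⟩, fun e => by simp at e⟩
  rw [PartialRep.coe_toCycle (hz α h2)]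
  exact hl.2 α h1 h2

theorem hasRep_of_isBoundaryRep {F : Filtration} {b d : ℕ} {x : Chain} {cyc : List (List ℕ)}
    (h : F.IsBoundaryRep b d fun α => PartialBoundaryRep.toBoundary (F.K α) x)
    (hz : ∀ α, b ≤ α → α ≤ d → x ∈ boundaries (F.K α)) (hl : Cmd.Lists F b d (fun _ => x) cyc) :
    Bar.HasRep F ⟨true, b, d, cyc⟩ := by
  have := h.le
  refine ⟨hl.1.trans (by simp only; omega), fun e => by simp at e, fun _ => ⟨_, h, fun α h1 h2 => ?_⟩⟩
  rw [PartialBoundaryRep.coe_toBoundary (hz α h1 h2)]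
  exact hl.2 α h1 h2

namespace Decomp.Valid

variable {F : Filtration} {i : ℕ} {A : Decomp} {cyc : List (List ℕ)}

theorem rep_mem (h : A.Valid F i) {r : ℕ} (hr : r ∈ A.HR) {α : ℕ} (hα : α ≤ i) :
    A.rep r α ∈ cycles (F.K α) := (h.hom r hr).mem α hα

theorem advance_insertBirth (h : A.Valid F i) (hi : i < F.m) (hd : F.dir i = true)
    (hH : A.hitH (F.σ i) = ∅) {r₀ : ℕ} (h₀ : r₀ ∉ A.rows) (hn : r₀ < F.n) :
    Advance F i A (A.insertBirth i (F.σ i) r₀) [] := by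
  have hb := (h.bounds_iff_insert hi hd).2 hH
  refine ⟨h.insertBirth hi hd hH h₀ hn, by simp, ?_, ?_, ?_, ?_⟩
  · rw [if_pos ((homologyBirth_iff hi).2 (by simp [hd, hb]))]
    change 0 + (insert r₀ A.HR).val.map (Function.update A.birth r₀ (i + 1)) = _
    rw [map_insert_update (fun e => h₀ (HR_subset e)), zero_add, add_comm _ {i + 1}]
    rfl
  · rw [if_neg (by rw [boundaryBirth_iff hi]; simp [hb])]
    change 0 + A.BR.val.map (Function.update A.birth r₀ (i + 1)) = _
    rw [map_update (fun e => h₀ (BR_subset e)), zero_add, add_zero]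
  · rw [if_neg (by rw [homologyDeath_iff hi]; simp [hd, hb])]
    rfl
  · rw [if_neg (by rw [boundaryDeath_iff hi]; simp [hd])]
    rfl

/-- The row `M` closes its homology bar at `i` and returns as a boundary row born at `i + 1`; the
multisets of births balance accordingly. -/
theorem advance_insertDeath (h : A.Valid F i) (hi : i < F.m) (hd : F.dir i = true) {M : ℕ}
    (hM : M ∈ A.hitH (F.σ i))
    (hkey : ∀ r ∈ A.hitH (F.σ i), F.key (A.birth r) ≤ F.key (A.birth M))
    (hl : Cmd.Lists F (A.birth M) i (bundleChain A.wire (∑ r ∈ A.hitH (F.σ i), A.U r)) cyc) :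
    Advance F i A (A.insertDeath i (F.σ i) M) [⟨false, A.birth M, i, cyc⟩] := by
  have hb : ¬ F.Bounds i := fun hb => by
    rw [(h.bounds_iff_insert hi hd).1 hb] at hM
    exact absurd hM (Finset.notMem_empty M)
  have hMH := (Finset.mem_filter.1 hM).1
  have hz : bundleChain A.wire (∑ r ∈ A.hitH (F.σ i), A.U r) =
      fun α => ∑ r ∈ A.hitH (F.σ i), A.rep r α := funext fun α => bundleChain_sum _ _ _ _
  rw [hz] at hl
  refine ⟨h.insertDeath hi hd hM, ?_, ?_, ?_, ?_, ?_⟩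
  · rw [List.forall_mem_singleton]
    exact hasRep_of_isHomologyRep (h.insertDeath_isHomologyRep hi hd hM hkey)
      (fun α hα => sum_mem fun r hr => h.rep_mem (Finset.mem_filter.1 hr).1 hα) hl
  · rw [if_neg (by rw [homologyBirth_iff hi]; simp [hd, hb])]
    change {A.birth M} + (A.HR.erase M).val.map (Function.update A.birth M (i + 1)) = _
    rw [map_update (Finset.notMem_erase _ _), map_erase_add hMH, add_zero]
  · rw [if_pos ((boundaryBirth_iff hi).2 ⟨hd, hb⟩)]
    change 0 + (insert M A.BR).val.map (Function.update A.birth M (i + 1)) = _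
    rw [map_insert_update (h.notMem_BR hMH), zero_add, add_comm _ {i + 1}]
    rfl
  · rw [if_pos ((homologyDeath_iff hi).2 (by simp [hd, hb]))]
    rfl
  · rw [if_neg (by rw [boundaryDeath_iff hi]; simp [hd])]
    rfl

theorem advance_deleteDeath (h : A.Valid F i) (hi : i < F.m) (hd : F.dir i = false) {M : ℕ}
    (hM : M ∈ A.HR) (hM1 : A.x M (F.σ i) = 1)
    (hkey : ∀ r ∈ A.HR, A.x r (F.σ i) = 1 → F.key (A.birth M) ≤ F.key (A.birth r))
    (hl : Cmd.Lists F (A.birth M) i (A.rep M) cyc) :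
    Advance F i A (A.deleteDeath (F.σ i) M) [⟨false, A.birth M, i, cyc⟩] := by
  have hb := h.bounds_of_delete hi hd hM hM1
  refine ⟨h.deleteDeath hi hd hM hM1 hkey, ?_, ?_, ?_, ?_, ?_⟩
  · rw [List.forall_mem_singleton]
    exact hasRep_of_isHomologyRep (h.deleteDeath_isHomologyRep hi hd hM hM1)
      (fun α hα => h.rep_mem hM hα) hl
  · rw [if_neg (by rw [homologyBirth_iff hi]; simp [hd, hb])]
    change {A.birth M} + (A.HR.erase M).val.map A.birth = _
    rw [map_erase_add hM, add_zero]
  · rw [if_neg (by rw [boundaryBirth_iff hi]; simp [hd])]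
    change 0 + A.BR.val.map A.birth = _
    rw [zero_add, add_zero]
  · rw [if_pos ((homologyDeath_iff hi).2 (by simp [hd, hb]))]
    rfl
  · rw [if_neg (by rw [boundaryDeath_iff hi]; simp [hb])]
    rfl

/-- The mirror image: the row `M` closes its boundary bar at `i` and returns as a homology row born
at `i + 1`. -/
theorem advance_deleteBirth (h : A.Valid F i) (hi : i < F.m) (hd : F.dir i = false)
    (hx : ∀ r ∈ A.HR, A.x r (F.σ i) = 0) {M : ℕ} (hM : M ∈ A.BR) (hM1 : A.y M (F.σ i) = 1)
    (hmin : ∀ r ∈ A.BR, A.y r (F.σ i) = 1 → A.birth M ≤ A.birth r)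
    (hl : Cmd.Lists F (A.birth M) i (fun _ => A.x M) cyc) :
    Advance F i A (A.deleteBirth i (F.σ i) M) [⟨true, A.birth M, i, cyc⟩] := by
  have hb := h.not_bounds_of_delete hi hd hx
  refine ⟨h.deleteBirth hi hd hx hM hM1 hmin, ?_, ?_, ?_, ?_, ?_⟩
  · rw [List.forall_mem_singleton]
    exact hasRep_of_isBoundaryRep (h.deleteBirth_isBoundaryRep hi hd hx hM hM1).2
      (h.bd M hM).mem hl
  · rw [if_pos ((homologyBirth_iff hi).2 (by simp [hd, hb]))]
    change 0 + (insert M A.HR).val.map (Function.update A.birth M (i + 1)) = _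
    rw [map_insert_update (h.notMem_HR hM), zero_add, add_comm _ {i + 1}]
    rfl
  · rw [if_neg (by rw [boundaryBirth_iff hi]; simp [hd])]
    change {A.birth M} + (A.BR.erase M).val.map (Function.update A.birth M (i + 1)) = _
    rw [map_update (Finset.notMem_erase _ _), map_erase_add hM, add_zero]
  · rw [if_neg (by rw [homologyDeath_iff hi]; simp [hd, hb])]
    rfl
  · rw [if_pos ((boundaryDeath_iff hi).2 ⟨hd, hb⟩)]
    rfl

end Decomp.Valid

namespace Cmd

variable {F : Filtration} {X : Limits} {μ : ℕ → ℕ → ℕ} {o : List ℕ}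
  {Q : (ℕ → ℕ → ℕ) → List ℕ → Prop} {q q' : ℕ → ℕ} {i f : ℕ} {A : Decomp} {nm : ℕ → ℕ → ℕ}

/-- Overwrite the row `r` of the array `A`; the environment is `[L, r * L, p, 0, 0]`. -/
theorem wp_setRow {B L r p tag : ℕ} {e : Ex} (val : ℕ → ℕ) (hL : L ≤ X.β tag) (hS : r * L + L ≤ X.S)
    (he : ∀ k < L, ∀ g : ℕ → ℕ, e.Ok X.S [L, r * L, p, 0, 0, L, k] (upd μ B g) ∧
        e.eval [L, r * L, p, 0, 0, L, k] (upd μ B g) = val k ∧ val k ≤ X.B)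
    (hQ : ∀ g : ℕ → ℕ, (∀ k, ∀ s < L, g (k * L + s) = if k = r then val s else μ B (k * L + s)) →
      (∀ b < r * L, g b = μ B b) → Q (upd μ B g) o) :
    (fillRow tag B e).wp X [L, r * L, p, 0, 0] μ o Q :=
  wp_fillRow val hL hS (fun k hk g _ _ => he k hk g) fun g h1 h2 =>
    hQ g (row_apply h1 h2) fun b hb => h2 b (Or.inl hb)

/-- Store the newborn cycle in a free row; the environment is `[m, n, i, f]`. -/
def insertBirth : Cmd :=
  block [call [.var 1, .lit 0, .lit 0] (select (Ex.eqb (.load 3 (.var 4)) (.lit 0))),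
    letv (.load 18 (.lit 0)) (block [
      call [.var 1, .var 4 * .var 1, .lit 0, .lit 0, .lit 0] (fillRow 0 6 (.load 14 (.var 6))),
      call [.var 1, .var 4 * .var 1, .var 3, .lit 0, .lit 0] (fillRow 0 8 (Ex.eqb (.var 6) (.var 2))),
      store 3 (.var 4) (.lit 1), store 4 (.var 4) (.var 2 + .lit 1),
      store 5 (.var 4) (.var 0 + .lit 1 + (.var 2 + .lit 1)),
      call [.var 0 + .lit 1, .var 4 * (.var 0 + .lit 1), .var 2 + .lit 1, .lit 0, .lit 0]
        (fillRow 2 9 (Ex.eqb (.var 6) (.var 2))),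
      call [.var 1, (.var 2 + .lit 1) * .var 1, .lit 0, .lit 0, .lit 0]
        (fillRow 0 10 (.load 14 (.var 6)))])]

/-- The number of rows in use is at most the number of simplices before the insertion, which is less
than the number after it, hence less than `n`. -/
theorem exists_free_row (hv : A.Valid F i) (hi : i < F.m) (hd : F.dir i = true) :
    ∃ r < F.n, r ∉ A.rows := by
  have h1 := Filtration.ncard_of_adds (F.adds_of_fwd hi hd) (F.finite_faces hi.le)
  have h2 := F.ncard_le (i := i + 1) hi
  have h3 := hv.card
  have h4 : A.rows.card ≤ A.HR.card + A.BR.card := Finset.card_union_le _ _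
  by_contra hc
  push Not at hc
  have h5 := Finset.card_le_card (fun r hr => hc r (Finset.mem_range.1 hr) : Finset.range F.n ⊆ A.rows)
  rw [Finset.card_range] at h5
  omega

theorem wp_insertBirth (hX : Room F X) (h : InsertReady F i A nm q' f μ)
    (hv : A.Valid F i) (hi : i < F.m) (hd : F.dir i = true) (hH : A.hitH (F.σ i) = ∅)
    (hQ : ∀ A' nm' μ' bars, Advance F i A A' bars → Stores F (i + 1) A' nm' μ' → Input F μ' →
      Q μ' (o ++ bars.flatMap Bar.encode)) :
    insertBirth.wp X [F.m, F.n, i, f] μ o Q := by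
  have hn := hX.n_le
  have hS := hX.m_lt
  have hSB := hX.S_le
  have hB := hX.B_ge
  have e1 := hX.tab
  have e2 := hX.sq_le
  have e3 := hX.tab'
  have hf := h.change.lt
  refine wp_block_cons (wp_call [F.n, 0, 0] (by simp) (by simp) (by simp; omega) ?_)
  refine wp_select (fun r => if r ∈ A.rows then 0 else 1) hX.β0.ge (by omega) (by omega)
    (fun r hr g g' => ⟨by simp; omega, ?_, by split_ifs <;> omega⟩) fun g g' hg => ?_
  · simp [upd_apply, h.kind r hr, Decomp.kind_eq_zero]
  obtain ⟨r, hr, hr'⟩ : ∃ r < F.n, r ∉ A.rows ∧ r = g' 0 := by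
    rcases hg with ⟨-, hg⟩ | ⟨-, h1, h2, -⟩
    · obtain ⟨r, hr, hr'⟩ := exists_free_row hv hi hd
      have := hg r hr
      rw [if_neg hr'] at this
      omega
    · exact ⟨g' 0, h1, fun e => by rw [if_pos e] at h2; omega, rfl⟩
  obtain ⟨hr', rfl⟩ := hr'
  set r := g' 0 with hrdef
  refine wp_block_cons (wp_letv r (by simp; omega) (by simp; rfl) (by omega) ?_)
  have l1 := Nat.mul_le_mul_right F.n (show r + 1 ≤ F.n from hr)
  have l2 := Nat.mul_le_mul_right (F.m + 1) (show r + 1 ≤ F.n from hr)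
  have l3 := Nat.mul_le_mul_right F.n (show i + 1 + 1 ≤ F.m + 1 by omega)
  rw [Nat.succ_mul] at l1 l2 l3
  have hc : ∀ s < F.n, μ 14 s ≤ 1 := fun s hs => h.cone s hs ▸ zmod_val_le _
  refine wp_block_cons (wp_call [F.n, r * F.n, 0, 0, 0] (by simp) (by simp) (by simp; omega) ?_)
  refine wp_setRow (fun s => μ 14 s) hX.β0.ge (by omega)
    (fun s hs g => ⟨by simp; omega, by simp [upd_apply], (hc s hs).trans (by omega)⟩) fun g6 h6 _ => ?_
  refine wp_block_cons (wp_call [F.n, r * F.n, f, 0, 0] (by simp) (by simp) (by simp; omega) ?_)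
  refine wp_setRow (fun s => if s = f then 1 else 0) hX.β0.ge (by omega)
    (fun s hs g => ⟨by simp, by simp, by split_ifs <;> omega⟩) fun g8 h8 _ => ?_
  refine wp_block_cons (wp_store r 1 (by simp) (by simp) (by simp) (by simp) (by omega) (by omega) ?_)
  refine wp_block_cons (wp_store r (i + 1) (by simp) (by simp) (by simp) (by simp) (by omega) (by omega) ?_)
  refine wp_block_cons (wp_store r (F.m + 1 + (i + 1)) (by simp) (by simp) (by simp) (by simp)
    (by omega) (by omega) ?_)
  refine wp_block_cons (wp_call [F.m + 1, r * (F.m + 1), i + 1, 0, 0] (by simp) (by simp)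
    (by simp; omega) ?_)
  refine wp_setRow (fun s => if s = i + 1 then 1 else 0) hX.β2.ge (by omega)
    (fun s hs g => ⟨by simp, by simp, by split_ifs <;> omega⟩) fun g9 h9 _ => ?_
  refine wp_block_cons (wp_call [F.n, (i + 1) * F.n, 0, 0, 0] (by simp) (by simp) (by simp; omega) ?_)
  refine wp_setRow (fun s => μ 14 s) hX.β0.ge (by omega)
    (fun s hs g => ⟨by simp; omega, by simp [upd_apply], (hc s hs).trans (by omega)⟩)
    fun g10 h10 h10' => ?_
  refine wp_block_nil ?_
  rw [← List.append_nil o]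
  refine hQ _ _ _ [] (hv.advance_insertBirth hi hd hH hr' hr)
    (h.toStores.insertBirth (q' := q') (f := f) hv hi hd h.change hr' hr ?_ ?_ ?_ ?_ ?_ ?_ ?_ ?_ ?_ ?_ ?_)
    (Input.congr h.toInput ?_ ?_)
  all_goals simp only [upd_apply, Nat.reduceEqDiff, if_false, if_true]
  · exact h.newtab
  · intro _ _; trivial
  · intro k _
    rw [Function.update_apply]
  · intro k
    rw [Function.update_apply]
  · intro k
    rw [Function.update_apply]
  · intro k s hs
    rw [h6 k s hs, h.cone s hs]
    rfl
  · intro k hk s hs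
    rw [h8 k s hs]
    simp only [upd_apply, Nat.reduceEqDiff, if_false]
    split_ifs with a b c
    · rfl
    · rfl
    · rw [c, h.φ_f k hk]
    · rfl
  · exact h9
  · intro s hs
    rw [h10 _ s hs, if_pos rfl, h.cone s hs]
  · exact h10'

end Cmd

/-! ### The program for an insertion that kills a cycle -/

namespace Cmd

variable {F : Filtration} {X : Limits} {μ : ℕ → ℕ → ℕ} {o : List ℕ}
  {Q : (ℕ → ℕ → ℕ) → List ℕ → Prop} {q q' : ℕ → ℕ} {i f : ℕ} {A : Decomp} {nm : ℕ → ℕ → ℕ}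

/-- Turn the cycle of the row found last into a boundary; the environment is `[m, n, i, f]`. -/
def insertDeath : Cmd :=
  letv (.load 18 (.lit 0)) (block [
    call [.var 1, .var 1] (sumRows 0 6 22),
    call [.var 1, .var 4 * .var 1, .lit 0, .lit 0, .lit 0] (fillRow 0 6 (.load 22 (.var 6))),
    call [.var 1, .var 0 + .lit 1] (sumRows 2 9 22),
    call [.var 0 + .lit 1, .var 4 * (.var 0 + .lit 1), .lit 0, .lit 0, .lit 0]
      (fillRow 2 9 (.load 22 (.var 6))),
    store 15 (.var 4) (.lit 0),
    call [.var 1, .var 1, .var 4] (addRows 0 8 8),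
    call [.var 0, .var 1, .var 4, .var 2] emitHomology,
    call [.var 1, .var 4 * .var 1, .lit 0, .lit 0, .lit 0] (fillRow 0 7 (.load 14 (.var 6))),
    store 3 (.var 4) (.lit 2), store 4 (.var 4) (.var 2 + .lit 1)])

theorem exists_of_sum_apply_ne_zero {S : Finset ℕ} {U : ℕ → ℕ → ZMod 2} {w : ℕ}
    (h : (∑ r ∈ S, U r) w ≠ 0) : ∃ r ∈ S, U r w ≠ 0 := by
  rw [Finset.sum_apply] at h
  exact Finset.exists_ne_zero_of_sum_ne_zero h

/-- The sum of the bundles is placed in the row `M` before the bar is written, since the bar that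
dies is represented by this sum and not by the old bundle of `M`. -/
theorem wp_insertDeath (hX : Room F X) (h : InsertReady F i A nm q' f μ)
    (hv : A.Valid F i) (hi : i < F.m) (hd : F.dir i = true) (hM : μ 18 0 ∈ A.hitH (F.σ i))
    (hkey : ∀ r ∈ A.hitH (F.σ i), F.key (A.birth r) ≤ F.key (A.birth (μ 18 0)))
    (hQ : ∀ A' nm' μ' bars, Advance F i A A' bars → Stores F (i + 1) A' nm' μ' → Input F μ' →
      Q μ' (o ++ bars.flatMap Bar.encode)) :
    insertDeath.wp X [F.m, F.n, i, f] μ o Q := by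
  have hn := hX.n_le
  have hS := hX.m_lt
  have hSB := hX.S_le
  have hB := hX.B_ge
  have e1 := hX.tab
  have e2 := hX.sq_le
  have e3 := hX.tab'
  have hf := h.change.lt
  obtain ⟨M, hMdef⟩ : ∃ M, M = μ 18 0 := ⟨_, rfl⟩
  rw [← hMdef] at hM hkey
  have hMH := (Finset.mem_filter.1 hM).1
  have hMr := Decomp.HR_subset hMH
  have hMn := hv.lt_n M hMr
  have hHR : ∀ {r}, r ∈ A.hitH (F.σ i) → r ∈ A.HR := fun hr => (Finset.mem_filter.1 hr).1
  have hlt : ∀ r ∈ A.hitH (F.σ i), r < F.n := fun r hr => hv.lt_n r (Decomp.HR_subset (hHR hr))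
  have l1 := Nat.mul_le_mul_right F.n (show M + 1 ≤ F.n from hMn)
  have l2 := Nat.mul_le_mul_right (F.m + 1) (show M + 1 ≤ F.n from hMn)
  rw [Nat.succ_mul] at l1 l2
  have hc : ∀ s < F.n, μ 14 s ≤ 1 := fun s hs => h.cone s hs ▸ zmod_val_le _
  refine wp_letv M (by simp; omega) (by simp; rw [hMdef]) (by omega) ?_
  refine wp_block_cons (wp_call [F.n, F.n] (by simp) (by simp) (by simp; omega) ?_)
  refine wp_sumRows (fun k s => if k ∈ A.hitH (F.σ i) then bitAt F (nm i s) (A.x k) else 0)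
    hX.β0.ge hX.β0.ge (by omega) e2 (by omega) (by omega) (by decide) (by decide)
    (fun k hk s hs => ?_) fun g1 hg1 => ?_
  · rw [h.mask k hk]
    split_ifs with h1
    · rw [one_mul, h.x k (Decomp.HR_subset (hHR h1)) s hs]
    · rw [zero_mul, ZMod.val_zero]
  simp only [sum_range_ite hlt, ← bitAt_sum] at hg1
  refine wp_block_cons (wp_call [F.n, M * F.n, 0, 0, 0] (by simp) (by simp) (by simp; omega) ?_)
  refine wp_setRow (fun s => (bitAt F (nm i s) (∑ k ∈ A.hitH (F.σ i), A.x k)).val) hX.β0.ge (by omega)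
    (fun s hs g => ⟨by simp; omega, by simp [upd_apply, hg1 s hs], (zmod_val_le _).trans (by omega)⟩)
    fun g6 h6 _ => ?_
  refine wp_block_cons (wp_call [F.n, F.m + 1] (by simp) (by simp) (by simp; omega) ?_)
  refine wp_sumRows (fun k w => if k ∈ A.hitH (F.σ i) then A.U k w else 0)
    hX.β0.ge hX.β2.ge (by omega) e3 (by omega) (by omega) (by decide) (by decide)
    (fun k hk w hw => ?_) fun g2 hg2 => ?_
  · simp only [upd_apply, Nat.reduceEqDiff, if_false]
    rw [h.mask k hk]
    split_ifs with h1
    · rw [one_mul, h.U k (hHR h1) w (by omega)]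
    · rw [zero_mul, ZMod.val_zero]
  simp only [sum_range_ite hlt] at hg2
  refine wp_block_cons (wp_call [F.m + 1, M * (F.m + 1), 0, 0, 0] (by simp) (by simp)
    (by simp; omega) ?_)
  refine wp_setRow (fun w => (∑ k ∈ A.hitH (F.σ i), A.U k w).val) hX.β2.ge (by omega)
    (fun w hw g => ⟨by simp; omega, by simp [upd_apply, hg2 w hw], (zmod_val_le _).trans (by omega)⟩)
    fun g9 h9 _ => ?_
  -- The row `M` is unmarked, because its functional is added to the others and must itself stay
  -- unchanged.
  refine wp_block_cons (wp_store M 0 (by simp) (by simp) (by simp) (by simp) (by omega) (by omega) ?_)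
  refine wp_block_cons (wp_call [F.n, F.n, M] (by simp) (by simp) (by simp; omega) ?_)
  refine wp_addRows hX.β0.ge hX.β0.ge (by omega) e2 (by omega) hMn (by decide) (fun _ => ?_)
    fun g8 h8 => ?_
  · simp only [upd_apply, Nat.reduceEqDiff, if_false, if_true, Function.update_self, true_and]
    exact h.φ_le M hMn
  refine wp_block_cons (wp_call [F.m, F.n, M, i] (by simp) (by simp) (by simp; omega) ?_)
  refine wp_emitHomology (b := A.birth M) (nm := nm) (u := ∑ r ∈ A.hitH (F.σ i), A.U r)
    (wire := A.wire) hX hi.le hMn h.slots h.step h.tab (h.birth M hMr) (fun w hw => ?_)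
    (fun w _ hu => ?_) (fun w hu => ?_) (fun α hα => ?_) fun μ' cyc keep hl => ?_
  · change g9 _ = _
    rw [h9 M w (by omega), if_pos rfl, Finset.sum_apply]
  · obtain ⟨r, hr, hru⟩ := exists_of_sum_apply_ne_zero hu
    exact h.wire r (hHR hr) w hru
  · obtain ⟨r, hr, hru⟩ := exists_of_sum_apply_ne_zero hu
    exact (hv.wire_mem r (hHR hr) w hru).2
  · rw [bundleChain_sum]
    exact sum_mem fun r hr => (mem_cycles.1 (hv.rep_mem (hHR hr) hα)).1
  have k0 : μ' 0 = μ 0 := keep 0 (by decide) (by decide)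
  have k1 : μ' 1 = μ 1 := keep 1 (by decide) (by decide)
  have k2 : μ' 2 = μ 2 := keep 2 (by decide) (by decide)
  have k3 : μ' 3 = μ 3 := keep 3 (by decide) (by decide)
  have k4 : μ' 4 = μ 4 := keep 4 (by decide) (by decide)
  have k5 : μ' 5 = μ 5 := keep 5 (by decide) (by decide)
  have k6 : μ' 6 = g6 := keep 6 (by decide) (by decide)
  have k7 : μ' 7 = μ 7 := keep 7 (by decide) (by decide)
  have k8 : μ' 8 = g8 := keep 8 (by decide) (by decide)
  have k9 : μ' 9 = g9 := keep 9 (by decide) (by decide)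
  have k10 : μ' 10 = μ 10 := keep 10 (by decide) (by decide)
  have k14 : μ' 14 = μ 14 := keep 14 (by decide) (by decide)
  refine wp_block_cons (wp_call [F.n, M * F.n, 0, 0, 0] (by simp) (by simp) (by simp; omega) ?_)
  refine wp_setRow (fun s => μ 14 s) hX.β0.ge (by omega)
    (fun s hs g => ⟨by simp; omega, by simp [upd_apply, k14], (hc s hs).trans (by omega)⟩) fun g7 h7 _ => ?_
  refine wp_block_cons (wp_store M 2 (by simp) (by simp) (by simp) (by simp) (by omega) (by omega) ?_)
  refine wp_block_cons (wp_store M (i + 1) (by simp) (by simp) (by simp) (by simp) (by omega) (by omega) ?_)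
  refine wp_block_nil ?_
  have hout : [(⟨false, A.birth M, i, cyc⟩ : Bar)].flatMap Bar.encode =
      [0, A.birth M, i] ++ cyc.flatMap fun js => js.length :: js := by simp [Bar.encode]
  rw [← hout]
  refine hQ _ _ _ _ (hv.advance_insertDeath hi hd hM hkey hl)
    (h.toStores.insertDeath (q' := q') (f := f) hv hi hd h.change hM ?_ ?_ ?_ ?_ ?_ ?_ ?_ ?_ ?_ ?_)
    (Input.congr h.toInput ?_ ?_)
  all_goals simp only [upd_apply, Nat.reduceEqDiff, if_false, if_true, k0, k1, k2, k3, k4, k5, k6, k8,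
    k9, k10]
  · exact h.newtab
  · intro _ _; trivial
  · intro r _
    rw [Function.update_apply]
  · intro r
    rw [Function.update_apply]
  · intro r s hs
    rw [h6 r s hs]
    rfl
  · intro r s hs
    rw [h7 r s hs, h.cone s hs, k7]
  · intro r hr s hs
    -- The column `f` was cleared beforehand, so the entries cleared at `f` are the stored ones.
    have e : ∀ k < F.n, (if s = f then 0 else μ 8 (k * F.n + s)) = μ 8 (k * F.n + s) := by
      intro k hk
      split_ifs with e
      · rw [e, h.φ_f k hk]
      · rfl
    rw [e r hr, e M hMn, h8 r hr s hs]
    simp only [upd_apply, Nat.reduceEqDiff, if_false, if_true, Function.update_apply, h.mask r hr,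
      Finset.mem_erase, ne_eq]
    by_cases e : r = M <;> simp [e]
  · intro r hr w hw
    rw [h9 r w hw, if_neg hr]
    rfl

end Cmd

/-! ## Deletions -/

/-- The slot `f` holds `σ i`, which is to be deleted; the next row of the table of slots is
written. -/
structure DeleteReady (F : Filtration) (i : ℕ) (A : Decomp) (nm : ℕ → ℕ → ℕ) (q' : ℕ → ℕ) (f : ℕ)
    (μ : ℕ → ℕ → ℕ) : Prop extends Stores F i A nm μ, Input F μ where
  change : SlotStep F i (nm i) q' f
  newtab : ∀ s < F.n, μ 2 ((i + 1) * F.n + s) = q' s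

theorem DeleteReady.upd {F : Filtration} {i f : ℕ} {A : Decomp} {nm μ : ℕ → ℕ → ℕ} {q' : ℕ → ℕ}
    (h : DeleteReady F i A nm q' f μ) {B : ℕ} (hB : 10 < B) (g : ℕ → ℕ) :
    DeleteReady F i A nm q' f (upd μ B g) where
  toStores := h.toStores.upd (by omega) g
  toInput := h.toInput.upd (by omega) g
  change := h.change
  newtab := by
    rw [upd_apply, if_neg (by omega)]
    exact h.newtab

namespace Cmd

variable {F : Filtration} {X : Limits} {μ : ℕ → ℕ → ℕ} {o : List ℕ}
  {Q : (ℕ → ℕ → ℕ) → List ℕ → Prop} {q q' : ℕ → ℕ} {i f : ℕ} {A : Decomp} {nm : ℕ → ℕ → ℕ}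

/-- Mark the rows of the kind `k` at which the array `B` has a one in the column `f`; the environment
is `[n, 0, f, 0, 0]`. -/
def markColumn (k B : ℕ) : Cmd :=
  fillRow 0 15 (Ex.eqb (.load 3 (.var 6)) (.lit k) * .load B (.var 6 * .var 0 + .var 2))

theorem wp_markColumn {k B : ℕ} {S : Finset ℕ} {c : ℕ → Chain} (h15 : B ≠ 15) (hX : Room F X)
    (hf : f < F.n) (hS : ∀ r < F.n, μ 3 r = k ↔ r ∈ S)
    (hc : ∀ r ∈ S, μ B (r * F.n + f) = (c r (F.σ i)).val)
    (hQ : ∀ g : ℕ → ℕ, (∀ r < F.n, g r = if r ∈ S ∧ c r (F.σ i) = 1 then 1 else 0) →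
      Q (upd μ 15 g) o) :
    (markColumn k B).wp X [F.n, 0, f, 0, 0] μ o Q := by
  have hn := hX.n_le
  have hm := hX.m_lt
  have e2 := hX.sq_le
  refine wp_mask (fun r => r ∈ S ∧ c r (F.σ i) = 1) hX (fun r hr g => ⟨?_, ?_⟩) hQ
  · have := row_lt hr hf
    simp
    omega
  · simp only [upd_apply, h15, Ex.eval_mul, Ex.eval_eqb, Ex.eval_load, Ex.eval_var, Ex.eval_lit,
      Ex.eval_add, List.getD_cons_zero, List.getD_cons_succ, Nat.reduceEqDiff, if_false, hS r hr]
    by_cases h1 : r ∈ S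
    · simp [h1, hc r h1, zmod_val_eq_ite]
    · simp [h1]

/-- Destroy the cycle of the row found last; the environment is `[m, n, i, f]`. -/
def deleteDeath : Cmd :=
  letv (.load 18 (.lit 0)) (block [
    call [.var 0, .var 1, .var 4, .var 2] emitHomology,
    call [.var 1, .lit 0, .var 3, .lit 0, .lit 0] (markColumn 2 7),
    call [.var 1, .var 1, .var 4] (addRows 0 7 6),
    store 3 (.var 4) (.lit 0),
    call [.var 1, .lit 0, .var 3, .lit 0, .lit 0] (markColumn 1 6),
    call [.var 1, .var 0 + .lit 1, .var 4] (addRows 2 9 9),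
    call [.var 1, .var 1, .var 4] (addRows 0 6 6)])

/-- The bar is written first, while bundles and cycles are untouched. Afterwards the row `M` is
added to the rows containing the deleted simplex. -/
theorem wp_deleteDeath (hX : Room F X) (h : DeleteReady F i A nm q' f μ)
    (hv : A.Valid F i) (hi : i < F.m) (hd : F.dir i = false) (hM : μ 18 0 ∈ A.HR)
    (hM1 : A.x (μ 18 0) (F.σ i) = 1)
    (hkey : ∀ r ∈ A.HR, A.x r (F.σ i) = 1 → F.key (A.birth (μ 18 0)) ≤ F.key (A.birth r))
    (hQ : ∀ A' nm' μ' bars, Advance F i A A' bars → Stores F (i + 1) A' nm' μ' → Input F μ' →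
      Q μ' (o ++ bars.flatMap Bar.encode)) :
    deleteDeath.wp X [F.m, F.n, i, f] μ o Q := by
  have hn := hX.n_le
  have hS := hX.m_lt
  have hSB := hX.S_le
  have hB := hX.B_ge
  have e2 := hX.sq_le
  have e3 := hX.tab'
  have hf := h.change.lt
  obtain ⟨M, hMdef⟩ : ∃ M, M = μ 18 0 := ⟨_, rfl⟩
  rw [← hMdef] at hM hkey hM1
  have hMr := Decomp.HR_subset hM
  have hMn := hv.lt_n M hMr
  have bit : ∀ c, bitAt F (nm i f) c = c (F.σ i) := h.change.apply_eq_bit hd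
  refine wp_letv M (by simp; omega) (by simp; rw [hMdef]) (by omega) ?_
  refine wp_block_cons (wp_call [F.m, F.n, M, i] (by simp) (by simp) (by simp; omega) ?_)
  refine wp_emitHomology (b := A.birth M) (nm := nm) (u := A.U M)
    (wire := A.wire) hX hi.le hMn h.slots h.step h.tab (h.birth M hMr) (h.U M hM)
    (fun w _ hu => h.wire M hM w hu) (fun w hu => (hv.wire_mem M hM w hu).2)
    (fun α hα => (mem_cycles.1 (hv.rep_mem hM hα)).1) fun μ' cyc keep hl => ?_
  have k0 : μ' 0 = μ 0 := keep 0 (by decide) (by decide)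
  have k1 : μ' 1 = μ 1 := keep 1 (by decide) (by decide)
  have k2 : μ' 2 = μ 2 := keep 2 (by decide) (by decide)
  have k3 : μ' 3 = μ 3 := keep 3 (by decide) (by decide)
  have k4 : μ' 4 = μ 4 := keep 4 (by decide) (by decide)
  have k5 : μ' 5 = μ 5 := keep 5 (by decide) (by decide)
  have k6 : μ' 6 = μ 6 := keep 6 (by decide) (by decide)
  have k7 : μ' 7 = μ 7 := keep 7 (by decide) (by decide)
  have k8 : μ' 8 = μ 8 := keep 8 (by decide) (by decide)
  have k9 : μ' 9 = μ 9 := keep 9 (by decide) (by decide)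
  have k10 : μ' 10 = μ 10 := keep 10 (by decide) (by decide)
  refine wp_block_cons (wp_call [F.n, 0, f, 0, 0] (by simp) (by simp) (by simp; omega) ?_)
  refine wp_markColumn (S := A.BR) (c := A.y) (i := i) (by decide) hX hf (fun r hr => ?_)
    (fun r hr => ?_) fun g1 hg1 => ?_
  · rw [k3, h.kind r hr, Decomp.kind_eq_two hv]
  · rw [k7, h.y r hr f hf, bit]
  refine wp_block_cons (wp_call [F.n, F.n, M] (by simp) (by simp) (by simp; omega) ?_)
  refine wp_addRows hX.β0.ge hX.β0.ge (by omega) e2 (by omega) hMn (by decide) (by simp)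
    fun g7 h7 => ?_
  -- Declaring the row `M` free keeps it from being marked in the next pass, so it is not added to
  -- itself.
  refine wp_block_cons (wp_store M 0 (by simp) (by simp) (by simp) (by simp) (by omega) (by omega) ?_)
  refine wp_block_cons (wp_call [F.n, 0, f, 0, 0] (by simp) (by simp) (by simp; omega) ?_)
  refine wp_markColumn (S := A.HR.erase M) (c := A.x) (i := i) (by decide) hX hf (fun r hr => ?_)
    (fun r hr => ?_) fun g2 hg2 => ?_
  · simp only [upd_apply, Nat.reduceEqDiff, if_false, if_true, k3, Function.update_apply,
      h.kind r hr, Finset.mem_erase]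
    by_cases e : r = M
    · simp [e]
    · simp [e, Decomp.kind_eq_one]
  · change μ' 6 _ = _
    rw [k6, h.x r (Decomp.HR_subset (Finset.mem_of_mem_erase hr)) f hf, bit]
  have g2M : g2 M = 0 := by
    rw [hg2 M hMn, if_neg (by simp)]
  refine wp_block_cons (wp_call [F.n, F.m + 1, M] (by simp) (by simp) (by simp; omega) ?_)
  refine wp_addRows hX.β0.ge hX.β2.ge (by omega) e3 (by omega) hMn (by decide)
    (fun _ => ⟨g2M, fun w hw => ?_⟩) fun g9 h9 => ?_
  · change μ' 9 _ ≤ 1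
    rw [k9, h.U M hM w (by omega)]
    exact zmod_val_le _
  refine wp_block_cons (wp_call [F.n, F.n, M] (by simp) (by simp) (by simp; omega) ?_)
  refine wp_addRows hX.β0.ge hX.β0.ge (by omega) e2 (by omega) hMn (by decide)
    (fun _ => ⟨g2M, fun s hs => ?_⟩) fun g6 h6 => ?_
  · change μ' 6 _ ≤ 1
    rw [k6, h.x M hMr s hs]
    exact zmod_val_le _
  refine wp_block_nil ?_
  have hout : [(⟨false, A.birth M, i, cyc⟩ : Bar)].flatMap Bar.encode =
      [0, A.birth M, i] ++ cyc.flatMap fun js => js.length :: js := by simp [Bar.encode]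
  rw [← hout]
  have hadv := hv.advance_deleteDeath hi hd hM hM1 hkey hl
  refine hQ _ _ _ _ hadv
    (h.toStores.deleteDeath (q' := q') (f := f) hv hi hd h.change hM hadv.valid ?_ ?_ ?_ ?_ ?_ ?_ ?_ ?_
      ?_ ?_)
    (Input.congr h.toInput ?_ ?_)
  all_goals simp only [upd_apply, Nat.reduceEqDiff, if_false, if_true, k0, k1, k2, k3, k4, k5, k8, k10]
  · exact h.newtab
  · intro _ _; trivial
  · intro r _
    rw [Function.update_apply]
  · intro r hr hrM s hs
    rw [h6 r hr s hs]
    simp only [upd_apply, Nat.reduceEqDiff, if_false, if_true, k6, hg2 r hr, Finset.mem_erase, hrM,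
      ne_eq, not_false_eq_true, true_and]
  · intro r hr s hs
    rw [h7 r hr s hs]
    simp only [upd_apply, Nat.reduceEqDiff, if_false, if_true, k6, k7, hg1 r hr]
  · intro r hr hrM w hw
    rw [h9 r hr w hw]
    simp only [upd_apply, Nat.reduceEqDiff, if_false, if_true, k9, hg2 r hr, Finset.mem_erase, hrM,
      ne_eq, not_false_eq_true, true_and]

/-- Turn the boundary of the row found last into a nontrivial cycle; the environment is
`[m, n, i, f]`. -/
def deleteBirth : Cmd :=
  letv (.load 18 (.lit 0)) (block [
    call [.var 1, .var 1] (sumRows 0 8 22),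
    call [.var 1, .var 4 * .var 1, .lit 0, .lit 0, .lit 0] (fillRow 0 8 (.load 22 (.var 6))),
    call [.var 0, .var 1, .var 4, .var 2] emitBoundary,
    store 15 (.var 4) (.lit 0),
    call [.var 1, .var 1, .var 4] (addRows 0 6 6),
    call [.var 1, .var 1, .var 4] (addRows 0 7 7),
    store 3 (.var 4) (.lit 1), store 4 (.var 4) (.var 2 + .lit 1),
    store 5 (.var 4) (.var 0 + .lit 1 - (.var 2 + .lit 1)),
    call [.var 0 + .lit 1, .var 4 * (.var 0 + .lit 1), .var 2 + .lit 1, .lit 0, .lit 0]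
      (fillRow 2 9 (Ex.eqb (.var 6) (.var 2))),
    call [.var 1, (.var 2 + .lit 1) * .var 1, .var 4 * .var 1, .lit 0, .lit 0]
      (fillRow 0 10 (.load 6 (.var 2 + .var 6)))])

/-- The functionals are summed while `M` is still marked, as its own functional belongs to the sum;
for the additions to cycles and bounding chains `M` is unmarked. -/
theorem wp_deleteBirth (hX : Room F X) (h : DeleteReady F i A nm q' f μ)
    (hv : A.Valid F i) (hi : i < F.m) (hd : F.dir i = false) (hx : ∀ r ∈ A.HR, A.x r (F.σ i) = 0)
    (hφ : ∀ r < F.n, ∀ s < F.n, μ 8 (r * F.n + s) ≤ 1)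
    (hmask : ∀ r < F.n, μ 15 r = if r ∈ A.BR ∧ A.y r (F.σ i) = 1 then 1 else 0)
    (hM : μ 18 0 ∈ A.BR) (hM1 : A.y (μ 18 0) (F.σ i) = 1)
    (hmin : ∀ r ∈ A.BR, A.y r (F.σ i) = 1 → A.birth (μ 18 0) ≤ A.birth r)
    (hQ : ∀ A' nm' μ' bars, Advance F i A A' bars → Stores F (i + 1) A' nm' μ' → Input F μ' →
      Q μ' (o ++ bars.flatMap Bar.encode)) :
    deleteBirth.wp X [F.m, F.n, i, f] μ o Q := by
  have hn := hX.n_le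
  have hS := hX.m_lt
  have hSB := hX.S_le
  have hB := hX.B_ge
  have e1 := hX.tab
  have e2 := hX.sq_le
  have e3 := hX.tab'
  obtain ⟨M, hMdef⟩ : ∃ M, M = μ 18 0 := ⟨_, rfl⟩
  rw [← hMdef] at hM hmin hM1
  have hMr := Decomp.BR_subset hM
  have hMn := hv.lt_n M hMr
  have l1 := Nat.mul_le_mul_right F.n (show M + 1 ≤ F.n from hMn)
  have l2 := Nat.mul_le_mul_right (F.m + 1) (show M + 1 ≤ F.n from hMn)
  have l3 := Nat.mul_le_mul_right F.n (show i + 1 + 1 ≤ F.m + 1 by omega)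
  rw [Nat.succ_mul] at l1 l2 l3
  set T := A.BR.filter fun r => A.y r (F.σ i) = 1 with hT
  have hTn : ∀ r ∈ T, r < F.n := fun r hr =>
    hv.lt_n r (Decomp.BR_subset (Finset.mem_filter.1 hr).1)
  refine wp_letv M (by simp; omega) (by simp; rw [hMdef]) (by omega) ?_
  refine wp_block_cons (wp_call [F.n, F.n] (by simp) (by simp) (by simp; omega) ?_)
  -- At an empty slot the entry is not the value of a functional; it is summed as a bare bit.
  refine wp_sumRows (fun k s => if k ∈ T then ((μ 8 (k * F.n + s) : ℕ) : ZMod 2) else 0)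
    hX.β0.ge hX.β0.ge (by omega) e2 (by omega) (by omega) (by decide) (by decide)
    (fun k hk s hs => ?_) fun g1 hg1 => ?_
  · rw [hmask k hk]
    simp only [hT, Finset.mem_filter]
    split_ifs
    · rw [one_mul, ZMod.val_natCast_of_lt]
      have := hφ k hk s hs
      omega
    · rw [zero_mul, ZMod.val_zero]
  simp only [sum_range_ite hTn] at hg1
  refine wp_block_cons (wp_call [F.n, M * F.n, 0, 0, 0] (by simp) (by simp) (by simp; omega) ?_)
  refine wp_setRow (fun s => (∑ k ∈ T, ((μ 8 (k * F.n + s) : ℕ) : ZMod 2)).val) hX.β0.ge (by omega)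
    (fun s hs g => ⟨by simp; omega, by simp [upd_apply, hg1 s hs], (zmod_val_le _).trans (by omega)⟩)
    fun g8 h8 _ => ?_
  refine wp_block_cons (wp_call [F.m, F.n, M, i] (by simp) (by simp) (by simp; omega) ?_)
  refine wp_emitBoundary (b := A.birth M) (nm := nm) (x := A.x M) hX hi.le hMn h.slots h.step h.tab
    (h.birth M hMr) (h.x M hMr) (fun α h1 h2 =>
      (mem_cycles.1 (boundaries_le_cycles _ ((hv.bd M hM).mem α h1 h2))).1) fun μ' cyc keep hl => ?_
  have k0 : μ' 0 = μ 0 := keep 0 (by decide) (by decide)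
  have k1 : μ' 1 = μ 1 := keep 1 (by decide) (by decide)
  have k2 : μ' 2 = μ 2 := keep 2 (by decide) (by decide)
  have k3 : μ' 3 = μ 3 := keep 3 (by decide) (by decide)
  have k4 : μ' 4 = μ 4 := keep 4 (by decide) (by decide)
  have k5 : μ' 5 = μ 5 := keep 5 (by decide) (by decide)
  have k6 : μ' 6 = μ 6 := keep 6 (by decide) (by decide)
  have k7 : μ' 7 = μ 7 := keep 7 (by decide) (by decide)
  have k8 : μ' 8 = g8 := keep 8 (by decide) (by decide)
  have k9 : μ' 9 = μ 9 := keep 9 (by decide) (by decide)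
  have k10 : μ' 10 = μ 10 := keep 10 (by decide) (by decide)
  have k15 : μ' 15 = μ 15 := keep 15 (by decide) (by decide)
  have hmask' : ∀ r < F.n, Function.update (μ 15) M 0 r =
      if r ∈ A.BR.erase M ∧ A.y r (F.σ i) = 1 then 1 else 0 := by
    intro r hr
    rw [Function.update_apply, hmask r hr]
    simp only [Finset.mem_erase]
    by_cases e : r = M <;> simp [e]
  refine wp_block_cons (wp_store M 0 (by simp) (by simp) (by simp) (by simp) (by omega) (by omega) ?_)
  refine wp_block_cons (wp_call [F.n, F.n, M] (by simp) (by simp) (by simp; omega) ?_)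
  refine wp_addRows hX.β0.ge hX.β0.ge (by omega) e2 (by omega) hMn (by decide)
    (fun _ => ⟨Function.update_self _ _ _, fun s hs => ?_⟩) fun g6 h6 => ?_
  · change μ' 6 _ ≤ 1
    rw [k6, h.x M hMr s hs]
    exact zmod_val_le _
  refine wp_block_cons (wp_call [F.n, F.n, M] (by simp) (by simp) (by simp; omega) ?_)
  refine wp_addRows hX.β0.ge hX.β0.ge (by omega) e2 (by omega) hMn (by decide)
    (fun _ => ⟨Function.update_self _ _ _, fun s hs => ?_⟩) fun g7 h7 => ?_
  · change μ' 7 _ ≤ 1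
    rw [k7, h.y M hM s hs]
    exact zmod_val_le _
  refine wp_block_cons (wp_store M 1 (by simp) (by simp) (by simp) (by simp) (by omega) (by omega) ?_)
  refine wp_block_cons (wp_store M (i + 1) (by simp) (by simp) (by simp) (by simp) (by omega) (by omega) ?_)
  refine wp_block_cons (wp_store M (F.m + 1 - (i + 1)) (by simp) (by simp) (by simp) (by simp)
    (by omega) (by omega) ?_)
  refine wp_block_cons (wp_call [F.m + 1, M * (F.m + 1), i + 1, 0, 0] (by simp) (by simp)
    (by simp; omega) ?_)
  refine wp_setRow (fun s => if s = i + 1 then 1 else 0) hX.β2.ge (by omega)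
    (fun s hs g => ⟨by simp, by simp, by split_ifs <;> omega⟩) fun g9 h9 _ => ?_
  refine wp_block_cons (wp_call [F.n, (i + 1) * F.n, M * F.n, 0, 0] (by simp) (by simp)
    (by simp; omega) ?_)
  refine wp_setRow (fun s => g6 (M * F.n + s)) hX.β0.ge (by omega)
    (fun s hs g => ⟨by simp; omega, by simp [upd_apply], ?_⟩) fun g10 h10 h10' => ?_
  · rw [h6 M hMn s hs]
    split_ifs <;> omega
  refine wp_block_nil ?_
  have hout : [(⟨true, A.birth M, i, cyc⟩ : Bar)].flatMap Bar.encode =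
      [1, A.birth M, i] ++ cyc.flatMap fun js => js.length :: js := by simp [Bar.encode]
  rw [← hout]
  have hadv := hv.advance_deleteBirth hi hd hx hM hM1 hmin hl
  refine hQ _ _ _ _ hadv
    (h.toStores.deleteBirth (q' := q') (f := f) hv hi hd h.change hM hadv.valid ?_ ?_ ?_ ?_ ?_ ?_ ?_ ?_
      ?_ ?_ ?_)
    (Input.congr h.toInput ?_ ?_)
  all_goals simp only [upd_apply, Nat.reduceEqDiff, if_false, if_true, k0, k1, k2, k3, k4, k5, k8]
  · exact h.newtab
  · intro _ _; trivial
  · intro r _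
    rw [Function.update_apply]
  · intro r
    rw [Function.update_apply]
  · intro r
    rw [Function.update_apply]
  · intro r hr s hs
    rw [h6 r hr s hs]
    simp only [upd_apply, Nat.reduceEqDiff, if_false, if_true, k6, k15, hmask' r hr]
  · intro r hr s hs
    rw [h7 r hr s hs]
    simp only [upd_apply, Nat.reduceEqDiff, if_false, if_true, k7, k15, hmask' r hr]
  · intro r s hs h0
    rw [h8 r s hs]
    simp only [upd_apply, Nat.reduceEqDiff, if_false]
    split_ifs
    · refine congrArg ZMod.val (Finset.sum_congr rfl fun k hk => ?_)
      rw [h.φ k (Decomp.BR_subset (Finset.mem_filter.1 hk).1) s hs h0, ZMod.natCast_zmod_val]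
    · rfl
  · intro r w hw
    rw [h9 r w hw]
    simp only [upd_apply, Nat.reduceEqDiff, if_false, k9]
  · intro s hs
    rw [h10 _ s hs, if_pos rfl]
  · intro b hb
    rw [h10' b hb]
    simp only [upd_apply, Nat.reduceEqDiff, if_false, k10]

/-- Delete the simplex in the slot `f`; the environment is `[m, n, i, f]`. -/
def delete : Cmd :=
  block [call [.var 1, (.var 2 + .lit 1) * .var 1, .var 2 * .var 1, .var 3, .lit 0] copySlots,
    call [.var 1, .lit 0, .var 3, .lit 0, .lit 0] (markColumn 1 6),
    call [.var 1, .var 0, .lit 0]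
      (select (.load 15 (.var 4) * (.var 1 + .var 1 + .lit 3 - .load 5 (.var 4)))),
    ite (.lit 0) (.load 17 (.lit 0)) deleteDeath (block [call [.var 1, .var 1] clean,
      call [.var 1, .lit 0, .var 3, .lit 0, .lit 0] (markColumn 2 7),
      call [.var 1, .var 0, .lit 0]
        (select (.load 15 (.var 4) * (.var 1 + .lit 1 - .load 4 (.var 4)))), deleteBirth])]

theorem wp_delete (hX : Room F X) (h : Stores F i A nm μ) (hin : Input F μ)
    (hv : A.Valid F i) (hi : i < F.m) (hd : F.dir i = false) (hf : f < F.n) (hf0 : nm i f ≠ 0)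
    (hfσ : F.σ (nm i f - 1) = F.σ i)
    (hQ : ∀ A' nm' μ' bars, Advance F i A A' bars → Stores F (i + 1) A' nm' μ' → Input F μ' →
      Q μ' (o ++ bars.flatMap Bar.encode)) :
    delete.wp X [F.m, F.n, i, f] μ o Q := by
  have hn := hX.n_le
  have hS := hX.m_lt
  have hSB := hX.S_le
  have hB := hX.B_ge
  have e1 := hX.tab
  have e2 : (i + 1) * F.n ≤ (F.m + 1) * F.n := Nat.mul_le_mul_right _ (by omega)
  have e3 : i * F.n ≤ (F.m + 1) * F.n := Nat.mul_le_mul_right _ (by omega)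
  have hslot : SlotStep F i (nm i) (Function.update (nm i) f 0) f :=
    ⟨hf, fun s _ hs => Function.update_of_ne hs _ _, fun e => by simp [hd] at e,
      fun _ => ⟨hf0, hfσ, Function.update_self _ _ _⟩⟩
  have bit : ∀ c, bitAt F (nm i f) c = c (F.σ i) := hslot.apply_eq_bit hd
  refine wp_block_cons (wp_call [F.n, (i + 1) * F.n, i * F.n, f, 0] (by simp) (by simp)
    (by simp; omega) ?_)
  refine wp_copySlots hX hi (by omega) (h.slots i le_rfl).le (h.tab i le_rfl) fun t1 ht1 ht1' => ?_
  have r1 : DeleteReady F i A nm (Function.update (nm i) f 0) f (upd μ 2 t1) := by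
    refine ⟨⟨h.slots, h.step, fun α hα s hs => ?_, h.kind, h.birth, h.key, h.x, h.y, h.φ, h.U, h.wire⟩,
      hin.upd (by omega) t1, hslot, fun s hs => ?_⟩
    · rw [upd_self, ht1' _ (Or.inl (row_lt (by omega) hs)), h.tab α hα s hs]
    · rw [upd_self, ht1 s hs, Function.update_apply]
  refine wp_block_cons (wp_call [F.n, 0, f, 0, 0] (by simp) (by simp) (by simp; omega) ?_)
  refine wp_markColumn (S := A.HR) (c := A.x) (i := i) (by decide) hX hf (fun r hr => ?_)
    (fun r hr => ?_) fun g1 hg1 => ?_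
  · rw [r1.kind r hr, Decomp.kind_eq_one]
  · rw [r1.x r (Decomp.HR_subset hr) f hf, bit]
  have r2 := r1.upd (B := 15) (by omega) g1
  have hkey : ∀ r ∈ A.HR, μ 5 r = F.key (A.birth r) ∧ F.key (A.birth r) ≤ 2 * F.m + 2 := by
    intro r hr
    refine ⟨h.key r hr, ?_⟩
    have h3 := hv.birth_le (Decomp.HR_subset hr)
    unfold Filtration.key
    split_ifs <;> omega
  refine wp_block_cons (wp_call [F.n, F.m, 0] (by simp) (by simp) (by simp; omega) ?_)
  -- Subtracting from `2 m + 3`, which exceeds all keys, turns the search for the smallest key into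
  -- one for the largest positive score.
  refine wp_select (fun r => if r ∈ A.HR ∧ A.x r (F.σ i) = 1 then F.m + F.m + 3 - F.key (A.birth r) else 0)
    hX.β0.ge (by omega)
    (by omega) (fun r hr g g' => ⟨by simp; omega, ?_, ?_⟩) fun g2 g2' hg2 => ?_
  · simp only [upd_apply, Ex.eval_mul, Ex.eval_load, Ex.eval_var, Ex.eval_add, Ex.eval_sub, Ex.eval_lit,
      List.getD_cons_zero, List.getD_cons_succ, Nat.reduceEqDiff, if_false, if_true, hg1 r hr]
    by_cases h1 : r ∈ A.HR ∧ A.x r (F.σ i) = 1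
    · rw [if_pos h1, if_pos h1, one_mul, (hkey r h1.1).1]
    · rw [if_neg h1, if_neg h1, zero_mul]
  · split_ifs <;> omega
  have r3 := (r2.upd (B := 17) (by omega) g2).upd (B := 18) (by omega) g2'
  refine wp_block_cons ⟨by simp, by simp; omega, fun hlt => ?_, fun hlt => ?_⟩
  · have hlt : 0 < g2 0 := hlt
    rcases hg2 with ⟨h1, -⟩ | ⟨-, h2, h3, h4⟩
    · omega
    have h5 : g2' 0 ∈ A.HR ∧ A.x (g2' 0) (F.σ i) = 1 := by
      by_contra hn
      rw [if_neg hn] at h3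
      omega
    refine wp_deleteDeath hX r3 hv hi hd h5.1 h5.2 (fun r hr hr1 => ?_) hQ
    have := h4 r (hv.lt_n r (Decomp.HR_subset hr))
    rw [if_pos h5, if_pos ⟨hr, hr1⟩] at this
    have := hkey r hr
    have := hkey _ h5.1
    change F.key (A.birth (g2' 0)) ≤ _
    omega
  · have hlt : ¬ 0 < g2 0 := hlt
    have hx : ∀ r ∈ A.HR, A.x r (F.σ i) = 0 := by
      intro r hr
      rcases hg2 with ⟨-, h2⟩ | ⟨h1, -⟩
      · have h3 := h2 r (hv.lt_n r (Decomp.HR_subset hr))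
        by_contra h0
        have h1 : A.x r (F.σ i) = 1 := by
          revert h0
          generalize A.x r (F.σ i) = u
          revert u
          decide
        have := hkey r hr
        rw [if_pos ⟨hr, h1⟩] at h3
        omega
      · omega
    clear hg2
    generalize upd (upd (upd (upd μ 2 t1) 15 g1) 17 g2) 18 g2' = ν at r3
    -- The column number `n` is out of range: entries are normalized to bits, but no column is
    -- cleared.
    refine wp_block_cons (wp_call [F.n, F.n] (by simp) (by simp) (by simp; omega) ?_)
    refine wp_clean hX fun g hg => ?_
    have hφ : ∀ r ∈ A.rows, ∀ s < F.n, nm i s ≠ 0 →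
        g (r * F.n + s) = (A.φ r (F.σ (nm i s - 1))).val := by
      intro r hr s hs h0
      rw [hg r (hv.lt_n r hr) s hs, if_neg hs.ne, r3.φ r hr s hs h0, zmod_val_ite]
    have r4 : DeleteReady F i A nm (Function.update (nm i) f 0) f (upd ν 8 g) :=
      ⟨⟨r3.slots, r3.step, r3.tab, r3.kind, r3.birth, r3.key, r3.x, r3.y, hφ, r3.U, r3.wire⟩,
        r3.toInput.upd (by omega) g, r3.change, r3.newtab⟩
    refine wp_block_cons (wp_call [F.n, 0, f, 0, 0] (by simp) (by simp) (by simp; omega) ?_)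
    refine wp_markColumn (S := A.BR) (c := A.y) (i := i) (by decide) hX hf (fun r hr => ?_)
      (fun r hr => ?_) fun g3 hg3 => ?_
    · rw [r4.kind r hr, Decomp.kind_eq_two hv]
    · rw [r4.y r hr f hf, bit]
    have r5 := r4.upd (B := 15) (by omega) g3
    have hbirth : ∀ r ∈ A.BR, ν 4 r = A.birth r ∧ A.birth r ≤ i := fun r hr =>
      ⟨r3.birth r (Decomp.BR_subset hr), hv.birth_le (Decomp.BR_subset hr)⟩
    refine wp_block_cons (wp_call [F.n, F.m, 0] (by simp) (by simp) (by simp; omega) ?_)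
    -- The score is positive and largest for the earliest birth. Some row qualifies by
    -- `exists_y_of_delete`.
    refine wp_select (fun r => if r ∈ A.BR ∧ A.y r (F.σ i) = 1 then F.m + 1 - A.birth r else 0)
      hX.β0.ge (by omega)
      (by omega) (fun r hr g g' => ⟨by simp; omega, ?_, ?_⟩) fun g4 g4' hg4 => ?_
    · simp only [upd_apply, Ex.eval_mul, Ex.eval_load, Ex.eval_var, Ex.eval_add, Ex.eval_sub,
        Ex.eval_lit, List.getD_cons_zero, List.getD_cons_succ, Nat.reduceEqDiff, if_false, if_true,
        hg3 r hr]
      by_cases h1 : r ∈ A.BR ∧ A.y r (F.σ i) = 1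
      · rw [if_pos h1, if_pos h1, one_mul, (hbirth r h1.1).1]
      · rw [if_neg h1, if_neg h1, zero_mul]
    · split_ifs <;> omega
    have r6 := (r5.upd (B := 17) (by omega) g4).upd (B := 18) (by omega) g4'
    refine wp_block_cons ?_
    rcases hg4 with ⟨-, h2⟩ | ⟨-, h2, h3, h4⟩
    · obtain ⟨r, hr, hr1⟩ := hv.exists_y_of_delete hi hd hx
      have h3 := h2 r (hv.lt_n r (Decomp.BR_subset hr))
      have := hbirth r hr
      rw [if_pos ⟨hr, hr1⟩] at h3
      omega
    have h5 : g4' 0 ∈ A.BR ∧ A.y (g4' 0) (F.σ i) = 1 := by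
      by_contra hn
      rw [if_neg hn] at h3
      omega
    refine wp_deleteBirth hX r6 hv hi hd hx (fun r hr s hs => ?_) hg3 h5.1 h5.2 (fun r hr hr1 => ?_)
      fun A' nm' μ' bars h1 h2 h3 => wp_block_nil (hQ A' nm' μ' bars h1 h2 h3)
    · change g _ ≤ 1
      rw [hg r hr s hs]
      split_ifs <;> omega
    · have := h4 r (hv.lt_n r (Decomp.BR_subset hr))
      rw [if_pos h5, if_pos ⟨hr, hr1⟩] at this
      have := hbirth r hr
      have := hbirth _ h5.1
      change A.birth (g4' 0) ≤ _
      omega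

end Cmd

/-! ## The algorithm -/

namespace Cmd

variable {F : Filtration} {X : Limits} {μ : ℕ → ℕ → ℕ} {o : List ℕ}
  {Q : (ℕ → ℕ → ℕ) → List ℕ → Prop} {i f : ℕ} {A : Decomp} {nm : ℕ → ℕ → ℕ}

/-- Insert `σ i` into the slot `f`; the environment is `[m, n, i, f]`. -/
def insert : Cmd :=
  block [prepareInsert, ite (.lit 0) (.load 17 (.lit 0)) insertDeath insertBirth]

theorem wp_insert (hX : Room F X) (h : Stores F i A nm μ) (hin : Input F μ)
    (hv : A.Valid F i) (hi : i < F.m) (hd : F.dir i = true) (hf : f < F.n) (hf0 : nm i f = 0)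
    (h12 : ∀ s < F.n, μ 12 s = (bitAt F (nm i s) (boundary (simplexChain (F.σ i)))).val)
    (hQ : ∀ A' nm' μ' bars, Advance F i A A' bars → Stores F (i + 1) A' nm' μ' → Input F μ' →
      Q μ' (o ++ bars.flatMap Bar.encode)) :
    insert.wp X [F.m, F.n, i, f] μ o Q := by
  have hS := hX.m_lt
  refine wp_block_cons (wp_prepareInsert hX h hin hv hi hd hf hf0 h12 fun μ' h' => ?_)
  refine wp_block_cons ⟨by simp, by simp; omega, fun hlt => ?_, fun hlt => ?_⟩
  · rcases h'.best with ⟨h1, -⟩ | ⟨-, h2, h3⟩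
    · exact absurd hlt (by simp [h1])
    · exact wp_insertDeath hX h' hv hi hd h2 h3 hQ
  · rcases h'.best with ⟨-, h2⟩ | ⟨h1, -⟩
    · exact wp_insertBirth hX h' hv hi hd h2 hQ
    · exact absurd h1 hlt

/-- One step of the filtration; the environment is `[m, n, i]`. -/
def step : Cmd :=
  block [scan, ite (.load 0 (.load 1 (.var 2) - .lit 1)) (.lit 1)
    (block [call [.var 1, .lit 0, .lit 0] (select (.load 13 (.var 4))),
      letv (.load 18 (.lit 0)) delete])
    (block [call [.var 1, .var 2 * .var 1, .lit 0]
        (select (Ex.eqb (.load 2 (.var 1 + .var 4)) (.lit 0))),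
      letv (.load 18 (.lit 0)) insert])]

/-- The slot is found by a search: for a deletion the one marked as holding `σ i`, for an insertion
a free one, which exists because the next complex has at most `n` simplices. -/
theorem wp_step (hX : Room F X) (h : Stores F i A nm μ) (hin : Input F μ)
    (hv : A.Valid F i) (hi : i < F.m)
    (hQ : ∀ A' nm' μ' bars, Advance F i A A' bars → Stores F (i + 1) A' nm' μ' → Input F μ' →
      Q μ' (o ++ bars.flatMap Bar.encode)) :
    step.wp X [F.m, F.n, i] μ o Q := by
  classical
  have hn := hX.n_le
  have hS := hX.m_lt
  have hSB := hX.S_le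
  have hB := hX.B_ge
  have hin' := hX.input
  have hoi := F.offset_lt hi
  have e1 := hX.tab
  have e3 : i * F.n ≤ (F.m + 1) * F.n := Nat.mul_le_mul_right _ (by omega)
  have hq := h.slots i le_rfl
  refine wp_block_cons (wp_scan hX hi hin hq (h.tab i le_rfl) fun g g' g'' hg' hg'' => ?_)
  have s1 := ((h.upd (B := 16) (by omega) g).upd (B := 12) (by omega) g').upd (B := 13) (by omega) g''
  have i1 := ((hin.upd (B := 16) (by omega) g).upd (B := 12) (by omega) g').upd (B := 13) (by omega) g''
  have h12 : ∀ s < F.n, upd (upd (upd μ 16 g) 12 g') 13 g'' 12 s =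
    (bitAt F (nm i s) (boundary (simplexChain (F.σ i)))).val := hg'
  have h13 : ∀ s < F.n, upd (upd (upd μ 16 g) 12 g') 13 g'' 13 s =
    if nm i s ≠ 0 ∧ F.σ (nm i s - 1) = F.σ i then 1 else 0 := hg''
  generalize upd (upd (upd μ 16 g) 12 g') 13 g'' = ν at s1 i1 h12 h13
  refine wp_block_cons ⟨by simp [i1.pos i hi]; omega, by simp, fun hlt => ?_, fun hlt => ?_⟩
  · have hd : F.dir i = false := by
      by_contra hc
      rw [Bool.not_eq_false] at hc
      simp [i1.pos i hi, i1.dir hi, hc] at hlt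
    refine wp_block_cons (wp_call [F.n, 0, 0] (by simp) (by simp) (by simp; omega) ?_)
    refine wp_select (fun s => if nm i s ≠ 0 ∧ F.σ (nm i s - 1) = F.σ i then 1 else 0) hX.β0.ge
      (by omega) (by omega) (fun s hs g g' => ⟨by simp; omega, by simp [upd_apply, h13 s hs],
        by split_ifs <;> omega⟩) fun g2 g2' hg2 => ?_
    have s2 := (s1.upd (B := 17) (by omega) g2).upd (B := 18) (by omega) g2'
    have i2 := (i1.upd (B := 17) (by omega) g2).upd (B := 18) (by omega) g2'
    obtain ⟨hf, hf0, hfσ⟩ : g2' 0 < F.n ∧ nm i (g2' 0) ≠ 0 ∧ F.σ (nm i (g2' 0) - 1) = F.σ i := by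
      rcases hg2 with ⟨-, h2⟩ | ⟨-, h2, h3, -⟩
      · obtain ⟨s, hs, h4⟩ := hq.surj (F.σ i) (F.deletion i hi hd).1
        have h5 := h2 s hs
        rw [if_pos h4] at h5
        omega
      · refine ⟨h2, ?_⟩
        by_contra h4
        rw [if_neg h4] at h3
        omega
    refine wp_block_cons (wp_letv (g2' 0) (by simp; omega) (by simp) (by omega) ?_)
    exact wp_delete hX s2 i2 hv hi hd hf hf0 hfσ hQ
  · have hd : F.dir i = true := by
      by_contra hc
      rw [Bool.not_eq_true] at hc
      simp [i1.pos i hi, i1.dir hi, hc] at hlt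
    refine wp_block_cons (wp_call [F.n, i * F.n, 0] (by simp) (by simp) (by simp; omega) ?_)
    have ht := s1.tab i le_rfl
    refine wp_select (fun s => if nm i s = 0 then 1 else 0) hX.β0.ge
      (by omega) (by omega) (fun s hs g g' => ⟨?_, by simp [upd_apply, ht s hs],
        by split_ifs <;> omega⟩) fun g2 g2' hg2 => ?_
    · have := row_lt (show i < F.m + 1 by omega) hs
      simp
      omega
    have s2 := (s1.upd (B := 17) (by omega) g2).upd (B := 18) (by omega) g2'
    have i2 := (i1.upd (B := 17) (by omega) g2).upd (B := 18) (by omega) g2'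
    obtain ⟨hf, hf0⟩ : g2' 0 < F.n ∧ nm i (g2' 0) = 0 := by
      rcases hg2 with ⟨-, h2⟩ | ⟨-, h2, h3, -⟩
      · have hcard : (F.K i).faces.ncard < F.n := by
          have h4 := Filtration.ncard_of_adds (F.adds_of_fwd hi hd) (F.finite_faces hi.le)
          have h5 := F.ncard_le (i := i + 1) hi
          omega
        obtain ⟨s, hs, h4⟩ := hq.exists_free hcard (F.finite_faces hi.le)
        have h5 := h2 s hs
        rw [if_pos h4] at h5
        omega
      · refine ⟨h2, ?_⟩
        by_contra h4
        rw [if_neg h4] at h3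
        omega
    refine wp_block_cons (wp_letv (g2' 0) (by simp; omega) (by simp) (by omega) ?_)
    exact wp_insert hX s2 i2 hv hi hd hf hf0 h12 hQ

/-- Write the bars that are alive at the end; the environment is `[m, n]`. -/
def finish : Cmd :=
  loop 0 (.var 1) (ite (.lit 0) (Ex.eqb (.load 3 (.var 3)) (.lit 1))
    (call [.var 0, .var 1, .var 3, .var 0] emitHomology)
    (ite (.lit 0) (Ex.eqb (.load 3 (.var 3)) (.lit 2))
      (call [.var 0, .var 1, .var 3, .var 0] emitBoundary) skip))

end Cmd

/-! ### The bars that reach the last index -/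

/-- The bars are the ones that are alive at the end, up to the row `k`. -/
structure Finish (F : Filtration) (A : Decomp) (k : ℕ) (bars : List Bar) : Prop where
  rep : ∀ B ∈ bars, B.HasRep F
  birth_H : birthsOf false bars = (A.HR.filter (· < k)).val.map A.birth
  birth_B : birthsOf true bars = (A.BR.filter (· < k)).val.map A.birth
  death : ∀ B ∈ bars, B.death = F.m

theorem filter_lt_succ_of_mem {S : Finset ℕ} {k : ℕ} (h : k ∈ S) (b : ℕ → ℕ) :
    (S.filter (· < k + 1)).val.map b = (S.filter (· < k)).val.map b + {b k} := by
  have : S.filter (· < k + 1) = Insert.insert k (S.filter (· < k)) := by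
    ext r
    simp only [Finset.mem_filter, Finset.mem_insert]
    constructor
    · rintro ⟨h1, h2⟩
      rcases Nat.lt_succ_iff_lt_or_eq.1 h2 with h3 | h3
      · exact Or.inr ⟨h1, h3⟩
      · exact Or.inl h3
    · rintro (rfl | ⟨h1, h2⟩)
      · exact ⟨h, by omega⟩
      · exact ⟨h1, by omega⟩
  rw [this, Finset.insert_val_of_notMem (by simp), Multiset.map_cons, add_comm]
  rfl

theorem filter_lt_succ_of_notMem {S : Finset ℕ} {k : ℕ} (h : k ∉ S) :
    S.filter (· < k + 1) = S.filter (· < k) := by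
  refine Finset.filter_congr fun r hr => ?_
  have : r ≠ k := by
    rintro rfl
    exact h hr
  omega

namespace Decomp.Valid

variable {F : Filtration} {A : Decomp} {cyc : List (List ℕ)} {k r : ℕ} {bars : List Bar}

theorem isHomologyDeath (hv : A.Valid F F.m) (hr : r ∈ A.HR) : F.IsHomologyDeath F.m := by
  refine Or.inr ⟨rfl, ⟨homologyClass _ (PartialRep.toCycle _ (A.x r)), 0, ?_⟩⟩
  rw [Ne, homologyClass_eq_zero, PartialRep.coe_toCycle (hv.x_mem (HR_subset hr))]
  exact hv.x_notMem hr

theorem isBoundaryDeath (hv : A.Valid F F.m) (hr : r ∈ A.BR) : F.IsBoundaryDeath F.m := by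
  have h := hv.bd r hr
  refine Or.inr ⟨rfl, ⟨⟨A.x r, h.mem F.m h.le le_rfl⟩, 0, fun e => ?_⟩⟩
  have h1 : A.x r = 0 := congrArg Subtype.val e
  have h2 := hv.pair_x r (BR_subset hr) r (BR_subset hr)
  rw [h1, map_zero, if_pos rfl] at h2
  exact absurd h2 (by decide)

theorem finish_HR (hv : A.Valid F F.m) (hr : k ∈ A.HR) (h : Finish F A k bars)
    (hl : Cmd.Lists F (A.birth k) F.m (A.rep k) cyc) :
    Finish F A (k + 1) (bars ++ [⟨false, A.birth k, F.m, cyc⟩]) := by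
  refine ⟨?_, ?_, ?_, ?_⟩
  · simp only [List.mem_append, List.mem_singleton]
    rintro B (hB | rfl)
    · exact h.rep B hB
    · refine hasRep_of_isHomologyRep ((hv.hom k hr).isHomologyRep (hv.isHomologyDeath hr)
        (fun h' => absurd h' (lt_irrefl _)) fun h' => absurd h' (lt_irrefl _))
        (fun α hα => hv.rep_mem hr hα) hl
  · rw [birthsOf_append, filter_lt_succ_of_mem hr, h.birth_H]
    rfl
  · rw [birthsOf_append, filter_lt_succ_of_notMem (hv.notMem_BR hr), h.birth_B]
    exact add_zero _
  · simp only [List.mem_append, List.mem_singleton]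
    rintro B (hB | rfl)
    · exact h.death B hB
    · rfl

theorem finish_BR (hv : A.Valid F F.m) (hr : k ∈ A.BR) (h : Finish F A k bars)
    (hl : Cmd.Lists F (A.birth k) F.m (fun _ => A.x k) cyc) :
    Finish F A (k + 1) (bars ++ [⟨true, A.birth k, F.m, cyc⟩]) := by
  refine ⟨?_, ?_, ?_, ?_⟩
  · simp only [List.mem_append, List.mem_singleton]
    rintro B (hB | rfl)
    · exact h.rep B hB
    · exact hasRep_of_isBoundaryRep ((hv.bd k hr).isBoundaryRep (hv.isBoundaryDeath hr)
        fun h' => absurd h' (lt_irrefl _)) (hv.bd k hr).mem hl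
  · rw [birthsOf_append, filter_lt_succ_of_notMem (hv.notMem_HR hr), h.birth_H]
    exact add_zero _
  · rw [birthsOf_append, filter_lt_succ_of_mem hr, h.birth_B]
    rfl
  · simp only [List.mem_append, List.mem_singleton]
    rintro B (hB | rfl)
    · exact h.death B hB
    · rfl

theorem finish_skip (hr : k ∉ A.rows) (h : Finish F A k bars) : Finish F A (k + 1) bars := by
  refine ⟨h.rep, ?_, ?_, h.death⟩
  · rw [filter_lt_succ_of_notMem fun e => hr (HR_subset e), h.birth_H]
  · rw [filter_lt_succ_of_notMem fun e => hr (BR_subset e), h.birth_B]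

end Decomp.Valid

namespace Cmd

variable {F : Filtration} {X : Limits} {μ : ℕ → ℕ → ℕ} {o : List ℕ}
  {Q : (ℕ → ℕ → ℕ) → List ℕ → Prop} {A : Decomp} {nm : ℕ → ℕ → ℕ}

theorem wp_finish (hX : Room F X) (h : Stores F F.m A nm μ) (hv : A.Valid F F.m)
    (hQ : ∀ μ' bars, Finish F A F.n bars → Q μ' (o ++ bars.flatMap Bar.encode)) :
    finish.wp X [F.m, F.n] μ o Q := by
  have hn := hX.n_le
  have hS := hX.m_lt
  have hSB := hX.S_le
  have hB := hX.B_ge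
  refine ⟨by simp, by simp [hX.β0], fun k μ' o' => Stores F F.m A nm μ' ∧
    ∃ bars, o' = o ++ bars.flatMap Bar.encode ∧ Finish F A k bars, ⟨h, [], by simp, ?_⟩, ?_, ?_⟩
  · exact ⟨by simp, by simp [birthsOf, intervalsOf], by simp [birthsOf, intervalsOf], by simp⟩
  · rintro r hr μ₁ _ ⟨hs, bars, rfl, hb⟩
    have hr : r < F.n := hr
    refine ⟨by simp, by simp; omega, fun h1 => ?_, fun h1 => ⟨by simp, by simp; omega, fun h2 => ?_,
      fun h2 => ?_⟩⟩
    · have hrH : r ∈ A.HR := Decomp.kind_eq_one.1 (by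
        by_contra hc
        simp [hs.kind r hr, hc] at h1)
      refine wp_call [F.m, F.n, r, F.m] (by simp) (by simp) (by simp; omega) ?_
      refine wp_emitHomology (b := A.birth r) (nm := nm) (u := A.U r) (wire := A.wire) hX le_rfl hr
        hs.slots hs.step hs.tab (hs.birth r (Decomp.HR_subset hrH)) (hs.U r hrH)
        (fun w _ hu => hs.wire r hrH w hu) (fun w hu => (hv.wire_mem r hrH w hu).2)
        (fun α hα => (mem_cycles.1 (hv.rep_mem hrH hα)).1) fun μ' cyc keep hl => ?_
      refine ⟨hs.congr fun B h1 h2 => keep B (by omega) (by omega), _, ?_, hv.finish_HR hrH hb hl⟩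
      simp [Bar.encode]
    · have hrB : r ∈ A.BR := (Decomp.kind_eq_two hv).1 (by
        by_contra hc
        simp [hs.kind r hr, hc] at h2)
      refine wp_call [F.m, F.n, r, F.m] (by simp) (by simp) (by simp; omega) ?_
      refine wp_emitBoundary (b := A.birth r) (nm := nm) (x := A.x r) hX le_rfl hr
        hs.slots hs.step hs.tab (hs.birth r (Decomp.BR_subset hrB)) (hs.x r (Decomp.BR_subset hrB))
        (fun α h1 h2 => (mem_cycles.1 (boundaries_le_cycles _ ((hv.bd r hrB).mem α h1 h2))).1)
        fun μ' cyc keep hl => ?_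
      refine ⟨hs.congr fun B h1 h2 => keep B (by omega) (by omega), _, ?_, hv.finish_BR hrB hb hl⟩
      simp [Bar.encode]
    · simp [hs.kind r hr] at h1 h2
      have h3 := Decomp.kind_le (A := A) (r := r)
      refine ⟨hs, bars, rfl, Decomp.Valid.finish_skip (Decomp.kind_eq_zero.1 ?_) hb⟩
      omega
  · rintro μ' _ ⟨-, bars, rfl, hb⟩
    exact hQ μ' bars hb

end Cmd

/-! ## The bars of the output -/

open Classical in
/-- The bars are the ones that have died before the index `i`, and the decomposition `A` holds the
other ones that are born up to `i`. -/
structure Account (F : Filtration) (i : ℕ) (A : Decomp) (bars : List Bar) : Prop where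
  rep : ∀ B ∈ bars, B.HasRep F
  birth_H : birthsOf false bars + A.HR.val.map A.birth =
    ((Multiset.range i).filter fun j => F.IsHomologyBirth (j + 1)).map (· + 1)
  birth_B : birthsOf true bars + A.BR.val.map A.birth =
    ((Multiset.range i).filter fun j => F.IsBoundaryBirth (j + 1)).map (· + 1)
  death_H : deathsOf false bars = (Multiset.range i).filter F.IsHomologyDeath
  death_B : deathsOf true bars = (Multiset.range i).filter F.IsBoundaryDeath

theorem map_filter_range_succ (p : ℕ → Prop) [DecidablePred p] (i : ℕ) :
    ((Multiset.range (i + 1)).filter p).map (· + 1) =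
      ((Multiset.range i).filter p).map (· + 1) + if p i then {i + 1} else 0 := by
  rw [Multiset.range_succ, Multiset.filter_cons, Multiset.map_add, add_comm]
  split_ifs <;> rfl

theorem filter_range_succ (p : ℕ → Prop) [DecidablePred p] (i : ℕ) :
    (Multiset.range (i + 1)).filter p = (Multiset.range i).filter p + if p i then {i} else 0 := by
  rw [Multiset.range_succ, Multiset.filter_cons, add_comm]

theorem Account.step {F : Filtration} {i : ℕ} {A A' : Decomp} {bars bars' : List Bar}
    (h : Account F i A bars) (h' : Advance F i A A' bars') : Account F (i + 1) A' (bars ++ bars') where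
  rep B hB := (List.mem_append.1 hB).elim (h.rep B) (h'.rep B)
  birth_H := by
    rw [birthsOf_append, add_assoc, h'.birth_H, ← add_assoc, h.birth_H, map_filter_range_succ]
  birth_B := by
    rw [birthsOf_append, add_assoc, h'.birth_B, ← add_assoc, h.birth_B, map_filter_range_succ]
  death_H := by rw [deathsOf_append, h.death_H, h'.death_H, filter_range_succ]
  death_B := by rw [deathsOf_append, h.death_B, h'.death_B, filter_range_succ]

/-- Multiplicity one as a value means a unique position in the list; this passes from multisets of
end points to the pairing. -/
theorem exists_get_of_count {l : List (ℕ × ℕ)} {g : ℕ × ℕ → ℕ} {v : ℕ}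
    (h : Multiset.count v (l.map g : List ℕ) = 1) :
    ∃ k : Fin l.length, g (l.get k) = v ∧ ∀ k' : Fin l.length, g (l.get k') = v → k' = k := by
  rw [Multiset.coe_count] at h
  induction l with
  | nil => simp at h
  | cons a l ih =>
    by_cases e : g a = v
    · refine ⟨⟨0, by simp⟩, e, fun k hk => ?_⟩
      rw [List.map_cons, e, List.count_cons_self, Nat.add_eq_right, List.count_eq_zero] at h
      rcases k with ⟨_ | k, hk'⟩
      · rfl
      · exact absurd (List.mem_map.2 ⟨l.get ⟨k, by simpa using hk'⟩, List.get_mem _ _, hk⟩) h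
    · rw [List.map_cons, List.count_cons_of_ne e] at h
      obtain ⟨k, h1, h2⟩ := ih h
      refine ⟨k.succ, h1, fun k' hk' => ?_⟩
      rcases k' with ⟨_ | k', hk''⟩
      · exact absurd hk' e
      · exact congrArg Fin.succ (h2 ⟨k', by simpa using hk''⟩ hk')

/-- `D` collects the deaths at the last index. They may be repeated, but `Pairs` only concerns
deaths before `m`. -/
theorem pairs_of_count {m : ℕ} {Bi De : ℕ → Prop} [DecidablePred De]
    [DecidablePred fun j => Bi (j + 1)] {l : List (ℕ × ℕ)} {D : Multiset ℕ}
    (hle : ∀ I ∈ l, 1 ≤ I.1 ∧ I.1 ≤ I.2 ∧ I.2 ≤ m)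
    (hb : ((l.map Prod.fst : List ℕ) : Multiset ℕ) =
      ((Multiset.range m).filter fun j => Bi (j + 1)).map (· + 1))
    (hd : ((l.map Prod.snd : List ℕ) : Multiset ℕ) = (Multiset.range m).filter De + D)
    (hD : ∀ d ∈ D, d = m) : Pairs m Bi De l where
  le := hle
  birth i hi h := by
    refine exists_get_of_count ?_
    rw [hb]
    exact Multiset.count_eq_one_of_mem
      (((Multiset.nodup_range m).filter _).map (add_left_injective 1)) (by simp [hi, h])
  birth_not i hi h k hk := by
    have : i + 1 ∈ ((l.map Prod.fst : List ℕ) : Multiset ℕ) :=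
      List.mem_map.2 ⟨_, List.get_mem l k, hk⟩
    rw [hb] at this
    simp [hi, h] at this
  death i hi h := by
    refine exists_get_of_count ?_
    rw [hd, Multiset.count_add, Multiset.count_eq_one_of_mem ((Multiset.nodup_range m).filter _)
      (by simp [hi, h]), Multiset.count_eq_zero_of_notMem fun hm => by have := hD i hm; omega]
  death_not i hi h k hk := by
    have : i ∈ ((l.map Prod.snd : List ℕ) : Multiset ℕ) := List.mem_map.2 ⟨_, List.get_mem l k, hk⟩
    rw [hd, Multiset.mem_add] at this
    rcases this with h1 | h1
    · simp [h] at h1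
    · have := hD i h1
      omega

theorem exists_bar_of_mem {k : Bool} {bars : List Bar} {I : ℕ × ℕ} (h : I ∈ intervalsOf k bars) :
    ∃ B ∈ bars, B.isBoundary = k ∧ I = (B.birth, B.death) := by
  obtain ⟨B, hB, rfl⟩ := List.mem_map.1 h
  obtain ⟨h1, h2⟩ := List.mem_filter.1 hB
  exact ⟨B, h1, by simpa using h2, rfl⟩

theorem deathsOf_eq {F : Filtration} {A : Decomp} {k : ℕ} {bars : List Bar} (h : Finish F A k bars)
    (b : Bool) : ∀ d ∈ deathsOf b bars, d = F.m := by
  intro d hd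
  obtain ⟨I, hI, rfl⟩ := List.mem_map.1 (Multiset.mem_coe.1 hd)
  obtain ⟨B, hB, -, rfl⟩ := exists_bar_of_mem hI
  exact h.death B hB

/-- The bars written during the run account for all deaths before `m`. The bars written at the end
carry the births of the rows still alive, so together every birth index occurs once. -/
theorem isSolution {F : Filtration} {A : Decomp} {bars bars' : List Bar} (hv : A.Valid F F.m)
    (h : Account F F.m A bars) (h' : Finish F A F.n bars') : IsSolution F (bars ++ bars') := by
  classical
  have rep : ∀ B ∈ bars ++ bars', B.HasRep F := fun B hB =>
    (List.mem_append.1 hB).elim (h.rep B) (h'.rep B)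
  refine ⟨?_, ?_, rep⟩
  · have key : ∀ k : Fin (intervalsOf false (bars ++ bars')).length, ∃ z : ∀ α, cycles (F.K α),
        F.IsHomologyRep ((intervalsOf false (bars ++ bars')).get k).1
          ((intervalsOf false (bars ++ bars')).get k).2 z := by
      intro k
      obtain ⟨B, hB, hk, e⟩ := exists_bar_of_mem (List.get_mem _ k)
      obtain ⟨z, hz, -⟩ := (rep B hB).2.1 hk
      rw [e]
      exact ⟨z, hz⟩
    choose z hz using key
    refine homology_isBarcode (pairs_of_count (D := deathsOf false bars') (fun I hI => ?_) ?_ ?_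
      (deathsOf_eq h' _)) z hz
    · obtain ⟨k, rfl⟩ := List.get_of_mem hI
      have h1 := hz k
      obtain ⟨j, -, hj, -⟩ := h1.birth
      refine ⟨by omega, h1.le, ?_⟩
      rcases h1.death with ⟨hd, -⟩ | ⟨hd, -⟩ <;> omega
    · rw [← h.birth_H]
      refine (birthsOf_append false bars bars').trans ?_
      rw [h'.birth_H, Finset.filter_true_of_mem fun r hr => hv.lt_n r (Decomp.HR_subset hr)]
    · rw [← h.death_H]
      exact deathsOf_append false bars bars'
  · have key : ∀ k : Fin (intervalsOf true (bars ++ bars')).length, ∃ z : ∀ α, boundaries (F.K α),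
        F.IsBoundaryRep ((intervalsOf true (bars ++ bars')).get k).1
          ((intervalsOf true (bars ++ bars')).get k).2 z := by
      intro k
      obtain ⟨B, hB, hk, e⟩ := exists_bar_of_mem (List.get_mem _ k)
      obtain ⟨z, hz, -⟩ := (rep B hB).2.2 hk
      rw [e]
      exact ⟨z, hz⟩
    choose z hz using key
    refine boundary_isBarcode (pairs_of_count (D := deathsOf true bars') (fun I hI => ?_) ?_ ?_
      (deathsOf_eq h' _)) z hz
    · obtain ⟨k, rfl⟩ := List.get_of_mem hI
      have h1 := hz k
      obtain ⟨j, -, hj, -⟩ := h1.birth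
      refine ⟨by omega, h1.le, ?_⟩
      rcases h1.death with ⟨hd, -⟩ | ⟨hd, -⟩ <;> omega
    · rw [← h.birth_B]
      refine (birthsOf_append true bars bars').trans ?_
      rw [h'.birth_B, Finset.filter_true_of_mem fun r hr => hv.lt_n r (Decomp.BR_subset hr)]
    · rw [← h.death_B]
      exact deathsOf_append true bars bars'

/-- The decomposition of the trivial chain group. -/
def Decomp.empty : Decomp :=
  ⟨∅, ∅, fun _ => 0, fun _ => 0, fun _ _ => 0, fun _ => 0, fun _ => 0, fun _ _ => 0, fun _ => 0⟩

theorem Decomp.empty_valid (F : Filtration) : Decomp.empty.Valid F 0 where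
  disj := Finset.disjoint_empty_left _
  card := by simp [Decomp.empty, F.K_zero]
  lt_n r hr := absurd hr (Finset.notMem_empty r)
  y_mem r hr := absurd hr (Finset.notMem_empty r)
  boundary_y r hr := absurd hr (Finset.notMem_empty r)
  pair_x r hr := absurd hr (Finset.notMem_empty r)
  pair_y r hr := absurd hr (Finset.notMem_empty r)
  span := by simp [chains, F.K_zero]
  hom r hr := absurd hr (Finset.notMem_empty r)
  rep_self r hr := absurd hr (Finset.notMem_empty r)
  wire_mem r hr := absurd hr (Finset.notMem_empty r)
  bd r hr := absurd hr (Finset.notMem_empty r)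
  deg_y r hr := absurd hr (Finset.notMem_empty r)
  deg_φ r hr := absurd hr (Finset.notMem_empty r)
  inj_H r hr := absurd hr (Finset.notMem_empty r)
  inj_B r hr := absurd hr (Finset.notMem_empty r)

theorem stores_empty {F : Filtration} {μ : ℕ → ℕ → ℕ} (h2 : μ 2 = fun _ => 0) (h3 : μ 3 = fun _ => 0) :
    Stores F 0 Decomp.empty (fun _ _ => 0) μ where
  slots α hα := by
    obtain rfl : α = 0 := by omega
    exact slotsAt_zero fun _ _ => rfl
  step α hα := absurd hα (Nat.not_lt_zero α)
  tab α _ s _ := by rw [h2]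
  kind r _ := by rw [h3]; rfl
  birth r hr := absurd hr (Finset.notMem_empty r)
  key r hr := absurd hr (Finset.notMem_empty r)
  x r hr := absurd hr (Finset.notMem_empty r)
  y r hr := absurd hr (Finset.notMem_empty r)
  φ r hr := absurd hr (Finset.notMem_empty r)
  U r hr := absurd hr (Finset.notMem_empty r)
  wire r hr := absurd hr (Finset.notMem_empty r)

namespace Cmd

variable {F : Filtration} {X : Limits} {μ : ℕ → ℕ → ℕ} {o : List ℕ}
  {Q : (ℕ → ℕ → ℕ) → List ℕ → Prop} {A : Decomp} {nm : ℕ → ℕ → ℕ}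

/-- Compute the addresses of the records in the input, and the largest number of simplices of a
complex; the environment is `[m]`. -/
def firstPass : Cmd :=
  block [store 21 (.lit 0) (.lit 1), loop 1 (.var 0) (block [
    store 1 (.var 2) (.load 21 (.lit 0) + .lit 1),
    store 23 (.lit 0) (.load 23 (.lit 0) + .load 0 (.load 21 (.lit 0)) +
      .load 0 (.load 21 (.lit 0)) - .lit 1),
    store 24 (.lit 0) (.load 24 (.lit 0) + (.load 23 (.lit 0) - .load 24 (.lit 0))),
    store 21 (.lit 0) (.load 21 (.lit 0) + .lit 2 + .load 0 (.load 21 (.lit 0) + .lit 1))])]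

/-- The direction `d` is `1` or `0`, and the number of simplices changes by `2 d - 1`; the truncated
subtraction is exact because a deletion starts from a nonempty complex. The maximum is computed as
`a + (b - a)`, again with truncated subtraction. -/
theorem wp_firstPass (hX : Room F X) (hw : ∀ a, μ 0 a = F.encode.getD a 0) (h23 : μ 23 0 = 0)
    (h24 : μ 24 0 = 0)
    (hQ : ∀ μ', (∀ B, B ≠ 1 → B ≠ 21 → B ≠ 23 → B ≠ 24 → μ' B = μ B) → Input F μ' →
      μ' 24 0 = F.n → Q μ' o) :
    firstPass.wp X [F.m] μ o Q := by
  have hn := hX.n_le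
  have hS := hX.m_lt
  have hSB := hX.S_le
  have hB := hX.B_ge
  have hin' := hX.input
  have hI : Input F (upd μ 1 fun j => F.offset j + 1) := ⟨hw, fun _ _ => by simp⟩
  refine wp_block_cons (wp_store 0 1 (by simp) (by simp) (by simp) (by simp) (by omega) (by omega) ?_)
  refine wp_block_cons ⟨by simp, by simp [hX.β1], fun k μ' o' => o' = o ∧
    (∀ B, B ≠ 1 → B ≠ 21 → B ≠ 23 → B ≠ 24 → μ' B = μ B) ∧ (∀ j < k, μ' 1 j = F.offset j + 1) ∧
    μ' 21 0 = F.offset k ∧ μ' 23 0 = (F.K k).faces.ncard ∧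
    μ' 24 0 = (Finset.range (k + 1)).sup fun i => (F.K i).faces.ncard, ⟨rfl, ?_, ?_, ?_, ?_, ?_⟩, ?_, ?_⟩
  · intro B _ h _ _
    rw [upd_apply, if_neg h]
  · intro j hj
    omega
  · simp [offset]
  · simp [upd_apply, h23, F.K_zero]
  · simp [upd_apply, h24, F.K_zero]
  · rintro k hk ν o' ⟨rfl, keep, hpos, h21, h23, h24⟩
    have hk : k < F.m := hk
    have hok := F.offset_lt hk
    have hcard : ν 0 (F.offset k + 1) = (F.σ k).card := by
      rw [keep 0 (by decide) (by decide) (by decide) (by decide)]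
      exact hI.card hk
    have hdir : ν 0 (F.offset k) = if F.dir k then 1 else 0 := by
      rw [keep 0 (by decide) (by decide) (by decide) (by decide)]
      exact hI.dir hk
    have hnum : (F.K k).faces.ncard + ν 0 (F.offset k) + ν 0 (F.offset k) - 1 =
        (F.K (k + 1)).faces.ncard := by
      rw [hdir]
      rcases Bool.eq_false_or_eq_true (F.dir k) with hd | hd
      · have := Filtration.ncard_of_adds (F.adds_of_fwd hk hd) (F.finite_faces hk.le)
        simp [hd]
        omega
      · have := Filtration.ncard_of_adds (F.adds_of_bwd hk hd) (F.finite_faces hk)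
        simp [hd]
        omega
    have hle := F.ncard_le (i := k + 1) hk
    have hsup : ∀ j ≤ F.m + 1, ((Finset.range j).sup fun i => (F.K i).faces.ncard) ≤ F.n := fun j hj =>
      Finset.sup_mono (Finset.range_mono hj)
    have hs1 := hsup (k + 1) (by omega)
    have hs2 := hsup (k + 1 + 1) (by omega)
    refine wp_block_cons (wp_store k (F.offset k + 1) (by simp) (by simp; omega) (by simp)
      (by simp [h21]) (by omega) (by omega) ?_)
    refine wp_block_cons (wp_store 0 (F.K (k + 1)).faces.ncard (by simp)
      (by simp [upd_apply, h21]; omega) (by simp) (by simp [upd_apply, h21, h23, hnum]) (by omega)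
      (by omega) ?_)
    refine wp_block_cons (wp_store 0 ((Finset.range (k + 1 + 1)).sup fun i => (F.K i).faces.ncard)
      (by simp) (by simp; omega) (by simp) ?_ (by omega) (by omega) ?_)
    · simp [upd_apply, h24]
      rw [Finset.range_add_one (n := k + 1), Finset.sup_insert]
      omega
    refine wp_block_cons (wp_store 0 (F.offset (k + 1)) (by simp) (by simp [upd_apply, h21]; omega)
      (by simp) (by simp [upd_apply, h21, hcard, offset_succ]) (by omega) ?_ ?_)
    · rw [offset_succ]
      omega
    refine wp_block_nil ⟨rfl, ?_, ?_, ?_, ?_, ?_⟩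
    · intro B h1 h2 h3 h4
      simp only [upd_apply, h1, h2, h3, h4, if_false]
      exact keep B h1 h2 h3 h4
    · intro j hj
      simp only [upd_apply, Nat.reduceEqDiff, if_false, if_true, Function.update_apply]
      split_ifs with e
      · rw [e]
      · exact hpos j (by omega)
    · simp
    · simp [upd_apply]
    · simp [upd_apply]
  · rintro μ' o' ⟨rfl, keep, hpos, -, -, h24⟩
    exact wp_block_nil (hQ μ' keep ⟨by
      rw [keep 0 (by decide) (by decide) (by decide) (by decide)]
      exact hw, hpos⟩ h24)

/-- The whole algorithm. -/
def main : Cmd :=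
  letv (.load 0 (.lit 0)) (block [firstPass, letv (.load 24 (.lit 0)) (block [
    loop 1 (.var 0) (call [.var 0, .var 1, .var 3] step), finish])])

/-- After `k` steps the memory holds a valid decomposition at `k`, and the output lists exactly the
bars that died before `k`. -/
theorem wp_main (hX : Room F X) : main.wp X [] (initState F.encode).mem [] fun _ o =>
    ∃ bars : List Bar, o = bars.flatMap Bar.encode ∧ IsSolution F bars := by
  have hn := hX.n_le
  have hS := hX.m_lt
  have hSB := hX.S_le
  have hB := hX.B_ge
  refine wp_letv F.m (by simp; omega) (by simp [initState, encode]) (by omega) ?_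
  refine wp_block_cons (wp_firstPass hX (fun a => by simp [initState]) (by simp [initState])
    (by simp [initState]) fun μ keep hin h24 => ?_)
  refine wp_block_cons (wp_letv F.n (by simp; omega) (by simp [h24]) (by omega) ?_)
  have hs : Stores F 0 Decomp.empty (fun _ _ => 0) μ := by
    refine stores_empty ?_ ?_
    all_goals
      rw [keep _ (by decide) (by decide) (by decide) (by decide)]
      rfl
  refine wp_block_cons ⟨by simp, by simp [hX.β1], fun k μ' o' => ∃ A nm bars, A.Valid F k ∧
    Stores F k A nm μ' ∧ Input F μ' ∧ Account F k A bars ∧ o' = bars.flatMap Bar.encode,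
    ⟨_, _, [], Decomp.empty_valid F, hs, hin, ?_, rfl⟩, ?_, ?_⟩
  · refine ⟨by simp, ?_, ?_, ?_, ?_⟩ <;> rfl
  · rintro k hk ν o' ⟨A, nm, bars, hv, hs, hin, hacc, rfl⟩
    have hk : k < F.m := hk
    refine wp_call [F.m, F.n, k] (by simp) (by simp) (by simp; omega) ?_
    refine wp_step hX hs hin hv hk fun A' nm' μ' bars' h1 h2 h3 => ?_
    exact ⟨A', nm', bars ++ bars', h1.valid, h2, h3, hacc.step h1, by rw [List.flatMap_append]⟩
  · rintro ν o' ⟨A, nm, bars, hv, hs, hin, hacc, rfl⟩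
    refine wp_block_cons (wp_finish hX hs hv fun μ' bars' hb => ?_)
    exact ⟨bars ++ bars', by rw [List.flatMap_append], isSolution hv hacc hb⟩

end Cmd

/-! ## The running time -/

/-- More memory and larger words do no harm. -/
theorem Exec.mono {S W S' W' : ℕ} (hS : S ≤ S') (hW : W ≤ W') {P : Prog} {s s' : State} {t : ℕ}
    (h : Exec S W P s t s') : Exec S' W' P s t s' := by
  have set : ∀ {s s' : State} {r v : ℕ}, s.setReg W r v = some s' → s.setReg W' r v = some s' := by
    intro s s' r v h
    unfold State.setReg at h ⊢
    split_ifs at h with h1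
    rwa [if_pos (h1.trans_le hW)]
  induction h with
  | skip s => exact .skip s
  | @instr i s s' h =>
    refine .instr ?_
    cases i with
    | load r A a =>
      simp only [Instr.exec] at h ⊢
      split_ifs at h with h1
      rw [if_pos (h1.trans_le hS)]
      exact set h
    | store A a r =>
      simp only [Instr.exec] at h ⊢
      split_ifs at h with h1
      rwa [if_pos (h1.trans_le hS)]
    | emit a => exact h
    | _ => exact set h
  | seq _ _ ih ih' => exact .seq ih ih'
  | ifTrue hab _ ih => exact .ifTrue hab ih
  | ifFalse hab _ ih => exact .ifFalse hab ih
  | whileTrue hab _ _ ih ih' => exact .whileTrue hab ih ih'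
  | whileFalse hab => exact .whileFalse hab

namespace Cmd

/-- The number of iterations of each nest of loops is at most `w`, if the command is executed `k`
times. -/
def Fits (β : ℕ → ℕ) (w : ℕ) : Cmd → ℕ → Prop
  | skip, k => k ≤ w
  | store _ _ _, k => k ≤ w
  | emit _, k => k ≤ w
  | seq c d, k => c.Fits β w k ∧ d.Fits β w k
  | ite _ _ c d, k => c.Fits β w k ∧ d.Fits β w k
  | letv _ c, k => c.Fits β w k
  | loop tag _ c, k => k ≤ w ∧ c.Fits β w (k * β tag)
  | call _ c, k => c.Fits β w k

/-- The constant in the running time. -/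
def coeff : Cmd → ℕ
  | skip => 1
  | store _ a v => v.size + a.size + 1
  | emit e => e.size + 1
  | seq c d => c.coeff + d.coeff
  | ite a b c d => a.size + b.size + 1 + (c.coeff + d.coeff)
  | letv e c => e.size + c.coeff
  | loop _ e c => e.size + 2 + (c.coeff + 3)
  | call args c => (args.map Ex.size).sum + 1 + c.coeff

theorem Fits.le {β : ℕ → ℕ} {w : ℕ} {c : Cmd} : ∀ {k : ℕ}, c.Fits β w k → k ≤ w := by
  induction c with
  | skip => exact id
  | store _ _ _ => exact id
  | emit _ => exact id
  | seq c d ihc _ => exact fun h => ihc h.1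
  | ite _ _ c d ihc _ => exact fun h => ihc h.1
  | letv _ c ih => exact ih
  | loop _ _ c _ => exact fun h => h.1
  | call _ c ih => exact ih

/-- A command executed `k` times is charged to its elementary parts. Each of them runs at most `w`
times by `Fits`, so the total is `w` times a constant that depends only on the program text. -/
theorem Fits.cost_le {β : ℕ → ℕ} {w : ℕ} {c : Cmd} :
    ∀ {k : ℕ}, c.Fits β w k → k * c.cost β ≤ c.coeff * w := by
  have leaf : ∀ a {k : ℕ}, k ≤ w → k * a ≤ a * w := fun a k h => by
    rw [Nat.mul_comm]
    exact Nat.mul_le_mul_left a h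
  induction c with
  | skip => exact leaf 1
  | store _ a v => exact leaf _
  | emit e => exact leaf _
  | seq c d ihc ihd =>
    intro k h
    simp only [cost, coeff, Nat.mul_add, Nat.add_mul]
    exact Nat.add_le_add (ihc h.1) (ihd h.2)
  | ite a b c d ihc ihd =>
    intro k h
    rw [cost, coeff, Nat.mul_add k (a.size + b.size + 1), Nat.mul_add k (c.cost β),
      Nat.add_mul (a.size + b.size + 1), Nat.add_mul c.coeff]
    exact Nat.add_le_add (leaf _ h.1.le) (Nat.add_le_add (ihc h.1) (ihd h.2))
  | letv e c ih =>
    intro k h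
    rw [cost, coeff, Nat.mul_add, Nat.add_mul]
    exact Nat.add_le_add (leaf _ h.le) (ih h)
  | loop tag e c ih =>
    intro k h
    rw [cost, coeff, Nat.mul_add, Nat.add_mul, ← Nat.mul_assoc, Nat.mul_add (k * _), Nat.add_mul _ 3]
    exact Nat.add_le_add (leaf _ h.1) (Nat.add_le_add (ih h.2) (leaf 3 h.2.le))
  | call args c ih =>
    intro k h
    rw [cost, coeff, Nat.mul_add, Nat.add_mul]
    exact Nat.add_le_add (leaf _ h.le) (ih h)

end Cmd

/-! ### Bounds for the sizes of the filtration and of its simplices -/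

theorem sq_le_two_pow (k : ℕ) : k * k + 2 ≤ 2 * 2 ^ k := by
  induction k with
  | zero => norm_num
  | succ k ih =>
    have := @Nat.lt_two_pow_self k
    rw [pow_succ]
    nlinarith

namespace Filtration

variable (F : Filtration)

/-- Each step adds at most one simplex to the empty complex; this gives `n ≤ m`. -/
theorem ncard_le_index {i : ℕ} (hi : i ≤ F.m) : (F.K i).faces.ncard ≤ i := by
  induction i with
  | zero => simp [F.K_zero]
  | succ i ih =>
    have := ih (by omega)
    rcases Bool.eq_false_or_eq_true (F.dir i) with hd | hd
    · rw [ncard_of_adds (F.adds_of_fwd hi hd) (F.finite_faces (by omega))]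
      omega
    · have := ncard_of_adds (F.adds_of_bwd hi hd) (F.finite_faces hi)
      omega

theorem n_le_m : F.n ≤ F.m :=
  Finset.sup_le fun i hi => by
    have hi := Finset.mem_range.1 hi
    exact (F.ncard_le_index (by omega)).trans (by omega)

theorem sigma_mem {i : ℕ} (hi : i < F.m) : ∃ j ≤ F.m, F.σ i ∈ (F.K j).faces := by
  rcases Bool.eq_false_or_eq_true (F.dir i) with hd | hd
  · exact ⟨i + 1, hi, (F.adds_of_fwd hi hd).mem⟩
  · exact ⟨i, hi.le, (F.adds_of_bwd hi hd).mem⟩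

/-- All nonempty faces of a simplex lie in the complex that contains it, so `2 ^ k - 1 ≤ n` for `k`
vertices. -/
theorem two_pow_card_le {i : ℕ} (hi : i < F.m) : 2 ^ (F.σ i).card ≤ F.n + 1 := by
  obtain ⟨j, hj, hmem⟩ := F.sigma_mem hi
  have h1 : (((F.σ i).powerset.erase ∅ : Finset (Finset ℕ)) : Set (Finset ℕ)) ⊆ (F.K j).faces := by
    intro τ hτ
    obtain ⟨h1, h2⟩ := Finset.mem_erase.1 (Finset.mem_coe.1 hτ)
    exact ((F.K j).isRelLowerSet_faces hmem).2 (Finset.mem_powerset.1 h2)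
      (Finset.nonempty_iff_ne_empty.2 h1)
  have h2 := Set.ncard_le_ncard h1 (F.finite_faces hj)
  rw [Set.ncard_coe_finset, Finset.card_erase_of_mem (by simp), Finset.card_powerset] at h2
  have h3 := F.ncard_le hj
  omega

theorem card_pos {i : ℕ} (hi : i < F.m) : 1 ≤ (F.σ i).card := by
  obtain ⟨j, -, hmem⟩ := F.sigma_mem hi
  exact Finset.card_pos.2 ((F.K j).isRelLowerSet_faces hmem).1

/-- The largest number of vertices of a simplex. -/
def maxCard : ℕ := (Finset.range F.m).sup fun i => (F.σ i).card

theorem card_le_maxCard {i : ℕ} (hi : i < F.m) : (F.σ i).card ≤ F.maxCard :=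
  Finset.le_sup (f := fun i => (F.σ i).card) (Finset.mem_range.2 hi)

theorem exists_card_eq (h : F.m ≠ 0) : ∃ i < F.m, F.maxCard = (F.σ i).card := by
  obtain ⟨i, hi, e⟩ := Finset.exists_mem_eq_sup (Finset.range F.m) ⟨0, by simp; omega⟩
    fun i => (F.σ i).card
  exact ⟨i, Finset.mem_range.1 hi, e⟩

/-- Makes the quadratic comparison of vertex lists affordable: all face tests of one step together
take `O(n ^ 2)` operations. -/
theorem maxCard_sq_le : F.maxCard * F.maxCard ≤ 2 * F.n := by
  by_cases h : F.m = 0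
  · simp [maxCard, h]
  · obtain ⟨i, hi, e⟩ := F.exists_card_eq h
    have h1 := F.two_pow_card_le hi
    have h2 := sq_le_two_pow (F.σ i).card
    rw [e]
    omega

theorem maxCard_le : F.maxCard ≤ F.n := by
  by_cases h : F.m = 0
  · simp [maxCard, h]
  · obtain ⟨i, hi, e⟩ := F.exists_card_eq h
    have h1 := F.two_pow_card_le hi
    have h2 := @Nat.lt_two_pow_self (F.σ i).card
    omega

/-- Used to absorb terms such as `m` and `m ^ 2` into `m n` and `m ^ 2 n`; the additive `1` in the
bounds takes care of the empty filtration. -/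
theorem one_le_n (h : F.m ≠ 0) : 1 ≤ F.n := by
  have h0 : 0 < F.m := by omega
  have h1 := F.two_pow_card_le h0
  have h2 := F.card_pos h0
  have h3 := Nat.pow_le_pow_right (n := 2) (by omega) h2
  omega

/-- The parameters of the run for `F`. -/
noncomputable def limits : Limits where
  S := 4 * (F.m * F.n + 1)
  B := (F.m + F.maxVertex + 2) ^ 4
  β t := match t with
    | 0 => F.n
    | 1 => F.m
    | 2 => F.m + 1
    | 3 => F.maxCard
    | _ => 0

theorem length_encode_le : F.encode.length ≤ 4 * (F.m * F.n + 1) := by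
  by_cases h : F.m = 0
  · simp [length_encode, offset, h]
  · have h1 := F.one_le_n h
    have h2 : ∑ j ∈ Finset.range F.m, ((F.σ j).card + 2) ≤ F.m * (F.n + 2) := by
      calc _ ≤ ∑ j ∈ Finset.range F.m, (F.n + 2) := Finset.sum_le_sum fun j hj => by
              have := (F.card_le_maxCard (Finset.mem_range.1 hj)).trans F.maxCard_le
              omega
        _ = _ := by simp
    have h3 : F.m * 1 ≤ F.m * F.n := Nat.mul_le_mul_left _ h1
    rw [length_encode, offset]
    rw [Nat.mul_add] at h2
    omega

theorem le_limits {v : ℕ} (hv : v ≤ 2 * F.m + F.maxVertex + 3) : v ≤ F.limits.B := by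
  change v ≤ (F.m + F.maxVertex + 2) ^ 4
  have h1 : 2 ^ 3 ≤ (F.m + F.maxVertex + 2) ^ 3 := Nat.pow_le_pow_left (by omega) 3
  calc v ≤ 2 ^ 3 * (F.m + F.maxVertex + 2) := by omega
    _ ≤ (F.m + F.maxVertex + 2) ^ 3 * (F.m + F.maxVertex + 2) := Nat.mul_le_mul_right _ h1
    _ = _ := (pow_succ _ 3).symm

/-- The factor `4` in the memory bound suffices for the tables with `m + 1` rows and for the input,
since `n ≤ m ≤ mn`. The fourth power bounds every stored word: `4 ≤ x ^ 2` and `mn + 1 ≤ x ^ 2` for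
`x = m + v + 2`. -/
theorem room : Room F F.limits := by
  have hnm := F.n_le_m
  have h0 : F.m * F.n ≤ F.m * F.m := Nat.mul_le_mul_left _ hnm
  have hmn : F.m ≤ F.m * F.n := by
    by_cases h : F.m = 0
    · simp [h]
    · exact Nat.le_mul_of_pos_right _ (F.one_le_n h)
  have hκ := F.maxCard_sq_le
  refine ⟨hnm, rfl, rfl, rfl, fun i hi => F.card_le_maxCard hi, ?_, F.length_encode_le, ?_, ?_, ?_, ?_, ?_⟩
  · change (F.m + 1) * F.n ≤ 4 * (F.m * F.n + 1)
    rw [Nat.succ_mul]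
    omega
  · change F.m + 2 ≤ 4 * (F.m * F.n + 1)
    omega
  · change 4 * (F.m * F.n + 1) ≤ (F.m + F.maxVertex + 2) ^ 4
    have h1 : 2 ^ 2 ≤ (F.m + F.maxVertex + 2) ^ 2 := Nat.pow_le_pow_left (by omega) 2
    have h2 : F.m * F.n + 1 ≤ (F.m + F.maxVertex + 2) ^ 2 := by
      have h3 : (F.m + 1) ^ 2 ≤ (F.m + F.maxVertex + 2) ^ 2 := Nat.pow_le_pow_left (by omega) 2
      nlinarith
    calc 4 * (F.m * F.n + 1) ≤ 2 ^ 2 * (F.m + F.maxVertex + 2) ^ 2 := Nat.mul_le_mul_left _ h2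
      _ ≤ (F.m + F.maxVertex + 2) ^ 2 * (F.m + F.maxVertex + 2) ^ 2 := Nat.mul_le_mul_right _ h1
      _ = _ := by rw [← pow_add]
  · exact F.le_limits (by omega)
  · intro v hv
    refine F.le_limits ?_
    rw [encode, List.mem_cons, List.mem_flatMap] at hv
    rcases hv with rfl | ⟨i, hi, hv⟩
    · omega
    · have hi := List.mem_range.1 hi
      rw [List.mem_cons, List.mem_cons, Finset.mem_sort] at hv
      rcases hv with rfl | rfl | hv
      · split_ifs <;> omega
      · have := (F.card_le_maxCard hi).trans F.maxCard_le
        omega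
      · have : v ≤ F.maxVertex := (Finset.le_sup (f := id) hv).trans
          (Finset.le_sup (f := fun i => (F.σ i).sup id) (Finset.mem_range.2 hi))
        omega
  · intro j hj i hi
    have := Nat.mul_le_mul (F.card_le_maxCard hj) (F.card_le_maxCard hi)
    exact F.le_limits (by omega)

theorem limits_le (t : ℕ) : F.limits.β t ≤ F.limits.B := by
  have h1 := F.n_le_m
  have h2 := F.maxCard_le
  refine F.le_limits ?_
  match t with
  | 0 => change F.n ≤ _; omega
  | 1 => change F.m ≤ _; omega
  | 2 => change F.m + 1 ≤ _; omega
  | 3 => change F.maxCard ≤ _; omega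
  | _ + 4 => exact Nat.zero_le _

end Filtration

namespace Cmd

/-- Each product of loop bounds that occurs along a nest of loops in the program is at most `8 (m ^
2 n + 1)`. The products with `κ` come from comparing vertices, those with `m + 1` from bundles and
from writing bars. -/
theorem fits_main (F : Filtration) : main.Fits F.limits.β (8 * (F.m ^ 2 * F.n + 1)) 1 := by
  have hnm := F.n_le_m
  have hκ := F.maxCard_sq_le
  have hκn := F.maxCard_le
  have h1 : F.m ≠ 0 → 1 ≤ F.n := F.one_le_n
  have b0 : F.limits.β 0 = F.n := rfl
  have b1 : F.limits.β 1 = F.m := rfl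
  have b2 : F.limits.β 2 = F.m + 1 := rfl
  have b3 : F.limits.β 3 = F.maxCard := rfl
  generalize F.limits.β = β at *
  generalize F.m = m, F.n = n, F.maxCard = κ at *
  obtain ⟨w, hw⟩ : ∃ w, w = 8 * (m ^ 2 * n + 1) := ⟨_, rfl⟩
  have hmm : m * m ≤ m * m * n := by
    by_cases h : m = 0
    · simp [h]
    · exact Nat.le_mul_of_pos_right _ (h1 h)
  have hmn : m * n ≤ m * m := Nat.mul_le_mul_left _ hnm
  have hnn : n * n ≤ m * n := Nat.mul_le_mul_right _ hnm
  have hm : m ≤ m * m := Nat.le_mul_self m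
  have hmnn : m * n * n ≤ m * m * n := Nat.mul_le_mul_right _ hmn
  have hnmn : n * m * n ≤ m * m * n := Nat.mul_le_mul_right _ (Nat.mul_le_mul_right _ hnm)
  have hmnκ : m * n * κ ≤ m * n * n := Nat.mul_le_mul_left _ hκn
  have hmnκκ : m * n * κ * κ ≤ 2 * (m * n * n) := by
    rw [Nat.mul_assoc (m * n), Nat.mul_left_comm 2]
    exact Nat.mul_le_mul_left _ hκ
  have hw' : w = 8 * (m * m * n) + 8 := by
    rw [hw, pow_two, Nat.mul_add]
  have f1 : 1 ≤ w := by omega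
  have f2 : m ≤ w := by omega
  have f3 : n ≤ w := by omega
  have f4 : m * n ≤ w := by omega
  have f5 : n * n ≤ w := by omega
  have f6 : m * n * n ≤ w := by omega
  have f7 : m * n * κ ≤ w := by omega
  have f8 : m * n * κ * κ ≤ w := by omega
  have f9 : m * (m + 1) ≤ w := by rw [Nat.mul_add]; omega
  have f10 : m * (m + 1) * n ≤ w := by rw [Nat.mul_add, Nat.add_mul, Nat.mul_one]; omega
  have f11 : n * (m + 1) ≤ w := by rw [Nat.mul_add, Nat.mul_comm n]; omega
  have f12 : n * (m + 1) * n ≤ w := by rw [Nat.mul_add, Nat.add_mul, Nat.mul_one]; omega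
  have f13 : m * n * (m + 1) ≤ w := by rw [Nat.mul_add, Nat.mul_right_comm]; omega
  rw [← hw]
  simp only [main, firstPass, block, step, finish, scan, overlap, markFaces, fillRow, select, argmax,
    Cmd.delete, Cmd.insert, copySlots, markColumn, clean, deleteDeath, deleteBirth, prepareInsert,
    hits, sumRows, sumBits, insertDeath, insertBirth, addRows, emitHomology, emitBoundary, emitCycles,
    emitCycle, count, Fits, b0, b1, b2, b3, one_mul, and_self, f1, f2, f3, f4, f5, f6, f7, f8, f9,
    f10, f11, f12, f13]

end Cmd

theorem initState_mem_le {l : List ℕ} {B : ℕ} (h : ∀ v ∈ l, v ≤ B) (A a : ℕ) :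
    (initState l).mem A a ≤ B := by
  change (if A = 0 then l.getD a 0 else 0) ≤ B
  split_ifs
  · by_cases ha : a < l.length
    · rw [List.getD_eq_getElem _ _ ha]
      exact h _ (List.getElem_mem ha)
    · rw [List.getD_eq_default _ _ (by omega)]
      exact Nat.zero_le _
  · exact Nat.zero_le _

end ZigzagRep

theorem mainTheorem2 :
    ∃ (P : ZigzagRep.Prog) (C : ℕ), ∀ F : ZigzagRep.Filtration,
      ∃ (t : ℕ) (s : ZigzagRep.State) (bars : List ZigzagRep.Bar),
        ZigzagRep.Exec (C * (F.m * F.n + 1)) ((F.m + F.maxVertex + 2) ^ C) P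
          (ZigzagRep.initState F.encode) t s ∧
        t ≤ C * (F.m ^ 2 * F.n + 1) ∧
        s.out = bars.flatMap ZigzagRep.Bar.encode ∧
        ZigzagRep.IsSolution F bars := by
  -- The program is replaced by a variable, so that its size and its coefficient remain opaque
  -- numbers.
  obtain ⟨c, hc⟩ : ∃ c, c = ZigzagRep.Cmd.main := ⟨_, rfl⟩
  -- The summands serve the memory bound (`4`), the word size (the exponent) and the running time
  -- (`8` times the coefficient); their sum dominates each of them.
  refine ⟨c.comp 0 0, 4 + (5 * (c.size + 1) + 1) + 8 * c.coeff, fun F => ?_⟩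
  have hX := F.room
  have hx : 2 ≤ F.m + F.maxVertex + 2 := by omega
  -- Words up to `B = x ^ 4` are stored, and `B + 2 ≤ x ^ 5`; intermediate values are then below a
  -- power of `x` with exponent linear in the size of the program.
  have hB : F.limits.B + 2 ≤ (F.m + F.maxVertex + 2) ^ 5 := by
    change (F.m + F.maxVertex + 2) ^ 4 + 2 ≤ _
    have : 2 ^ 4 ≤ (F.m + F.maxVertex + 2) ^ 4 := Nat.pow_le_pow_left hx 4
    rw [pow_succ _ 4]
    have := Nat.mul_le_mul_left ((F.m + F.maxVertex + 2) ^ 4) hx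
    omega
  have hW : (F.limits.B + 2) ^ (c.size + 1) < (F.m + F.maxVertex + 2) ^ (5 * (c.size + 1) + 1) := by
    refine (Nat.pow_le_pow_left hB _).trans_lt ?_
    rw [← pow_mul]
    exact Nat.pow_lt_pow_right (by omega) (by omega)
  obtain ⟨t, s, hE, ht, ⟨bars, ho, hsol⟩, -⟩ := ZigzagRep.Cmd.sound F.limits_le c [] 0
    (ZigzagRep.initState F.encode) _ (hc ▸ ZigzagRep.Cmd.wp_main hX) hW (by simp)
    (ZigzagRep.initState_mem_le hX.input_le) (by simp)
  refine ⟨t, s, bars, hE.mono ?_ ?_, ?_, ho, hsol⟩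
  · exact Nat.mul_le_mul_right _ (by omega)
  · exact Nat.pow_le_pow_right (by omega) (by omega)
  · have h := (ZigzagRep.Cmd.fits_main F).cost_le
    rw [Nat.one_mul, ← hc] at h
    refine ht.trans (h.trans ?_)
    rw [← Nat.mul_assoc, Nat.mul_comm _ 8]
    exact Nat.mul_le_mul_right _ (by omega)
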